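/- Work with structures $(M,E,\mathcal C)$ for the two-sorted language of class theory: $M$ is the domain of sets, $E$ interprets membership (and need not be well-founded), and $\mathcal C\subseteq\mathcal P(M)$ is the collection of classes. $\mathbf{NBG}$ has the set axioms Extensionality, Pairing, Infinity, Union and Power Set, and the class axioms Foundation, Class Replacement, Comprehension for formulas without class quantifiers, and Global Choice. $\Sigma^1_1$-Comprehension is comprehension, with set and class parameters, for formulas $\exists X_1\cdots\exists X_k\,\varphi$ with $\varphi$ free of class quantifiers. $\Delta^1_1$-Comprehension is comprehension for such formulas that are equivalent in the model to some $\forall X_1\cdots\forall X_l\,\psi$ with $\psi$ free of class quantifiers. All notions below are understood inside $(M,E,\mathcal C)$; in particular "isomorphic" means that some class is an isomorphism, and natural numbers are those of the model. A *coding pair* is a class $N$ with a distinguished element $a$ and a class relation $R$ on $N$ such that: every $z\in N$ has a unique finite $R$-distance from $a$; if $y\neq z$, $y\mathrel R x$ and $z\mathrel R x$, then the parts of $(N,R)$ below $y$ and below $z$ are not isomorphic; two distinct nodes at the same distance from $a$ have no common $R$-predecessor; and $R$ is well-founded (every non-empty subclass of $N$ has an $R$-minimal element). Its *quotient pair* $(\tilde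 N,\tilde R)$ has one representative for each class $[x]$ of nodes of $N$ under isomorphism of the parts below them, with $\tilde x\mathrel{\tilde R}\tilde y$ iff $x_0\mathrel R y_0$ for some $x_0\in[x]$, $y_0\in[y]$. It is coded by the single class $(\tilde N\times\{1\})\cup(\tilde R\times\{2\})$. A quotient pair codes an ideal set $x$ by presenting the transitive closure of $\{x\}$: the top node $\tilde a$ stands for $x$, and the nodes $b$ with $b\mathrel{\tilde R}\tilde a$ stand for the elements of $x$. Write $y\mathrel{\hat\in}x$ if the pair coding $y$ is isomorphic to the part of the pair coding $x$ below one of the latter nodes. An ideal set is *admissible over $V$* if it is transitive, satisfies Kripke–Platek set theory (Extensionality, Union, Pairing, Foundation, $\Delta_0$-Separation, $\Delta_0$-Collection), and has an element whose elements form, with $\tilde R$, a transitive copy of $(M,E)$ (by a class isomorphism). $Hyp(V)$ is the least ideal set admissible over $V$: it is admissible over $V$, and each of its elements is, in the sense of $\hat\in$, an element of every ideal set admissible over $V$. **Theorem.** 1. $\mathbf{NBG}+\Sigma^1_1$-Comprehension proves that there is a class coding $Hyp(V)$; that is, every model of this theory contains such a class. 2. Let $(M,E,\mathcal C)$ be a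 model of $\mathbf{NBG}+\Sigma^1_1$-Comprehension, let a quotient pair in $\mathcal C$ code its $Hyp(V)$, and let $\mathcal C'$ be the collection of those $X\in\mathcal C$ that are, as subclasses of $V$, elements of $Hyp(V)$. Then $(M,E,\mathcal C')$ satisfies $\Delta^1_1$-Comprehension, together with all axioms of $\mathbf{NBG}$ except possibly Global Choice, and the axiom of choice for sets. Nevertheless $(M,E,\mathcal C')$ contains no class coding $Hyp(V)$: no $X\in\mathcal C'$ codes $Hyp(V)$ in the sense of $(M,E,\mathcal C')$, and none does in the sense of $(M,E,\mathcal C)$. 3. Consequently $\Delta^1_1$-Comprehension does not suffice: there is a model of the axioms of $\mathbf{NBG}$ other than Global Choice, together with the axiom of choice for sets and $\Delta^1_1$-Comprehension, that contains no class coding $Hyp(V)$. -/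

import Mathlib

universe u

namespace ClassTheory

/-- First-order formulas in the language of class theory with `n` free set variables and `m` free
class variables. Set quantifiers are allowed, class quantifiers are not (such formulas are called
elementary). The bound variable of `all φ` is variable `0` of `φ`. -/
inductive SetFormula : ℕ → ℕ → Type
  | eq {n m : ℕ} (i j : Fin n) : SetFormula n m
  | mem {n m : ℕ} (i j : Fin n) : SetFormula n m
  | memClass {n m : ℕ} (i : Fin n) (J : Fin m) : SetFormula n m
  | neg {n m : ℕ} (φ : SetFormula n m) : SetFormula n m
  | and {n m : ℕ} (φ ψ : SetFormula n m) : SetFormula n m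
  | all {n m : ℕ} (φ : SetFormula (n + 1) m) : SetFormula n m

namespace SetFormula

/-- Satisfaction in a structure `(A, E)`, set variables being evaluated by `v` and class variables
by `W`. -/
def Realize {A : Type u} (E : A → A → Prop) :
    {n m : ℕ} → SetFormula n m → (Fin n → A) → (Fin m → Set A) → Prop
  | _, _, eq i j, v, _ => v i = v j
  | _, _, mem i j, v, _ => E (v i) (v j)
  | _, _, memClass i J, v, W => v i ∈ W J
  | _, _, neg φ, v, W => ¬ φ.Realize E v W
  | _, _, and φ ψ, v, W => φ.Realize E v W ∧ ψ.Realize E v W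
  | _, _, all φ, v, W => ∀ a : A, φ.Realize E (Fin.cons a v) W

/-- The bounded quantification `∀ x ∈ vᵢ, φ`. -/
def ball {n m : ℕ} (i : Fin n) (φ : SetFormula (n + 1) m) : SetFormula n m :=
  all (neg (and (mem 0 i.succ) (neg φ)))

/-- `Δ₀` formulas: all quantifiers are bounded. -/
inductive IsDelta0 : {n m : ℕ} → SetFormula n m → Prop
  | eq {n m : ℕ} (i j : Fin n) : IsDelta0 (SetFormula.eq (m := m) i j)
  | mem {n m : ℕ} (i j : Fin n) : IsDelta0 (SetFormula.mem (m := m) i j)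
  | memClass {n m : ℕ} (i : Fin n) (J : Fin m) : IsDelta0 (SetFormula.memClass i J)
  | neg {n m : ℕ} {φ : SetFormula n m} : IsDelta0 φ → IsDelta0 (SetFormula.neg φ)
  | and {n m : ℕ} {φ ψ : SetFormula n m} : IsDelta0 φ → IsDelta0 ψ → IsDelta0 (SetFormula.and φ ψ)
  | ball {n m : ℕ} (i : Fin n) {φ : SetFormula (n + 1) m} :
      IsDelta0 φ → IsDelta0 (SetFormula.ball i φ)

end SetFormula

/-- `(A, E)` is a model of Kripke-Platek set theory. -/
structure ModelsKP (A : Type u) (E : A → A → Prop) : Prop where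
  extensionality : ∀ x y, (∀ z, E z x ↔ E z y) → x = y
  union : ∀ x, ∃ y, ∀ z, E z y ↔ ∃ w, E w x ∧ E z w
  pairing : ∀ x y, ∃ z, ∀ w, E w z ↔ w = x ∨ w = y
  foundation : ∀ {n : ℕ} (φ : SetFormula (n + 1) 0) (p : Fin n → A),
    (∃ x, φ.Realize E (Fin.cons x p) Fin.elim0) →
      ∃ x, φ.Realize E (Fin.cons x p) Fin.elim0 ∧
        ∀ y, E y x → ¬ φ.Realize E (Fin.cons y p) Fin.elim0
  separation : ∀ {n : ℕ} (φ : SetFormula (n + 1) 0), φ.IsDelta0 → ∀ (p : Fin n → A) (a : A),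
    ∃ b, ∀ x, E x b ↔ E x a ∧ φ.Realize E (Fin.cons x p) Fin.elim0
  collection : ∀ {n : ℕ} (φ : SetFormula (n + 2) 0), φ.IsDelta0 → ∀ (p : Fin n → A) (a : A),
    (∀ x, E x a → ∃ y, φ.Realize E (Fin.cons x (Fin.cons y p)) Fin.elim0) →
      ∃ b, ∀ x, E x a → ∃ y, E y b ∧ φ.Realize E (Fin.cons x (Fin.cons y p)) Fin.elim0

/-- A structure for the two-sorted language of class theory: a domain of sets with a binary
relation interpreting membership, and a domain of classes. Classes are identified with their
extensions, so that Class Extensionality holds by construction. The membership relation need not be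
well-founded, and only some subsets of the domain need be classes. -/
structure ClassModel : Type (u + 1) where
  carrier : Type u
  mem : carrier → carrier → Prop
  classes : Set (Set carrier)

/-- A pair of subsets of `M` (a set of nodes and a set of ordered pairs), together with a
distinguished element. -/
structure PointedGraph (M : Type u) : Type u where
  nodes : Set M
  rel : Set M
  top : M

namespace ClassModel

variable (𝔐 : ClassModel.{u})

/-! ### Basic set-theoretic notions, as understood in the model -/

/-- `z = {x, y}`. -/
def IsUPair (z x y : 𝔐.carrier) : Prop := ∀ w, 𝔐.mem w z ↔ w = x ∨ w = y

/-- `p` is the ordered pair `⟨x, y⟩ = {{x}, {x, y}}`. -/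
def IsPair (p x y : 𝔐.carrier) : Prop :=
  ∃ s d, 𝔐.IsUPair s x x ∧ 𝔐.IsUPair d x y ∧ 𝔐.IsUPair p s d

/-- `⟨x, y⟩ ∈ R`, for a class `R`. -/
def Rel (R : Set 𝔐.carrier) (x y : 𝔐.carrier) : Prop := ∃ p ∈ R, 𝔐.IsPair p x y

/-- `⟨x, y⟩ ∈ f`, for a set `f`. -/
def App (f x y : 𝔐.carrier) : Prop := ∃ p, 𝔐.mem p f ∧ 𝔐.IsPair p x y

/-- `e = ∅`. -/
def IsZero (e : 𝔐.carrier) : Prop := ∀ z, ¬ 𝔐.mem z e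

/-- `s = x ∪ {x}`. -/
def IsSucc (s x : 𝔐.carrier) : Prop := ∀ z, 𝔐.mem z s ↔ 𝔐.mem z x ∨ z = x

/-- `w` contains `∅` and is closed under `x ↦ x ∪ {x}`. -/
def IsInductive (w : 𝔐.carrier) : Prop :=
  (∃ e, 𝔐.mem e w ∧ 𝔐.IsZero e) ∧ ∀ x, 𝔐.mem x w → ∃ s, 𝔐.mem s w ∧ 𝔐.IsSucc s x

/-- `n` is a natural number of the model. -/
def IsNat (n : 𝔐.carrier) : Prop := ∀ w, 𝔐.IsInductive w → 𝔐.mem n w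

/-! ### Axioms of class theory -/

/-- Comprehension for formulas without class quantifiers (with set and class parameters). -/
def ElementaryComprehension : Prop :=
  ∀ {n m : ℕ} (φ : SetFormula (n + 1) m) (p : Fin n → 𝔐.carrier) (P : Fin m → Set 𝔐.carrier),
    (∀ i, P i ∈ 𝔐.classes) → {x | φ.Realize 𝔐.mem (Fin.cons x p) P} ∈ 𝔐.classes

/-- The extension `{x | ∃ X₁ … ∃ Xₖ φ(x, p, P, X₁, …, Xₖ)}` of a `Σ¹₁` formula, the `Xᵢ` ranging
over the classes of the model and `φ` having no class quantifiers. -/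
def sigmaExt {n m k : ℕ} (φ : SetFormula (n + 1) (m + k)) (p : Fin n → 𝔐.carrier)
    (P : Fin m → Set 𝔐.carrier) : Set 𝔐.carrier :=
  {x | ∃ X : Fin k → Set 𝔐.carrier, (∀ i, X i ∈ 𝔐.classes) ∧
    φ.Realize 𝔐.mem (Fin.cons x p) (Fin.append P X)}

/-- The extension `{x | ∀ X₁ … ∀ Xₖ φ(x, p, P, X₁, …, Xₖ)}` of a `Π¹₁` formula. -/
def piExt {n m k : ℕ} (φ : SetFormula (n + 1) (m + k)) (p : Fin n → 𝔐.carrier)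
    (P : Fin m → Set 𝔐.carrier) : Set 𝔐.carrier :=
  {x | ∀ X : Fin k → Set 𝔐.carrier, (∀ i, X i ∈ 𝔐.classes) →
    φ.Realize 𝔐.mem (Fin.cons x p) (Fin.append P X)}

/-- `Σ¹₁`-Comprehension. -/
def Sigma11Comprehension : Prop :=
  ∀ {n m k : ℕ} (φ : SetFormula (n + 1) (m + k)) (p : Fin n → 𝔐.carrier)
    (P : Fin m → Set 𝔐.carrier), (∀ i, P i ∈ 𝔐.classes) → 𝔐.sigmaExt φ p P ∈ 𝔐.classes

/-- `Δ¹₁`-Comprehension. -/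
def Delta11Comprehension : Prop :=
  ∀ {n m k l : ℕ} (φ : SetFormula (n + 1) (m + k)) (ψ : SetFormula (n + 1) (m + l))
    (p : Fin n → 𝔐.carrier) (P : Fin m → Set 𝔐.carrier), (∀ i, P i ∈ 𝔐.classes) →
      𝔐.sigmaExt φ p P = 𝔐.piExt ψ p P → 𝔐.sigmaExt φ p P ∈ 𝔐.classes

/-- Global Choice: some class function picks an element from every non-empty set. -/
def GlobalChoice : Prop :=
  ∃ F ∈ 𝔐.classes, (∀ x y y', 𝔐.Rel F x y → 𝔐.Rel F x y' → y = y') ∧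
    ∀ x, (∃ y, 𝔐.mem y x) → ∃ y, 𝔐.mem y x ∧ 𝔐.Rel F x y

/-- The axiom of choice for sets: every set of non-empty, pairwise disjoint sets has a
transversal. -/
def SetChoice : Prop :=
  ∀ x, (∀ y, 𝔐.mem y x → ∃ z, 𝔐.mem z y) →
    (∀ y y' z, 𝔐.mem y x → 𝔐.mem y' x → 𝔐.mem z y → 𝔐.mem z y' → y = y') →
      ∃ c, ∀ y, 𝔐.mem y x → ∃! z, 𝔐.mem z y ∧ 𝔐.mem z c

/-- The axioms of von Neumann-Bernays-Gödel class theory other than choice. -/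
structure NBGWithoutChoice : Prop where
  extensionality : ∀ x y, (∀ z, 𝔐.mem z x ↔ 𝔐.mem z y) → x = y
  pairing : ∀ x y, ∃ z, 𝔐.IsUPair z x y
  infinity : ∃ w, 𝔐.IsInductive w
  union : ∀ x, ∃ y, ∀ z, 𝔐.mem z y ↔ ∃ w, 𝔐.mem w x ∧ 𝔐.mem z w
  powerSet : ∀ x, ∃ y, ∀ z, 𝔐.mem z y ↔ ∀ w, 𝔐.mem w z → 𝔐.mem w x
  foundation : ∀ X ∈ 𝔐.classes, X.Nonempty → ∃ x ∈ X, ∀ y ∈ X, ¬ 𝔐.mem y x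
  comprehension : 𝔐.ElementaryComprehension
  replacement : ∀ F ∈ 𝔐.classes, (∀ x y y', 𝔐.Rel F x y → 𝔐.Rel F x y' → y = y') →
    ∀ a, ∃ b, ∀ y, 𝔐.mem y b ↔ ∃ x, 𝔐.mem x a ∧ 𝔐.Rel F x y

/-- Von Neumann-Bernays-Gödel class theory, with Global Choice. -/
structure NBG : Prop extends 𝔐.NBGWithoutChoice where
  globalChoice : 𝔐.GlobalChoice

/-! ### Coding pairs and quotient pairs -/

/-- `R` is a class of ordered pairs of elements of `N`. -/
def IsRelOn (R N : Set 𝔐.carrier) : Prop := ∀ p ∈ R, ∃ x ∈ N, ∃ y ∈ N, 𝔐.IsPair p x y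

/-- `z` has `R`-distance `n` from `x`: there is a function `f` with `f 0 = x`, `f n = z` and
`f (k + 1) R f k` for all `k < n`. -/
def HasDistance (R : Set 𝔐.carrier) (x n z : 𝔐.carrier) : Prop :=
  ∃ f, (∀ k y y', 𝔐.App f k y → 𝔐.App f k y' → y = y') ∧
    (∀ k, 𝔐.IsZero k → 𝔐.App f k x) ∧ 𝔐.App f n z ∧
    ∀ k k' y, 𝔐.mem k n → 𝔐.IsSucc k' k → 𝔐.App f k y → ∃ y', 𝔐.App f k' y' ∧ 𝔐.Rel R y' y

/-- The part of `G` below `x` (with `x` as its top): all nodes at finite distance from `x`. -/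
def below (G : PointedGraph 𝔐.carrier) (x : 𝔐.carrier) : PointedGraph 𝔐.carrier where
  nodes := {z | z ∈ G.nodes ∧ ∃ n, 𝔐.IsNat n ∧ 𝔐.HasDistance G.rel x n z}
  rel := G.rel
  top := x

/-- Some class is an isomorphism between the two graphs. -/
def Iso (G H : PointedGraph 𝔐.carrier) : Prop :=
  ∃ F ∈ 𝔐.classes,
    (∀ x ∈ G.nodes, ∃! y, y ∈ H.nodes ∧ 𝔐.Rel F x y) ∧
    (∀ y ∈ H.nodes, ∃! x, x ∈ G.nodes ∧ 𝔐.Rel F x y) ∧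
    ∀ x ∈ G.nodes, ∀ x' ∈ G.nodes, ∀ y ∈ H.nodes, ∀ y' ∈ H.nodes,
      𝔐.Rel F x y → 𝔐.Rel F x' y' → (𝔐.Rel G.rel x' x ↔ 𝔐.Rel H.rel y' y)

/-- Coding pairs. -/
structure IsCodingPair (G : PointedGraph 𝔐.carrier) : Prop where
  nodes_mem : G.nodes ∈ 𝔐.classes
  rel_mem : G.rel ∈ 𝔐.classes
  rel_on : 𝔐.IsRelOn G.rel G.nodes
  top_mem : G.top ∈ G.nodes
  distance : ∀ z ∈ G.nodes, ∃! n, 𝔐.IsNat n ∧ 𝔐.HasDistance G.rel G.top n z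
  siblings : ∀ x ∈ G.nodes, ∀ y ∈ G.nodes, ∀ z ∈ G.nodes, y ≠ z →
    𝔐.Rel G.rel y x → 𝔐.Rel G.rel z x → ¬ 𝔐.Iso (𝔐.below G y) (𝔐.below G z)
  levels : ∀ y ∈ G.nodes, ∀ z ∈ G.nodes, ∀ n, 𝔐.IsNat n → 𝔐.HasDistance G.rel G.top n y →
    𝔐.HasDistance G.rel G.top n z → y ≠ z → ∀ v, 𝔐.Rel G.rel v y → ¬ 𝔐.Rel G.rel v z
  wellFounded : ∀ X ∈ 𝔐.classes, X ⊆ G.nodes → X.Nonempty →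
    ∃ x ∈ X, ∀ y ∈ X, ¬ 𝔐.Rel G.rel y x

/-- `Q` is a quotient of `G`: its nodes are representatives of the classes of nodes of `G` under
isomorphism of the parts below them, related when some members of the two classes are related. -/
structure IsQuotientOf (Q G : PointedGraph 𝔐.carrier) : Prop where
  nodes_mem : Q.nodes ∈ 𝔐.classes
  rel_mem : Q.rel ∈ 𝔐.classes
  nodes_subset : Q.nodes ⊆ G.nodes
  representative : ∀ x ∈ G.nodes, ∃! r, r ∈ Q.nodes ∧ 𝔐.Iso (𝔐.below G r) (𝔐.below G x)
  rel_on : 𝔐.IsRelOn Q.rel Q.nodes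
  rel_iff : ∀ x ∈ Q.nodes, ∀ y ∈ Q.nodes, 𝔐.Rel Q.rel x y ↔
    ∃ x₀ ∈ G.nodes, ∃ y₀ ∈ G.nodes, 𝔐.Iso (𝔐.below G x) (𝔐.below G x₀) ∧
      𝔐.Iso (𝔐.below G y) (𝔐.below G y₀) ∧ 𝔐.Rel G.rel x₀ y₀
  top_mem : Q.top ∈ Q.nodes
  top_iso : 𝔐.Iso (𝔐.below G Q.top) (𝔐.below G G.top)

/-- `Q` is the quotient pair of some coding pair. Quotient pairs are the objects of `(V)⁺`. Such a
`Q` codes an ideal set `x` by presenting the transitive closure of `{x}` with membership; `Q.top`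
stands for `x`, and the nodes related to `Q.top` stand for the elements of `x`. -/
def IsQuotientPair (Q : PointedGraph 𝔐.carrier) : Prop :=
  ∃ G, 𝔐.IsCodingPair G ∧ 𝔐.IsQuotientOf Q G

/-- Membership between objects of `(V)⁺`: `S` is isomorphic to a direct subtree of `T`. -/
def MemHat (S T : PointedGraph 𝔐.carrier) : Prop :=
  ∃ b, 𝔐.Rel T.rel b T.top ∧ 𝔐.Iso S (𝔐.below T b)

/-- The class `X` is `{⟨z, 1⟩ | z ∈ A} ∪ {⟨z, 2⟩ | z ∈ B}`, which represents the pair `⟨A, B⟩`. -/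
def IsRep (X A B : Set 𝔐.carrier) : Prop :=
  ∀ w, w ∈ X ↔ ∃ z o i, 𝔐.IsZero o ∧ 𝔐.IsSucc i o ∧
    ((z ∈ A ∧ 𝔐.IsPair w z i) ∨ (z ∈ B ∧ ∃ j, 𝔐.IsSucc j i ∧ 𝔐.IsPair w z j))

/-! ### Hyp(V) -/

/-- The node `v` of `Q` stands for `V`, as witnessed by the class isomorphism `F` from `(V, ∈)` onto
the nodes related to `v`. -/
structure IsCopyOfV (Q : PointedGraph 𝔐.carrier) (v : 𝔐.carrier) (F : Set 𝔐.carrier) : Prop where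
  class_mem : F ∈ 𝔐.classes
  total : ∀ x, ∃! c, 𝔐.Rel F x c
  range : ∀ x c, 𝔐.Rel F x c → 𝔐.Rel Q.rel c v
  bijective : ∀ c, 𝔐.Rel Q.rel c v → ∃! x, 𝔐.Rel F x c
  mem_iff : ∀ x y c d, 𝔐.Rel F x c → 𝔐.Rel F y d → (𝔐.mem x y ↔ 𝔐.Rel Q.rel c d)
  transitive : ∀ c d, 𝔐.Rel Q.rel c v → 𝔐.Rel Q.rel d c → 𝔐.Rel Q.rel d v

/-- `Q` codes an ideal set which is admissible over `V`, that is, a transitive model of KP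
containing `V` as an element. -/
structure IsAdmissibleOverV (Q : PointedGraph 𝔐.carrier) : Prop where
  quotientPair : 𝔐.IsQuotientPair Q
  transitive : ∀ b c, 𝔐.Rel Q.rel b Q.top → 𝔐.Rel Q.rel c b → 𝔐.Rel Q.rel c Q.top
  modelsKP : ModelsKP {b : 𝔐.carrier // 𝔐.Rel Q.rel b Q.top} fun b c => 𝔐.Rel Q.rel b.1 c.1
  contains_V : ∃ v F, 𝔐.Rel Q.rel v Q.top ∧ 𝔐.IsCopyOfV Q v F

/-- The quotient pair `Q` codes `Hyp(V)`, the smallest ideal set admissible over `V`. -/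
def CodesHyp (Q : PointedGraph 𝔐.carrier) : Prop :=
  𝔐.IsAdmissibleOverV Q ∧
    ∀ K, 𝔐.IsAdmissibleOverV K → ∀ b, 𝔐.Rel Q.rel b Q.top → 𝔐.MemHat (𝔐.below Q b) K

/-- The single class `X` of the model codes `Hyp(V)`. -/
def IsHypCode (X : Set 𝔐.carrier) : Prop :=
  X ∈ 𝔐.classes ∧ ∃ Q, 𝔐.IsRep X Q.nodes Q.rel ∧ 𝔐.CodesHyp Q

/-- The class `X` is an element of the ideal set coded by `Q`: some node related to the top stands
for a subset of `V` whose elements are those of `X`. -/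
def IsClassIn (Q : PointedGraph 𝔐.carrier) (X : Set 𝔐.carrier) : Prop :=
  ∃ v F b, 𝔐.Rel Q.rel v Q.top ∧ 𝔐.IsCopyOfV Q v F ∧ 𝔐.Rel Q.rel b Q.top ∧
    (∀ c, 𝔐.Rel Q.rel c b → 𝔐.Rel Q.rel c v) ∧
    ∀ x c, 𝔐.Rel F x c → (x ∈ X ↔ 𝔐.Rel Q.rel c b)

/-- The same sets, with only those classes that are elements of the ideal set coded by `Q`. -/
def restrict (Q : PointedGraph 𝔐.carrier) : ClassModel.{u} where
  carrier := 𝔐.carrier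
  mem := 𝔐.mem
  classes := {X | X ∈ 𝔐.classes ∧ 𝔐.IsClassIn Q X}

end ClassModel

end ClassTheory

/-!
`Hyp(V)` is the first admissible stage of the constructible hierarchy built over the universe `V` as the
set of its bottom stage. The proof constructs that hierarchy inside class theory.

Definability is handled by the classes `Dfn`, `Tm` and `CT`: a predicate is elementary, or `Δ₀`, if some
formula with parameters defines it, and instance search establishes this for predicates written in
ordinary notation. A well-founded extensional class relation `(N, R)` presents an ideal set: the tree of
its finite descending sequences is a coding pair (`IsGraph.isCodingPair_unravel`) with an explicit
quotient pair. Conversely a quotient pair is well-founded (`IsQuotientOf.classWF`), so that it suffices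
to work with well-founded extensional relations.

*Towers.* An initial segment of the hierarchy is coded by a class, a tower (`IsTower`), in which every
stage but the last comes with its satisfaction class. As stages outnumber the ordinals of `V`, the new
sets of a stage are named by formulas, parameters and a tag of the stage, reduced to a set by taking the
names of least rank. A tag (`TagAt`) is a failure of collection that arises at this very stage; it is
destroyed by the next stage, whence names of distinct stages are distinct. A stage without a tag is
admissible (`isAdm_of_noTag`) and has no successor; a tower whose last stage has a tag can be prolonged
(`isTower_nextTower`). Any two towers are comparable (`tower_comparable`), because membership in a tower
is determined by names that mention only earlier stages. By `Σ¹₁`-Comprehension the union of all towers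
is a class. It is a tower that cannot be prolonged, hence admissible (`isAdm_allTower`).

*Minimality.* Let `K` be admissible over `V`. The classes that are elements of `K` satisfy elementary
comprehension, and `Δ¹₁`-Comprehension by `Δ₀`-Collection in `K` (`Emb.delta_mem`). Every level of the
union of all towers occurs in a tower which is an element of `K`: for the first level that did not,
`Δ₀`-Collection applied to a tag of its stage would give a tower in `K` reaching up to it, and
prolonging this tower by one stage would reach the level (`exists_coded_tower`). As `K` is a model of KP,
it contains the Mostowski collapse of such towers (`exists_collapse_class`), hence all elements of the
union. This proves the existence of `Hyp(V)` (`codesHyp_allTower`).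

*The restricted model.* The classes of the restricted model are those which are elements of `Hyp(V)`, so
that it satisfies `Δ¹₁`-Comprehension. If one of them coded `Hyp(V)`, or any admissible set over `V`, then
its collapse would be a set of `Hyp(V)` that includes `Hyp(V)` as a class, and so would contain itself
(`CodesHyp.not_isAdm`). The sets of ZFC with all their subcollections as classes satisfy
`Σ¹₁`-Comprehension, so that such restricted models exist.
-/

set_option linter.unusedSectionVars false

namespace ClassTheory

/-! ### Renaming variables in formulas -/

namespace SetFormula

/-- Renaming of the free set and class variables of a formula. -/
def rename : {n m : ℕ} → SetFormula n m → {n' m' : ℕ} → (Fin n → Fin n') → (Fin m → Fin m') →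
    SetFormula n' m'
  | _, _, eq i j, _, _, σ, _ => eq (σ i) (σ j)
  | _, _, mem i j, _, _, σ, _ => mem (σ i) (σ j)
  | _, _, memClass i J, _, _, σ, τ => memClass (σ i) (τ J)
  | _, _, neg φ, _, _, σ, τ => neg (φ.rename σ τ)
  | _, _, and φ ψ, _, _, σ, τ => and (φ.rename σ τ) (ψ.rename σ τ)
  | _, _, all φ, _, _, σ, τ => all (φ.rename (Fin.cons 0 fun i => (σ i).succ) τ)

variable {A : Type u} {E : A → A → Prop}

theorem realize_rename {n m : ℕ} (φ : SetFormula n m) : ∀ {n' m' : ℕ} (σ : Fin n → Fin n')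
    (τ : Fin m → Fin m') (v : Fin n' → A) (W : Fin m' → Set A),
    (φ.rename σ τ).Realize E v W ↔ φ.Realize E (fun i => v (σ i)) (fun j => W (τ j)) := by
  induction φ with
  | eq i j => intros; rfl
  | mem i j => intros; rfl
  | memClass i J => intros; rfl
  | neg φ ih => intros; simp only [rename, Realize, ih]
  | and φ ψ ih ih' => intros; simp only [rename, Realize, ih, ih']
  | all φ ih =>
    intro n' m' σ τ v W
    simp only [rename, Realize, ih]
    refine forall_congr' fun a => ?_
    have : (fun i => (Fin.cons a v : Fin (n' + 1) → A) ((Fin.cons 0 fun i => (σ i).succ :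
        Fin _ → Fin (n' + 1)) i)) = Fin.cons a fun i => v (σ i) := by
      funext i
      refine Fin.cases ?_ (fun i => ?_) i <;> simp
    rw [this]

theorem realize_ball {n m : ℕ} (i : Fin n) (φ : SetFormula (n + 1) m) (v : Fin n → A)
    (W : Fin m → Set A) : (ball i φ).Realize E v W ↔
      ∀ x, E x (v i) → φ.Realize E (Fin.cons x v) W := by
  simp [ball, Realize]

theorem IsDelta0.rename {n m : ℕ} {φ : SetFormula n m} (h : φ.IsDelta0) : ∀ {n' m' : ℕ}
    (σ : Fin n → Fin n') (τ : Fin m → Fin m'), (φ.rename σ τ).IsDelta0 := by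
  induction h with
  | eq i j => intros; exact .eq _ _
  | mem i j => intros; exact .mem _ _
  | memClass i J => intros; exact .memClass _ _
  | neg _ ih => intros; exact .neg (ih _ _)
  | and _ _ ih ih' => intros; exact .and (ih _ _) (ih' _ _)
  | ball i h ih =>
    intro n' m' σ τ
    exact .ball (σ i) (ih (Fin.cons 0 fun i => (σ i).succ) τ)

end SetFormula

open SetFormula

/-! ### Definable predicates -/

/-- The predicate `P` of `n` sets and `m` classes is definable over `(A, E)` by a formula without
class quantifiers, with set parameters from `A` and class parameters from `𝒞`; if `d` holds, the
formula can be taken to be `Δ₀`. Working with this notion instead of concrete formulas lets instance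
search check definability. -/
class Dfn (d : Prop) {A : Type u} (E : A → A → Prop) (𝒞 : Set (Set A)) {n m : ℕ}
    (P : (Fin n → A) → (Fin m → Set A) → Prop) : Prop where
  out : ∃ (a b : ℕ) (φ : SetFormula (n + a) (m + b)) (p : Fin a → A) (C : Fin b → Set A),
    (d → φ.IsDelta0) ∧ (∀ i, C i ∈ 𝒞) ∧
      ∀ v W, P v W ↔ φ.Realize E (Fin.append v p) (Fin.append W C)

/-- The function `t` from tuples of sets to sets may be substituted into definable predicates. For
`Δ₀` definability this asks for more than a definable graph, whence the formulation; the renaming `σ`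
allows substitution next to further variables. -/
class Tm (d : Prop) {A : Type u} (E : A → A → Prop) (𝒞 : Set (Set A)) {n : ℕ}
    (t : (Fin n → A) → A) : Prop where
  subst : ∀ {n' m : ℕ} (σ : Fin n → Fin n') (P : A → (Fin n' → A) → (Fin m → Set A) → Prop),
    Dfn d E 𝒞 (fun (w : Fin (n' + 1) → A) W => P (w 0) (fun i => w i.succ) W) →
      Dfn d E 𝒞 fun v W => P (t fun i => v (σ i)) v W

/-- `F` is a class depending definably on a tuple of sets and a tuple of classes. -/
class CT (d : Prop) {A : Type u} (E : A → A → Prop) (𝒞 : Set (Set A)) {n m : ℕ}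
    (F : (Fin n → A) → (Fin m → Set A) → Set A) : Prop where
  out : Dfn d E 𝒞 fun (w : Fin (n + 1) → A) W => w 0 ∈ F (fun i => w i.succ) W

section

variable {d : Prop} {A : Type u} {E : A → A → Prop} {𝒞 : Set (Set A)} {n m : ℕ}

theorem Dfn.congr {P Q : (Fin n → A) → (Fin m → Set A) → Prop} (h : Dfn d E 𝒞 P)
    (hPQ : ∀ v W, Q v W ↔ P v W) : Dfn d E 𝒞 Q := by
  have : Q = P := by funext v W; exact propext (hPQ v W)
  exact this ▸ h

theorem Dfn.of_formula {d : Prop} (E : A → A → Prop) (𝒞 : Set (Set A)) (φ : SetFormula n m)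
    (h : d → φ.IsDelta0) :
    Dfn d E 𝒞 fun v W => φ.Realize E v W := by
  refine ⟨⟨0, 0, φ, Fin.elim0, Fin.elim0, h, fun i => i.elim0, fun v W => ?_⟩⟩
  rw [Fin.append_elim0, Fin.append_elim0]
  rfl

theorem Dfn.rename {n' m' : ℕ} {P : (Fin n → A) → (Fin m → Set A) → Prop} (h : Dfn d E 𝒞 P)
    (σ : Fin n → Fin n') (τ : Fin m → Fin m') :
    Dfn d E 𝒞 fun (v : Fin n' → A) (W : Fin m' → Set A) =>
      P (fun i => v (σ i)) (fun j => W (τ j)) := by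
  obtain ⟨a, b, φ, p, C, hd, hC, hφ⟩ := h.out
  refine ⟨⟨a, b, φ.rename (Fin.addCases (fun i => Fin.castAdd a (σ i)) fun i => Fin.natAdd n' i)
    (Fin.addCases (fun i => Fin.castAdd b (τ i)) fun i => Fin.natAdd m' i), p, C,
    fun h => (hd h).rename _ _, hC, fun v W => ?_⟩⟩
  rw [hφ, realize_rename]
  have h1 : Fin.append (fun i => v (σ i)) p = fun i => Fin.append v p
      ((Fin.addCases (fun i => Fin.castAdd a (σ i)) fun i => Fin.natAdd n' i : Fin (n + a) → _) i) := by
    funext i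
    refine Fin.addCases (fun i => ?_) (fun i => ?_) i <;> simp
  have h2 : Fin.append (fun i => W (τ i)) C = fun i => Fin.append W C
      ((Fin.addCases (fun i => Fin.castAdd b (τ i)) fun i => Fin.natAdd m' i : Fin (m + b) → _) i) := by
    funext i
    refine Fin.addCases (fun i => ?_) (fun i => ?_) i <;> simp
  rw [h1, h2]

/-- Turning the last set variable into a parameter. -/
theorem Dfn.param {P : (Fin (n + 1) → A) → (Fin m → Set A) → Prop} (h : Dfn d E 𝒞 P) (c : A) :
    Dfn d E 𝒞 fun v W => P (Fin.snoc v c : Fin (n + 1) → A) W := by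
  obtain ⟨a, b, φ, p, C, hd, hC, hφ⟩ := h.out
  refine ⟨⟨1 + a, b, φ.rename (Fin.cast (Nat.add_assoc n 1 a)) id, Fin.append (fun _ => c) p, C,
    fun h => (hd h).rename _ _, hC, fun v W => ?_⟩⟩
  rw [hφ, realize_rename]
  have h1 : Fin.append (Fin.snoc v c : Fin (n + 1) → A) p = fun i =>
      Fin.append v (Fin.append (fun _ : Fin 1 => c) p) (Fin.cast (Nat.add_assoc n 1 a) i) := by
    rw [← Fin.append_right_eq_snoc v (fun _ => c), Fin.append_assoc]
    rfl
  rw [h1]; rfl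

/-- Turning the last class variable into a parameter. -/
theorem Dfn.classParam {P : (Fin n → A) → (Fin (m + 1) → Set A) → Prop} (h : Dfn d E 𝒞 P)
    {X : Set A} (hX : X ∈ 𝒞) :
    Dfn d E 𝒞 fun v W => P v (Fin.snoc W X : Fin (m + 1) → Set A) := by
  obtain ⟨a, b, φ, p, C, hd, hC, hφ⟩ := h.out
  refine ⟨⟨a, 1 + b, φ.rename id (Fin.cast (Nat.add_assoc m 1 b)), p,
    Fin.append (fun _ => X) C, fun h => (hd h).rename _ _, fun i => ?_, fun v W => ?_⟩⟩
  · refine Fin.addCases (fun i => ?_) (fun i => ?_) i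
    · simpa using hX
    · simpa using hC i
  rw [hφ, realize_rename]
  have h1 : Fin.append (Fin.snoc W X : Fin (m + 1) → Set A) C = fun i =>
      Fin.append W (Fin.append (fun _ : Fin 1 => X) C) (Fin.cast (Nat.add_assoc m 1 b) i) := by
    rw [← Fin.append_right_eq_snoc W (fun _ => X), Fin.append_assoc]
    rfl
  rw [h1]; rfl

instance Dfn.not (P : (Fin n → A) → (Fin m → Set A) → Prop) [h : Dfn d E 𝒞 P] :
    Dfn d E 𝒞 fun v W => ¬ P v W := by
  obtain ⟨a, b, φ, p, C, hd, hC, hφ⟩ := h.out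
  exact ⟨⟨a, b, φ.neg, p, C, fun h => .neg (hd h), hC, fun v W => not_congr (hφ v W)⟩⟩

instance Dfn.and (P Q : (Fin n → A) → (Fin m → Set A) → Prop) [h : Dfn d E 𝒞 P]
    [h' : Dfn d E 𝒞 Q] : Dfn d E 𝒞 fun v W => P v W ∧ Q v W := by
  obtain ⟨a, b, φ, p, C, hd, hC, hφ⟩ := h.out
  obtain ⟨a', b', φ', p', C', hd', hC', hφ'⟩ := h'.out
  refine ⟨⟨a + a', b + b', .and
    (φ.rename (Fin.addCases (Fin.castAdd _) fun i => Fin.natAdd n (Fin.castAdd a' i))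
      (Fin.addCases (Fin.castAdd _) fun i => Fin.natAdd m (Fin.castAdd b' i)))
    (φ'.rename (Fin.addCases (Fin.castAdd _) fun i => Fin.natAdd n (Fin.natAdd a i))
      (Fin.addCases (Fin.castAdd _) fun i => Fin.natAdd m (Fin.natAdd b i))),
    Fin.append p p', Fin.append C C', fun h => .and ((hd h).rename _ _) ((hd' h).rename _ _),
    fun i => ?_, fun v W => ?_⟩⟩
  · refine Fin.addCases (fun i => ?_) (fun i => ?_) i
    · simpa using hC i
    · simpa using hC' i
  rw [hφ, hφ']
  refine Iff.symm (and_congr ?_ ?_) <;> rw [realize_rename] <;> apply iff_of_eq <;> congr 1 <;>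
  · funext i
    refine Fin.addCases (fun i => ?_) (fun i => ?_) i <;> simp

instance Dfn.or (P Q : (Fin n → A) → (Fin m → Set A) → Prop) [h : Dfn d E 𝒞 P]
    [h' : Dfn d E 𝒞 Q] : Dfn d E 𝒞 fun v W => P v W ∨ Q v W :=
  (inferInstance : Dfn d E 𝒞 fun v W => ¬ (¬ P v W ∧ ¬ Q v W)).congr fun v W => by tauto

instance Dfn.imp (P Q : (Fin n → A) → (Fin m → Set A) → Prop) [h : Dfn d E 𝒞 P]
    [h' : Dfn d E 𝒞 Q] : Dfn d E 𝒞 fun v W => P v W → Q v W :=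
  (inferInstance : Dfn d E 𝒞 fun v W => ¬ (P v W ∧ ¬ Q v W)).congr fun v W => by tauto

instance Dfn.iff (P Q : (Fin n → A) → (Fin m → Set A) → Prop) [h : Dfn d E 𝒞 P]
    [h' : Dfn d E 𝒞 Q] : Dfn d E 𝒞 fun v W => P v W ↔ Q v W :=
  (inferInstance : Dfn d E 𝒞 fun v W => (P v W → Q v W) ∧ (Q v W → P v W)).congr
    fun v W => by tauto

theorem Fin.append_cons_eq {α : Type*} {n a : ℕ} (x : α) (v : Fin n → α) (p : Fin a → α) :
    (Fin.cons x (Fin.append v p) : Fin (n + a + 1) → α) =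
      fun i => (Fin.append (Fin.cons x v : Fin (n + 1) → α) p)
        (Fin.cast (by omega) i) := by
  rw [Fin.append_cons]
  rfl

instance (priority := 900) Dfn.all (P : A → (Fin n → A) → (Fin m → Set A) → Prop)
    [h : Dfn False E 𝒞 fun (w : Fin (n + 1) → A) W => P (w 0) (fun i => w i.succ) W] :
    Dfn False E 𝒞 fun v W => ∀ x, P x v W := by
  obtain ⟨a, b, φ, p, C, hd, hC, hφ⟩ := h.out
  refine ⟨⟨a, b, .all (φ.rename (Fin.cast (by omega)) id), p, C, False.elim, hC, fun v W => ?_⟩⟩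
  refine forall_congr' fun x => ?_
  have := hφ (Fin.cons x v) W
  simp only [Fin.cons_zero, Fin.cons_succ] at this
  rw [this, realize_rename, Fin.append_cons_eq]
  rfl

instance (priority := 900) Dfn.ex (P : A → (Fin n → A) → (Fin m → Set A) → Prop)
    [h : Dfn False E 𝒞 fun (w : Fin (n + 1) → A) W => P (w 0) (fun i => w i.succ) W] :
    Dfn False E 𝒞 fun v W => ∃ x, P x v W :=
  (inferInstance : Dfn False E 𝒞 fun v W => ¬ ∀ x, ¬ P x v W).congr fun v W => by
    push Not; rfl

theorem Dfn.ball_var (i : Fin n) (P : A → (Fin n → A) → (Fin m → Set A) → Prop)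
    (h : Dfn d E 𝒞 fun (w : Fin (n + 1) → A) W => P (w 0) (fun i => w i.succ) W) :
    Dfn d E 𝒞 fun v W => ∀ x, E x (v i) → P x v W := by
  obtain ⟨a, b, φ, p, C, hd, hC, hφ⟩ := h.out
  refine ⟨⟨a, b, ball (Fin.castAdd a i) (φ.rename (Fin.cast (by omega)) id), p, C,
    fun h => .ball _ ((hd h).rename _ _), hC, fun v W => ?_⟩⟩
  rw [realize_ball, Fin.append_left]
  refine forall_congr' fun x => imp_congr_right fun _ => ?_
  have := hφ (Fin.cons x v) W
  simp only [Fin.cons_zero, Fin.cons_succ] at this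
  rw [this, realize_rename, Fin.append_cons_eq]
  rfl

instance Tm.var (i : Fin n) : Tm d E 𝒞 fun v => v i :=
  ⟨fun {_ m} σ P h => (h.rename (Fin.cons (σ i) id) id).congr fun v W => by simp⟩

instance Tm.const (c : A) : Tm d E 𝒞 fun _ : Fin n → A => c := by
  refine ⟨fun {n' m} σ P h => ?_⟩
  refine ((h.rename (n' := n' + 1) (Fin.cons (Fin.last n') Fin.castSucc) id).param c).congr
    fun v W => by simp

theorem Tm.rename {t : (Fin n → A) → A} (h : Tm d E 𝒞 t) {k : ℕ} (ρ : Fin n → Fin k) :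
    Tm d E 𝒞 fun v => t fun i => v (ρ i) :=
  ⟨fun σ P hP => h.subst (fun i => σ (ρ i)) P hP⟩

theorem Dfn.subst₂ {s t : (Fin n → A) → A} [hs : Tm d E 𝒞 s] [ht : Tm d E 𝒞 t]
    (P : A → A → Prop) (h : Dfn d E 𝒞 fun (w : Fin 2 → A) (_ : Fin m → Set A) => P (w 0) (w 1)) :
    Dfn d E 𝒞 fun v (_ : Fin m → Set A) => P (s v) (t v) := by
  refine hs.subst id (fun x v W => P x (t v)) ?_
  refine ht.subst Fin.succ (fun x v W => P (v 0) x) ?_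
  exact h.rename ![1, 0] id

instance Dfn.eq (s t : (Fin n → A) → A) [hs : Tm d E 𝒞 s] [ht : Tm d E 𝒞 t] :
    Dfn d E 𝒞 fun v (_ : Fin m → Set A) => s v = t v :=
  Dfn.subst₂ (fun x y => x = y) 
    ((Dfn.of_formula E 𝒞 (.eq 0 1) fun _ => .eq _ _).congr fun _ _ => Iff.rfl)

instance Dfn.mem (s t : (Fin n → A) → A) [hs : Tm d E 𝒞 s] [ht : Tm d E 𝒞 t] :
    Dfn d E 𝒞 fun v (_ : Fin m → Set A) => E (s v) (t v) :=
  Dfn.subst₂ (fun x y => E x y) 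
    ((Dfn.of_formula E 𝒞 (.mem 0 1) fun _ => .mem _ _).congr fun _ _ => Iff.rfl)

instance Dfn.memClass (s : (Fin n → A) → A) (F : (Fin n → A) → (Fin m → Set A) → Set A)
    [hs : Tm d E 𝒞 s] [hF : CT d E 𝒞 F] : Dfn d E 𝒞 fun v W => s v ∈ F v W :=
  hs.subst id (fun x v W => x ∈ F v W) hF.out

instance Dfn.ball (t : (Fin n → A) → A) (P : A → (Fin n → A) → (Fin m → Set A) → Prop)
    [ht : Tm d E 𝒞 t]
    [h : Dfn d E 𝒞 fun (w : Fin (n + 1) → A) W => P (w 0) (fun i => w i.succ) W] :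
    Dfn d E 𝒞 fun v W => ∀ x, E x (t v) → P x v W := by
  refine ht.subst id (fun y v W => ∀ x, E x y → P x v W) ?_
  refine Dfn.ball_var 0 (fun x w W => P x (fun i => w i.succ) W) ?_
  exact h.rename (Fin.cons 0 fun i => i.succ.succ) id

instance Dfn.bex (t : (Fin n → A) → A) (P : A → (Fin n → A) → (Fin m → Set A) → Prop)
    [ht : Tm d E 𝒞 t]
    [h : Dfn d E 𝒞 fun (w : Fin (n + 1) → A) W => P (w 0) (fun i => w i.succ) W] :
    Dfn d E 𝒞 fun v W => ∃ x, E x (t v) ∧ P x v W :=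
  (inferInstance : Dfn d E 𝒞 fun v W => ¬ ∀ x, E x (t v) → ¬ P x v W).congr fun v W => by
    push Not; rfl

instance Dfn.exUnique (P : A → (Fin n → A) → (Fin m → Set A) → Prop)
    [h : Dfn False E 𝒞 fun (w : Fin (n + 1) → A) W => P (w 0) (fun i => w i.succ) W] :
    Dfn False E 𝒞 fun v W => ∃! x, P x v W := by
  have h1 : Dfn False E 𝒞 fun (w : Fin (n + 1) → A) W =>
      ∀ y, P y (fun i => w i.succ) W → y = w 0 := by
    have h2 := h.rename (n' := n + 2) (Fin.cons 0 fun i => i.succ.succ) id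
    exact @Dfn.all _ _ _ _ _ (fun y w W => P y (fun i => w i.succ) W → y = w 0)
      (@Dfn.imp _ _ _ _ _ _ _ _ h2 inferInstance)
  exact @Dfn.ex _ _ _ _ _ (fun x v W => P x v W ∧ ∀ y, P y v W → y = x)
    (@Dfn.and _ _ _ _ _ _ _ _ h h1)

instance CT.var (j : Fin m) : CT d E 𝒞 fun (_ : Fin n → A) (W : Fin m → Set A) => W j :=
  ⟨(Dfn.of_formula (n := n + 1) E 𝒞 (.memClass 0 j) fun _ => .memClass _ _).congr
    fun _ _ => Iff.rfl⟩

/-- Membership of a class parameter in `𝒞` is a `Fact`, so that instance search can use it. -/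
instance CT.const (X : Set A) [hX : Fact (X ∈ 𝒞)] :
    CT d E 𝒞 fun (_ : Fin n → A) (_ : Fin m → Set A) => X :=
  ⟨((Dfn.of_formula (n := n + 1) (m := m + 1) E 𝒞 (.memClass 0 (Fin.last m))
    fun _ => .memClass _ _).classParam hX.out).congr fun v W => by simp [Realize]⟩

instance CT.setOf (P : A → (Fin n → A) → (Fin m → Set A) → Prop)
    [h : Dfn d E 𝒞 fun (w : Fin (n + 1) → A) W => P (w 0) (fun i => w i.succ) W] :
    CT d E 𝒞 fun v W => {x | P x v W} := ⟨h⟩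

theorem CT.rename {F : (Fin n → A) → (Fin m → Set A) → Set A} (h : CT d E 𝒞 F) {k : ℕ}
    (ρ : Fin n → Fin k) : CT d E 𝒞 fun v W => F (fun i => v (ρ i)) W := by
  refine ⟨(h.out.rename (Fin.cons 0 fun i => (ρ i).succ) id).congr fun v W => ?_⟩
  simp

theorem Dfn.realize (φ : SetFormula n m) : ∀ {n' m' : ℕ} (t : Fin n → (Fin n' → A) → A)
    (F : Fin m → (Fin n' → A) → (Fin m' → Set A) → Set A) (_ : ∀ i, Tm False E 𝒞 (t i))
    (_ : ∀ j, CT False E 𝒞 (F j)),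
    Dfn False E 𝒞 fun v W => φ.Realize E (fun i => t i v) (fun j => F j v W) := by
  induction φ with
  | eq i j => intro _ _ t F ht hF; exact Dfn.eq (t i) (t j)
  | mem i j => intro _ _ t F ht hF; exact Dfn.mem (t i) (t j)
  | memClass i j => intro _ _ t F ht hF; exact Dfn.memClass (t i) (F j)
  | neg φ ih => intro _ _ t F ht hF; exact @Dfn.not _ _ _ _ _ _ _ (ih t F ht hF)
  | and φ ψ ih ih' =>
    intro _ _ t F ht hF; exact @Dfn.and _ _ _ _ _ _ _ _ (ih t F ht hF) (ih' t F ht hF)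
  | all φ ih =>
    intro n' m' t F ht hF
    refine @Dfn.all _ _ _ _ _ (fun x v W => φ.Realize E (Fin.cons x fun i => t i v) _) ?_
    refine (ih (Fin.cons (fun w => w 0) fun i w => t i fun i => w i.succ)
      (fun j w W => F j (fun i => w i.succ) W) (fun i => ?_)
      (fun j => (hF j).rename _)).congr fun v W => ?_
    · refine Fin.cases ?_ (fun i => ?_) i
      · exact Tm.var 0
      · exact (ht i).rename _
    · apply iff_of_eq; congr 1
      funext i
      refine Fin.cases ?_ (fun i => ?_) i <;> simp

theorem Dfn.realize_delta0 {φ : SetFormula n m} (h : φ.IsDelta0) : ∀ {n' m' : ℕ}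
    (t : Fin n → (Fin n' → A) → A)
    (F : Fin m → (Fin n' → A) → (Fin m' → Set A) → Set A) (_ : ∀ i, Tm d E 𝒞 (t i))
    (_ : ∀ j, CT d E 𝒞 (F j)),
    Dfn d E 𝒞 fun v W => φ.Realize E (fun i => t i v) (fun j => F j v W) := by
  induction h with
  | eq i j => intro _ _ t F ht hF; exact Dfn.eq (t i) (t j)
  | mem i j => intro _ _ t F ht hF; exact Dfn.mem (t i) (t j)
  | memClass i j => intro _ _ t F ht hF; exact Dfn.memClass (t i) (F j)
  | neg _ ih => intro _ _ t F ht hF; exact @Dfn.not _ _ _ _ _ _ _ (ih t F ht hF)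
  | and _ _ ih ih' =>
    intro _ _ t F ht hF; exact @Dfn.and _ _ _ _ _ _ _ _ (ih t F ht hF) (ih' t F ht hF)
  | @ball _ _ i φ _ ih =>
    intro n' m' t F ht hF
    refine (@Dfn.ball _ _ _ _ _ _ (t i)
      (fun x v W => φ.Realize E (Fin.cons x fun i => t i v) fun j => F j v W) (ht i) ?_).congr
      fun v W => realize_ball _ _ _ _
    refine (ih (Fin.cons (fun w => w 0) fun i w => t i fun i => w i.succ)
      (fun j w W => F j (fun i => w i.succ) W) (fun i => ?_)
      (fun j => (hF j).rename _)).congr fun v W => ?_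
    · refine Fin.cases ?_ (fun i => ?_) i
      · exact Tm.var 0
      · exact (ht i).rename _
    · apply iff_of_eq; congr 1
      funext i
      refine Fin.cases ?_ (fun i => ?_) i <;> simp

/-- Simultaneous substitution of terms and class terms into a definable predicate. -/
theorem Dfn.comp {k l : ℕ} {P : (Fin k → A) → (Fin l → Set A) → Prop} (h : Dfn d E 𝒞 P)
    (t : Fin k → (Fin n → A) → A) (F : Fin l → (Fin n → A) → (Fin m → Set A) → Set A)
    (ht : ∀ i, Tm d E 𝒞 (t i)) (hF : ∀ j, CT d E 𝒞 (F j)) :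
    Dfn d E 𝒞 fun v W => P (fun i => t i v) (fun j => F j v W) := by
  obtain ⟨a, b, φ, p, C, hd, hC, hφ⟩ := h.out
  have key : Dfn d E 𝒞 fun v W => φ.Realize E
      (fun i => Fin.append t (fun i _ => p i) i v) (fun j => Fin.append F (fun j _ _ => C j) j v W) := by
    have h1 : ∀ i, Tm d E 𝒞 (Fin.append t (fun i _ => p i) i) := fun i => by
      refine Fin.addCases (fun i => ?_) (fun i => ?_) i
      · simpa using ht i
      · simpa using Tm.const (p i)
    have h2 : ∀ i, CT d E 𝒞 (Fin.append F (fun j _ _ => C j) i) := fun i => by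
      refine Fin.addCases (fun i => ?_) (fun i => ?_) i
      · simpa using hF i
      · have : Fact (C i ∈ 𝒞) := ⟨hC i⟩
        simpa using CT.const (C i)
    by_cases hd' : d
    · exact Dfn.realize_delta0 (hd hd') _ _ h1 h2
    · have : d = False := eq_false hd'
      subst this
      exact Dfn.realize φ _ _ h1 h2
  refine key.congr fun v W => ?_
  rw [hφ]
  apply iff_of_eq; congr 1 <;>
  · funext i
    refine Fin.addCases (fun i => ?_) (fun i => ?_) i <;> simp

/-- Terms with a definable graph may be substituted, at the cost of an unbounded quantifier. -/
theorem Tm.of_graph (t : (Fin n → A) → A)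
    (h : Dfn False E 𝒞 fun (w : Fin (n + 1) → A) (_ : Fin 0 → Set A) =>
      w 0 = t fun i => w i.succ) : Tm False E 𝒞 t := by
  refine ⟨fun {n' m} σ P hP => ?_⟩
  have h1 : Dfn False E 𝒞 fun v W => ∃ x, x = (t fun i => v (σ i)) ∧ P x v W := by
    refine @Dfn.ex _ _ _ _ _ _ (@Dfn.and _ _ _ _ _ _ _ _ ?_ hP)
    exact (h.rename (Fin.cons 0 fun i => (σ i).succ) Fin.elim0).congr fun v W => by simp
  exact h1.congr fun v W => by simp

theorem Tm.comp {k : ℕ} {f : (Fin k → A) → A} (h : Tm False E 𝒞 f)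
    (t : Fin k → (Fin n → A) → A) (ht : ∀ i, Tm False E 𝒞 (t i)) :
    Tm False E 𝒞 fun v => f fun i => t i v := by
  refine Tm.of_graph _ ?_
  have h1 : Dfn False E 𝒞 fun (w : Fin (k + 1) → A) (_ : Fin 0 → Set A) =>
      w 0 = f fun i => w i.succ :=
    h.subst Fin.succ (fun x w _ => w 0 = x) inferInstance
  refine (h1.comp (Fin.cons (fun w => w 0) fun i w => t i fun j => w j.succ) Fin.elim0 (fun i => ?_)
    fun j => j.elim0).congr fun v W => ?_
  · refine Fin.cases (Tm.var 0) (fun i => (ht i).rename _) i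
  · simp

/-- The class term obtained by substitution into a class term. -/
theorem CT.comp {k l : ℕ} {G : (Fin k → A) → (Fin l → Set A) → Set A} (h : CT d E 𝒞 G)
    (t : Fin k → (Fin n → A) → A) (F : Fin l → (Fin n → A) → (Fin m → Set A) → Set A)
    (ht : ∀ i, Tm d E 𝒞 (t i)) (hF : ∀ j, CT d E 𝒞 (F j)) :
    CT d E 𝒞 fun v W => G (fun i => t i v) (fun j => F j v W) := by
  refine ⟨(h.out.comp (Fin.cons (fun w => w 0) fun i w => t i fun j => w j.succ)
    (fun j w W => F j (fun i => w i.succ) W) (fun i => ?_) fun j => (hF j).rename _).congr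
      fun v W => ?_⟩
  · refine Fin.cases (Tm.var 0) (fun i => (ht i).rename _) i
  · simp

instance Tm.vecCons (s : (Fin n → A) → A) {k : ℕ} (t : Fin k → (Fin n → A) → A)
    [hs : Tm d E 𝒞 s] [ht : ∀ i, Tm d E 𝒞 (t i)] (i : Fin (k + 1)) :
    Tm d E 𝒞 (Matrix.vecCons s t i) := by
  refine Fin.cases hs (fun i => ht i) i

instance Tm.vecEmpty (i : Fin 0) : Tm d E 𝒞 (![] i : (Fin n → A) → A) := i.elim0

instance CT.vecCons (F : (Fin n → A) → (Fin m → Set A) → Set A) {k : ℕ}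
    (G : Fin k → (Fin n → A) → (Fin m → Set A) → Set A)
    [hF : CT d E 𝒞 F] [hG : ∀ i, CT d E 𝒞 (G i)] (i : Fin (k + 1)) :
    CT d E 𝒞 (Matrix.vecCons F G i) := by
  refine Fin.cases hF (fun i => hG i) i

instance CT.vecEmpty (i : Fin 0) :
    CT d E 𝒞 (![] i : (Fin n → A) → (Fin m → Set A) → Set A) := i.elim0

/-- Substitution, the definability of the substituted terms being left to instance search. -/
theorem Dfn.app {k l : ℕ} {P : (Fin k → A) → (Fin l → Set A) → Prop} (h : Dfn d E 𝒞 P)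
    (t : Fin k → (Fin n → A) → A) (F : Fin l → (Fin n → A) → (Fin m → Set A) → Set A)
    [ht : ∀ i, Tm d E 𝒞 (t i)] [hF : ∀ j, CT d E 𝒞 (F j)] :
    Dfn d E 𝒞 fun v W => P (fun i => t i v) (fun j => F j v W) := h.comp t F ht hF

/-- A disjunction over a standard finite index set is definable. -/
instance (priority := 900) Dfn.exFin {k : ℕ}
    (P : Fin k → (Fin n → A) → (Fin m → Set A) → Prop) [h : ∀ i, Dfn False E 𝒞 (P i)] :
    Dfn False E 𝒞 fun v W => ∃ i, P i v W := by
  induction k with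
  | zero =>
    have : Dfn False E 𝒞 fun (_ : Fin n → A) (_ : Fin m → Set A) => ¬ ∀ x : A, x = x := inferInstance
    exact this.congr fun v W => by simp
  | succ k ih =>
    have h1 := ih fun i => P i.succ
    have : Dfn False E 𝒞 fun v W => P 0 v W ∨ ∃ i : Fin k, P i.succ v W := inferInstance
    exact this.congr fun v W => Fin.exists_fin_succ

theorem Dfn.mono {𝒞' : Set (Set A)} {P : (Fin n → A) → (Fin m → Set A) → Prop} (h : Dfn d E 𝒞 P)
    (hs : 𝒞 ⊆ 𝒞') : Dfn d E 𝒞' P := by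
  obtain ⟨a, b, φ, p, C, hd, hC, hφ⟩ := h.out
  exact ⟨a, b, φ, p, C, hd, fun i => hs (hC i), hφ⟩

end

/-! ### Comprehension and the axioms of KP for definable predicates -/

namespace ClassModel

variable {𝔐 : ClassModel.{u}}

/-- `P` is definable in `𝔐` by a formula without class quantifiers, with parameters from `𝔐`. -/
abbrev El (𝔐 : ClassModel.{u}) {n m : ℕ}
    (P : (Fin n → 𝔐.carrier) → (Fin m → Set 𝔐.carrier) → Prop) : Prop :=
  Dfn False 𝔐.mem 𝔐.classes P

theorem _root_.ClassTheory.append_one {α : Type*} {a : ℕ} (x : α) (p : Fin a → α) :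
    Fin.append (fun _ : Fin 1 => x) p = fun i => (Fin.cons x p : Fin (a + 1) → α)
      (Fin.cast (Nat.add_comm 1 a) i) := by
  rw [Fin.append_left_eq_cons]; rfl

theorem sigma_setOf_mem (h : 𝔐.Sigma11Comprehension) {k : ℕ}
    (P : 𝔐.carrier → (Fin k → Set 𝔐.carrier) → Prop)
    [hP : 𝔐.El fun (v : Fin 1 → 𝔐.carrier) W => P (v 0) W] :
    {x | ∃ X : Fin k → Set 𝔐.carrier, (∀ i, X i ∈ 𝔐.classes) ∧ P x X} ∈ 𝔐.classes := by
  obtain ⟨a, b, φ, p, C, -, hC, hφ⟩ := hP.out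
  have := h (n := a) (m := b) (k := k) (φ.rename (Fin.cast (by omega))
    (Fin.addCases (Fin.natAdd b) (Fin.castAdd k))) p C hC
  convert this using 1
  ext x
  refine exists_congr fun X => and_congr_right fun _ => ?_
  have h1 := hφ (fun _ => x) X
  rw [h1, realize_rename]
  apply iff_of_eq; congr 1
  · exact append_one x p
  · funext i
    refine Fin.addCases (fun i => ?_) (fun i => ?_) i <;> simp

theorem delta_setOf_mem (h : 𝔐.Delta11Comprehension) {k l : ℕ}
    (P : 𝔐.carrier → (Fin k → Set 𝔐.carrier) → Prop)
    (P' : 𝔐.carrier → (Fin l → Set 𝔐.carrier) → Prop)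
    [hP : 𝔐.El fun (v : Fin 1 → 𝔐.carrier) W => P (v 0) W]
    [hP' : 𝔐.El fun (v : Fin 1 → 𝔐.carrier) W => P' (v 0) W]
    (hPP : ∀ x, (∃ X : Fin k → Set 𝔐.carrier, (∀ i, X i ∈ 𝔐.classes) ∧ P x X) ↔
      ∀ X : Fin l → Set 𝔐.carrier, (∀ i, X i ∈ 𝔐.classes) → P' x X) :
    {x | ∃ X : Fin k → Set 𝔐.carrier, (∀ i, X i ∈ 𝔐.classes) ∧ P x X} ∈ 𝔐.classes := by
  obtain ⟨a, b, φ, p, C, -, hC, hφ⟩ := hP.out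
  obtain ⟨a', b', φ', p', C', -, hC', hφ'⟩ := hP'.out
  have e : {x | ∃ X : Fin k → Set 𝔐.carrier, (∀ i, X i ∈ 𝔐.classes) ∧ P x X} =
      𝔐.sigmaExt (n := a + a') (m := b + b') (k := k)
        (φ.rename (Fin.addCases (fun _ => 0) fun i => (Fin.castAdd a' i).succ)
        (Fin.addCases (Fin.natAdd _) fun j => Fin.castAdd k (Fin.castAdd b' j)))
        (Fin.append p p') (Fin.append C C') := by
    ext x
    refine exists_congr fun X => and_congr_right fun _ => ?_
    have h1 := hφ (fun _ => x) X
    rw [h1, realize_rename]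
    apply iff_of_eq; congr 1 <;>
    · funext i
      refine Fin.addCases (fun i => ?_) (fun i => ?_) i <;> simp
  have e' : {x | ∀ X : Fin l → Set 𝔐.carrier, (∀ i, X i ∈ 𝔐.classes) → P' x X} =
      𝔐.piExt (n := a + a') (m := b + b') (k := l)
        (φ'.rename (Fin.addCases (fun _ => 0) fun i => (Fin.natAdd a i).succ)
        (Fin.addCases (Fin.natAdd _) fun j => Fin.castAdd l (Fin.natAdd b j)))
        (Fin.append p p') (Fin.append C C') := by
    ext x
    refine forall_congr' fun X => imp_congr_right fun _ => ?_
    have h1 := hφ' (fun _ => x) X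
    rw [h1, realize_rename]
    apply iff_of_eq; congr 1 <;>
    · funext i
      refine Fin.addCases (fun i => ?_) (fun i => ?_) i <;> simp
  have := h _ _ (Fin.append p p') (Fin.append C C') (fun i => ?_)
    (e.symm.trans ((Set.ext hPP).trans e'))
  · rwa [← e] at this
  · refine Fin.addCases (fun i => ?_) (fun i => ?_) i
    · simpa using hC i
    · simpa using hC' i

theorem setOf_mem (h : 𝔐.ElementaryComprehension) (P : 𝔐.carrier → Prop)
    [hP : 𝔐.El fun (v : Fin 1 → 𝔐.carrier) (_ : Fin 0 → Set 𝔐.carrier) => P (v 0)] :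
    {x | P x} ∈ 𝔐.classes := by
  obtain ⟨a, b, φ, p, C, -, hC, hφ⟩ := hP.out
  have := h (n := a) (m := b) (φ.rename (Fin.cast (by omega)) (Fin.cast (by omega))) p C hC
  convert this using 1
  ext x
  have h1 := hφ (fun _ => x) Fin.elim0
  change P x ↔ Realize 𝔐.mem _ _ _
  rw [h1, realize_rename]
  apply iff_of_eq; congr 1
  · exact append_one x p
  · rw [Fin.elim0_append]; rfl

end ClassModel

namespace ModelsKP

variable {B : Type u} {e : B → B → Prop}

/-- `P` is `Δ₀` over `(B, e)`, with parameters. -/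
abbrev D0 (e : B → B → Prop) {n : ℕ} (P : (Fin n → B) → (Fin 0 → Set B) → Prop) : Prop :=
  Dfn True e ∅ P

theorem exists_formula {d : Prop} {n : ℕ} {P : (Fin n → B) → (Fin 0 → Set B) → Prop}
    (h : Dfn d e ∅ P) : ∃ (a : ℕ) (φ : SetFormula (n + a) 0) (p : Fin a → B),
      (d → φ.IsDelta0) ∧ ∀ v, P v Fin.elim0 ↔ φ.Realize e (Fin.append v p) Fin.elim0 := by
  obtain ⟨a, b, φ, p, C, hd, hC, hφ⟩ := h.out
  have hb : b = 0 := by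
    rcases b with - | b
    · rfl
    · exact absurd (hC 0) (by simp)
  subst hb
  refine ⟨a, φ, p, hd, fun v => ?_⟩
  rw [hφ]
  apply iff_of_eq; congr 1
  funext i; exact i.elim0

theorem sep (h : ModelsKP B e) (P : B → Prop)
    [hP : D0 e fun (v : Fin 1 → B) (_ : Fin 0 → Set B) => P (v 0)] (a : B) :
    ∃ b, ∀ x, e x b ↔ e x a ∧ P x := by
  obtain ⟨k, φ, p, hd, hφ⟩ := exists_formula hP
  obtain ⟨b, hb⟩ := h.separation (n := k) (φ.rename (Fin.cast (by omega)) id)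
    ((hd trivial).rename _ _) p a
  refine ⟨b, fun x => (hb x).trans (and_congr_right fun _ => ?_)⟩
  have h1 := hφ fun _ => x
  rw [h1, realize_rename, append_one]; rfl

theorem coll (h : ModelsKP B e) (P : B → B → Prop)
    [hP : D0 e fun (v : Fin 2 → B) (_ : Fin 0 → Set B) => P (v 0) (v 1)] (a : B)
    (ha : ∀ x, e x a → ∃ y, P x y) : ∃ b, ∀ x, e x a → ∃ y, e y b ∧ P x y := by
  obtain ⟨k, φ, p, hd, hφ⟩ := exists_formula hP
  have key : ∀ x y, P x y ↔ (φ.rename (Fin.cast (by omega)) id : SetFormula (k + 2) 0).Realize e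
      (Fin.cons x (Fin.cons y p)) Fin.elim0 := fun x y => by
    have h1 := hφ ![x, y]
    simp only [Matrix.cons_val_zero, Matrix.cons_val_one] at h1
    rw [h1, realize_rename]
    apply iff_of_eq; congr 1
    funext i
    refine Fin.addCases (fun i => ?_) (fun i => ?_) i
    · fin_cases i <;> rfl
    · simp only [Fin.append_right]
      have : Fin.cast (by omega : 2 + k = k + 2) (Fin.natAdd 2 i) = i.succ.succ := by
        ext; simp
      rw [this]; rfl
  simp only [key] at ha ⊢
  exact h.collection _ ((hd trivial).rename _ _) p a ha

end ModelsKP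

end ClassTheory

namespace ClassTheory
open SetFormula
namespace ClassModel

/-! ### Pairs, definability of the basic notions -/

section Bounded

variable {𝔐 : ClassModel.{u}} {d : Prop} {n m : ℕ} {𝒞 : Set (Set 𝔐.carrier)}
  (s t r : (Fin n → 𝔐.carrier) → 𝔐.carrier)
  [Tm d 𝔐.mem 𝒞 s] [Tm d 𝔐.mem 𝒞 t] [Tm d 𝔐.mem 𝒞 r]

theorem isUPair_iff_bounded {z x y : 𝔐.carrier} : 𝔐.IsUPair z x y ↔
    𝔐.mem x z ∧ 𝔐.mem y z ∧ ∀ w, 𝔐.mem w z → w = x ∨ w = y := by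
  constructor
  · intro h; exact ⟨(h x).2 (Or.inl rfl), (h y).2 (Or.inr rfl), fun w => (h w).1⟩
  · rintro ⟨hx, hy, h⟩ w
    refine ⟨h w, ?_⟩
    rintro (rfl | rfl) <;> assumption

theorem isPair_iff_bounded {p x y : 𝔐.carrier} : 𝔐.IsPair p x y ↔
    ∃ s, 𝔐.mem s p ∧ ∃ d, 𝔐.mem d p ∧ 𝔐.IsUPair s x x ∧ 𝔐.IsUPair d x y ∧
      ∀ w, 𝔐.mem w p → w = s ∨ w = d := by
  constructor
  · rintro ⟨s, d, hs, hd, hp⟩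
    exact ⟨s, (hp s).2 (Or.inl rfl), d, (hp d).2 (Or.inr rfl), hs, hd, fun w => (hp w).1⟩
  · rintro ⟨s, hs, d, hd, hs', hd', h⟩
    exact ⟨s, d, hs', hd', isUPair_iff_bounded.2 ⟨hs, hd, h⟩⟩

instance : Dfn d 𝔐.mem 𝒞 fun v (_ : Fin m → Set 𝔐.carrier) =>
    𝔐.IsUPair (s v) (t v) (r v) := by
  have : Dfn d 𝔐.mem 𝒞 fun (v : Fin 3 → 𝔐.carrier) (_ : Fin 0 → Set 𝔐.carrier) =>
      𝔐.IsUPair (v 0) (v 1) (v 2) := by simp only [isUPair_iff_bounded]; infer_instance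
  exact this.app ![s, t, r] ![]

instance : Dfn d 𝔐.mem 𝒞 fun v (_ : Fin m → Set 𝔐.carrier) =>
    𝔐.IsPair (s v) (t v) (r v) := by
  have : Dfn d 𝔐.mem 𝒞 fun (v : Fin 3 → 𝔐.carrier) (_ : Fin 0 → Set 𝔐.carrier) =>
      𝔐.IsPair (v 0) (v 1) (v 2) := by simp only [isPair_iff_bounded]; infer_instance
  exact this.app ![s, t, r] ![]

instance : Dfn d 𝔐.mem 𝒞 fun v (_ : Fin m → Set 𝔐.carrier) =>
    𝔐.App (s v) (t v) (r v) := by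
  have : Dfn d 𝔐.mem 𝒞 fun (v : Fin 3 → 𝔐.carrier) (_ : Fin 0 → Set 𝔐.carrier) =>
      𝔐.App (v 0) (v 1) (v 2) := by unfold App; infer_instance
  exact this.app ![s, t, r] ![]

theorem IsPair.exists_mem {p x y : 𝔐.carrier} (h : 𝔐.IsPair p x y) :
    ∃ e, 𝔐.mem e p ∧ 𝔐.mem x e ∧ 𝔐.mem y e := by
  obtain ⟨s, d, hs, hd, hp⟩ := h
  exact ⟨d, (hp d).2 (Or.inr rfl), (hd x).2 (Or.inl rfl), (hd y).2 (Or.inr rfl)⟩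

/-- Quantification over the values of a set function is bounded. -/
instance Dfn.ballApp (P : 𝔐.carrier → (Fin n → 𝔐.carrier) → (Fin m → Set 𝔐.carrier) → Prop)
    [h : Dfn d 𝔐.mem 𝒞 fun (w : Fin (n + 1) → 𝔐.carrier) W => P (w 0) (fun i => w i.succ) W] :
    Dfn d 𝔐.mem 𝒞 fun v W => ∀ y, 𝔐.App (s v) (t v) y → P y v W := by
  have hs : Tm d 𝔐.mem 𝒞 s := inferInstance
  have ht : Tm d 𝔐.mem 𝒞 t := inferInstance
  have h3 : Dfn d 𝔐.mem 𝒞 fun (w : Fin (n + 3) → 𝔐.carrier) W =>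
      P (w 0) (fun i => w i.succ.succ.succ) W := h.rename (Fin.cons 0 fun i => i.succ.succ.succ) id
  have ht3 : Tm d 𝔐.mem 𝒞 fun w : Fin (n + 3) → 𝔐.carrier => t fun i => w i.succ.succ.succ :=
    ht.rename _
  have key : Dfn d 𝔐.mem 𝒞 fun v W => ∀ p, 𝔐.mem p (s v) → ∀ e, 𝔐.mem e p → ∀ y, 𝔐.mem y e →
      𝔐.IsPair p (t v) y → P y v W :=
    @Dfn.ball _ _ _ _ _ _ s (fun p v W => ∀ e, 𝔐.mem e p → ∀ y, 𝔐.mem y e →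
      𝔐.IsPair p (t v) y → P y v W) _
    (@Dfn.ball _ _ _ _ _ _ (fun w => w 0) (fun e w W => ∀ y, 𝔐.mem y e →
      𝔐.IsPair (w 0) (t fun i => w i.succ) y → P y (fun i => w i.succ) W) _
    (@Dfn.ball _ _ _ _ _ _ (fun w => w 0) (fun y w W =>
      𝔐.IsPair (w 1) (t fun i => w i.succ.succ) y → P y (fun i => w i.succ.succ) W) _
    (@Dfn.imp _ _ _ _ _ _ _ _ inferInstance h3)))
  refine key.congr fun v W => ⟨fun h p hp e _ y _ hpy => h y ⟨p, hp, hpy⟩, fun h y hy => ?_⟩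
  obtain ⟨p, hp, hpy⟩ := hy
  obtain ⟨e, he, -, hye⟩ := hpy.exists_mem
  exact h p hp e he y hye hpy

instance Dfn.bexApp (P : 𝔐.carrier → (Fin n → 𝔐.carrier) → (Fin m → Set 𝔐.carrier) → Prop)
    [h : Dfn d 𝔐.mem 𝒞 fun (w : Fin (n + 1) → 𝔐.carrier) W => P (w 0) (fun i => w i.succ) W] :
    Dfn d 𝔐.mem 𝒞 fun v W => ∃ y, 𝔐.App (s v) (t v) y ∧ P y v W :=
  (inferInstance : Dfn d 𝔐.mem 𝒞 fun v W => ¬ ∀ y, 𝔐.App (s v) (t v) y → ¬ P y v W).congr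
    fun v W => by push Not; rfl

end Bounded

section Definability

variable {𝔐 : ClassModel.{u}} {n m : ℕ} {𝒞 : Set (Set 𝔐.carrier)}
  (s t r : (Fin n → 𝔐.carrier) → 𝔐.carrier)
  (F G : (Fin n → 𝔐.carrier) → (Fin m → Set 𝔐.carrier) → Set 𝔐.carrier)
  [Tm False 𝔐.mem 𝒞 s] [Tm False 𝔐.mem 𝒞 t] [Tm False 𝔐.mem 𝒞 r]
  [CT False 𝔐.mem 𝒞 F] [CT False 𝔐.mem 𝒞 G]

instance : Dfn False 𝔐.mem 𝒞 fun v W => 𝔐.Rel (F v W) (s v) (t v) := by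
  have : Dfn False 𝔐.mem 𝒞 fun (v : Fin 2 → 𝔐.carrier) (W : Fin 1 → Set 𝔐.carrier) =>
      𝔐.Rel (W 0) (v 0) (v 1) := by unfold Rel; infer_instance
  exact this.app ![s, t] ![F]

instance : Dfn False 𝔐.mem 𝒞 fun v (_ : Fin m → Set 𝔐.carrier) => 𝔐.IsZero (s v) := by
  have : Dfn False 𝔐.mem 𝒞 fun (v : Fin 1 → 𝔐.carrier) (_ : Fin 0 → Set 𝔐.carrier) =>
      𝔐.IsZero (v 0) := by unfold IsZero; infer_instance
  exact this.app ![s] ![]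

instance : Dfn False 𝔐.mem 𝒞 fun v (_ : Fin m → Set 𝔐.carrier) => 𝔐.IsSucc (s v) (t v) := by
  have : Dfn False 𝔐.mem 𝒞 fun (v : Fin 2 → 𝔐.carrier) (_ : Fin 0 → Set 𝔐.carrier) =>
      𝔐.IsSucc (v 0) (v 1) := by unfold IsSucc; infer_instance
  exact this.app ![s, t] ![]

instance : Dfn False 𝔐.mem 𝒞 fun v (_ : Fin m → Set 𝔐.carrier) => 𝔐.IsInductive (s v) := by
  have : Dfn False 𝔐.mem 𝒞 fun (v : Fin 1 → 𝔐.carrier) (_ : Fin 0 → Set 𝔐.carrier) =>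
      𝔐.IsInductive (v 0) := by unfold IsInductive; infer_instance
  exact this.app ![s] ![]

instance : Dfn False 𝔐.mem 𝒞 fun v (_ : Fin m → Set 𝔐.carrier) => 𝔐.IsNat (s v) := by
  have : Dfn False 𝔐.mem 𝒞 fun (v : Fin 1 → 𝔐.carrier) (_ : Fin 0 → Set 𝔐.carrier) =>
      𝔐.IsNat (v 0) := by unfold IsNat; infer_instance
  exact this.app ![s] ![]

instance : Dfn False 𝔐.mem 𝒞 fun v W => 𝔐.HasDistance (F v W) (s v) (t v) (r v) := by
  have : Dfn False 𝔐.mem 𝒞 fun (v : Fin 3 → 𝔐.carrier) (W : Fin 1 → Set 𝔐.carrier) =>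
      𝔐.HasDistance (W 0) (v 0) (v 1) (v 2) := by unfold HasDistance; infer_instance
  exact this.app ![s, t, r] ![F]

end Definability

/-- Extensionality and Pairing. -/
class Pairs (𝔐 : ClassModel.{u}) : Prop where
  ext : ∀ x y, (∀ z, 𝔐.mem z x ↔ 𝔐.mem z y) → x = y
  pairing : ∀ x y, ∃ z, 𝔐.IsUPair z x y

/-- `𝔐` satisfies the axioms of class theory other than choice. -/
class Nbg (𝔐 : ClassModel.{u}) : Prop where
  out : 𝔐.NBGWithoutChoice

instance (𝔐 : ClassModel.{u}) [h : Nbg 𝔐] : Pairs 𝔐 := ⟨h.out.extensionality, h.out.pairing⟩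

variable {𝔐 : ClassModel.{u}}

/-- The ordered pair `⟨x, y⟩`. -/
noncomputable def pr (𝔐 : ClassModel.{u}) (x y : 𝔐.carrier) : 𝔐.carrier :=
  @Classical.epsilon _ ⟨x⟩ fun p => 𝔐.IsPair p x y

section Pairs

variable [Pairs 𝔐]

theorem IsUPair.unique {z z' x y : 𝔐.carrier} (h : 𝔐.IsUPair z x y) (h' : 𝔐.IsUPair z' x y) :
    z = z' := Pairs.ext _ _ fun w => (h w).trans (h' w).symm

theorem exists_isPair (x y : 𝔐.carrier) : ∃ p, 𝔐.IsPair p x y := by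
  obtain ⟨s, hs⟩ := Pairs.pairing x x
  obtain ⟨d, hd⟩ := Pairs.pairing x y
  obtain ⟨p, hp⟩ := Pairs.pairing s d
  exact ⟨p, s, d, hs, hd, hp⟩

theorem isPair_iff {p x y : 𝔐.carrier} : 𝔐.IsPair p x y ↔ p = 𝔐.pr x y := by
  have h1 : 𝔐.IsPair (𝔐.pr x y) x y := @Classical.epsilon_spec _ _ (exists_isPair x y)
  constructor
  · rintro ⟨s, d, hs, hd, hp⟩
    obtain ⟨s', d', hs', hd', hp'⟩ := h1
    obtain rfl := hs.unique hs'
    obtain rfl := hd.unique hd'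
    exact hp.unique hp'
  · rintro rfl; exact h1

theorem isPair_pr (x y : 𝔐.carrier) : 𝔐.IsPair (𝔐.pr x y) x y := isPair_iff.2 rfl

theorem pr_inj {x y x' y' : 𝔐.carrier} : 𝔐.pr x y = 𝔐.pr x' y' ↔ x = x' ∧ y = y' := by
  refine ⟨fun h => ?_, by rintro ⟨rfl, rfl⟩; rfl⟩
  obtain ⟨s, d, hs, hd, hp⟩ := isPair_pr x y
  obtain ⟨s', d', hs', hd', hp'⟩ := isPair_pr x' y'
  rw [h] at hp
  have h1 : ∀ w, (w = s ∨ w = d) ↔ (w = s' ∨ w = d') := fun w => (hp w).symm.trans (hp' w)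
  have hs1 := fun w => (hs w)
  have e1 : s = s' ∨ s = d' := (h1 s).1 (Or.inl rfl)
  have e2 : d = s' ∨ d = d' := (h1 d).1 (Or.inr rfl)
  have e3 : s' = s ∨ s' = d := (h1 s').2 (Or.inl rfl)
  have e4 : d' = s ∨ d' = d := (h1 d').2 (Or.inr rfl)
  have hx : x = x' := by
    rcases e1 with rfl | rfl
    · simpa using (hs' x).1 ((hs x).2 (Or.inl rfl))
    · simpa [eq_comm] using (hs x').1 ((hd' x').2 (Or.inl rfl))
  subst hx
  refine ⟨rfl, ?_⟩
  obtain rfl := hs.unique hs'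
  have a1 : ∀ {d y : 𝔐.carrier}, 𝔐.IsUPair d x y → d = s → y = x := by
    rintro d y hd rfl
    simpa using (hs y).1 ((hd y).2 (Or.inr rfl))
  rcases e2 with rfl | rfl
  · have := a1 hd rfl
    subst this
    rcases e4 with rfl | rfl
    · exact (a1 hd' rfl).symm
    · exact (a1 hd' rfl).symm
  · have b1 := (hd y').1 ((hd' y').2 (Or.inr rfl))
    have b2 := (hd' y).1 ((hd y).2 (Or.inr rfl))
    rcases b1 with rfl | rfl
    · rcases b2 with rfl | rfl <;> rfl
    · rfl

theorem rel_iff {R : Set 𝔐.carrier} {x y : 𝔐.carrier} : 𝔐.Rel R x y ↔ 𝔐.pr x y ∈ R := by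
  simp [Rel, isPair_iff]

theorem app_iff {f x y : 𝔐.carrier} : 𝔐.App f x y ↔ 𝔐.mem (𝔐.pr x y) f := by
  simp [App, isPair_iff]

instance Tm.pr {n : ℕ} {𝒞 : Set (Set 𝔐.carrier)} (s t : (Fin n → 𝔐.carrier) → 𝔐.carrier)
    [Tm False 𝔐.mem 𝒞 s] [Tm False 𝔐.mem 𝒞 t] : Tm False 𝔐.mem 𝒞 fun v => 𝔐.pr (s v) (t v) := by
  have : Tm False 𝔐.mem 𝒞 fun v : Fin 2 → 𝔐.carrier => 𝔐.pr (v 0) (v 1) := by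
    refine Tm.of_graph _ ?_
    have : Dfn False 𝔐.mem 𝒞 fun (w : Fin 3 → 𝔐.carrier) (_ : Fin 0 → Set 𝔐.carrier) =>
      𝔐.IsPair (w 0) (w 1) (w 2) := inferInstance
    exact this.congr fun v W => isPair_iff.symm
  exact this.comp ![s, t] inferInstance

end Pairs

/-! ### Sets, successors and natural numbers -/

section Nbg

variable [hM : Nbg 𝔐]

theorem ext {x y : 𝔐.carrier} (h : ∀ z, 𝔐.mem z x ↔ 𝔐.mem z y) : x = y :=
  Pairs.ext x y h

theorem setOf_mem' (P : 𝔐.carrier → Prop)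
    [hP : 𝔐.El fun (v : Fin 1 → 𝔐.carrier) (_ : Fin 0 → Set 𝔐.carrier) => P (v 0)] :
    {x | P x} ∈ 𝔐.classes := setOf_mem hM.out.comprehension P

theorem replace (G : 𝔐.carrier → 𝔐.carrier → Prop)
    [hG : 𝔐.El fun (v : Fin 2 → 𝔐.carrier) (_ : Fin 0 → Set 𝔐.carrier) => G (v 0) (v 1)]
    (h : ∀ x y y', G x y → G x y' → y = y') (a : 𝔐.carrier) :
    ∃ b, ∀ y, 𝔐.mem y b ↔ ∃ x, 𝔐.mem x a ∧ G x y := by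
  have h1 : 𝔐.El fun (v : Fin 3 → 𝔐.carrier) (_ : Fin 0 → Set 𝔐.carrier) => G (v 1) (v 0) :=
    hG.rename ![1, 0] id
  have h2 : {p | ∃ x y, G x y ∧ p = 𝔐.pr x y} ∈ 𝔐.classes := by
    have : 𝔐.El fun (v : Fin 1 → 𝔐.carrier) (_ : Fin 0 → Set 𝔐.carrier) =>
        ∃ x y, G x y ∧ v 0 = 𝔐.pr x y := by
      refine @Dfn.ex _ _ _ _ _ (fun x v _ => ∃ y, G x y ∧ v 0 = 𝔐.pr x y)
        (@Dfn.ex _ _ _ _ _ (fun y w _ => G (w 0) y ∧ w 1 = 𝔐.pr (w 0) y)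
          (@Dfn.and _ _ _ _ _ _ _ _ h1 inferInstance))
    exact setOf_mem' _
  obtain ⟨b, hb⟩ := hM.out.replacement _ h2 (fun x y y' => by
    simp only [rel_iff, Set.mem_ofPred_eq, pr_inj]
    rintro ⟨x1, y1, h1, rfl, rfl⟩ ⟨x2, y2, h2, rfl, rfl⟩
    exact h _ _ _ h1 h2) a
  refine ⟨b, fun y => (hb y).trans (exists_congr fun x => and_congr_right fun _ => ?_)⟩
  simp only [rel_iff, Set.mem_ofPred_eq, pr_inj]
  constructor
  · rintro ⟨x1, y1, h1, rfl, rfl⟩; exact h1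
  · intro h; exact ⟨_, _, h, rfl, rfl⟩

theorem sep (a : 𝔐.carrier) (P : 𝔐.carrier → Prop)
    [hP : 𝔐.El fun (v : Fin 1 → 𝔐.carrier) (_ : Fin 0 → Set 𝔐.carrier) => P (v 0)] :
    ∃ b, ∀ x, 𝔐.mem x b ↔ 𝔐.mem x a ∧ P x := by
  have h1 : 𝔐.El fun (v : Fin 2 → 𝔐.carrier) (_ : Fin 0 → Set 𝔐.carrier) => P (v 0) :=
    hP.rename ![0] id
  obtain ⟨b, hb⟩ := replace (fun x y => P x ∧ y = x) (hG := Dfn.and _ _)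
    (by rintro x y y' ⟨-, rfl⟩ ⟨-, rfl⟩; rfl) a
  refine ⟨b, fun x => (hb x).trans ⟨?_, ?_⟩⟩
  · rintro ⟨x, hx, h, rfl⟩; exact ⟨hx, h⟩
  · rintro ⟨hx, h⟩; exact ⟨x, hx, h, rfl⟩

/-- Induction on membership. -/
theorem mem_induction (P : 𝔐.carrier → Prop)
    [hP : 𝔐.El fun (v : Fin 1 → 𝔐.carrier) (_ : Fin 0 → Set 𝔐.carrier) => P (v 0)]
    (h : ∀ x, (∀ y, 𝔐.mem y x → P y) → P x) (x : 𝔐.carrier) : P x := by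
  by_contra hx
  obtain ⟨y, hy, h'⟩ := hM.out.foundation _ (setOf_mem' fun x => ¬ P x) ⟨x, hx⟩
  exact hy (h y fun z hz => by_contra fun hz' => h' z hz' hz)

theorem mem_irrefl (x : 𝔐.carrier) : ¬ 𝔐.mem x x :=
  mem_induction (fun x => ¬ 𝔐.mem x x) (fun x h hx => h x hx hx) x

theorem mem_asymm {x y : 𝔐.carrier} : 𝔐.mem x y → ¬ 𝔐.mem y x := by
  have := mem_induction (𝔐 := 𝔐) (fun x => ∀ y, 𝔐.mem x y → ¬ 𝔐.mem y x)
    (fun x h y hxy hyx => h y hyx x hyx hxy) x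
  exact this y

theorem exists_union₂ (x y : 𝔐.carrier) : ∃ u, ∀ z, 𝔐.mem z u ↔ 𝔐.mem z x ∨ 𝔐.mem z y := by
  obtain ⟨p, hp⟩ := hM.out.pairing x y
  obtain ⟨u, hu⟩ := hM.out.union p
  refine ⟨u, fun z => (hu z).trans ?_⟩
  constructor
  · rintro ⟨w, hw, hz⟩
    rcases (hp w).1 hw with rfl | rfl
    · exact Or.inl hz
    · exact Or.inr hz
  · rintro (h | h)
    · exact ⟨x, (hp x).2 (Or.inl rfl), h⟩
    · exact ⟨y, (hp y).2 (Or.inr rfl), h⟩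

theorem exists_insert (x y : 𝔐.carrier) : ∃ u, ∀ z, 𝔐.mem z u ↔ 𝔐.mem z x ∨ z = y := by
  obtain ⟨p, hp⟩ := hM.out.pairing y y
  obtain ⟨u, hu⟩ := exists_union₂ x p
  exact ⟨u, fun z => (hu z).trans (or_congr_right ((hp z).trans or_self_iff))⟩

/-- The empty set. -/
noncomputable def o (𝔐 : ClassModel.{u}) [hM : Nbg 𝔐] : 𝔐.carrier :=
  (hM.out.infinity.choose_spec.1).choose

theorem not_mem_o (z : 𝔐.carrier) : ¬ 𝔐.mem z 𝔐.o :=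
  hM.out.infinity.choose_spec.1.choose_spec.2 z

theorem isZero_iff {e : 𝔐.carrier} : 𝔐.IsZero e ↔ e = 𝔐.o :=
  ⟨fun h => ext fun z => iff_of_false (h z) (not_mem_o z), by rintro rfl; exact not_mem_o⟩

/-- The successor `x ∪ {x}`. -/
noncomputable def sc (𝔐 : ClassModel.{u}) [hM : Nbg 𝔐] (x : 𝔐.carrier) : 𝔐.carrier :=
  (exists_insert x x).choose

theorem mem_sc {x z : 𝔐.carrier} : 𝔐.mem z (𝔐.sc x) ↔ 𝔐.mem z x ∨ z = x :=
  (exists_insert x x).choose_spec z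

theorem isSucc_iff {s x : 𝔐.carrier} : 𝔐.IsSucc s x ↔ s = 𝔐.sc x :=
  ⟨fun h => ext fun z => (h z).trans mem_sc.symm, by rintro rfl z; exact mem_sc⟩

instance Tm.sc {n : ℕ} {𝒞 : Set (Set 𝔐.carrier)} (s : (Fin n → 𝔐.carrier) → 𝔐.carrier)
    [Tm False 𝔐.mem 𝒞 s] : Tm False 𝔐.mem 𝒞 fun v => 𝔐.sc (s v) := by
  have : Tm False 𝔐.mem 𝒞 fun v : Fin 1 → 𝔐.carrier => 𝔐.sc (v 0) := by
    refine Tm.of_graph _ ?_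
    have : Dfn False 𝔐.mem 𝒞 fun (w : Fin 2 → 𝔐.carrier) (_ : Fin 0 → Set 𝔐.carrier) =>
      𝔐.IsSucc (w 0) (w 1) := inferInstance
    exact this.congr fun v W => isSucc_iff.symm
  exact this.comp ![s] inferInstance

theorem sc_inj {x y : 𝔐.carrier} (h : 𝔐.sc x = 𝔐.sc y) : x = y := by
  have h1 : 𝔐.mem x (𝔐.sc y) := h ▸ mem_sc.2 (Or.inr rfl)
  have h2 : 𝔐.mem y (𝔐.sc x) := h ▸ mem_sc.2 (Or.inr rfl)
  rcases mem_sc.1 h1 with h1 | h1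
  · rcases mem_sc.1 h2 with h2 | h2
    · exact absurd h1 (mem_asymm h2)
    · exact h2.symm
  · exact h1

theorem sc_ne_o (x : 𝔐.carrier) : 𝔐.sc x ≠ 𝔐.o := fun h =>
  not_mem_o x (h ▸ mem_sc.2 (Or.inr rfl))

theorem isInductive_iff {w : 𝔐.carrier} :
    𝔐.IsInductive w ↔ 𝔐.mem 𝔐.o w ∧ ∀ x, 𝔐.mem x w → 𝔐.mem (𝔐.sc x) w := by
  simp [IsInductive, isZero_iff, isSucc_iff]

theorem isNat_o : 𝔐.IsNat 𝔐.o := fun _ hw => (isInductive_iff.1 hw).1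

theorem IsNat.sc {n : 𝔐.carrier} (h : 𝔐.IsNat n) : 𝔐.IsNat (𝔐.sc n) :=
  fun w hw => (isInductive_iff.1 hw).2 _ (h w hw)

theorem exists_omega (𝔐 : ClassModel.{u}) [hM : Nbg 𝔐] : ∃ w, ∀ n, 𝔐.mem n w ↔ 𝔐.IsNat n := by
  obtain ⟨w, hw⟩ := hM.out.infinity
  obtain ⟨b, hb⟩ := sep w 𝔐.IsNat
  exact ⟨b, fun n => (hb n).trans ⟨fun h => h.2, fun h => ⟨h w hw, h⟩⟩⟩

theorem nat_induction (P : 𝔐.carrier → Prop)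
    [hP : 𝔐.El fun (v : Fin 1 → 𝔐.carrier) (_ : Fin 0 → Set 𝔐.carrier) => P (v 0)]
    (h0 : P 𝔐.o) (hs : ∀ n, 𝔐.IsNat n → P n → P (𝔐.sc n)) {n : 𝔐.carrier} (hn : 𝔐.IsNat n) :
    P n := by
  obtain ⟨w, hw⟩ := exists_omega 𝔐
  obtain ⟨b, hb⟩ := sep w P
  have : 𝔐.IsInductive b := isInductive_iff.2 ⟨(hb _).2 ⟨(hw _).2 isNat_o, h0⟩, fun x hx => by
    obtain ⟨h1, h2⟩ := (hb _).1 hx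
    exact (hb _).2 ⟨(hw _).2 ((hw _).1 h1).sc, hs _ ((hw _).1 h1) h2⟩⟩
  exact ((hb n).1 (hn b this)).2

theorem IsNat.cases {n : 𝔐.carrier} (hn : 𝔐.IsNat n) :
    n = 𝔐.o ∨ ∃ k, 𝔐.IsNat k ∧ n = 𝔐.sc k :=
  nat_induction (fun n => n = 𝔐.o ∨ ∃ k, 𝔐.IsNat k ∧ n = 𝔐.sc k) (Or.inl rfl)
    (fun n hn _ => Or.inr ⟨n, hn, rfl⟩) hn

theorem IsNat.trans {n : 𝔐.carrier} (hn : 𝔐.IsNat n) :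
    ∀ k, 𝔐.mem k n → ∀ j, 𝔐.mem j k → 𝔐.mem j n :=
  nat_induction (fun n => ∀ k, 𝔐.mem k n → ∀ j, 𝔐.mem j k → 𝔐.mem j n)
    (fun k hk => absurd hk (not_mem_o k))
    (fun n hn ih k hk j hj => by
      rcases mem_sc.1 hk with h | rfl
      · exact mem_sc.2 (Or.inl (ih k h j hj))
      · exact mem_sc.2 (Or.inl hj)) hn

/-! ### Finite distances -/

theorem hasDistance_o {R : Set 𝔐.carrier} {x z : 𝔐.carrier} :
    𝔐.HasDistance R x 𝔐.o z ↔ z = x := by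
  constructor
  · rintro ⟨f, hf, h0, hz, -⟩
    exact hf _ _ _ hz (h0 _ (isZero_iff.2 rfl))
  · rintro rfl
    obtain ⟨f, hf⟩ := hM.out.pairing (𝔐.pr 𝔐.o z) (𝔐.pr 𝔐.o z)
    have h : ∀ k y, 𝔐.App f k y ↔ k = 𝔐.o ∧ y = z := fun k y => by
      rw [app_iff, hf, or_self_iff, pr_inj]
    refine ⟨f, ?_, ?_, ?_, ?_⟩
    · intro k y y' h1 h2
      rw [((h _ _).1 h1).2, ((h _ _).1 h2).2]
    · intro k hk; exact (h _ _).2 ⟨isZero_iff.1 hk, rfl⟩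
    · exact (h _ _).2 ⟨rfl, rfl⟩
    · intro k _ _ hk; exact absurd hk (not_mem_o k)

theorem hasDistance_sc {R : Set 𝔐.carrier} {x n z : 𝔐.carrier} (hn : 𝔐.IsNat n) :
    𝔐.HasDistance R x (𝔐.sc n) z ↔ ∃ y, 𝔐.HasDistance R x n y ∧ 𝔐.Rel R z y := by
  constructor
  · rintro ⟨f, hf, h0, hz, hs⟩
    have h1 : ∀ k, 𝔐.IsNat k → 𝔐.mem k (𝔐.sc n) → ∃ y, 𝔐.App f k y := fun k hk =>
      nat_induction (fun k => 𝔐.mem k (𝔐.sc n) → ∃ y, 𝔐.App f k y)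
        (fun _ => ⟨x, h0 _ (isZero_iff.2 rfl)⟩) (fun k hk ih hk' => by
          have h2 : 𝔐.mem k (𝔐.sc n) := hn.sc.trans _ hk' _ (mem_sc.2 (Or.inr rfl))
          obtain ⟨y, hy⟩ := ih h2
          obtain ⟨y', hy', -⟩ := hs k _ y h2 (isSucc_iff.2 rfl) hy
          exact ⟨y', hy'⟩) hk
    obtain ⟨y, hy⟩ := h1 n hn (mem_sc.2 (Or.inr rfl))
    obtain ⟨y', hy', hR⟩ := hs n _ y (mem_sc.2 (Or.inr rfl)) (isSucc_iff.2 rfl) hy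
    obtain rfl := hf _ _ _ hz hy'
    exact ⟨y, ⟨f, hf, h0, hy, fun k k' y hk => hs k k' y (mem_sc.2 (Or.inl hk))⟩, hR⟩
  · rintro ⟨y, ⟨f, hf, h0, hy, hs⟩, hR⟩
    obtain ⟨g, hg⟩ := sep f fun p => ∃ k y, p = 𝔐.pr k y ∧ 𝔐.mem k (𝔐.sc n)
    obtain ⟨f', hf'⟩ := exists_insert g (𝔐.pr (𝔐.sc n) z)
    have h : ∀ k y, 𝔐.App f' k y ↔ (𝔐.App f k y ∧ 𝔐.mem k (𝔐.sc n)) ∨ k = 𝔐.sc n ∧ y = z :=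
      fun k y => by
        rw [app_iff, app_iff, hf', hg, pr_inj]
        refine or_congr_left (and_congr_right fun _ => ⟨?_, fun h => ⟨k, y, rfl, h⟩⟩)
        rintro ⟨k', y', e, h⟩
        obtain ⟨rfl, rfl⟩ := pr_inj.1 e
        exact h
    have h0n : 𝔐.mem 𝔐.o (𝔐.sc n) := nat_induction (fun n => 𝔐.mem 𝔐.o (𝔐.sc n))
      (mem_sc.2 (Or.inr rfl)) (fun n _ h => mem_sc.2 (Or.inl h)) hn
    refine ⟨f', ?_, ?_, ?_, ?_⟩
    · intro k y1 y2 h1 h2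
      rcases (h _ _).1 h1 with ⟨h1, h1'⟩ | ⟨rfl, rfl⟩ <;>
        rcases (h _ _).1 h2 with ⟨h2, h2'⟩ | ⟨e, rfl⟩
      · exact hf _ _ _ h1 h2
      · exact absurd (e ▸ h1') (mem_irrefl _)
      · exact absurd h2' (mem_irrefl _)
      · rfl
    · intro k hk
      exact (h _ _).2 (Or.inl ⟨h0 k hk, isZero_iff.1 hk ▸ h0n⟩)
    · exact (h _ _).2 (Or.inr ⟨rfl, rfl⟩)
    · intro k k' y1 hk hk' h1
      obtain rfl := isSucc_iff.1 hk'
      rcases (h _ _).1 h1 with ⟨h1, -⟩ | ⟨rfl, -⟩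
      · rcases mem_sc.1 hk with hk | rfl
        · obtain ⟨y', hy', hR'⟩ := hs k _ y1 hk hk' h1
          refine ⟨y', (h _ _).2 (Or.inl ⟨hy', ?_⟩), hR'⟩
          have : 𝔐.mem (𝔐.sc k) (𝔐.sc n) := nat_induction
            (fun n => 𝔐.mem k n → 𝔐.mem (𝔐.sc k) (𝔐.sc n)) (fun h => absurd h (not_mem_o k))
            (fun n _ ih h => by
              rcases mem_sc.1 h with h | rfl
              · exact mem_sc.2 (Or.inl (ih h))
              · exact mem_sc.2 (Or.inr rfl)) hn hk
          exact this
        · obtain rfl := hf _ _ _ h1 hy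
          exact ⟨z, (h _ _).2 (Or.inr ⟨rfl, rfl⟩), hR⟩
      · exact absurd hk (mem_irrefl _)

/-- The class of all points at finite `R`-distance from `x`. -/
def reach (𝔐 : ClassModel.{u}) (R : Set 𝔐.carrier) (x : 𝔐.carrier) : Set 𝔐.carrier :=
  {z | ∃ n, 𝔐.IsNat n ∧ 𝔐.HasDistance R x n z}

instance CT.reach {n m : ℕ} {𝒞 : Set (Set 𝔐.carrier)} (s : (Fin n → 𝔐.carrier) → 𝔐.carrier)
    (F : (Fin n → 𝔐.carrier) → (Fin m → Set 𝔐.carrier) → Set 𝔐.carrier)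
    [Tm False 𝔐.mem 𝒞 s] [CT False 𝔐.mem 𝒞 F] :
    CT False 𝔐.mem 𝒞 fun v W => 𝔐.reach (F v W) (s v) := by
  have : CT False 𝔐.mem 𝒞 fun (v : Fin 1 → 𝔐.carrier) (W : Fin 1 → Set 𝔐.carrier) =>
      𝔐.reach (W 0) (v 0) := by unfold ClassModel.reach; infer_instance
  exact this.comp ![s] ![F] inferInstance inferInstance

theorem reach_refl {R : Set 𝔐.carrier} {x : 𝔐.carrier} : x ∈ 𝔐.reach R x :=
  ⟨𝔐.o, isNat_o, hasDistance_o.2 rfl⟩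

theorem reach_step {R : Set 𝔐.carrier} {x y z : 𝔐.carrier} (h : y ∈ 𝔐.reach R x)
    (hz : 𝔐.Rel R z y) : z ∈ 𝔐.reach R x := by
  obtain ⟨n, hn, h⟩ := h
  exact ⟨_, hn.sc, (hasDistance_sc hn).2 ⟨y, h, hz⟩⟩

theorem reach_induction {R : Set 𝔐.carrier} (hR : R ∈ 𝔐.classes) {x : 𝔐.carrier}
    (P : 𝔐.carrier → Prop)
    [hP : 𝔐.El fun (v : Fin 1 → 𝔐.carrier) (_ : Fin 0 → Set 𝔐.carrier) => P (v 0)]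
    (h0 : P x) (hs : ∀ y z, y ∈ 𝔐.reach R x → P y → 𝔐.Rel R z y → P z) {z : 𝔐.carrier}
    (hz : z ∈ 𝔐.reach R x) : P z := by
  have : Fact (R ∈ 𝔐.classes) := ⟨hR⟩
  have : Fact ({x | P x} ∈ 𝔐.classes) := ⟨setOf_mem' P⟩
  obtain ⟨n, hn, hz⟩ := hz
  exact nat_induction (fun n => ∀ z, 𝔐.HasDistance R x n z → z ∈ {x | P x})
    (fun z hz => (hasDistance_o.1 hz) ▸ h0) (fun n hn ih z hz => by
      obtain ⟨y, hy, hz⟩ := (hasDistance_sc hn).1 hz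
      exact hs y z ⟨n, hn, hy⟩ (ih y hy) hz) hn z hz

theorem reach_cases {R : Set 𝔐.carrier} {x z : 𝔐.carrier} (h : z ∈ 𝔐.reach R x) :
    z = x ∨ ∃ y ∈ 𝔐.reach R x, 𝔐.Rel R z y := by
  obtain ⟨n, hn, h⟩ := h
  rcases hn.cases with rfl | ⟨k, hk, rfl⟩
  · exact Or.inl (hasDistance_o.1 h)
  · obtain ⟨y, hy, hz⟩ := (hasDistance_sc hk).1 h
    exact Or.inr ⟨y, ⟨k, hk, hy⟩, hz⟩

end Nbg

end ClassModel

end ClassTheory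

namespace ClassTheory
open SetFormula
namespace ClassModel

variable {𝔐 : ClassModel.{u}}

/-! ### Levels of the cumulative hierarchy and Scott's trick -/

/-- `x` is a subset of `y`. -/
def Sub (𝔐 : ClassModel.{u}) (x y : 𝔐.carrier) : Prop := ∀ w, 𝔐.mem w x → 𝔐.mem w y

/-- `h` is a history: each `y ∈ h` is the set of all subsets of members of `h ∩ y`. Histories are the
initial segments of the sequence of the `V_α`. -/
def IsHistory (𝔐 : ClassModel.{u}) (h : 𝔐.carrier) : Prop :=
  ∀ y, 𝔐.mem y h → ∀ x, 𝔐.mem x y ↔ ∃ z, 𝔐.mem z h ∧ 𝔐.mem z y ∧ 𝔐.Sub x z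

/-- `s` is a level of the cumulative hierarchy, given by a history. This avoids ordinals. -/
def IsLevel (𝔐 : ClassModel.{u}) (s : 𝔐.carrier) : Prop :=
  ∃ h, 𝔐.IsHistory h ∧ ∀ x, 𝔐.mem x s ↔ ∃ z, 𝔐.mem z h ∧ 𝔐.Sub x z

/-- `l` is the first level which meets `X`. -/
def IsFirstLevel (𝔐 : ClassModel.{u}) (X : Set 𝔐.carrier) (l : 𝔐.carrier) : Prop :=
  𝔐.IsLevel l ∧ (∃ x, x ∈ X ∧ 𝔐.mem x l) ∧ ∀ l', 𝔐.mem l' l → 𝔐.IsLevel l' → ∀ x, x ∈ X → ¬ 𝔐.mem x l'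

/-- `s` is the set of all elements of `X` of minimal rank. -/
def IsScott (𝔐 : ClassModel.{u}) (X : Set 𝔐.carrier) (s : 𝔐.carrier) : Prop :=
  ∃ l, 𝔐.IsFirstLevel X l ∧ ∀ z, 𝔐.mem z s ↔ 𝔐.mem z l ∧ z ∈ X

section Definability

variable {n m : ℕ} {𝒞 : Set (Set 𝔐.carrier)}
  (s t : (Fin n → 𝔐.carrier) → 𝔐.carrier)
  (F : (Fin n → 𝔐.carrier) → (Fin m → Set 𝔐.carrier) → Set 𝔐.carrier)
  [Tm False 𝔐.mem 𝒞 s] [Tm False 𝔐.mem 𝒞 t] [CT False 𝔐.mem 𝒞 F]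

instance : Dfn False 𝔐.mem 𝒞 fun v (_ : Fin m → Set 𝔐.carrier) => 𝔐.Sub (s v) (t v) := by
  have : Dfn False 𝔐.mem 𝒞 fun (v : Fin 2 → 𝔐.carrier) (_ : Fin 0 → Set 𝔐.carrier) =>
      𝔐.Sub (v 0) (v 1) := by unfold Sub; infer_instance
  exact this.app ![s, t] ![]

instance : Dfn False 𝔐.mem 𝒞 fun v (_ : Fin m → Set 𝔐.carrier) => 𝔐.IsLevel (s v) := by
  have : Dfn False 𝔐.mem 𝒞 fun (v : Fin 1 → 𝔐.carrier) (_ : Fin 0 → Set 𝔐.carrier) =>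
      𝔐.IsLevel (v 0) := by unfold IsLevel IsHistory; infer_instance
  exact this.app ![s] ![]

instance : Dfn False 𝔐.mem 𝒞 fun v W => 𝔐.IsFirstLevel (F v W) (s v) := by
  have : Dfn False 𝔐.mem 𝒞 fun (v : Fin 1 → 𝔐.carrier) (W : Fin 1 → Set 𝔐.carrier) =>
      𝔐.IsFirstLevel (W 0) (v 0) := by unfold IsFirstLevel; infer_instance
  exact this.app ![s] ![F]

instance : Dfn False 𝔐.mem 𝒞 fun v W => 𝔐.IsScott (F v W) (s v) := by
  have : Dfn False 𝔐.mem 𝒞 fun (v : Fin 1 → 𝔐.carrier) (W : Fin 1 → Set 𝔐.carrier) =>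
      𝔐.IsScott (W 0) (v 0) := by unfold IsScott; infer_instance
  exact this.app ![s] ![F]

end Definability

variable [hM : Nbg 𝔐]

theorem IsHistory.trans_of_mem {h : 𝔐.carrier} (hh : 𝔐.IsHistory h) :
    ∀ y, 𝔐.mem y h → ∀ z w, 𝔐.mem z y → 𝔐.mem w z → 𝔐.mem w y :=
  mem_induction (fun y => 𝔐.mem y h → ∀ z w, 𝔐.mem z y → 𝔐.mem w z → 𝔐.mem w y)
    fun y ih hy z w hz hw => by
      obtain ⟨z0, h0, h0y, hs⟩ := (hh y hy z).1 hz
      obtain ⟨z1, h1, h10, hs1⟩ := (hh z0 h0 w).1 (hs w hw)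
      refine (hh y hy w).2 ⟨z1, h1, (hh y hy z1).2 ⟨z0, h0, h0y, fun v hv => ?_⟩, hs1⟩
      exact ih z0 h0y h0 z1 v h10 hv

theorem IsHistory.isLevel_of_mem {h y : 𝔐.carrier} (hh : 𝔐.IsHistory h) (hy : 𝔐.mem y h) :
    𝔐.IsLevel y := by
  obtain ⟨h', hh'⟩ := sep h fun z => 𝔐.mem z y
  refine ⟨h', fun y' hy' x => ?_, fun x => ?_⟩
  · obtain ⟨h1, h2⟩ := (hh' _).1 hy'
    rw [hh y' h1]
    refine exists_congr fun z => ⟨?_, ?_⟩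
    · rintro ⟨a, b, c⟩
      exact ⟨(hh' _).2 ⟨a, hh.trans_of_mem y hy _ _ h2 b⟩, b, c⟩
    · rintro ⟨a, b, c⟩
      exact ⟨((hh' _).1 a).1, b, c⟩
  · rw [hh y hy]
    refine exists_congr fun z => ?_
    rw [hh', and_assoc]

namespace IsLevel

variable {s t : 𝔐.carrier}

theorem sub_mem (hs : 𝔐.IsLevel s) {x w : 𝔐.carrier} (hx : 𝔐.mem x s) (hw : 𝔐.Sub w x) :
    𝔐.mem w s := by
  obtain ⟨h, -, hh⟩ := hs
  obtain ⟨z, hz, hxz⟩ := (hh x).1 hx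
  exact (hh w).2 ⟨z, hz, fun v hv => hxz v (hw v hv)⟩

theorem mem_trans (hs : 𝔐.IsLevel s) {x w : 𝔐.carrier} (hx : 𝔐.mem x s) (hw : 𝔐.mem w x) :
    𝔐.mem w s := by
  obtain ⟨h, hist, hh⟩ := hs
  obtain ⟨z, hz, hxz⟩ := (hh x).1 hx
  obtain ⟨z', hz', -, hw'⟩ := (hist z hz w).1 (hxz w hw)
  exact (hh w).2 ⟨z', hz', hw'⟩

theorem mem_iff (hs : 𝔐.IsLevel s) {x : 𝔐.carrier} :
    𝔐.mem x s ↔ ∃ r, 𝔐.IsLevel r ∧ 𝔐.mem r s ∧ 𝔐.Sub x r := by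
  constructor
  · intro hx
    obtain ⟨h, hist, hh⟩ := hs
    obtain ⟨z, hz, hxz⟩ := (hh x).1 hx
    exact ⟨z, hist.isLevel_of_mem hz, (hh z).2 ⟨z, hz, fun _ => id⟩, hxz⟩
  · rintro ⟨r, -, hr, hx⟩
    exact hs.sub_mem hr hx

/-- The levels are linearly ordered by membership. -/
theorem comparable (hs : 𝔐.IsLevel s) (ht : 𝔐.IsLevel t) : 𝔐.mem s t ∨ s = t ∨ 𝔐.mem t s := by
  refine mem_induction (fun s => 𝔐.IsLevel s → ∀ t, 𝔐.IsLevel t → 𝔐.mem s t ∨ s = t ∨ 𝔐.mem t s)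
    (fun s ihs hs => mem_induction
      (fun t => 𝔐.IsLevel t → 𝔐.mem s t ∨ s = t ∨ 𝔐.mem t s) fun t iht ht => ?_) s hs t ht
  by_contra hc
  push Not at hc
  refine hc.2.1 (ext fun x => ⟨fun hx => ?_, fun hx => ?_⟩)
  · obtain ⟨r, hr, hrs, hxr⟩ := hs.mem_iff.1 hx
    rcases ihs r hrs hr t ht with h | rfl | h
    · exact ht.sub_mem h hxr
    · exact absurd hrs hc.2.2
    · exact absurd (hs.mem_trans hrs h) hc.2.2
  · obtain ⟨r, hr, hrt, hxr⟩ := ht.mem_iff.1 hx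
    rcases iht r hrt hr with h | rfl | h
    · exact absurd (ht.mem_trans hrt h) hc.1
    · exact absurd hrt hc.1
    · exact hs.sub_mem h hxr

end IsLevel

theorem IsFirstLevel.unique {X : Set 𝔐.carrier} {l l' : 𝔐.carrier} (h : 𝔐.IsFirstLevel X l)
    (h' : 𝔐.IsFirstLevel X l') : l = l' := by
  obtain ⟨h1, ⟨x, hx, hxl⟩, h2⟩ := h
  obtain ⟨h1', ⟨x', hx', hxl'⟩, h2'⟩ := h'
  rcases h1.comparable h1' with h | h | h
  · exact absurd hxl (h2' l h h1 x hx)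
  · exact h
  · exact absurd hxl' (h2 l' h h1' x' hx')

theorem exists_firstLevel_of_mem {X : Set 𝔐.carrier} (hX : X ∈ 𝔐.classes) {x l : 𝔐.carrier}
    (hx : x ∈ X) (hl : 𝔐.IsLevel l) (hxl : 𝔐.mem x l) : ∃ l, 𝔐.IsFirstLevel X l := by
  have : Fact (X ∈ 𝔐.classes) := ⟨hX⟩
  obtain ⟨l, ⟨hl, hxl⟩, hmin⟩ := hM.out.foundation {l | 𝔐.IsLevel l ∧ ∃ x, x ∈ X ∧ 𝔐.mem x l}
    (setOf_mem' _) ⟨l, hl, x, hx, hxl⟩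
  exact ⟨l, hl, hxl, fun l' h h' x hx hx' => hmin l' ⟨h', x, hx, hx'⟩ h⟩

/-- The levels exhaust the universe. -/
theorem exists_isLevel_mem (x : 𝔐.carrier) : ∃ s, 𝔐.IsLevel s ∧ 𝔐.mem x s := by
  refine mem_induction (fun x => ∃ s, 𝔐.IsLevel s ∧ 𝔐.mem x s) (fun x ih => ?_) x
  -- `g` is the set of the first levels of the elements of `x`, and `u` is its union
  obtain ⟨g, hg⟩ := replace (fun y l => 𝔐.IsFirstLevel {z | z = y} l)
    (fun y l l' h h' => h.unique h') x
  have hglev : ∀ r, 𝔐.mem r g → 𝔐.IsLevel r := fun r hr => by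
    obtain ⟨y, -, hy⟩ := (hg r).1 hr
    exact hy.1
  obtain ⟨u, hu⟩ := hM.out.union g
  have hux : ∀ y, 𝔐.mem y x → 𝔐.mem y u := fun y hy => by
    obtain ⟨l, hl, hyl⟩ := ih y hy
    obtain ⟨l, hl⟩ := exists_firstLevel_of_mem (X := {z | z = y}) (setOf_mem' _) rfl hl hyl
    obtain ⟨y', rfl, hyl'⟩ := hl.2.1
    exact (hu _).2 ⟨l, (hg l).2 ⟨_, hy, hl⟩, hyl'⟩
  have hulev : ∀ r v, 𝔐.mem r u → 𝔐.mem v r → 𝔐.mem v u := fun r v hr hv => by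
    obtain ⟨w, hw, hrw⟩ := (hu r).1 hr
    exact (hu v).2 ⟨w, hw, (hglev w hw).mem_trans hrw hv⟩
  -- `g` together with all levels in `u` is a history `h`
  obtain ⟨u', hu'⟩ := sep u 𝔐.IsLevel
  obtain ⟨h, hh⟩ := exists_union₂ u' g
  have hlev : ∀ r, 𝔐.mem r h → 𝔐.IsLevel r := fun r hr =>
    ((hh r).1 hr).elim (fun h => ((hu' r).1 h).2) (hglev r)
  have hclosed : ∀ y r, 𝔐.mem y h → 𝔐.IsLevel r → 𝔐.mem r y → 𝔐.mem r h := fun y r hy hr hry => by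
    refine (hh r).2 (Or.inl ((hu' r).2 ⟨?_, hr⟩))
    rcases (hh y).1 hy with h | h
    · exact hulev y r ((hu' y).1 h).1 hry
    · exact (hu r).2 ⟨y, h, hry⟩
  have hist : 𝔐.IsHistory h := fun y hy x => by
    rw [(hlev y hy).mem_iff]
    refine exists_congr fun z => ⟨?_, ?_⟩
    · rintro ⟨a, b, c⟩; exact ⟨hclosed y z hy a b, b, c⟩
    · rintro ⟨a, b, c⟩; exact ⟨hlev z a, b, c⟩
  -- the level given by `h` is found inside the power set of its union
  have key : ∀ h, 𝔐.IsHistory h → ∃ s, 𝔐.IsLevel s ∧ ∀ x, 𝔐.mem x s ↔ ∃ z, 𝔐.mem z h ∧ 𝔐.Sub x z := by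
    intro h hist
    obtain ⟨U, hU⟩ := hM.out.union h
    obtain ⟨P, hP⟩ := hM.out.powerSet U
    obtain ⟨s, hs⟩ := sep P fun x => ∃ z, 𝔐.mem z h ∧ 𝔐.Sub x z
    have : ∀ x, 𝔐.mem x s ↔ ∃ z, 𝔐.mem z h ∧ 𝔐.Sub x z := fun x => by
      rw [hs]
      refine and_iff_right_of_imp ?_
      rintro ⟨z, hz, hxz⟩
      exact (hP x).2 fun w hw => (hU w).2 ⟨z, hz, hxz w hw⟩
    exact ⟨s, ⟨h, hist, this⟩, this⟩
  obtain ⟨s, hs, hs'⟩ := key h hist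
  -- `x` is a subset of the level `s` given by `h`, hence an element of the next level, given by `h ∪ {s}`
  obtain ⟨h2, hh2⟩ := exists_insert h s
  have hist2 : 𝔐.IsHistory h2 := fun y hy x => by
    rcases (hh2 y).1 hy with hy | rfl
    · rw [hist y hy]
      refine exists_congr fun z => ⟨?_, ?_⟩
      · rintro ⟨a, b, c⟩; exact ⟨(hh2 z).2 (Or.inl a), b, c⟩
      · rintro ⟨a, b, c⟩
        rcases (hh2 z).1 a with a | rfl
        · exact ⟨a, b, c⟩
        · have : 𝔐.mem y z := (hs' y).2 ⟨y, hy, fun _ => id⟩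
          exact absurd this (mem_asymm b)
    · rw [hs']
      refine exists_congr fun z => ⟨?_, ?_⟩
      · rintro ⟨a, c⟩; exact ⟨(hh2 z).2 (Or.inl a), (hs' z).2 ⟨z, a, fun _ => id⟩, c⟩
      · rintro ⟨a, b, c⟩
        rcases (hh2 z).1 a with a | rfl
        · exact ⟨a, c⟩
        · exact absurd b (mem_irrefl _)
  obtain ⟨s2, hs2, hs2'⟩ := key h2 hist2
  refine ⟨s2, hs2, (hs2' x).2 ⟨s, (hh2 s).2 (Or.inr rfl), fun y hy => ?_⟩⟩
  obtain ⟨r, hr, hyr⟩ := (hu y).1 (hux y hy)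
  exact hs.mem_trans ((hs' r).2 ⟨r, (hh r).2 (Or.inr hr), fun _ => id⟩) hyr

theorem exists_firstLevel {X : Set 𝔐.carrier} (hX : X ∈ 𝔐.classes) (h : X.Nonempty) :
    ∃ l, 𝔐.IsFirstLevel X l := by
  obtain ⟨x, hx⟩ := h
  obtain ⟨l, hl, hxl⟩ := exists_isLevel_mem x
  exact exists_firstLevel_of_mem hX hx hl hxl

theorem exists_isScott {X : Set 𝔐.carrier} (hX : X ∈ 𝔐.classes) (h : X.Nonempty) :
    ∃ s, 𝔐.IsScott X s := by
  have : Fact (X ∈ 𝔐.classes) := ⟨hX⟩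
  obtain ⟨l, hl⟩ := exists_firstLevel hX h
  obtain ⟨s, hs⟩ := sep l fun z => z ∈ X
  exact ⟨s, l, hl, hs⟩

theorem IsScott.unique {X : Set 𝔐.carrier} {s s' : 𝔐.carrier} (h : 𝔐.IsScott X s)
    (h' : 𝔐.IsScott X s') : s = s' := by
  obtain ⟨l, hl, hs⟩ := h
  obtain ⟨l', hl', hs'⟩ := h'
  obtain rfl := hl.unique hl'
  exact ext fun z => (hs z).trans (hs' z).symm

theorem IsScott.mem_of_mem {X : Set 𝔐.carrier} {s z : 𝔐.carrier} (h : 𝔐.IsScott X s)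
    (hz : 𝔐.mem z s) : z ∈ X := by
  obtain ⟨l, hl, hs⟩ := h
  exact ((hs z).1 hz).2

theorem IsScott.nonempty {X : Set 𝔐.carrier} {s : 𝔐.carrier} (h : 𝔐.IsScott X s) :
    ∃ z, 𝔐.mem z s := by
  obtain ⟨l, ⟨-, ⟨x, hx, hxl⟩, -⟩, hs⟩ := h
  exact ⟨x, (hs x).2 ⟨hxl, hx⟩⟩

/-! ### Well-founded classes -/

/-- Every non-empty set of elements of `N` has an `R`-minimal element. -/
def SetWF (𝔐 : ClassModel.{u}) (N R : Set 𝔐.carrier) : Prop :=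
  ∀ s, (∃ x, 𝔐.mem x s) → (∀ x, 𝔐.mem x s → x ∈ N) →
    ∃ x, 𝔐.mem x s ∧ ∀ y, 𝔐.mem y s → ¬ 𝔐.Rel R y x

/-- Every non-empty subclass of `N` has an `R`-minimal element. -/
def ClassWF (𝔐 : ClassModel.{u}) (N R : Set 𝔐.carrier) : Prop :=
  ∀ X ∈ 𝔐.classes, X ⊆ N → X.Nonempty → ∃ x ∈ X, ∀ y ∈ X, ¬ 𝔐.Rel R y x

instance {n m : ℕ} {𝒞 : Set (Set 𝔐.carrier)}
    (F G : (Fin n → 𝔐.carrier) → (Fin m → Set 𝔐.carrier) → Set 𝔐.carrier)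
    [CT False 𝔐.mem 𝒞 F] [CT False 𝔐.mem 𝒞 G] :
    Dfn False 𝔐.mem 𝒞 fun v W => 𝔐.SetWF (F v W) (G v W) := by
  have : Dfn False 𝔐.mem 𝒞 fun (_ : Fin 0 → 𝔐.carrier) (W : Fin 2 → Set 𝔐.carrier) =>
      𝔐.SetWF (W 0) (W 1) := by unfold SetWF; infer_instance
  exact this.app ![] ![F, G]

theorem ClassWF.setWF {N R : Set 𝔐.carrier} (h : 𝔐.ClassWF N R) : 𝔐.SetWF N R :=
  fun s hs hsN => h {x | 𝔐.mem x s} (setOf_mem' _) hsN hs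

theorem ClassWF.irrefl {N R : Set 𝔐.carrier} (h : 𝔐.ClassWF N R) {x : 𝔐.carrier} (hx : x ∈ N) :
    ¬ 𝔐.Rel R x x := by
  obtain ⟨y, rfl, hy⟩ := h {y | y = x} (setOf_mem' _) (by rintro y rfl; exact hx) ⟨x, rfl⟩
  exact hy _ rfl

/-- A class without minimal elements includes a non-empty set without minimal elements: close a level
of the cumulative hierarchy under finding predecessors, in `ω` steps. Hence well-foundedness does not
depend on which classes are available. -/
theorem SetWF.classWF {N R : Set 𝔐.carrier} (hR : R ∈ 𝔐.classes) (h : 𝔐.SetWF N R) :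
    𝔐.ClassWF N R := by
  intro X hX hXN hne
  by_contra hc
  push Not at hc
  have : Fact (X ∈ 𝔐.classes) := ⟨hX⟩
  have : Fact (R ∈ 𝔐.classes) := ⟨hR⟩
  -- some level contains predecessors in `X` of all elements of `X` in `r`
  have hpred : ∀ r, ∃ l, 𝔐.IsLevel l ∧ ∀ x, 𝔐.mem x r → x ∈ X → ∃ y, y ∈ X ∧ 𝔐.mem y l ∧ 𝔐.Rel R y x := by
    intro r
    obtain ⟨g, hg⟩ := replace (fun x l => x ∈ X ∧ 𝔐.IsFirstLevel {y | y ∈ X ∧ 𝔐.Rel R y x} l)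
      (fun x l l' h h' => h.2.unique h'.2) r
    obtain ⟨l, hl, hgl⟩ := exists_isLevel_mem g
    refine ⟨l, hl, fun x hx hxX => ?_⟩
    obtain ⟨y, hy, hyx⟩ := hc x hxX
    obtain ⟨l', hl'⟩ := exists_firstLevel (X := {y | y ∈ X ∧ 𝔐.Rel R y x}) (setOf_mem' _)
      ⟨y, hy, hyx⟩
    obtain ⟨y, ⟨hy, hyx⟩, hyl⟩ := hl'.2.1
    exact ⟨y, hy, hl.mem_trans (hl.mem_trans hgl ((hg l').2 ⟨x, hx, hxX, hl'⟩)) hyl, hyx⟩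
  have hstep : ∀ r, ∃ l, 𝔐.IsFirstLevel {y | ∃ l, (𝔐.IsLevel l ∧ ∀ x, 𝔐.mem x r → x ∈ X →
      ∃ y, y ∈ X ∧ 𝔐.mem y l ∧ 𝔐.Rel R y x) ∧ l = y} l := fun r => by
    obtain ⟨l, hl⟩ := hpred r
    exact exists_firstLevel (setOf_mem' _) ⟨l, l, hl, rfl⟩
  obtain ⟨x0, hx0⟩ := hne
  obtain ⟨r0, -, hr0⟩ := exists_isLevel_mem x0
  -- `S` relates `r` to the first such level; the points at finite `S`-distance from `r0` are the steps
  -- of the closure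
  set S : Set 𝔐.carrier := {p | ∃ r l, 𝔐.IsFirstLevel {y | ∃ l, (𝔐.IsLevel l ∧ ∀ x, 𝔐.mem x r →
    x ∈ X → ∃ y, y ∈ X ∧ 𝔐.mem y l ∧ 𝔐.Rel R y x) ∧ l = y} l ∧ p = 𝔐.pr l r} with hS
  have hSc : S ∈ 𝔐.classes := setOf_mem' _
  have : Fact (S ∈ 𝔐.classes) := ⟨hSc⟩
  have hSrel : ∀ l r, 𝔐.Rel S l r ↔ 𝔐.IsFirstLevel {y | ∃ l, (𝔐.IsLevel l ∧ ∀ x, 𝔐.mem x r →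
      x ∈ X → ∃ y, y ∈ X ∧ 𝔐.mem y l ∧ 𝔐.Rel R y x) ∧ l = y} l := fun l r => by
    rw [rel_iff]
    constructor
    · rintro ⟨r', l', h', e⟩
      obtain ⟨rfl, rfl⟩ := pr_inj.1 e
      exact h'
    · intro h'; exact ⟨r, l, h', rfl⟩
  obtain ⟨w, hw⟩ := exists_omega 𝔐
  obtain ⟨b, hb⟩ := replace (fun n z => 𝔐.IsNat n ∧ 𝔐.HasDistance S r0 n z)
    (fun n z z' h1 h2 => nat_induction
      (fun n => ∀ z z', 𝔐.HasDistance S r0 n z → 𝔐.HasDistance S r0 n z' → z = z')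
      (fun z z' h1 h2 => by rw [hasDistance_o.1 h1, hasDistance_o.1 h2])
      (fun n hn ih z z' h1 h2 => by
        obtain ⟨y, hy, h1⟩ := (hasDistance_sc hn).1 h1
        obtain ⟨y', hy', h2⟩ := (hasDistance_sc hn).1 h2
        obtain rfl := ih y y' hy hy'
        exact ((hSrel _ _).1 h1).unique ((hSrel _ _).1 h2)) h1.1 z z' h1.2 h2.2) w
  have hb' : ∀ z, 𝔐.mem z b ↔ z ∈ 𝔐.reach S r0 := fun z => by
    rw [hb]
    refine exists_congr fun n => ?_
    rw [hw]; tauto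
  obtain ⟨U, hU⟩ := hM.out.union b
  obtain ⟨s, hs⟩ := sep U fun x => x ∈ X
  obtain ⟨x, hx, hmin⟩ := h s ⟨x0, (hs _).2 ⟨(hU _).2 ⟨r0, (hb' _).2 reach_refl, hr0⟩, hx0⟩⟩
    fun x hx => hXN ((hs x).1 hx).2
  obtain ⟨hxU, hxX⟩ := (hs x).1 hx
  obtain ⟨r, hr, hxr⟩ := (hU x).1 hxU
  obtain ⟨l, hl⟩ := hstep r
  obtain ⟨l', ⟨l', hl', rfl⟩, hll⟩ := hl.2.1
  obtain ⟨y, hy, hyl, hyx⟩ := hl'.2 x hxr hxX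
  refine hmin y ((hs y).2 ⟨(hU y).2 ⟨l, (hb' l).2 (reach_step ((hb' r).1 hr) ((hSrel _ _).2 hl)), ?_⟩,
    hy⟩) hyx
  exact hl.1.mem_trans hll hyl

end ClassModel

end ClassTheory

namespace ClassTheory
open SetFormula
namespace ClassModel

variable {𝔐 : ClassModel.{u}}

/-! ### Isomorphisms of pointed graphs -/

/-- The relation `F` is an isomorphism from `(N, R)` onto `(N', R')`. -/
def IsoVia (𝔐 : ClassModel.{u}) (F N R N' R' : Set 𝔐.carrier) : Prop :=
  (∀ x ∈ N, ∃! y, y ∈ N' ∧ 𝔐.Rel F x y) ∧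
    (∀ y ∈ N', ∃! x, x ∈ N ∧ 𝔐.Rel F x y) ∧
    ∀ x ∈ N, ∀ x' ∈ N, ∀ y ∈ N', ∀ y' ∈ N',
      𝔐.Rel F x y → 𝔐.Rel F x' y' → (𝔐.Rel R x' x ↔ 𝔐.Rel R' y' y)

theorem iso_iff {G H : PointedGraph 𝔐.carrier} :
    𝔐.Iso G H ↔ ∃ F ∈ 𝔐.classes, 𝔐.IsoVia F G.nodes G.rel H.nodes H.rel := Iff.rfl

instance {n m : ℕ} {𝒞 : Set (Set 𝔐.carrier)}
    (F₁ F₂ F₃ F₄ F₅ : (Fin n → 𝔐.carrier) → (Fin m → Set 𝔐.carrier) → Set 𝔐.carrier)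
    [CT False 𝔐.mem 𝒞 F₁] [CT False 𝔐.mem 𝒞 F₂] [CT False 𝔐.mem 𝒞 F₃] [CT False 𝔐.mem 𝒞 F₄]
    [CT False 𝔐.mem 𝒞 F₅] :
    Dfn False 𝔐.mem 𝒞 fun v W => 𝔐.IsoVia (F₁ v W) (F₂ v W) (F₃ v W) (F₄ v W) (F₅ v W) := by
  have : Dfn False 𝔐.mem 𝒞 fun (_ : Fin 0 → 𝔐.carrier) (W : Fin 5 → Set 𝔐.carrier) =>
      𝔐.IsoVia (W 0) (W 1) (W 2) (W 3) (W 4) := by unfold IsoVia; infer_instance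
  exact this.app ![] ![F₁, F₂, F₃, F₄, F₅]

variable [hM : Nbg 𝔐]

theorem below_nodes (G : PointedGraph 𝔐.carrier) (x : 𝔐.carrier) :
    (𝔐.below G x).nodes = {z | z ∈ G.nodes ∧ z ∈ 𝔐.reach G.rel x} := rfl

theorem rel_setOf_pr {P : 𝔐.carrier → 𝔐.carrier → Prop} {x y : 𝔐.carrier} :
    𝔐.Rel {p | ∃ x y, p = 𝔐.pr x y ∧ P x y} x y ↔ P x y := by
  rw [rel_iff]
  constructor
  · rintro ⟨x', y', e, h⟩
    obtain ⟨rfl, rfl⟩ := pr_inj.1 e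
    exact h
  · intro h; exact ⟨x, y, rfl, h⟩

theorem Iso.refl (G : PointedGraph 𝔐.carrier) : 𝔐.Iso G G := by
  refine ⟨{p | ∃ x y, p = 𝔐.pr x y ∧ x = y}, setOf_mem' _, ?_, ?_, ?_⟩
  · intro x hx
    exact ⟨x, ⟨hx, rel_setOf_pr.2 rfl⟩, fun y hy => (rel_setOf_pr.1 hy.2).symm⟩
  · intro x hx
    exact ⟨x, ⟨hx, rel_setOf_pr.2 rfl⟩, fun y hy => (rel_setOf_pr.1 hy.2)⟩
  · intro x _ x' _ y _ y' _ h h'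
    rw [rel_setOf_pr.1 h, rel_setOf_pr.1 h']

theorem Iso.symm {G H : PointedGraph 𝔐.carrier} (h : 𝔐.Iso G H) : 𝔐.Iso H G := by
  obtain ⟨F, hF, h1, h2, h3⟩ := h
  have : Fact (F ∈ 𝔐.classes) := ⟨hF⟩
  refine ⟨{p | ∃ x y, p = 𝔐.pr x y ∧ 𝔐.Rel F y x}, setOf_mem' _, ?_, ?_, ?_⟩
  · simpa only [rel_setOf_pr] using h2
  · simpa only [rel_setOf_pr] using h1
  · intro x hx x' hx' y hy y' hy' h h'
    exact (h3 y hy y' hy' x hx x' hx' 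
      (rel_setOf_pr (P := fun x y => 𝔐.Rel F y x).1 h)
      (rel_setOf_pr (P := fun x y => 𝔐.Rel F y x).1 h')).symm

theorem Iso.trans {G H K : PointedGraph 𝔐.carrier} (hN : H.nodes ∈ 𝔐.classes) (h : 𝔐.Iso G H)
    (h' : 𝔐.Iso H K) : 𝔐.Iso G K := by
  obtain ⟨F, hF, h1, h2, h3⟩ := h
  obtain ⟨F', hF', h1', h2', h3'⟩ := h'
  have : Fact (F ∈ 𝔐.classes) := ⟨hF⟩
  have : Fact (F' ∈ 𝔐.classes) := ⟨hF'⟩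
  have : Fact (H.nodes ∈ 𝔐.classes) := ⟨hN⟩
  refine ⟨{p | ∃ x y, p = 𝔐.pr x y ∧ ∃ z, z ∈ H.nodes ∧ 𝔐.Rel F x z ∧ 𝔐.Rel F' z y}, setOf_mem' _,
    ?_, ?_, ?_⟩
  · intro x hx
    obtain ⟨z, ⟨hz, hxz⟩, hz'⟩ := h1 x hx
    obtain ⟨y, ⟨hy, hzy⟩, hy'⟩ := h1' z hz
    refine ⟨y, ⟨hy, rel_setOf_pr.2 ⟨z, hz, hxz, hzy⟩⟩, ?_⟩
    rintro w ⟨hw, h⟩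
    obtain ⟨z', hz1, hz2, hz3⟩ := rel_setOf_pr.1 h
    obtain rfl := hz' z' ⟨hz1, hz2⟩
    exact hy' w ⟨hw, hz3⟩
  · intro y hy
    obtain ⟨z, ⟨hz, hxz⟩, hz'⟩ := h2' y hy
    obtain ⟨x, ⟨hx, hzx⟩, hx'⟩ := h2 z hz
    refine ⟨x, ⟨hx, rel_setOf_pr.2 ⟨z, hz, hzx, hxz⟩⟩, ?_⟩
    rintro w ⟨hw, h⟩
    obtain ⟨z', hz1, hz2, hz3⟩ := rel_setOf_pr.1 h
    obtain rfl := hz' z' ⟨hz1, hz3⟩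
    exact hx' w ⟨hw, hz2⟩
  · intro x hx x' hx' y hy y' hy' h h'
    obtain ⟨z, hz1, hz2, hz3⟩ := rel_setOf_pr.1 h
    obtain ⟨z', hz1', hz2', hz3'⟩ := rel_setOf_pr.1 h'
    exact (h3 x hx x' hx' z hz1 z' hz1' hz2 hz2').trans (h3' z hz1 z' hz1' y hy y' hy' hz3 hz3')

theorem reach_sub {N R : Set 𝔐.carrier} (hN : N ∈ 𝔐.classes) (hR : R ∈ 𝔐.classes)
    (hRN : ∀ x y, 𝔐.Rel R x y → x ∈ N) {x z : 𝔐.carrier} (hx : x ∈ N)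
    (hz : z ∈ 𝔐.reach R x) : z ∈ N := by
  have : Fact (N ∈ 𝔐.classes) := ⟨hN⟩
  exact reach_induction hR (fun z => z ∈ N) hx (fun y z _ _ h => hRN z y h) hz

theorem reach_head {R : Set 𝔐.carrier} (hR : R ∈ 𝔐.classes) {x z : 𝔐.carrier}
    (hz : z ∈ 𝔐.reach R x) : z = x ∨ ∃ y, 𝔐.Rel R y x ∧ z ∈ 𝔐.reach R y := by
  have : Fact (R ∈ 𝔐.classes) := ⟨hR⟩
  refine reach_induction hR (fun z => z = x ∨ ∃ y, 𝔐.Rel R y x ∧ z ∈ 𝔐.reach R y) (Or.inl rfl)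
    (fun y z _ hy hzy => Or.inr ?_) hz
  rcases hy with rfl | ⟨w, hw, hyw⟩
  · exact ⟨z, hzy, reach_refl⟩
  · exact ⟨w, hw, reach_step hyw hzy⟩

/-- A well-founded relation has no finite cycles. -/
theorem ClassWF.no_cycle {N R : Set 𝔐.carrier} (h : 𝔐.ClassWF N R) (hN : N ∈ 𝔐.classes)
    (hR : R ∈ 𝔐.classes) (hRN : ∀ x y, 𝔐.Rel R x y → x ∈ N) {x y : 𝔐.carrier} (hx : x ∈ N)
    (hy : y ∈ 𝔐.reach R x) : ¬ 𝔐.Rel R x y := by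
  intro hxy
  have : Fact (R ∈ 𝔐.classes) := ⟨hR⟩
  obtain ⟨z, ⟨hz1, hz2⟩, hmin⟩ := h {z | z ∈ 𝔐.reach R x ∧ x ∈ 𝔐.reach R z} (setOf_mem' _)
    (fun z hz => reach_sub hN hR hRN hx hz.1) ⟨x, reach_refl, reach_refl⟩
  rcases reach_head hR hz2 with rfl | ⟨w, hw, hxw⟩
  · rcases reach_head hR hy with rfl | ⟨w, hw, hyw⟩
    · exact hmin _ ⟨reach_refl, reach_refl⟩ hxy
    · exact hmin w ⟨reach_step reach_refl hw, reach_step hyw hxy⟩ hw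
  · exact hmin w ⟨reach_step hz1 hw, hxw⟩ hw

/-- An injective bisimulation restricts to an isomorphism of the parts below two points. -/
theorem iso_below_of_bisim {G H : PointedGraph 𝔐.carrier} {x y : 𝔐.carrier}
    (hG : G.nodes ∈ 𝔐.classes) (hGr : G.rel ∈ 𝔐.classes) (hGN : ∀ x y, 𝔐.Rel G.rel x y → x ∈ G.nodes)
    (hH : H.nodes ∈ 𝔐.classes) (hHr : H.rel ∈ 𝔐.classes) (hHN : ∀ x y, 𝔐.Rel H.rel x y → x ∈ H.nodes)
    (hx : x ∈ G.nodes) (hy : y ∈ H.nodes) {F : Set 𝔐.carrier} (hF : F ∈ 𝔐.classes)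
    (hxy : 𝔐.Rel F x y) (hfun : ∀ x y y', 𝔐.Rel F x y → 𝔐.Rel F x y' → y = y')
    (hinj : ∀ x x' y, 𝔐.Rel F x y → 𝔐.Rel F x' y → x = x')
    (hforth : ∀ x y x', 𝔐.Rel F x y → 𝔐.Rel G.rel x' x → ∃ y', 𝔐.Rel F x' y' ∧ 𝔐.Rel H.rel y' y)
    (hback : ∀ x y y', 𝔐.Rel F x y → 𝔐.Rel H.rel y' y → ∃ x', 𝔐.Rel F x' y' ∧ 𝔐.Rel G.rel x' x) :
    𝔐.Iso (𝔐.below G x) (𝔐.below H y) := by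
  have : Fact (F ∈ 𝔐.classes) := ⟨hF⟩
  have : Fact (G.rel ∈ 𝔐.classes) := ⟨hGr⟩
  have : Fact (H.rel ∈ 𝔐.classes) := ⟨hHr⟩
  refine ⟨F, hF, ?_, ?_, ?_⟩
  · rintro z ⟨-, hz⟩
    obtain ⟨w, hw, hzw⟩ := reach_induction hGr
      (fun z => ∃ w, w ∈ 𝔐.reach H.rel y ∧ 𝔐.Rel F z w) ⟨y, reach_refl, hxy⟩
      (fun z z' _ ⟨w, hw, hzw⟩ hz' => by
        obtain ⟨w', h1, h2⟩ := hforth z w z' hzw hz'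
        exact ⟨w', reach_step hw h2, h1⟩) hz
    exact ⟨w, ⟨⟨reach_sub hH hHr hHN hy hw, hw⟩, hzw⟩, fun w' hw' => hfun _ _ _ hw'.2 hzw⟩
  · rintro z ⟨-, hz⟩
    obtain ⟨w, hw, hzw⟩ := reach_induction hHr
      (fun z => ∃ w, w ∈ 𝔐.reach G.rel x ∧ 𝔐.Rel F w z) ⟨x, reach_refl, hxy⟩
      (fun z z' _ ⟨w, hw, hzw⟩ hz' => by
        obtain ⟨w', h1, h2⟩ := hback w z z' hzw hz'
        exact ⟨w', reach_step hw h2, h1⟩) hz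
    exact ⟨w, ⟨⟨reach_sub hG hGr hGN hx hw, hw⟩, hzw⟩, fun w' hw' => hinj _ _ _ hw'.2 hzw⟩
  · intro a _ a' _ b _ b' _ h h'
    constructor
    · intro hr
      obtain ⟨c, h1, h2⟩ := hforth a b a' h hr
      obtain rfl := hfun _ _ _ h1 h'
      exact h2
    · intro hr
      obtain ⟨c, h1, h2⟩ := hback a b b' h hr
      obtain rfl := hinj _ _ _ h1 h'
      exact h2

/-- An isomorphism of parts of well-founded graphs matches the tops. -/
theorem IsoVia.top {G H : PointedGraph 𝔐.carrier} {x y : 𝔐.carrier} (hG : G.nodes ∈ 𝔐.classes)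
    (hGr : G.rel ∈ 𝔐.classes) (hGN : ∀ x y, 𝔐.Rel G.rel x y → x ∈ G.nodes)
    (hH : H.nodes ∈ 𝔐.classes) (hHr : H.rel ∈ 𝔐.classes) (hHN : ∀ x y, 𝔐.Rel H.rel x y → x ∈ H.nodes)
    (hwf : 𝔐.ClassWF G.nodes G.rel) (hx : x ∈ G.nodes) (hy : y ∈ H.nodes) {F : Set 𝔐.carrier}
    (h : 𝔐.IsoVia F (𝔐.below G x).nodes G.rel (𝔐.below H y).nodes H.rel) : 𝔐.Rel F x y := by
  obtain ⟨h1, h2, h3⟩ := h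
  obtain ⟨z, ⟨⟨hz, hzr⟩, hxz⟩, -⟩ := h1 x ⟨hx, reach_refl⟩
  rcases reach_cases hzr with rfl | ⟨w, hw, hzw⟩
  · exact hxz
  · have hwH : w ∈ H.nodes := reach_sub hH hHr hHN hy hw
    obtain ⟨w0, ⟨⟨hw0, hw0r⟩, hww⟩, -⟩ := h2 w ⟨hwH, hw⟩
    have := (h3 w0 ⟨hw0, hw0r⟩ x ⟨hx, reach_refl⟩ w ⟨hwH, hw⟩ z ⟨hz, hzr⟩ hww hxz).2 hzw
    exact absurd this (hwf.no_cycle hG hGr hGN hx hw0r)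

/-! ### Quotient pairs are well-founded -/

theorem IsRelOn.left {R N : Set 𝔐.carrier} (h : 𝔐.IsRelOn R N) (x y : 𝔐.carrier)
    (hxy : 𝔐.Rel R x y) : x ∈ N := by
  obtain ⟨a, ha, b, hb, e⟩ := h _ (rel_iff.1 hxy)
  obtain ⟨rfl, rfl⟩ := pr_inj.1 (isPair_iff.1 e)
  exact ha

/-- If the parts below `y` and `z` are isomorphic, every predecessor of `y` is matched by a predecessor
of `z`. -/
theorem IsCodingPair.iso_child {G : PointedGraph 𝔐.carrier} (hG : 𝔐.IsCodingPair G)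
    {x y z : 𝔐.carrier} (hy : y ∈ G.nodes) (hz : z ∈ G.nodes) (hxy : 𝔐.Rel G.rel x y)
    (h : 𝔐.Iso (𝔐.below G y) (𝔐.below G z)) :
    ∃ w, 𝔐.Rel G.rel w z ∧ 𝔐.Iso (𝔐.below G x) (𝔐.below G w) := by
  have hN := hG.nodes_mem
  have hR := hG.rel_mem
  have hl := hG.rel_on.left
  obtain ⟨F, hF, h⟩ := iso_iff.1 h
  have htop : 𝔐.Rel F y z := IsoVia.top hN hR hl hN hR hl hG.wellFounded hy hz h
  obtain ⟨h1, h2, h3⟩ := h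
  have hy' : y ∈ (𝔐.below G y).nodes := ⟨hy, reach_refl⟩
  have hz' : z ∈ (𝔐.below G z).nodes := ⟨hz, reach_refl⟩
  have hx' : x ∈ (𝔐.below G y).nodes := ⟨hl _ _ hxy, reach_step reach_refl hxy⟩
  obtain ⟨w, ⟨hw, hxw⟩, -⟩ := h1 x hx'
  refine ⟨w, (h3 y hy' x hx' z hz' w hw htop hxw).1 hxy, ?_⟩
  have : Fact (F ∈ 𝔐.classes) := ⟨hF⟩
  have : Fact (G.rel ∈ 𝔐.classes) := ⟨hR⟩
  have : Fact (G.nodes ∈ 𝔐.classes) := ⟨hN⟩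
  refine iso_below_of_bisim hN hR hl hN hR hl (hl _ _ hxy) hw.1
    (F := {p | ∃ a b, p = 𝔐.pr a b ∧ 𝔐.Rel F a b ∧ (a ∈ G.nodes ∧ a ∈ 𝔐.reach G.rel y) ∧
      (b ∈ G.nodes ∧ b ∈ 𝔐.reach G.rel z)})
    (setOf_mem' _) (rel_setOf_pr.2 ⟨hxw, hx', hw⟩) ?_ ?_ ?_ ?_ <;> simp only [rel_setOf_pr]
  · rintro a b b' ⟨h, ha, hb⟩ ⟨h', -, hb'⟩
    exact (h1 a ha).unique ⟨hb, h⟩ ⟨hb', h'⟩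
  · rintro a a' b ⟨h, ha, hb⟩ ⟨h', ha', -⟩
    exact (h2 b hb).unique ⟨ha, h⟩ ⟨ha', h'⟩
  · rintro a b a' ⟨h, ha, hb⟩ hr
    have ha' : a' ∈ (𝔐.below G y).nodes := ⟨hl _ _ hr, reach_step ha.2 hr⟩
    obtain ⟨b', ⟨hb', h'⟩, -⟩ := h1 a' ha'
    exact ⟨b', ⟨h', ha', hb'⟩, (h3 a ha a' ha' b hb b' hb' h h').1 hr⟩
  · rintro a b b' ⟨h, ha, hb⟩ hr
    have hb' : b' ∈ (𝔐.below G z).nodes := ⟨hl _ _ hr, reach_step hb.2 hr⟩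
    obtain ⟨a', ⟨ha', h'⟩, -⟩ := h2 b' hb'
    exact ⟨a', ⟨h', ha', hb'⟩, (h3 a ha a' ha' b hb b' hb' h h').2 hr⟩

theorem below_nodes_mem {G : PointedGraph 𝔐.carrier} (hN : G.nodes ∈ 𝔐.classes)
    (hR : G.rel ∈ 𝔐.classes) (x : 𝔐.carrier) : (𝔐.below G x).nodes ∈ 𝔐.classes := by
  have : Fact (G.rel ∈ 𝔐.classes) := ⟨hR⟩
  have : Fact (G.nodes ∈ 𝔐.classes) := ⟨hN⟩
  rw [below_nodes]
  exact setOf_mem' _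

/-- The nodes of a coding pair whose representative lies in a given class form a class, by
`Δ¹₁`-Comprehension: having a representative in `X` is the negation of having one outside `X`. -/
theorem IsQuotientOf.exists_class {Q G : PointedGraph 𝔐.carrier} (hD : 𝔐.Delta11Comprehension)
    (hG : 𝔐.IsCodingPair G) (hQ : 𝔐.IsQuotientOf Q G) {X : Set 𝔐.carrier} (hX : X ∈ 𝔐.classes)
    (hXQ : X ⊆ Q.nodes) : ∃ T ∈ 𝔐.classes, ∀ g, g ∈ T ↔
      g ∈ G.nodes ∧ ∃ x ∈ X, 𝔐.Iso (𝔐.below G x) (𝔐.below G g) := by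
  have : Fact (X ∈ 𝔐.classes) := ⟨hX⟩
  have : Fact (G.rel ∈ 𝔐.classes) := ⟨hG.rel_mem⟩
  have : Fact (G.nodes ∈ 𝔐.classes) := ⟨hG.nodes_mem⟩
  have : Fact (Q.nodes ∈ 𝔐.classes) := ⟨hQ.nodes_mem⟩
  refine ⟨_, delta_setOf_mem hD (k := 1) (l := 1)
    (fun g W => g ∈ G.nodes ∧ ∃ x, x ∈ X ∧ 𝔐.IsoVia (W 0)
      {z | z ∈ G.nodes ∧ z ∈ 𝔐.reach G.rel x} G.rel {z | z ∈ G.nodes ∧ z ∈ 𝔐.reach G.rel g} G.rel)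
    (fun g W => g ∈ G.nodes ∧ ∀ x, x ∈ Q.nodes → ¬ x ∈ X → ¬ 𝔐.IsoVia (W 0)
      {z | z ∈ G.nodes ∧ z ∈ 𝔐.reach G.rel x} G.rel {z | z ∈ G.nodes ∧ z ∈ 𝔐.reach G.rel g} G.rel)
    (fun g => ⟨?_, ?_⟩), fun g => ⟨?_, ?_⟩⟩
  · rintro ⟨F, hF, hg, x, hx, h⟩ F' hF'
    refine ⟨hg, fun x' hx' hx'X h' => hx'X ?_⟩
    rwa [(hQ.representative g hg).unique ⟨hx', F' 0, hF' 0, h'⟩ ⟨hXQ hx, F 0, hF 0, h⟩]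
  · intro h
    obtain ⟨hg, -⟩ := h (fun _ => X) fun _ => hX
    obtain ⟨r, ⟨hr, F, hF, hFr⟩, -⟩ := hQ.representative g hg
    refine ⟨fun _ => F, fun _ => hF, hg, r, ?_, hFr⟩
    by_contra hrX
    exact (h (fun _ => F) fun _ => hF).2 r hr hrX hFr
  · rintro ⟨F, hF, hg, x, hx, h⟩
    exact ⟨hg, x, hx, F 0, hF 0, h⟩
  · rintro ⟨hg, x, hx, F, hF, h⟩
    exact ⟨fun _ => F, fun _ => hF, hg, x, hx, h⟩

/-- A non-empty class of representatives has a minimal element because the nodes of the coding pair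
represented by its elements form a class. -/
theorem IsQuotientOf.classWF {Q G : PointedGraph 𝔐.carrier} (hD : 𝔐.Delta11Comprehension)
    (hG : 𝔐.IsCodingPair G) (hQ : 𝔐.IsQuotientOf Q G) : 𝔐.ClassWF Q.nodes Q.rel := by
  intro X hX hXQ ⟨x, hx⟩
  obtain ⟨T, hT, hT'⟩ := hQ.exists_class hD hG hX hXQ
  obtain ⟨g, hg, hmin⟩ := hG.wellFounded T hT (fun g hg => ((hT' g).1 hg).1)
    ⟨x, (hT' x).2 ⟨hQ.nodes_subset (hXQ hx), x, hx, Iso.refl _⟩⟩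
  obtain ⟨hgG, y, hy, hyg⟩ := (hT' g).1 hg
  refine ⟨y, hy, fun z hz hzy => ?_⟩
  obtain ⟨z0, hz0, y0, hy0, hzz, hyy, hr⟩ := (hQ.rel_iff z (hXQ hz) y (hXQ hy)).1 hzy
  have hb := below_nodes_mem hG.nodes_mem hG.rel_mem
  obtain ⟨w, hw, hzw⟩ := hG.iso_child hy0 hgG hr (hyy.symm.trans (hb y) hyg)
  exact hmin w ((hT' w).2 ⟨hG.rel_on.left _ _ hw, z, hz, hzz.trans (hb z0) hzw⟩) hw

end ClassModel

end ClassTheory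

namespace ClassTheory
open SetFormula
namespace ClassModel

variable {𝔐 : ClassModel.{u}} [hM : Nbg 𝔐]

/-! ### The coding pair of a well-founded extensional class -/

theorem pr_ne_o (x y : 𝔐.carrier) : 𝔐.pr x y ≠ 𝔐.o := by
  intro h
  obtain ⟨s, d, hs, hd, hp⟩ := isPair_pr x y
  rw [h] at hp
  exact not_mem_o s ((hp s).2 (Or.inl rfl))

/-- `x` is a label of a child of the node `p` in the tree of finite descending sequences of `(N, R)`.
Sequences are nested pairs: `∅` is the empty sequence, `⟨x, p⟩` prolongs `p` by `x`. -/
def Lab (𝔐 : ClassModel.{u}) [hM : Nbg 𝔐] (N R : Set 𝔐.carrier) (p x : 𝔐.carrier) : Prop :=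
  (p = 𝔐.o ∧ x ∈ N) ∨ ∃ y r, p = 𝔐.pr y r ∧ 𝔐.Rel R x y

instance {n m : ℕ} {𝒞 : Set (Set 𝔐.carrier)} (s t : (Fin n → 𝔐.carrier) → 𝔐.carrier)
    (F G : (Fin n → 𝔐.carrier) → (Fin m → Set 𝔐.carrier) → Set 𝔐.carrier)
    [Tm False 𝔐.mem 𝒞 s] [Tm False 𝔐.mem 𝒞 t] [CT False 𝔐.mem 𝒞 F] [CT False 𝔐.mem 𝒞 G] :
    Dfn False 𝔐.mem 𝒞 fun v W => 𝔐.Lab (F v W) (G v W) (s v) (t v) := by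
  have : Dfn False 𝔐.mem 𝒞 fun (v : Fin 2 → 𝔐.carrier) (W : Fin 2 → Set 𝔐.carrier) =>
      𝔐.Lab (W 0) (W 1) (v 0) (v 1) := by unfold Lab; infer_instance
  exact this.app ![s, t] ![F, G]

/-- The relation between a child and its parent in the tree of finite descending sequences. -/
noncomputable def stepRel (𝔐 : ClassModel.{u}) [hM : Nbg 𝔐] (N R : Set 𝔐.carrier) : Set 𝔐.carrier :=
  {w | ∃ q p, w = 𝔐.pr q p ∧ ∃ x, q = 𝔐.pr x p ∧ 𝔐.Lab N R p x}

/-- The tree of finite descending sequences of `(N, R)`. -/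
noncomputable def unravel (𝔐 : ClassModel.{u}) [hM : Nbg 𝔐] (N R : Set 𝔐.carrier) :
    PointedGraph 𝔐.carrier where
  nodes := 𝔐.reach (𝔐.stepRel N R) 𝔐.o
  rel := {w | ∃ q p, w = 𝔐.pr q p ∧
    (p ∈ 𝔐.reach (𝔐.stepRel N R) 𝔐.o ∧ ∃ x, q = 𝔐.pr x p ∧ 𝔐.Lab N R p x)}
  top := 𝔐.o

/-- The sequences of length at most one: a quotient of the tree of finite descending sequences when
`(N, R)` is well-founded and extensional. It codes the ideal set whose elements form a copy of
`(N, R)`, the node `⟨x, ∅⟩` standing for `x`. -/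
noncomputable def quot (𝔐 : ClassModel.{u}) [hM : Nbg 𝔐] (N R : Set 𝔐.carrier) :
    PointedGraph 𝔐.carrier where
  nodes := {p | p = 𝔐.o ∨ ∃ x, x ∈ N ∧ p = 𝔐.pr x 𝔐.o}
  rel := {w | ∃ q p, w = 𝔐.pr q p ∧
    ((p = 𝔐.o ∨ ∃ x, x ∈ N ∧ p = 𝔐.pr x 𝔐.o) ∧ ∃ x, q = 𝔐.pr x 𝔐.o ∧ 𝔐.Lab N R p x)}
  top := 𝔐.o

/-- `(N, R)` is a well-founded extensional class with a relation on it. -/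
structure IsGraph (𝔐 : ClassModel.{u}) (N R : Set 𝔐.carrier) : Prop where
  nodes_mem : N ∈ 𝔐.classes
  rel_mem : R ∈ 𝔐.classes
  left : ∀ x y, 𝔐.Rel R x y → x ∈ N
  right : ∀ x y, 𝔐.Rel R x y → y ∈ N
  wf : 𝔐.ClassWF N R
  ext : ∀ x ∈ N, ∀ y ∈ N, (∀ z, 𝔐.Rel R z x ↔ 𝔐.Rel R z y) → x = y

theorem lab_o {N R : Set 𝔐.carrier} {x : 𝔐.carrier} : 𝔐.Lab N R 𝔐.o x ↔ x ∈ N := by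
  constructor
  · rintro (⟨-, h⟩ | ⟨y, r, e, -⟩)
    · exact h
    · exact absurd e.symm (pr_ne_o _ _)
  · intro h; exact Or.inl ⟨rfl, h⟩

theorem lab_pr {N R : Set 𝔐.carrier} {x y r : 𝔐.carrier} :
    𝔐.Lab N R (𝔐.pr y r) x ↔ 𝔐.Rel R x y := by
  constructor
  · rintro (⟨e, -⟩ | ⟨y', r', e, h⟩)
    · exact absurd e (pr_ne_o _ _)
    · obtain ⟨rfl, rfl⟩ := pr_inj.1 e
      exact h
  · intro h; exact Or.inr ⟨y, r, rfl, h⟩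

theorem rel_stepRel {N R : Set 𝔐.carrier} {q p : 𝔐.carrier} :
    𝔐.Rel (𝔐.stepRel N R) q p ↔ ∃ x, q = 𝔐.pr x p ∧ 𝔐.Lab N R p x := rel_setOf_pr

theorem rel_unravel {N R : Set 𝔐.carrier} {q p : 𝔐.carrier} :
    𝔐.Rel (𝔐.unravel N R).rel q p ↔
      p ∈ (𝔐.unravel N R).nodes ∧ ∃ x, q = 𝔐.pr x p ∧ 𝔐.Lab N R p x :=
  rel_setOf_pr (P := fun q p => p ∈ (𝔐.unravel N R).nodes ∧ ∃ x, q = 𝔐.pr x p ∧ 𝔐.Lab N R p x)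

theorem rel_quot {N R : Set 𝔐.carrier} {q p : 𝔐.carrier} :
    𝔐.Rel (𝔐.quot N R).rel q p ↔
      p ∈ (𝔐.quot N R).nodes ∧ ∃ x, q = 𝔐.pr x 𝔐.o ∧ 𝔐.Lab N R p x :=
  rel_setOf_pr (P := fun q p => p ∈ (𝔐.quot N R).nodes ∧ ∃ x, q = 𝔐.pr x 𝔐.o ∧ 𝔐.Lab N R p x)

namespace IsGraph

variable {N R : Set 𝔐.carrier} (h : 𝔐.IsGraph N R)

include h

theorem stepRel_mem : 𝔐.stepRel N R ∈ 𝔐.classes := by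
  have : Fact (N ∈ 𝔐.classes) := ⟨h.nodes_mem⟩
  have : Fact (R ∈ 𝔐.classes) := ⟨h.rel_mem⟩
  unfold stepRel
  exact setOf_mem' _

theorem unravel_nodes_mem : (𝔐.unravel N R).nodes ∈ 𝔐.classes := by
  have : Fact (𝔐.stepRel N R ∈ 𝔐.classes) := ⟨h.stepRel_mem⟩
  exact setOf_mem' fun x => x ∈ 𝔐.reach (𝔐.stepRel N R) 𝔐.o

theorem unravel_rel_mem : (𝔐.unravel N R).rel ∈ 𝔐.classes := by
  have : Fact (𝔐.stepRel N R ∈ 𝔐.classes) := ⟨h.stepRel_mem⟩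
  have : Fact (N ∈ 𝔐.classes) := ⟨h.nodes_mem⟩
  have : Fact (R ∈ 𝔐.classes) := ⟨h.rel_mem⟩
  exact setOf_mem' fun w => ∃ q p, w = 𝔐.pr q p ∧
    (p ∈ 𝔐.reach (𝔐.stepRel N R) 𝔐.o ∧ ∃ x, q = 𝔐.pr x p ∧ 𝔐.Lab N R p x)

theorem lab_mem {p x : 𝔐.carrier} (hx : 𝔐.Lab N R p x) : x ∈ N := by
  rcases hx with ⟨-, hx⟩ | ⟨y, r, -, hx⟩
  · exact hx
  · exact h.left _ _ hx

omit h in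
theorem _root_.ClassTheory.ClassModel.unravel_child {p x : 𝔐.carrier}
    (hp : p ∈ (𝔐.unravel N R).nodes) (hx : 𝔐.Lab N R p x) :
    𝔐.pr x p ∈ (𝔐.unravel N R).nodes ∧ 𝔐.Rel (𝔐.unravel N R).rel (𝔐.pr x p) p :=
  ⟨reach_step hp (rel_stepRel.2 ⟨x, rfl, hx⟩), rel_unravel.2 ⟨hp, x, rfl, hx⟩⟩

omit h in
theorem _root_.ClassTheory.ClassModel.unravel_left (x y : 𝔐.carrier)
    (hxy : 𝔐.Rel (𝔐.unravel N R).rel x y) : x ∈ (𝔐.unravel N R).nodes := by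
  obtain ⟨hp, a, rfl, ha⟩ := rel_unravel.1 hxy
  exact (unravel_child hp ha).1

theorem eq_o_or_pr {p : 𝔐.carrier} (hp : p ∈ (𝔐.unravel N R).nodes) :
    p = 𝔐.o ∨ ∃ a r, a ∈ N ∧ p = 𝔐.pr a r ∧ r ∈ (𝔐.unravel N R).nodes := by
  rcases reach_cases hp with rfl | ⟨y, hy, hr⟩
  · exact Or.inl rfl
  · obtain ⟨x, rfl, hx⟩ := rel_stepRel.1 hr
    exact Or.inr ⟨x, y, h.lab_mem hx, rfl, hy⟩

theorem lab_irrefl {a r : 𝔐.carrier} (ha : a ∈ N) : ¬ 𝔐.Lab N R (𝔐.pr a r) a := by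
  rw [lab_pr]; exact h.wf.irrefl ha

theorem unravel_wf : 𝔐.ClassWF (𝔐.unravel N R).nodes (𝔐.unravel N R).rel := by
  intro X hX hXN ⟨p, hp⟩
  have : Fact (X ∈ 𝔐.classes) := ⟨hX⟩
  by_cases hne : ∃ a p, p ∈ X ∧ ∃ r, p = 𝔐.pr a r
  · obtain ⟨a, ⟨q, hq, r, rfl⟩, hmin⟩ := h.wf {a | ∃ p, p ∈ X ∧ ∃ r, p = 𝔐.pr a r} (setOf_mem' _)
      (by
        rintro a ⟨p, hp, r, rfl⟩
        rcases h.eq_o_or_pr (hXN hp) with e | ⟨b, s, hb, e, -⟩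
        · exact absurd e (pr_ne_o _ _)
        · rw [(pr_inj.1 e).1]; exact hb) hne
    refine ⟨_, hq, fun y hy hr => ?_⟩
    obtain ⟨-, x, rfl, hx⟩ := rel_unravel.1 hr
    exact hmin x ⟨_, hy, _, rfl⟩ (lab_pr.1 hx)
  · refine ⟨p, hp, fun y hy hr => hne ?_⟩
    obtain ⟨-, x, rfl, hx⟩ := rel_unravel.1 hr
    exact ⟨x, _, hy, p, rfl⟩

/-- Isomorphic parts of the tree have the same labels below their tops. -/
theorem lab_iff_of_iso {p q : 𝔐.carrier} (hp : p ∈ (𝔐.unravel N R).nodes)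
    (hq : q ∈ (𝔐.unravel N R).nodes)
    (hpq : 𝔐.Iso (𝔐.below (𝔐.unravel N R) p) (𝔐.below (𝔐.unravel N R) q)) (x : 𝔐.carrier) :
    𝔐.Lab N R p x ↔ 𝔐.Lab N R q x := by
  obtain ⟨F, hF, hi⟩ := iso_iff.1 hpq
  set T := 𝔐.unravel N R with hT
  have hTN : T.nodes ∈ 𝔐.classes := h.unravel_nodes_mem
  have hTR : T.rel ∈ 𝔐.classes := h.unravel_rel_mem
  have : Fact (F ∈ 𝔐.classes) := ⟨hF⟩
  have : Fact (T.nodes ∈ 𝔐.classes) := ⟨hTN⟩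
  have : Fact (T.rel ∈ 𝔐.classes) := ⟨hTR⟩
  have htop : 𝔐.Rel F p q := hi.top hTN hTR unravel_left hTN hTR unravel_left h.unravel_wf hp hq
  obtain ⟨h1, h2, h3⟩ := hi
  have child : ∀ {p z x}, z ∈ (𝔐.below T p).nodes → 𝔐.Lab N R z x →
      𝔐.pr x z ∈ (𝔐.below T p).nodes ∧ 𝔐.Rel T.rel (𝔐.pr x z) z := fun hz hx =>
    ⟨⟨(unravel_child hz.1 hx).1, reach_step hz.2 (unravel_child hz.1 hx).2⟩,
      (unravel_child hz.1 hx).2⟩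
  -- corresponding children have the same label
  have key : ∀ a z w b, z ∈ (𝔐.below T p).nodes → w ∈ (𝔐.below T q).nodes → 𝔐.Rel F z w →
      𝔐.Lab N R z a → 𝔐.Lab N R w b → 𝔐.Rel F (𝔐.pr a z) (𝔐.pr b w) → a = b := by
    intro a0 z0 w0 b0 hz0 hw0 hzw0 ha0 hb0 hab0
    by_contra hne
    obtain ⟨a, ⟨z, w, b, hz, hw, hzw, ha, hb, hab, hne⟩, hmin⟩ := h.wf
      {a | ∃ z w b, (z ∈ T.nodes ∧ z ∈ 𝔐.reach T.rel p) ∧ (w ∈ T.nodes ∧ w ∈ 𝔐.reach T.rel q) ∧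
        𝔐.Rel F z w ∧ 𝔐.Lab N R z a ∧ 𝔐.Lab N R w b ∧ 𝔐.Rel F (𝔐.pr a z) (𝔐.pr b w) ∧ ¬ a = b}
      (by
        have : Fact (N ∈ 𝔐.classes) := ⟨h.nodes_mem⟩
        have : Fact (R ∈ 𝔐.classes) := ⟨h.rel_mem⟩
        exact setOf_mem' _)
      (by rintro a ⟨z, w, b, -, -, -, ha, -⟩; exact h.lab_mem ha)
      ⟨a0, z0, w0, b0, hz0, hw0, hzw0, ha0, hb0, hab0, hne⟩
    obtain ⟨hz', -⟩ := child hz ha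
    obtain ⟨hw', -⟩ := child hw hb
    refine hne (h.ext a (h.lab_mem ha) b (h.lab_mem hb) fun x => ⟨fun hx => ?_, fun hx => ?_⟩)
    · obtain ⟨hz'', hr⟩ := child hz' (lab_pr.2 hx)
      obtain ⟨y, ⟨hy, hzy⟩, -⟩ := h1 _ hz''
      have hr' := (h3 _ hz' _ hz'' _ hw' _ hy hab hzy).1 hr
      obtain ⟨-, c, rfl, hc⟩ := rel_unravel.1 hr'
      have : x = c := by
        by_contra hxc
        exact hmin x ⟨_, _, c, hz', hw', hab, lab_pr.2 hx, hc, hzy, hxc⟩ hx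
      rw [this]; exact lab_pr.1 hc
    · obtain ⟨hw'', hr⟩ := child hw' (lab_pr.2 hx)
      obtain ⟨y, ⟨hy, hzy⟩, -⟩ := h2 _ hw''
      have hr' := (h3 _ hz' _ hy _ hw' _ hw'' hab hzy).2 hr
      obtain ⟨-, c, rfl, hc⟩ := rel_unravel.1 hr'
      have : c = x := by
        by_contra hxc
        exact hmin c ⟨_, _, x, hz', hw', hab, hc, lab_pr.2 hx, hzy, hxc⟩ (lab_pr.1 hc)
      rw [← this]; exact lab_pr.1 hc
  have hp' : p ∈ (𝔐.below T p).nodes := ⟨hp, reach_refl⟩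
  have hq' : q ∈ (𝔐.below T q).nodes := ⟨hq, reach_refl⟩
  constructor
  · intro hx
    obtain ⟨hz, hr⟩ := child hp' hx
    obtain ⟨y, ⟨hy, hzy⟩, -⟩ := h1 _ hz
    have hr' := (h3 _ hp' _ hz _ hq' _ hy htop hzy).1 hr
    obtain ⟨-, c, rfl, hc⟩ := rel_unravel.1 hr'
    rw [key x p q c hp' hq' htop hx hc hzy]; exact hc
  · intro hx
    obtain ⟨hz, hr⟩ := child hq' hx
    obtain ⟨y, ⟨hy, hzy⟩, -⟩ := h2 _ hz
    have hr' := (h3 _ hp' _ hy _ hq' _ hz htop hzy).2 hr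
    obtain ⟨-, c, rfl, hc⟩ := rel_unravel.1 hr'
    rw [← key c p q x hp' hq' htop hc hx hzy]; exact hc

/-- Nodes with the same labels below them have isomorphic parts below them: prolong both by the same
finite sequences. -/
theorem iso_of_lab_iff {p q : 𝔐.carrier} (hp : p ∈ (𝔐.unravel N R).nodes)
    (hq : q ∈ (𝔐.unravel N R).nodes) (hpq : ∀ x, 𝔐.Lab N R p x ↔ 𝔐.Lab N R q x) :
    𝔐.Iso (𝔐.below (𝔐.unravel N R) p) (𝔐.below (𝔐.unravel N R) q) := by
  set T := 𝔐.unravel N R with hT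
  have hTN : T.nodes ∈ 𝔐.classes := h.unravel_nodes_mem
  have hTR : T.rel ∈ 𝔐.classes := h.unravel_rel_mem
  have : Fact (T.nodes ∈ 𝔐.classes) := ⟨hTN⟩
  have : Fact (T.rel ∈ 𝔐.classes) := ⟨hTR⟩
  have : Fact (N ∈ 𝔐.classes) := ⟨h.nodes_mem⟩
  have : Fact (R ∈ 𝔐.classes) := ⟨h.rel_mem⟩
  obtain ⟨S, hSc, hS⟩ : ∃ S ∈ 𝔐.classes, ∀ w' w, 𝔐.Rel S w' w ↔ ∃ x a b, w = 𝔐.pr a b ∧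
      w' = 𝔐.pr (𝔐.pr x a) (𝔐.pr x b) ∧ 𝔐.Lab N R a x :=
    ⟨{v | ∃ w' w, v = 𝔐.pr w' w ∧ ∃ x a b, w = 𝔐.pr a b ∧
      w' = 𝔐.pr (𝔐.pr x a) (𝔐.pr x b) ∧ 𝔐.Lab N R a x}, setOf_mem' _, fun _ _ => rel_setOf_pr⟩
  have : Fact (S ∈ 𝔐.classes) := ⟨hSc⟩
  obtain ⟨F, hF, hF'⟩ : ∃ F ∈ 𝔐.classes, ∀ w, w ∈ F ↔ w ∈ 𝔐.reach S (𝔐.pr p q) :=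
    ⟨_, setOf_mem' fun w => w ∈ 𝔐.reach S (𝔐.pr p q), fun _ => Iff.rfl⟩
  have : Fact (F ∈ 𝔐.classes) := ⟨hF⟩
  have hcase : ∀ {a b}, 𝔐.Rel F a b → (a = p ∧ b = q) ∨ ∃ x a' b', a = 𝔐.pr x a' ∧ b = 𝔐.pr x b' ∧
      𝔐.Rel F a' b' ∧ 𝔐.Lab N R a' x := fun {a b} hab => by
    rw [rel_iff, hF'] at hab
    rcases reach_cases hab with e | ⟨w, hw, hr⟩
    · exact Or.inl (pr_inj.1 e)
    · obtain ⟨x, a', b', rfl, e, hx⟩ := (hS _ _).1 hr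
      obtain ⟨rfl, rfl⟩ := pr_inj.1 e
      exact Or.inr ⟨x, a', b', rfl, rfl, rel_iff.2 ((hF' _).2 hw), hx⟩
  have hstep : ∀ {a b x}, 𝔐.Rel F a b → 𝔐.Lab N R a x → 𝔐.Rel F (𝔐.pr x a) (𝔐.pr x b) :=
    fun hab hx => by
      rw [rel_iff, hF'] at hab ⊢
      exact reach_step hab ((hS _ _).2 ⟨_, _, _, rfl, rfl, hx⟩)
  have hinv : ∀ a b, 𝔐.Rel F a b → (a ∈ T.nodes ∧ a ∈ 𝔐.reach T.rel p) ∧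
      (b ∈ T.nodes ∧ b ∈ 𝔐.reach T.rel q) ∧ ∀ x, 𝔐.Lab N R a x ↔ 𝔐.Lab N R b x := by
    intro a b hab
    obtain ⟨a', b', e, h'⟩ := reach_induction hSc (fun w => ∃ a b, w = 𝔐.pr a b ∧
      (a ∈ T.nodes ∧ a ∈ 𝔐.reach T.rel p) ∧
      (b ∈ T.nodes ∧ b ∈ 𝔐.reach T.rel q) ∧ ∀ x, 𝔐.Lab N R a x ↔ 𝔐.Lab N R b x)
      ⟨p, q, rfl, ⟨hp, reach_refl⟩, ⟨hq, reach_refl⟩, hpq⟩ (by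
        rintro w w' - ⟨a, b, rfl, ha, hb, hl⟩ hr
        obtain ⟨x, a', b', e, rfl, hx⟩ := (hS _ _).1 hr
        obtain ⟨rfl, rfl⟩ := pr_inj.1 e
        have h1 := unravel_child ha.1 hx
        have h2 := unravel_child hb.1 ((hl x).1 hx)
        exact ⟨_, _, rfl, ⟨h1.1, reach_step ha.2 h1.2⟩, ⟨h2.1, reach_step hb.2 h2.2⟩,
          fun y => by rw [lab_pr, lab_pr]⟩) ((hF' _).1 (rel_iff.1 hab))
    obtain ⟨rfl, rfl⟩ := pr_inj.1 e
    exact h'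
  have hcyc : ∀ {p a}, p ∈ T.nodes → a ∈ 𝔐.reach T.rel p → ¬ 𝔐.Rel T.rel p a := fun hp ha =>
    h.unravel_wf.no_cycle hTN hTR unravel_left hp ha
  have hfun : ∀ a, a ∈ 𝔐.reach T.rel p → ∀ b b', 𝔐.Rel F a b → 𝔐.Rel F a b' → b = b' := by
    intro a ha
    refine reach_induction hTR (fun a => ∀ b b', 𝔐.Rel F a b → 𝔐.Rel F a b' → b = b') ?_ ?_ ha
    · have : ∀ b, 𝔐.Rel F p b → b = q := fun b hb => by
        rcases hcase hb with h | ⟨x, a', b', e, -, hab, hx⟩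
        · exact h.2
        · have := (hinv _ _ hab).1
          exact absurd (e ▸ (unravel_child this.1 hx).2) (hcyc hp this.2)
      intro b b' hb hb'
      rw [this b hb, this b' hb']
    · intro a z ha ih hz
      obtain ⟨-, x, rfl, hx⟩ := rel_unravel.1 hz
      have : ∀ b, 𝔐.Rel F (𝔐.pr x a) b → ∃ b', b = 𝔐.pr x b' ∧ 𝔐.Rel F a b' := fun b hb => by
        rcases hcase hb with ⟨e, -⟩ | ⟨x', a', b', e, rfl, hab, -⟩
        · exact absurd (e ▸ hz) (hcyc hp ha)
        · obtain ⟨rfl, rfl⟩ := pr_inj.1 e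
          exact ⟨b', rfl, hab⟩
      intro b b' hb hb'
      obtain ⟨c, rfl, hc⟩ := this b hb
      obtain ⟨c', rfl, hc'⟩ := this b' hb'
      rw [ih c c' hc hc']
  have hinj : ∀ b, b ∈ 𝔐.reach T.rel q → ∀ a a', 𝔐.Rel F a b → 𝔐.Rel F a' b → a = a' := by
    intro b hb
    refine reach_induction hTR (fun b => ∀ a a', 𝔐.Rel F a b → 𝔐.Rel F a' b → a = a') ?_ ?_ hb
    · have : ∀ a, 𝔐.Rel F a q → a = p := fun a ha => by
        rcases hcase ha with h | ⟨x, a', b', -, e, hab, hx⟩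
        · exact h.1
        · have := (hinv _ _ hab).2
          exact absurd (e ▸ (unravel_child this.1.1 ((this.2 x).1 hx)).2) (hcyc hq this.1.2)
      intro a a' ha ha'
      rw [this a ha, this a' ha']
    · intro b z hb ih hz
      obtain ⟨-, x, rfl, hx⟩ := rel_unravel.1 hz
      have : ∀ a, 𝔐.Rel F a (𝔐.pr x b) → ∃ a', a = 𝔐.pr x a' ∧ 𝔐.Rel F a' b := fun a ha => by
        rcases hcase ha with ⟨-, e⟩ | ⟨x', a', b', rfl, e, hab, -⟩
        · exact absurd (e ▸ hz) (hcyc hq hb)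
        · obtain ⟨rfl, rfl⟩ := pr_inj.1 e
          exact ⟨a', rfl, hab⟩
      intro a a' ha ha'
      obtain ⟨c, rfl, hc⟩ := this a ha
      obtain ⟨c', rfl, hc'⟩ := this a' ha'
      rw [ih c c' hc hc']
  refine iso_below_of_bisim hTN hTR unravel_left hTN hTR unravel_left hp hq hF
    (rel_iff.2 ((hF' _).2 reach_refl)) (fun a b b' hab hab' => hfun a (hinv _ _ hab).1.2 b b' hab hab')
    (fun a a' b hab hab' => hinj b (hinv _ _ hab).2.1.2 a a' hab hab') ?_ ?_
  · intro a b z hab hz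
    obtain ⟨-, x, rfl, hx⟩ := rel_unravel.1 hz
    have := hinv _ _ hab
    exact ⟨_, hstep hab hx, (unravel_child this.2.1.1 ((this.2.2 x).1 hx)).2⟩
  · intro a b z hab hz
    obtain ⟨-, x, rfl, hx⟩ := rel_unravel.1 hz
    have := hinv _ _ hab
    have hx' := (this.2.2 x).2 hx
    exact ⟨_, hstep hab hx', (unravel_child this.1.1 hx').2⟩

/-- The nodes of the tree that have isomorphic parts below them have the same labels below them, so that
siblings with this property are equal by extensionality. -/
theorem isCodingPair_unravel : 𝔐.IsCodingPair (𝔐.unravel N R) where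
  nodes_mem := h.unravel_nodes_mem
  rel_mem := h.unravel_rel_mem
  rel_on := by
    rintro w ⟨q, p, rfl, hp, x, rfl, hx⟩
    exact ⟨_, (unravel_child hp hx).1, p, hp, isPair_pr _ _⟩
  top_mem := reach_refl
  distance := by
    have hTR := h.unravel_rel_mem
    have : Fact ((𝔐.unravel N R).rel ∈ 𝔐.classes) := ⟨hTR⟩
    have : Fact (𝔐.stepRel N R ∈ 𝔐.classes) := ⟨h.stepRel_mem⟩
    intro z hz
    have hz' : z ∈ 𝔐.reach (𝔐.unravel N R).rel 𝔐.o :=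
      reach_induction h.stepRel_mem (fun z => z ∈ 𝔐.reach (𝔐.unravel N R).rel 𝔐.o) reach_refl
        (fun y z hy ih hr => reach_step ih (rel_unravel.2 ⟨hy, rel_stepRel.1 hr⟩)) hz
    obtain ⟨n, hn, hd⟩ := hz'
    refine ⟨n, ⟨hn, hd⟩, ?_⟩
    rintro m ⟨hm, hd'⟩
    have key := nat_induction (fun n => ∀ m z, 𝔐.IsNat m →
      𝔐.HasDistance (𝔐.unravel N R).rel 𝔐.o n z → 𝔐.HasDistance (𝔐.unravel N R).rel 𝔐.o m z → m = n)
      ?_ ?_ hn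
    · exact key m z hm hd hd'
    · intro m z hm h1 h2
      obtain rfl := hasDistance_o.1 h1
      rcases hm.cases with rfl | ⟨k, hk, rfl⟩
      · rfl
      · obtain ⟨y, -, hr⟩ := (hasDistance_sc hk).1 h2
        obtain ⟨-, x, e, -⟩ := rel_unravel.1 hr
        exact absurd e.symm (pr_ne_o _ _)
    · intro n hn ih m z hm h1 h2
      obtain ⟨y, hy, hr⟩ := (hasDistance_sc hn).1 h1
      obtain ⟨-, x, rfl, -⟩ := rel_unravel.1 hr
      rcases hm.cases with rfl | ⟨k, hk, rfl⟩
      · exact absurd (hasDistance_o.1 h2) (pr_ne_o _ _)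
      · obtain ⟨y', hy', hr'⟩ := (hasDistance_sc hk).1 h2
        obtain ⟨-, x', e, -⟩ := rel_unravel.1 hr'
        obtain ⟨-, rfl⟩ := pr_inj.1 e
        rw [ih k y hk hy hy']
  siblings := by
    intro p hp y hy z hz hne hyp hzp hiso
    obtain ⟨-, a, rfl, ha⟩ := rel_unravel.1 hyp
    obtain ⟨-, b, rfl, hb⟩ := rel_unravel.1 hzp
    refine hne ?_
    rw [h.ext a (h.lab_mem ha) b (h.lab_mem hb) fun x => by
      rw [← lab_pr, h.lab_iff_of_iso hy hz hiso, lab_pr]]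
  levels := by
    intro y hy z hz n hn _ _ hne v hv hv'
    obtain ⟨-, a, rfl, ha⟩ := rel_unravel.1 hv
    obtain ⟨-, b, e, hb⟩ := rel_unravel.1 hv'
    exact hne (pr_inj.1 e).2
  wellFounded := h.unravel_wf

theorem quot_nodes_mem : (𝔐.quot N R).nodes ∈ 𝔐.classes := by
  have : Fact (N ∈ 𝔐.classes) := ⟨h.nodes_mem⟩
  exact setOf_mem' fun p => p = 𝔐.o ∨ ∃ x, x ∈ N ∧ p = 𝔐.pr x 𝔐.o

theorem quot_rel_mem : (𝔐.quot N R).rel ∈ 𝔐.classes := by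
  have : Fact (N ∈ 𝔐.classes) := ⟨h.nodes_mem⟩
  have : Fact (R ∈ 𝔐.classes) := ⟨h.rel_mem⟩
  exact setOf_mem' fun w => ∃ q p, w = 𝔐.pr q p ∧
    ((p = 𝔐.o ∨ ∃ x, x ∈ N ∧ p = 𝔐.pr x 𝔐.o) ∧ ∃ x, q = 𝔐.pr x 𝔐.o ∧ 𝔐.Lab N R p x)

omit h in
theorem _root_.ClassTheory.ClassModel.quot_nodes_subset :
    (𝔐.quot N R).nodes ⊆ (𝔐.unravel N R).nodes := by
  rintro p (rfl | ⟨x, hx, rfl⟩)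
  · exact reach_refl
  · exact (unravel_child reach_refl (lab_o.2 hx)).1

/-- The part below a sequence depends only on its last entry, so that each non-empty sequence is
represented by a sequence of length one. -/
theorem isQuotientOf_unravel : 𝔐.IsQuotientOf (𝔐.quot N R) (𝔐.unravel N R) where
  nodes_mem := h.quot_nodes_mem
  rel_mem := h.quot_rel_mem
  nodes_subset := quot_nodes_subset
  representative := by
    have uniq : ∀ r ∈ (𝔐.quot N R).nodes, ∀ s ∈ (𝔐.quot N R).nodes,
        (∀ x, 𝔐.Lab N R r x ↔ 𝔐.Lab N R s x) → r = s := by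
      rintro r (rfl | ⟨x, hx, rfl⟩) s (rfl | ⟨y, hy, rfl⟩) hl
      · rfl
      · exact absurd ((hl y).1 (lab_o.2 hy)) (h.lab_irrefl hy)
      · exact absurd ((hl x).2 (lab_o.2 hx)) (h.lab_irrefl hx)
      · rw [h.ext x hx y hy fun z => by rw [← lab_pr, hl, lab_pr]]
    intro p hp
    obtain ⟨r, hr, hl⟩ : ∃ r ∈ (𝔐.quot N R).nodes, ∀ x, 𝔐.Lab N R r x ↔ 𝔐.Lab N R p x := by
      rcases h.eq_o_or_pr hp with rfl | ⟨a, r, ha, rfl, -⟩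
      · exact ⟨𝔐.o, Or.inl rfl, fun _ => Iff.rfl⟩
      · exact ⟨𝔐.pr a 𝔐.o, Or.inr ⟨a, ha, rfl⟩, fun x => by rw [lab_pr, lab_pr]⟩
    refine ⟨r, ⟨hr, h.iso_of_lab_iff (quot_nodes_subset hr) hp hl⟩, ?_⟩
    rintro s ⟨hs, hi⟩
    exact uniq s hs r hr fun x => (h.lab_iff_of_iso (quot_nodes_subset hs) hp hi x).trans (hl x).symm
  rel_on := by
    rintro w ⟨q, p, rfl, hp, x, rfl, hx⟩
    exact ⟨_, Or.inr ⟨x, h.lab_mem hx, rfl⟩, p, hp, isPair_pr _ _⟩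
  rel_iff := by
    intro q hq p hp
    rw [rel_quot]
    constructor
    · rintro ⟨-, x, rfl, hx⟩
      have hp' := quot_nodes_subset hp
      exact ⟨_, (unravel_child hp' hx).1, p, hp', h.iso_of_lab_iff (quot_nodes_subset hq)
        (unravel_child hp' hx).1 (fun y => by rw [lab_pr, lab_pr]), Iso.refl _,
        (unravel_child hp' hx).2⟩
    · rintro ⟨q0, hq0, p0, hp0, hqq, hpp, hr⟩
      obtain ⟨-, x, rfl, hx⟩ := rel_unravel.1 hr
      have h1 := h.lab_iff_of_iso (quot_nodes_subset hq) hq0 hqq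
      have h2 := h.lab_iff_of_iso (quot_nodes_subset hp) hp0 hpp
      refine ⟨hp, x, ?_, (h2 x).2 hx⟩
      rcases hq with rfl | ⟨y, hy, rfl⟩
      · exact absurd ((h1 x).1 (lab_o.2 (h.lab_mem hx))) (h.lab_irrefl (h.lab_mem hx))
      · rw [h.ext y hy x (h.lab_mem hx) fun z => by rw [← lab_pr, h1, lab_pr]]
  top_mem := Or.inl rfl
  top_iso := Iso.refl _

theorem isQuotientPair_quot : 𝔐.IsQuotientPair (𝔐.quot N R) :=
  ⟨_, h.isCodingPair_unravel, h.isQuotientOf_unravel⟩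

end IsGraph

end ClassModel

end ClassTheory

namespace ClassTheory
open SetFormula
namespace ClassModel

variable {𝔐 : ClassModel.{u}}

/-! ### Satisfaction classes -/

/-- The section at `i` of a class of ordered pairs. -/
def sec (𝔐 : ClassModel.{u}) (X : Set 𝔐.carrier) (i : 𝔐.carrier) : Set 𝔐.carrier :=
  {x | 𝔐.pr i x ∈ X}

section Definability

variable [hP : Pairs 𝔐] {n m : ℕ} {𝒞 : Set (Set 𝔐.carrier)}

instance (s : (Fin n → 𝔐.carrier) → 𝔐.carrier)
    (F : (Fin n → 𝔐.carrier) → (Fin m → Set 𝔐.carrier) → Set 𝔐.carrier)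
    [Tm False 𝔐.mem 𝒞 s] [CT False 𝔐.mem 𝒞 F] :
    CT False 𝔐.mem 𝒞 fun v W => 𝔐.sec (F v W) (s v) := by
  have : CT False 𝔐.mem 𝒞 fun (v : Fin 1 → 𝔐.carrier) (W : Fin 1 → Set 𝔐.carrier) =>
      𝔐.sec (W 0) (v 0) := by unfold sec; infer_instance
  exact this.comp ![s] ![F] inferInstance inferInstance

end Definability

/-- The standard numerals. -/
noncomputable def num (𝔐 : ClassModel.{u}) [hM : Nbg 𝔐] : ℕ → 𝔐.carrier
  | 0 => 𝔐.o
  | n + 1 => 𝔐.sc (𝔐.num n)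

/-- `c'` is an immediate constituent of the code `c`. -/
def SubCode (𝔐 : ClassModel.{u}) (c' c : 𝔐.carrier) : Prop :=
  ∃ k c₁ c₂, c = 𝔐.pr k (𝔐.pr c₁ c₂) ∧ (c' = c₁ ∨ c' = c₂)

/-- One step of the definition of truth: the code `c` holds at the list `v` in `(S, E)`, provided that
`Z` gives the truth of the immediate constituents of `c`. Lists are nested pairs; the codes stand for
equality and (converse) membership of the first two entries of a list, the negation of a conjunction,
universal quantification, and omission of the second entry of a list. -/
def SatStep (𝔐 : ClassModel.{u}) [hM : Nbg 𝔐] (S E Z : Set 𝔐.carrier) (c v : 𝔐.carrier) : Prop :=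
  ∃ c₁ c₂, (c = 𝔐.pr (𝔐.num 0) (𝔐.pr c₁ c₂) ∧ ∃ x l, v = 𝔐.pr x (𝔐.pr x l)) ∨
    (c = 𝔐.pr (𝔐.num 1) (𝔐.pr c₁ c₂) ∧ ∃ x y l, v = 𝔐.pr x (𝔐.pr y l) ∧ x ∈ S ∧ 𝔐.Rel E y x) ∨
    (c = 𝔐.pr (𝔐.num 2) (𝔐.pr c₁ c₂) ∧ ¬ (𝔐.pr c₁ v ∈ Z ∧ 𝔐.pr c₂ v ∈ Z)) ∨
    (c = 𝔐.pr (𝔐.num 3) (𝔐.pr c₁ c₂) ∧ ∀ x, x ∈ S → 𝔐.pr c₁ (𝔐.pr x v) ∈ Z) ∨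
    (c = 𝔐.pr (𝔐.num 4) (𝔐.pr c₁ c₂) ∧
      ∃ x y l, v = 𝔐.pr x (𝔐.pr y l) ∧ 𝔐.pr c₁ (𝔐.pr x l) ∈ Z)

/-- `Z` is a satisfaction class for the structure `(S, E)`. -/
def IsSat (𝔐 : ClassModel.{u}) [hM : Nbg 𝔐] (S E Z : Set 𝔐.carrier) : Prop :=
  ∀ c v, 𝔐.pr c v ∈ Z ↔ 𝔐.SatStep S E Z c v

/-- `Z` is a satisfaction class for the codes in some set `d ∋ c` closed under constituents. -/
def IsPartialSat (𝔐 : ClassModel.{u}) [hM : Nbg 𝔐] (S E Z : Set 𝔐.carrier) (c : 𝔐.carrier) :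
    Prop :=
  ∃ d, 𝔐.mem c d ∧ (∀ c, 𝔐.mem c d → ∀ c', 𝔐.SubCode c' c → 𝔐.mem c' d) ∧
    ∀ c, 𝔐.mem c d → ∀ v, 𝔐.pr c v ∈ Z ↔ 𝔐.SatStep S E Z c v

section Definability

variable [hM : Nbg 𝔐] {n m : ℕ} {𝒞 : Set (Set 𝔐.carrier)}
  (s t : (Fin n → 𝔐.carrier) → 𝔐.carrier)
  (F G H : (Fin n → 𝔐.carrier) → (Fin m → Set 𝔐.carrier) → Set 𝔐.carrier)
  [Tm False 𝔐.mem 𝒞 s] [Tm False 𝔐.mem 𝒞 t] [CT False 𝔐.mem 𝒞 F] [CT False 𝔐.mem 𝒞 G]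
  [CT False 𝔐.mem 𝒞 H]

instance : Dfn False 𝔐.mem 𝒞 fun v (_ : Fin m → Set 𝔐.carrier) => 𝔐.SubCode (s v) (t v) := by
  have : Dfn False 𝔐.mem 𝒞 fun (v : Fin 2 → 𝔐.carrier) (_ : Fin 0 → Set 𝔐.carrier) =>
      𝔐.SubCode (v 0) (v 1) := by unfold SubCode; infer_instance
  exact this.app ![s, t] ![]

set_option synthInstance.maxSize 1000 in
set_option synthInstance.maxHeartbeats 200000 in
instance : Dfn False 𝔐.mem 𝒞 fun v W => 𝔐.SatStep (F v W) (G v W) (H v W) (s v) (t v) := by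
  have : Dfn False 𝔐.mem 𝒞 fun (v : Fin 2 → 𝔐.carrier) (W : Fin 3 → Set 𝔐.carrier) =>
      𝔐.SatStep (W 0) (W 1) (W 2) (v 0) (v 1) := by unfold SatStep; infer_instance
  exact this.app ![s, t] ![F, G, H]

instance : Dfn False 𝔐.mem 𝒞 fun v W => 𝔐.IsSat (F v W) (G v W) (H v W) := by
  have : Dfn False 𝔐.mem 𝒞 fun (_ : Fin 0 → 𝔐.carrier) (W : Fin 3 → Set 𝔐.carrier) =>
      𝔐.IsSat (W 0) (W 1) (W 2) := by unfold IsSat; infer_instance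
  exact this.app ![] ![F, G, H]

instance : Dfn False 𝔐.mem 𝒞 fun v W => 𝔐.IsPartialSat (F v W) (G v W) (H v W) (s v) := by
  have : Dfn False 𝔐.mem 𝒞 fun (v : Fin 1 → 𝔐.carrier) (W : Fin 3 → Set 𝔐.carrier) =>
      𝔐.IsPartialSat (W 0) (W 1) (W 2) (v 0) := by unfold IsPartialSat; infer_instance
  exact this.app ![s] ![F, G, H]

end Definability

variable [hM : Nbg 𝔐]

theorem num_inj {i j : ℕ} : 𝔐.num i = 𝔐.num j ↔ i = j := by
  refine ⟨fun h => ?_, by rintro rfl; rfl⟩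
  induction i generalizing j with
  | zero =>
    cases j with
    | zero => rfl
    | succ j => exact absurd h.symm (sc_ne_o _)
  | succ i ih =>
    cases j with
    | zero => exact absurd h (sc_ne_o _)
    | succ j => rw [ih (sc_inj h)]

theorem IsLevel.pr_mem {r x y : 𝔐.carrier} (hr : 𝔐.IsLevel r) (h : 𝔐.Sub (𝔐.pr x y) r) :
    𝔐.mem x r ∧ 𝔐.mem y r := by
  obtain ⟨e, he, hx, hy⟩ := (isPair_pr x y).exists_mem
  exact ⟨hr.mem_trans (h e he) hx, hr.mem_trans (h e he) hy⟩

theorem IsLevel.mem_of_subCode {r c c' : 𝔐.carrier} (hr : 𝔐.IsLevel r) (h : 𝔐.Sub c r)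
    (hc : 𝔐.SubCode c' c) : 𝔐.mem c' r := by
  obtain ⟨k, c₁, c₂, rfl, hc⟩ := hc
  have h2 := hr.pr_mem fun z hz => hr.mem_trans (hr.pr_mem h).2 hz
  rcases hc with rfl | rfl
  exacts [h2.1, h2.2]

/-- A class of codes which is not empty has an element `c` all whose constituents lie in a level which
does not meet the class. -/
theorem exists_least_code {X : Set 𝔐.carrier} (hX : X ∈ 𝔐.classes) (hne : X.Nonempty) :
    ∃ c ∈ X, ∃ r, 𝔐.IsLevel r ∧ 𝔐.Sub c r ∧ ∀ x ∈ X, ¬ 𝔐.mem x r := by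
  obtain ⟨l, hl, ⟨c, hc, hcl⟩, hmin⟩ := exists_firstLevel hX hne
  obtain ⟨r, hr, hrl, hcr⟩ := hl.mem_iff.1 hcl
  exact ⟨c, hc, r, hr, hcr, hmin r hrl hr⟩

/-- Induction on codes. -/
theorem code_induction (P : 𝔐.carrier → Prop)
    [hP : 𝔐.El fun (v : Fin 1 → 𝔐.carrier) (_ : Fin 0 → Set 𝔐.carrier) => P (v 0)]
    (h : ∀ c, (∀ c', 𝔐.SubCode c' c → P c') → P c) (c : 𝔐.carrier) : P c := by
  by_contra hc
  obtain ⟨c, hc, r, hr, hcr, hmin⟩ := exists_least_code (setOf_mem' fun c => ¬ P c) ⟨c, hc⟩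
  exact hc (h c fun c' hc' => by_contra fun h' => hmin c' h' (hr.mem_of_subCode hcr hc'))

theorem SatStep.congr {S E E' Z Z' : Set 𝔐.carrier} {c v : 𝔐.carrier}
    (hE : ∀ x ∈ S, ∀ y, 𝔐.Rel E y x ↔ 𝔐.Rel E' y x)
    (hZ : ∀ c', 𝔐.SubCode c' c → ∀ v, 𝔐.pr c' v ∈ Z ↔ 𝔐.pr c' v ∈ Z') :
    𝔐.SatStep S E Z c v ↔ 𝔐.SatStep S E' Z' c v := by
  refine exists_congr fun c₁ => exists_congr fun c₂ => ?_
  have h1 : ∀ k, c = 𝔐.pr k (𝔐.pr c₁ c₂) → ∀ v, 𝔐.pr c₁ v ∈ Z ↔ 𝔐.pr c₁ v ∈ Z' :=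
    fun k hk => hZ c₁ ⟨k, c₁, c₂, hk, Or.inl rfl⟩
  have h2 : ∀ k, c = 𝔐.pr k (𝔐.pr c₁ c₂) → ∀ v, 𝔐.pr c₂ v ∈ Z ↔ 𝔐.pr c₂ v ∈ Z' :=
    fun k hk => hZ c₂ ⟨k, c₁, c₂, hk, Or.inr rfl⟩
  refine or_congr Iff.rfl (or_congr ?_ (or_congr ?_ (or_congr ?_ ?_))) <;>
    refine and_congr_right fun e => ?_
  · refine exists_congr fun x => exists_congr fun y => exists_congr fun l => and_congr_right fun _ =>
      and_congr_right fun hx => hE x hx y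
  · rw [h1 _ e, h2 _ e]
  · simp only [h1 _ e]
  · simp only [h1 _ e]

theorem IsSat.unique {S E E' Z Z' : Set 𝔐.carrier} (hE : ∀ x ∈ S, ∀ y, 𝔐.Rel E y x ↔ 𝔐.Rel E' y x)
    (hZ : Z ∈ 𝔐.classes) (hZ' : Z' ∈ 𝔐.classes) (h : 𝔐.IsSat S E Z) (h' : 𝔐.IsSat S E' Z')
    (c v : 𝔐.carrier) : 𝔐.pr c v ∈ Z ↔ 𝔐.pr c v ∈ Z' := by
  have : Fact (Z ∈ 𝔐.classes) := ⟨hZ⟩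
  have : Fact (Z' ∈ 𝔐.classes) := ⟨hZ'⟩
  refine code_induction (fun c => ∀ v, 𝔐.pr c v ∈ Z ↔ 𝔐.pr c v ∈ Z') (fun c ih v => ?_) c v
  rw [h, h']
  exact SatStep.congr hE ih

theorem IsPartialSat.unique {S E Z Z' : Set 𝔐.carrier} {c : 𝔐.carrier} (hZ : Z ∈ 𝔐.classes)
    (hZ' : Z' ∈ 𝔐.classes) (h : 𝔐.IsPartialSat S E Z c) (h' : 𝔐.IsPartialSat S E Z' c)
    (v : 𝔐.carrier) : 𝔐.pr c v ∈ Z ↔ 𝔐.pr c v ∈ Z' := by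
  have : Fact (Z ∈ 𝔐.classes) := ⟨hZ⟩
  have : Fact (Z' ∈ 𝔐.classes) := ⟨hZ'⟩
  obtain ⟨d, hcd, hd, h⟩ := h
  obtain ⟨d', hcd', hd', h'⟩ := h'
  refine code_induction (fun c => 𝔐.mem c d → 𝔐.mem c d' → ∀ v, 𝔐.pr c v ∈ Z ↔ 𝔐.pr c v ∈ Z')
    (fun c ih hc hc' v => ?_) c hcd hcd' v
  rw [h c hc, h' c hc']
  exact SatStep.congr (fun _ _ _ => Iff.rfl) fun c₁ h₁ => ih c₁ h₁ (hd c hc c₁ h₁) (hd' c hc' c₁ h₁)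

/-- A collection of classes of `𝔐` closed under elementary comprehension and `Δ¹₁`-Comprehension, such
that existential quantification over the collection defines classes of `𝔐`. The instances needed are
all classes of a model of `Σ¹₁`-Comprehension and the classes that are elements of an admissible set:
towers are built in both. -/
structure IsDeltaClosed (𝔐 : ClassModel.{u}) (𝒞 : Set (Set 𝔐.carrier)) : Prop where
  subset : 𝒞 ⊆ 𝔐.classes
  elem : ∀ P : 𝔐.carrier → Prop,
    (Dfn False 𝔐.mem 𝒞 fun (v : Fin 1 → 𝔐.carrier) (_ : Fin 0 → Set 𝔐.carrier) => P (v 0)) →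
      {x | P x} ∈ 𝒞
  delta : ∀ P P' : 𝔐.carrier → Set 𝔐.carrier → Prop,
    (Dfn False 𝔐.mem 𝒞 fun (v : Fin 1 → 𝔐.carrier) (W : Fin 1 → Set 𝔐.carrier) => P (v 0) (W 0)) →
    (Dfn False 𝔐.mem 𝒞 fun (v : Fin 1 → 𝔐.carrier) (W : Fin 1 → Set 𝔐.carrier) => P' (v 0) (W 0)) →
      (∀ x, (∃ X ∈ 𝒞, P x X) ↔ ∀ X ∈ 𝒞, P' x X) → {x | ∃ X ∈ 𝒞, P x X} ∈ 𝒞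
  sigma : ∀ P : 𝔐.carrier → Set 𝔐.carrier → Prop,
    (Dfn False 𝔐.mem 𝒞 fun (v : Fin 1 → 𝔐.carrier) (W : Fin 1 → Set 𝔐.carrier) => P (v 0) (W 0)) →
      {x | ∃ X ∈ 𝒞, P x X} ∈ 𝔐.classes

theorem IsDeltaClosed.of_sigma11 (h : 𝔐.Sigma11Comprehension) : 𝔐.IsDeltaClosed 𝔐.classes := by
  have key : ∀ P : 𝔐.carrier → Set 𝔐.carrier → Prop,
      (𝔐.El fun (v : Fin 1 → 𝔐.carrier) (W : Fin 1 → Set 𝔐.carrier) => P (v 0) (W 0)) →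
      {x | ∃ X ∈ 𝔐.classes, P x X} ∈ 𝔐.classes := fun P hP => by
    have := sigma_setOf_mem h (k := 1) (fun x W => P x (W 0))
    convert this using 1
    ext x
    exact ⟨fun ⟨X, hX, hP⟩ => ⟨fun _ => X, fun _ => hX, hP⟩, fun ⟨X, hX, hP⟩ => ⟨X 0, hX 0, hP⟩⟩
  exact ⟨subset_rfl, fun P hP => setOf_mem' P, fun P _ hP _ _ => key P hP, key⟩

section SatExists

variable {𝒞 : Set (Set 𝔐.carrier)} (h𝒞 : 𝔐.IsDeltaClosed 𝒞) {S E : Set 𝔐.carrier}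
  (hS : S ∈ 𝒞) (hE : E ∈ 𝒞)

include h𝒞 hS hE

/-- The partial satisfaction classes for the codes in `G` fit together: they agree where they are defined,
so that truth for codes in `G` is `Δ¹₁`. -/
theorem exists_sat_of_partial {G : Set 𝔐.carrier} (hG : G ∈ 𝒞)
    (hsub : ∀ c ∈ G, ∀ c', 𝔐.SubCode c' c → c' ∈ G)
    (hex : ∀ c ∈ G, ∃ Z ∈ 𝒞, 𝔐.IsPartialSat S E Z c) :
    ∃ Z ∈ 𝒞, ∀ c ∈ G, ∀ v, 𝔐.pr c v ∈ Z ↔ 𝔐.SatStep S E Z c v := by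
  have : Fact (G ∈ 𝒞) := ⟨hG⟩
  have : Fact (S ∈ 𝒞) := ⟨hS⟩
  have : Fact (E ∈ 𝒞) := ⟨hE⟩
  have hZ := h𝒞.delta (fun w Z => ∃ c v, w = 𝔐.pr c v ∧ c ∈ G ∧ 𝔐.IsPartialSat S E Z c ∧ w ∈ Z)
    (fun w Z => ∃ c v, w = 𝔐.pr c v ∧ c ∈ G ∧ (𝔐.IsPartialSat S E Z c → w ∈ Z))
    inferInstance inferInstance fun w => by
      constructor
      · rintro ⟨Z, hZ, c, v, rfl, hc, hp, hw⟩ Z' hZ'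
        exact ⟨c, v, rfl, hc, fun hp' => (hp.unique (h𝒞.subset hZ) (h𝒞.subset hZ') hp' v).1 hw⟩
      · intro h
        obtain ⟨c, v, rfl, hc, -⟩ := h G hG
        obtain ⟨Z, hZ, hp⟩ := hex c hc
        obtain ⟨c', v', e, -, h'⟩ := h Z hZ
        obtain ⟨rfl, rfl⟩ := pr_inj.1 e
        exact ⟨Z, hZ, c, v, rfl, hc, hp, h' hp⟩
  have hmem : ∀ c ∈ G, ∀ Z ∈ 𝒞, 𝔐.IsPartialSat S E Z c → ∀ v,
      (𝔐.pr c v ∈ {w | ∃ Z ∈ 𝒞, ∃ c v, w = 𝔐.pr c v ∧ c ∈ G ∧ 𝔐.IsPartialSat S E Z c ∧ w ∈ Z} ↔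
        𝔐.pr c v ∈ Z) := fun c hc Z hZ hp v => by
    constructor
    · rintro ⟨Z', hZ', c', v', e, -, hp', hw⟩
      obtain ⟨rfl, rfl⟩ := pr_inj.1 e
      exact (hp'.unique (h𝒞.subset hZ') (h𝒞.subset hZ) hp v).1 hw
    · intro hw
      exact ⟨Z, hZ, c, v, rfl, hc, hp, hw⟩
  refine ⟨_, hZ, fun c hc v => ?_⟩
  obtain ⟨Z, hZ', hp⟩ := hex c hc
  rw [hmem c hc Z hZ' hp]
  have ⟨d, hcd, hd, h⟩ := hp
  rw [h c hcd]
  exact SatStep.congr (fun _ _ _ => Iff.rfl) fun c' hc' v =>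
    (hmem c' (hsub c hc c' hc') Z hZ' ⟨d, hd c hcd c' hc', hd, h⟩ v).symm

/-- By induction on codes: a satisfaction class for the codes in a level is prolonged to one more code by
one step of the definition of truth. -/
theorem exists_partialSat (c : 𝔐.carrier) : ∃ Z ∈ 𝒞, 𝔐.IsPartialSat S E Z c := by
  have : Fact (S ∈ 𝒞) := ⟨hS⟩
  have : Fact (E ∈ 𝒞) := ⟨hE⟩
  by_contra hc
  have hX : {c | ∃ Z ∈ 𝒞, 𝔐.IsPartialSat S E Z c} ∈ 𝔐.classes :=
    h𝒞.sigma (fun c Z => 𝔐.IsPartialSat S E Z c) inferInstance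
  have : Fact ({c | ∃ Z ∈ 𝒞, 𝔐.IsPartialSat S E Z c} ∈ 𝔐.classes) := ⟨hX⟩
  obtain ⟨c, hc, r, hr, hcr, hmin⟩ := exists_least_code
    (setOf_mem' fun c => ¬ c ∈ {c | ∃ Z ∈ 𝒞, 𝔐.IsPartialSat S E Z c}) ⟨c, hc⟩
  obtain ⟨Z, hZ, hsat⟩ := exists_sat_of_partial h𝒞 hS hE (G := {x | 𝔐.mem x r})
    (h𝒞.elem _ inferInstance) (fun c hc c' hc' =>
      hr.mem_of_subCode (fun z hz => hr.mem_trans hc hz) hc')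
    (fun c hc => by_contra fun h' => hmin c h' hc)
  have hcr' : ¬ 𝔐.mem c r := hmin c hc
  obtain ⟨d, hd⟩ := exists_insert r c
  have : Fact (Z ∈ 𝒞) := ⟨hZ⟩
  have hne : ∀ c', 𝔐.mem c' r → c' ≠ c := by rintro _ h rfl; exact hcr' h
  have hZ' : ∀ c', 𝔐.mem c' r → ∀ v, 𝔐.pr c' v ∈ {w | ∃ c' v, w = 𝔐.pr c' v ∧
      ((𝔐.mem c' r ∧ w ∈ Z) ∨ (c' = c ∧ 𝔐.SatStep S E Z c v))} ↔ 𝔐.pr c' v ∈ Z := fun c' hc' v => by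
    constructor
    · rintro ⟨c'', v', e, h | h⟩
      · exact h.2
      · obtain ⟨rfl, rfl⟩ := pr_inj.1 e
        exact absurd h.1 (hne _ hc')
    · intro h
      exact ⟨c', v, rfl, Or.inl ⟨hc', h⟩⟩
  refine hc ⟨{w | ∃ c' v, w = 𝔐.pr c' v ∧
      ((𝔐.mem c' r ∧ w ∈ Z) ∨ (c' = c ∧ 𝔐.SatStep S E Z c v))}, h𝒞.elem _ inferInstance, d,
      (hd c).2 (Or.inr rfl), fun c' hc' c'' hc'' => (hd _).2 (Or.inl ?_), fun c' hc' v => ?_⟩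
  · rcases (hd _).1 hc' with h | rfl
    · exact hr.mem_of_subCode (fun z hz => hr.mem_trans h hz) hc''
    · exact hr.mem_of_subCode hcr hc''
  · rcases (hd _).1 hc' with h | rfl
    · rw [hZ' c' h, hsat c' h]
      exact SatStep.congr (fun _ _ _ => Iff.rfl) fun c'' hc'' v =>
        (hZ' c'' (hr.mem_of_subCode (fun z hz => hr.mem_trans h hz) hc'') v).symm
    · have : 𝔐.SatStep S E Z c' v ↔ _ := SatStep.congr (fun _ _ _ => Iff.rfl) fun c'' hc'' v =>
        (hZ' c'' (hr.mem_of_subCode hcr hc'') v).symm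
      rw [← this]
      constructor
      · rintro ⟨c'', v', e, h | h⟩
        · obtain ⟨rfl, rfl⟩ := pr_inj.1 e
          exact absurd h.1 hcr'
        · obtain ⟨-, rfl⟩ := pr_inj.1 e
          exact h.2
      · intro h
        exact ⟨c', v, rfl, Or.inr ⟨rfl, h⟩⟩

theorem exists_isSat : ∃ Z ∈ 𝒞, 𝔐.IsSat S E Z := by
  obtain ⟨Z, hZ, h⟩ := exists_sat_of_partial h𝒞 hS hE (G := {x | x = x}) (h𝒞.elem _ inferInstance)
    (fun _ _ _ _ => rfl) fun c _ => exists_partialSat h𝒞 hS hE c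
  exact ⟨Z, hZ, fun c => h c rfl⟩

end SatExists

/-! ### Codes of formulas -/

/-- Satisfaction of formulas without class variables, the quantifiers being restricted to `S`. -/
def RealizeIn {A : Type u} (S : Set A) (e : A → A → Prop) :
    {n m : ℕ} → SetFormula n m → (Fin n → A) → Prop
  | _, _, .eq i j, v => v i = v j
  | _, _, .mem i j, v => e (v i) (v j)
  | _, _, .memClass _ _, _ => False
  | _, _, .neg φ, v => ¬ RealizeIn S e φ v
  | _, _, .and φ ψ, v => RealizeIn S e φ v ∧ RealizeIn S e ψ v
  | _, _, .all φ, v => ∀ a, a ∈ S → RealizeIn S e φ (Fin.cons a v)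

theorem realize_subtype {A : Type u} {S : Set A} {e : A → A → Prop} {n m : ℕ} (φ : SetFormula n m) :
    ∀ (v : Fin n → {a // a ∈ S}) (W : Fin m → Set {a // a ∈ S}), (∀ j, W j = ∅) →
      (φ.Realize (fun a b => e a.1 b.1) v W ↔ RealizeIn S e φ fun i => (v i).1) := by
  induction φ with
  | eq i j => intro v W _; exact Subtype.ext_iff
  | mem i j => intro v W _; exact Iff.rfl
  | memClass i J => intro v W h; simp [Realize, RealizeIn, h]
  | neg φ ih => intro v W h; exact not_congr (ih v W h)
  | and φ ψ ih ih' => intro v W h; exact and_congr (ih v W h) (ih' v W h)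
  | all φ ih =>
    intro v W h
    simp only [Realize, RealizeIn, ih _ W h, Subtype.forall]
    refine forall_congr' fun a => forall_congr' fun ha => ?_
    apply iff_of_eq; congr 1
    funext i
    refine Fin.cases ?_ (fun i => ?_) i <;> simp

/-- `RealizeIn` is elementary. -/
theorem El.realizeIn {𝒞 : Set (Set 𝔐.carrier)} {S E : Set 𝔐.carrier} (hS : S ∈ 𝒞) (hE : E ∈ 𝒞)
    {n m : ℕ} (φ : SetFormula n m) : ∀ {n' m' : ℕ} (t : Fin n → (Fin n' → 𝔐.carrier) → 𝔐.carrier)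
    (_ : ∀ i, Tm False 𝔐.mem 𝒞 (t i)), Dfn False 𝔐.mem 𝒞
      fun v (_ : Fin m' → Set 𝔐.carrier) => RealizeIn S (𝔐.Rel E) φ fun i => t i v := by
  have : Fact (S ∈ 𝒞) := ⟨hS⟩
  have : Fact (E ∈ 𝒞) := ⟨hE⟩
  induction φ with
  | eq i j => intro _ _ t ht; exact Dfn.eq (t i) (t j)
  | mem i j =>
    intro _ _ t ht
    have := ht i
    have := ht j
    exact (inferInstance : Dfn False 𝔐.mem 𝒞 fun v _ => 𝔐.Rel E (t i v) (t j v))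
  | memClass i J =>
    intro _ _ t ht
    exact (inferInstance : Dfn False 𝔐.mem 𝒞 fun v _ => ¬ 𝔐.o = 𝔐.o).congr
      fun v W => by simp [RealizeIn]
  | neg φ ih => intro _ _ t ht; exact @Dfn.not _ _ _ _ _ _ _ (ih t ht)
  | and φ ψ ih ih' => intro _ _ t ht; exact @Dfn.and _ _ _ _ _ _ _ _ (ih t ht) (ih' t ht)
  | all φ ih =>
    intro n' m' t ht
    refine @Dfn.all _ _ _ _ _ (fun x v _ => x ∈ S → RealizeIn S (𝔐.Rel E) φ (Fin.cons x fun i => t i v))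
      (@Dfn.imp _ _ _ _ _ _ _ _ inferInstance ?_)
    refine (ih (Fin.cons (fun w => w 0) fun i w => t i fun i => w i.succ) (fun i => ?_)).congr
      fun v W => ?_
    · refine Fin.cases ?_ (fun i => ?_) i
      · exact Tm.var 0
      · exact (ht i).rename _
    · apply iff_of_eq; congr 1
      funext i
      refine Fin.cases ?_ (fun i => ?_) i <;> simp

/-- Bounded formulas are absolute between `S` and transitive subclasses of `S`. -/
theorem realizeIn_delta0 {A : Type u} {S S' : Set A} {e : A → A → Prop} (hS : S' ⊆ S)
    (htr : ∀ a ∈ S', ∀ b, e b a → b ∈ S') {n m : ℕ} {φ : SetFormula n m} (hφ : φ.IsDelta0) :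
    ∀ v : Fin n → A, (∀ i, v i ∈ S') → (RealizeIn S' e φ v ↔ RealizeIn S e φ v) := by
  induction hφ with
  | eq i j => intro v _; exact Iff.rfl
  | mem i j => intro v _; exact Iff.rfl
  | memClass i J => intro v _; exact Iff.rfl
  | neg _ ih => intro v hv; exact not_congr (ih v hv)
  | and _ _ ih ih' => intro v hv; exact and_congr (ih v hv) (ih' v hv)
  | ball i _ ih =>
    intro v hv
    have h1 : ∀ a ∈ S', ∀ j, (Fin.cons a v : Fin _ → A) j ∈ S' := fun a ha j => by
      refine Fin.cases ?_ (fun j => ?_) j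
      · exact ha
      · exact hv j
    simp only [ball, RealizeIn, Fin.cons_zero, Fin.cons_succ, not_and, not_not]
    constructor
    · intro h a _ hav
      have ha := htr _ (hv i) _ hav
      exact (ih _ (h1 a ha)).1 (h a ha hav)
    · intro h a ha hav
      exact (ih _ (h1 a ha)).2 (h a (hS ha) hav)

/-- The code of the negation of the conjunction. -/
noncomputable def nandC (𝔐 : ClassModel.{u}) [hM : Nbg 𝔐] (c₁ c₂ : 𝔐.carrier) : 𝔐.carrier :=
  𝔐.pr (𝔐.num 2) (𝔐.pr c₁ c₂)

/-- The code of the universal quantification over the first entry of a list. -/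
noncomputable def allC (𝔐 : ClassModel.{u}) [hM : Nbg 𝔐] (c : 𝔐.carrier) : 𝔐.carrier :=
  𝔐.pr (𝔐.num 3) (𝔐.pr c 𝔐.o)

/-- The code saying that `c` holds at the list without its second entry. -/
noncomputable def skipC (𝔐 : ClassModel.{u}) [hM : Nbg 𝔐] (c : 𝔐.carrier) : 𝔐.carrier :=
  𝔐.pr (𝔐.num 4) (𝔐.pr c 𝔐.o)

/-- The code of the negation. -/
noncomputable def negC (𝔐 : ClassModel.{u}) [hM : Nbg 𝔐] (c : 𝔐.carrier) : 𝔐.carrier := 𝔐.nandC c c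

/-- The code of the conjunction. -/
noncomputable def andC (𝔐 : ClassModel.{u}) [hM : Nbg 𝔐] (c c' : 𝔐.carrier) : 𝔐.carrier :=
  𝔐.negC (𝔐.nandC c c')

/-- The code of the existential quantification over the first entry of a list. -/
noncomputable def exC (𝔐 : ClassModel.{u}) [hM : Nbg 𝔐] (c : 𝔐.carrier) : 𝔐.carrier :=
  𝔐.negC (𝔐.allC (𝔐.negC c))

/-- The code saying that the first entry of a list equals the entry number `i + 1`. -/
noncomputable def eqC (𝔐 : ClassModel.{u}) [hM : Nbg 𝔐] : ℕ → 𝔐.carrier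
  | 0 => 𝔐.pr (𝔐.num 0) (𝔐.pr 𝔐.o 𝔐.o)
  | i + 1 => 𝔐.skipC (𝔐.eqC i)

/-- The code saying that the second entry of a list is an element of the first entry. -/
noncomputable def memC (𝔐 : ClassModel.{u}) [hM : Nbg 𝔐] : 𝔐.carrier :=
  𝔐.pr (𝔐.num 1) (𝔐.pr 𝔐.o 𝔐.o)

/-- The code of a formula. Atomic formulas are rephrased so that their variables are the last ones to
be quantified. -/
noncomputable def code (𝔐 : ClassModel.{u}) [hM : Nbg 𝔐] : {n m : ℕ} → SetFormula n m → 𝔐.carrier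
  | _, _, .eq i j => 𝔐.exC (𝔐.andC (𝔐.eqC i) (𝔐.eqC j))
  | _, _, .mem i j => 𝔐.exC (𝔐.andC (𝔐.eqC i) (𝔐.exC (𝔐.andC (𝔐.eqC (j + 1)) 𝔐.memC)))
  | _, _, .memClass _ _ => 𝔐.o
  | _, _, .neg φ => 𝔐.negC (𝔐.code φ)
  | _, _, .and φ ψ => 𝔐.andC (𝔐.code φ) (𝔐.code ψ)
  | _, _, .all φ => 𝔐.allC (𝔐.code φ)

/-- The list with entries `v 0, …, v (n - 1)`. -/
noncomputable def list (𝔐 : ClassModel.{u}) [hM : Nbg 𝔐] : {n : ℕ} → (Fin n → 𝔐.carrier) → 𝔐.carrier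
  | 0, _ => 𝔐.o
  | _ + 1, v => 𝔐.pr (v 0) (𝔐.list fun i => v i.succ)

theorem list_cons {n : ℕ} (a : 𝔐.carrier) (v : Fin n → 𝔐.carrier) :
    𝔐.list (Fin.cons a v : Fin (n + 1) → 𝔐.carrier) = 𝔐.pr a (𝔐.list v) := by
  simp [list]

namespace IsSat

variable {S E Z : Set 𝔐.carrier} (h : 𝔐.IsSat S E Z)

include h

theorem nandC_iff {c₁ c₂ v : 𝔐.carrier} :
    𝔐.pr (𝔐.nandC c₁ c₂) v ∈ Z ↔ ¬ (𝔐.pr c₁ v ∈ Z ∧ 𝔐.pr c₂ v ∈ Z) := by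
  rw [h]
  simp only [SatStep, nandC, pr_inj, num_inj]
  constructor
  · rintro ⟨c₁', c₂', h⟩
    simp at h
    obtain ⟨⟨rfl, rfl⟩, h⟩ := h
    exact fun h' => h h'.1 h'.2
  · intro h
    exact ⟨c₁, c₂, by simpa using h⟩

theorem allC_iff {c v : 𝔐.carrier} :
    𝔐.pr (𝔐.allC c) v ∈ Z ↔ ∀ x, x ∈ S → 𝔐.pr c (𝔐.pr x v) ∈ Z := by
  rw [h]
  simp only [SatStep, allC, pr_inj, num_inj]
  constructor
  · rintro ⟨c₁', c₂', h⟩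
    simp at h
    obtain ⟨⟨rfl, rfl⟩, h⟩ := h
    exact h
  · intro h
    exact ⟨c, 𝔐.o, by simpa using h⟩

theorem skipC_iff {c x y l : 𝔐.carrier} :
    𝔐.pr (𝔐.skipC c) (𝔐.pr x (𝔐.pr y l)) ∈ Z ↔ 𝔐.pr c (𝔐.pr x l) ∈ Z := by
  rw [h]
  simp only [SatStep, skipC, pr_inj, num_inj]
  constructor
  · rintro ⟨c₁', c₂', h⟩
    simp at h
    obtain ⟨⟨rfl, rfl⟩, h⟩ := h
    exact h
  · intro h
    exact ⟨c, 𝔐.o, Or.inr (Or.inr (Or.inr (Or.inr ⟨by simp, x, y, l, by simp, h⟩)))⟩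

theorem negC_iff {c v : 𝔐.carrier} : 𝔐.pr (𝔐.negC c) v ∈ Z ↔ ¬ 𝔐.pr c v ∈ Z := by
  rw [negC, h.nandC_iff, and_self_iff]

theorem andC_iff {c c' v : 𝔐.carrier} :
    𝔐.pr (𝔐.andC c c') v ∈ Z ↔ 𝔐.pr c v ∈ Z ∧ 𝔐.pr c' v ∈ Z := by
  rw [andC, h.negC_iff, h.nandC_iff, not_not]

theorem exC_iff {c v : 𝔐.carrier} :
    𝔐.pr (𝔐.exC c) v ∈ Z ↔ ∃ x, x ∈ S ∧ 𝔐.pr c (𝔐.pr x v) ∈ Z := by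
  rw [exC, h.negC_iff, h.allC_iff]
  simp only [h.negC_iff, not_forall, not_not, exists_prop]

theorem eqC_zero_iff {x y l : 𝔐.carrier} :
    𝔐.pr (𝔐.eqC 0) (𝔐.pr x (𝔐.pr y l)) ∈ Z ↔ x = y := by
  rw [h]
  simp only [SatStep, eqC, pr_inj, num_inj]
  constructor
  · rintro ⟨c₁', c₂', h⟩
    simp at h
    obtain ⟨-, x', rfl, rfl, -⟩ := h
    rfl
  · rintro rfl
    exact ⟨𝔐.o, 𝔐.o, Or.inl ⟨by simp, x, l, by simp⟩⟩

theorem memC_iff {x y l : 𝔐.carrier} :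
    𝔐.pr 𝔐.memC (𝔐.pr x (𝔐.pr y l)) ∈ Z ↔ x ∈ S ∧ 𝔐.Rel E y x := by
  rw [h]
  simp only [SatStep, memC, pr_inj, num_inj]
  constructor
  · rintro ⟨c₁', c₂', h⟩
    simp at h
    exact h.2
  · intro h
    exact ⟨𝔐.o, 𝔐.o, Or.inr (Or.inl ⟨by simp, x, y, l, by simp, h⟩)⟩

theorem eqC_iff {x : 𝔐.carrier} {n : ℕ} (v : Fin n → 𝔐.carrier) (i : Fin n) :
    𝔐.pr (𝔐.eqC i) (𝔐.pr x (𝔐.list v)) ∈ Z ↔ x = v i := by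
  induction n with
  | zero => exact i.elim0
  | succ n ih =>
    refine Fin.cases ?_ (fun i => ?_) i
    · exact h.eqC_zero_iff
    · rw [list, Fin.val_succ, eqC, h.skipC_iff]
      exact ih _ i

/-- A satisfaction class decides standard formulas correctly. -/
theorem code_iff {n m : ℕ} (φ : SetFormula n m) : ∀ v : Fin n → 𝔐.carrier, (∀ i, v i ∈ S) →
    (𝔐.pr (𝔐.code φ) (𝔐.list v) ∈ Z ↔ RealizeIn S (𝔐.Rel E) φ v) := by
  induction φ with
  | eq i j =>
    intro v hv
    simp only [code, h.exC_iff, h.andC_iff, h.eqC_iff, RealizeIn]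
    constructor
    · rintro ⟨x, -, rfl, h⟩; exact h
    · intro h; exact ⟨v i, hv i, rfl, h⟩
  | mem i j =>
    intro v hv
    have key : ∀ x y, 𝔐.pr (𝔐.eqC (j + 1)) (𝔐.pr y (𝔐.pr x (𝔐.list v))) ∈ Z ↔ y = v j :=
      fun x y => by rw [eqC, h.skipC_iff, h.eqC_iff]
    simp only [code, h.exC_iff, h.andC_iff, h.eqC_iff, key, h.memC_iff, RealizeIn]
    constructor
    · rintro ⟨x, -, rfl, y, -, rfl, -, h⟩; exact h
    · intro h; exact ⟨v i, hv i, rfl, v j, hv j, rfl, hv j, h⟩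
  | memClass i J =>
    intro v hv
    rw [h]
    simp only [code, RealizeIn, iff_false]
    rintro ⟨c₁, c₂, h⟩
    rcases h with h | h | h | h | h <;> exact pr_ne_o _ _ h.1.symm
  | neg φ ih => intro v hv; simp only [code, h.negC_iff, ih v hv, RealizeIn]
  | and φ ψ ih ih' => intro v hv; simp only [code, h.andC_iff, ih v hv, ih' v hv, RealizeIn]
  | all φ ih =>
    intro v hv
    simp only [code, h.allC_iff, RealizeIn]
    refine forall_congr' fun x => forall_congr' fun hx => ?_
    rw [← list_cons, ih]
    intro i
    refine Fin.cases ?_ (fun i => ?_) i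
    · exact hx
    · exact hv i

end IsSat

end ClassModel

end ClassTheory

namespace ClassTheory
open SetFormula
namespace ClassModel

variable {𝔐 : ClassModel.{u}} [hM : Nbg 𝔐]

/-! ### Towers -/

/-- The name of the set `x` in all towers. -/
noncomputable def iota (𝔐 : ClassModel.{u}) [hM : Nbg 𝔐] (x : 𝔐.carrier) : 𝔐.carrier := 𝔐.pr 𝔐.o x

/-- The class of names of the tower coded by `X`. -/
noncomputable def tN (𝔐 : ClassModel.{u}) [hM : Nbg 𝔐] (X : Set 𝔐.carrier) : Set 𝔐.carrier :=
  𝔐.sec X (𝔐.num 0)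

/-- The membership relation between the names of the tower coded by `X`. -/
def In (𝔐 : ClassModel.{u}) [hM : Nbg 𝔐] (X : Set 𝔐.carrier) (x y : 𝔐.carrier) : Prop :=
  𝔐.Rel (𝔐.sec X (𝔐.num 1)) x y

/-- The class of names of levels of the tower coded by `X`. -/
noncomputable def tL (𝔐 : ClassModel.{u}) [hM : Nbg 𝔐] (X : Set 𝔐.carrier) : Set 𝔐.carrier :=
  𝔐.sec X (𝔐.num 2)

/-- The satisfaction class of the level `B` of the tower coded by `X`. -/
noncomputable def tY (𝔐 : ClassModel.{u}) [hM : Nbg 𝔐] (X : Set 𝔐.carrier) (B : 𝔐.carrier) :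
    Set 𝔐.carrier := 𝔐.sec (𝔐.sec X (𝔐.num 3)) B

/-- The elements of `B` in the tower coded by `X`. -/
def extn (𝔐 : ClassModel.{u}) [hM : Nbg 𝔐] (X : Set 𝔐.carrier) (B : 𝔐.carrier) : Set 𝔐.carrier :=
  {z | 𝔐.In X z B}

/-- The level `D`, which contains `b`, satisfies the formula with code `c` at `D`, `x` and `p`. -/
def Hit (𝔐 : ClassModel.{u}) [hM : Nbg 𝔐] (X : Set 𝔐.carrier) (c p b x D : 𝔐.carrier) : Prop :=
  D ∈ 𝔐.tL X ∧ 𝔐.In X b D ∧ 𝔐.pr c (𝔐.pr D (𝔐.pr x p)) ∈ 𝔐.tY X D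

/-- `t` is a tag of the stage `S`: a failure of collection which arises exactly at this stage. For
each element `x` of `a` some level in `S` satisfies a given condition, but no level in `S` bounds such
levels. The condition is given by a code `c` and a list `p` of parameters; the set `b` serves to bound
the parameters. A tag belongs to one stage only, whence it can be used to name the sets which are new at
this stage. -/
def TagAt (𝔐 : ClassModel.{u}) [hM : Nbg 𝔐] (S X : Set 𝔐.carrier) (t : 𝔐.carrier) : Prop :=
  ∃ c p a b, t = 𝔐.pr c (𝔐.pr p (𝔐.pr a b)) ∧ a ∈ S ∧ b ∈ S ∧
    (∀ x, 𝔐.In X x a → ∃ D, D ∈ S ∧ 𝔐.Hit X c p b x D) ∧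
    ¬ ∃ B, B ∈ S ∧ B ∈ 𝔐.tL X ∧ ∀ x, 𝔐.In X x a → ∃ D, 𝔐.In X D B ∧ 𝔐.Hit X c p b x D

/-- The raw names for the extension of `x` at the stage `S` with satisfaction class `Z`: they consist
of a tag, the code of a formula and a list of parameters. -/
def RawFor (𝔐 : ClassModel.{u}) [hM : Nbg 𝔐] (S X Z : Set 𝔐.carrier) (x : 𝔐.carrier) :
    Set 𝔐.carrier :=
  {r | ∃ t c p, r = 𝔐.pr t (𝔐.pr c p) ∧ 𝔐.TagAt S X t ∧
    ∀ z, 𝔐.In X z x ↔ z ∈ S ∧ 𝔐.pr c (𝔐.pr z p) ∈ Z}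

/-- `x` is a new name at the stage `S`: it is given by the set of raw names of least rank of its
extension, and no element of `S` has the same extension. The pair `⟨s, s⟩` differs from all names
`iota y = ⟨∅, y⟩`, as `s` is not empty. -/
def NewAt (𝔐 : ClassModel.{u}) [hM : Nbg 𝔐] (S X Z : Set 𝔐.carrier) (x : 𝔐.carrier) : Prop :=
  (∃ s, x = 𝔐.pr s s ∧ 𝔐.IsScott (𝔐.RawFor S X Z x) s) ∧
    ¬ ∃ y, y ∈ S ∧ ∀ z, 𝔐.In X z y ↔ 𝔐.In X z x

section Definability

variable {n m : ℕ} {𝒞 : Set (Set 𝔐.carrier)}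
  (s t : (Fin n → 𝔐.carrier) → 𝔐.carrier)
  (F G H : (Fin n → 𝔐.carrier) → (Fin m → Set 𝔐.carrier) → Set 𝔐.carrier)
  [Tm False 𝔐.mem 𝒞 s] [Tm False 𝔐.mem 𝒞 t] [CT False 𝔐.mem 𝒞 F] [CT False 𝔐.mem 𝒞 G]
  [CT False 𝔐.mem 𝒞 H]

instance : Tm False 𝔐.mem 𝒞 fun v => 𝔐.iota (s v) := by unfold iota; infer_instance

instance : CT False 𝔐.mem 𝒞 fun v W => 𝔐.tN (F v W) := by unfold tN; infer_instance

instance : CT False 𝔐.mem 𝒞 fun v W => 𝔐.tL (F v W) := by unfold tL; infer_instance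

instance : CT False 𝔐.mem 𝒞 fun v W => 𝔐.tY (F v W) (s v) := by unfold tY; infer_instance

instance : Dfn False 𝔐.mem 𝒞 fun v W => 𝔐.In (F v W) (s v) (t v) := by unfold In; infer_instance

instance : CT False 𝔐.mem 𝒞 fun v W => 𝔐.extn (F v W) (s v) := by
  have : CT False 𝔐.mem 𝒞 fun (v : Fin 1 → 𝔐.carrier) (W : Fin 1 → Set 𝔐.carrier) =>
      𝔐.extn (W 0) (v 0) := by unfold extn; infer_instance
  exact this.comp ![s] ![F] inferInstance inferInstance

instance : Dfn False 𝔐.mem 𝒞 fun v W => 𝔐.TagAt (F v W) (G v W) (s v) := by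
  have : Dfn False 𝔐.mem 𝒞 fun (v : Fin 1 → 𝔐.carrier) (W : Fin 2 → Set 𝔐.carrier) =>
      𝔐.TagAt (W 0) (W 1) (v 0) := by unfold TagAt Hit; infer_instance
  exact this.app ![s] ![F, G]

instance : CT False 𝔐.mem 𝒞 fun v W => 𝔐.RawFor (F v W) (G v W) (H v W) (s v) := by
  have : CT False 𝔐.mem 𝒞 fun (v : Fin 1 → 𝔐.carrier) (W : Fin 3 → Set 𝔐.carrier) =>
      𝔐.RawFor (W 0) (W 1) (W 2) (v 0) := by unfold RawFor; infer_instance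
  exact this.comp ![s] ![F, G, H] inferInstance inferInstance

instance : Dfn False 𝔐.mem 𝒞 fun v W => 𝔐.NewAt (F v W) (G v W) (H v W) (s v) := by
  have : Dfn False 𝔐.mem 𝒞 fun (v : Fin 1 → 𝔐.carrier) (W : Fin 3 → Set 𝔐.carrier) =>
      𝔐.NewAt (W 0) (W 1) (W 2) (v 0) := by unfold NewAt; infer_instance
  exact this.app ![s] ![F, G, H]

end Definability

/-- `x` is a new name at the stage given by the level `B`. -/
def NewAtLevel (𝔐 : ClassModel.{u}) [hM : Nbg 𝔐] (X : Set 𝔐.carrier) (B x : 𝔐.carrier) : Prop :=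
  𝔐.NewAt (𝔐.extn X B) X (𝔐.tY X B) x

instance {n m : ℕ} {𝒞 : Set (Set 𝔐.carrier)} (s t : (Fin n → 𝔐.carrier) → 𝔐.carrier)
    (F : (Fin n → 𝔐.carrier) → (Fin m → Set 𝔐.carrier) → Set 𝔐.carrier)
    [Tm False 𝔐.mem 𝒞 s] [Tm False 𝔐.mem 𝒞 t] [CT False 𝔐.mem 𝒞 F] :
    Dfn False 𝔐.mem 𝒞 fun v W => 𝔐.NewAtLevel (F v W) (s v) (t v) := by
  unfold NewAtLevel; infer_instance

/-- `X` codes a tower: an initial segment of the constructible hierarchy over `V`. Its first stage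
consists of the names `iota x`, and the union of all earlier stages is followed by its definable
subsets. Each stage except possibly the last one is itself a set of the tower, called a level, and
comes with a satisfaction class. By `closed`, all definable subclasses of a level are sets of the tower;
by `source`, there are no other sets; by `up`, what is new at a level belongs to all later levels.
A new level requires a tag, so that a tower stops at the first stage without a tag. -/
structure IsTower (𝔐 : ClassModel.{u}) [hM : Nbg 𝔐] (X : Set 𝔐.carrier) : Prop where
  in_left : ∀ x y, 𝔐.In X x y → x ∈ 𝔐.tN X
  in_right : ∀ x y, 𝔐.In X x y → y ∈ 𝔐.tN X
  level_name : ∀ B, B ∈ 𝔐.tL X → B ∈ 𝔐.tN X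
  base : ∀ x, 𝔐.iota x ∈ 𝔐.tN X
  base_in : ∀ x z, 𝔐.In X z (𝔐.iota x) ↔ ∃ y, 𝔐.mem y x ∧ z = 𝔐.iota y
  wf : 𝔐.SetWF (𝔐.tN X) (𝔐.sec X (𝔐.num 1))
  ext : ∀ x, x ∈ 𝔐.tN X → ∀ y, y ∈ 𝔐.tN X → (∀ z, 𝔐.In X z x ↔ 𝔐.In X z y) → x = y
  level_base : ∀ B, B ∈ 𝔐.tL X → ∀ x, 𝔐.In X (𝔐.iota x) B
  level_trans : ∀ B, B ∈ 𝔐.tL X → ∀ z w, 𝔐.In X z B → 𝔐.In X w z → 𝔐.In X w B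
  level_sat : ∀ B, B ∈ 𝔐.tL X → 𝔐.IsSat (𝔐.extn X B) (𝔐.sec X (𝔐.num 1)) (𝔐.tY X B)
  level_new : ∀ B, B ∈ 𝔐.tL X → 𝔐.NewAtLevel X B B
  closed : ∀ B, B ∈ 𝔐.tL X → ∀ c p, ∃ x, x ∈ 𝔐.tN X ∧ (𝔐.In X x B ∨ 𝔐.NewAtLevel X B x) ∧
    ∀ z, 𝔐.In X z x ↔ 𝔐.In X z B ∧ 𝔐.pr c (𝔐.pr z p) ∈ 𝔐.tY X B
  source : ∀ x, x ∈ 𝔐.tN X → (∃ y, x = 𝔐.iota y) ∨ ∃ B, B ∈ 𝔐.tL X ∧ 𝔐.NewAtLevel X B x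
  linear : ∀ B, B ∈ 𝔐.tL X → ∀ C, C ∈ 𝔐.tL X → 𝔐.In X B C ∨ B = C ∨ 𝔐.In X C B
  up : ∀ B, B ∈ 𝔐.tL X → ∀ C, C ∈ 𝔐.tL X → 𝔐.In X B C → ∀ x, x ∈ 𝔐.tN X → 𝔐.NewAtLevel X B x →
    𝔐.In X x C
  sat_level : ∀ B c w, 𝔐.pr c w ∈ 𝔐.tY X B → B ∈ 𝔐.tL X

/-- A form of the definition in which instance search recognizes its definability. -/
theorem isTower_iff {X : Set 𝔐.carrier} : 𝔐.IsTower X ↔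
    (((∀ x y, 𝔐.In X x y → x ∈ 𝔐.tN X) ∧ (∀ x y, 𝔐.In X x y → y ∈ 𝔐.tN X) ∧
    (∀ B, B ∈ 𝔐.tL X → B ∈ 𝔐.tN X) ∧ (∀ x, 𝔐.iota x ∈ 𝔐.tN X) ∧
    (∀ x z, 𝔐.In X z (𝔐.iota x) ↔ ∃ y, 𝔐.mem y x ∧ z = 𝔐.iota y) ∧
    (∀ B c w, 𝔐.pr c w ∈ 𝔐.tY X B → B ∈ 𝔐.tL X)) ∧
    (𝔐.SetWF (𝔐.tN X) (𝔐.sec X (𝔐.num 1)) ∧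
    (∀ x, x ∈ 𝔐.tN X → ∀ y, y ∈ 𝔐.tN X → (∀ z, 𝔐.In X z x ↔ 𝔐.In X z y) → x = y) ∧
    (∀ B, B ∈ 𝔐.tL X → ∀ x, 𝔐.In X (𝔐.iota x) B) ∧
    (∀ B, B ∈ 𝔐.tL X → ∀ z w, 𝔐.In X z B → 𝔐.In X w z → 𝔐.In X w B) ∧
    (∀ B, B ∈ 𝔐.tL X → 𝔐.IsSat (𝔐.extn X B) (𝔐.sec X (𝔐.num 1)) (𝔐.tY X B)))) ∧
    ((∀ B, B ∈ 𝔐.tL X → 𝔐.NewAtLevel X B B) ∧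
    (∀ B, B ∈ 𝔐.tL X → ∀ c p, ∃ x, x ∈ 𝔐.tN X ∧ (𝔐.In X x B ∨ 𝔐.NewAtLevel X B x) ∧
      ∀ z, 𝔐.In X z x ↔ 𝔐.In X z B ∧ 𝔐.pr c (𝔐.pr z p) ∈ 𝔐.tY X B) ∧
    (∀ x, x ∈ 𝔐.tN X → (∃ y, x = 𝔐.iota y) ∨ ∃ B, B ∈ 𝔐.tL X ∧ 𝔐.NewAtLevel X B x) ∧
    (∀ B, B ∈ 𝔐.tL X → ∀ C, C ∈ 𝔐.tL X → 𝔐.In X B C ∨ B = C ∨ 𝔐.In X C B) ∧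
    (∀ B, B ∈ 𝔐.tL X → ∀ C, C ∈ 𝔐.tL X → 𝔐.In X B C → ∀ x, x ∈ 𝔐.tN X → 𝔐.NewAtLevel X B x →
      𝔐.In X x C)) :=
  ⟨fun ⟨a, b, c, d, e, f, g, h, i, j, k, l, m, n, o, p⟩ =>
    ⟨⟨⟨a, b, c, d, e, p⟩, f, g, h, i, j⟩, k, l, m, n, o⟩,
    fun ⟨⟨⟨a, b, c, d, e, p⟩, f, g, h, i, j⟩, k, l, m, n, o⟩ =>
    ⟨a, b, c, d, e, f, g, h, i, j, k, l, m, n, o, p⟩⟩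

set_option synthInstance.maxSize 1000 in
set_option synthInstance.maxHeartbeats 200000 in
instance {n m : ℕ} {𝒞 : Set (Set 𝔐.carrier)}
    (F : (Fin n → 𝔐.carrier) → (Fin m → Set 𝔐.carrier) → Set 𝔐.carrier)
    [CT False 𝔐.mem 𝒞 F] : Dfn False 𝔐.mem 𝒞 fun v W => 𝔐.IsTower (F v W) := by
  have : Dfn False 𝔐.mem 𝒞 fun (_ : Fin 0 → 𝔐.carrier) (W : Fin 1 → Set 𝔐.carrier) =>
      𝔐.IsTower (W 0) := by simp only [isTower_iff]; infer_instance
  exact this.app ![] ![F]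

theorem iota_inj {x y : 𝔐.carrier} (h : 𝔐.iota x = 𝔐.iota y) : x = y := (pr_inj.1 h).2

theorem NewAt.ne_iota {S X Z : Set 𝔐.carrier} {x y : 𝔐.carrier} (h : 𝔐.NewAt S X Z x) :
    x ≠ 𝔐.iota y := by
  rintro rfl
  obtain ⟨⟨s, e, hs⟩, -⟩ := h
  obtain ⟨z, hz⟩ := hs.nonempty
  exact not_mem_o z ((pr_inj.1 e).1 ▸ hz)

theorem NewAt.not_mem {S X Z : Set 𝔐.carrier} {x : 𝔐.carrier} (h : 𝔐.NewAt S X Z x) : ¬ x ∈ S :=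
  fun hx => h.2 ⟨x, hx, fun _ => Iff.rfl⟩

theorem NewAt.exists_tag {S X Z : Set 𝔐.carrier} {x : 𝔐.carrier} (h : 𝔐.NewAt S X Z x) :
    ∃ t c p, 𝔐.TagAt S X t ∧ ∀ z, 𝔐.In X z x ↔ z ∈ S ∧ 𝔐.pr c (𝔐.pr z p) ∈ Z := by
  obtain ⟨⟨s, -, hs⟩, -⟩ := h
  obtain ⟨z, hz⟩ := hs.nonempty
  obtain ⟨t, c, p, -, h⟩ := hs.mem_of_mem hz
  exact ⟨t, c, p, h⟩

/-- The towers coded by `X` and `X'` agree on the stage `S`. -/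
def Agree (𝔐 : ClassModel.{u}) [hM : Nbg 𝔐] (S X X' : Set 𝔐.carrier) : Prop :=
  (∀ x, x ∈ S → ∀ z, 𝔐.In X z x ↔ 𝔐.In X' z x) ∧ (∀ x, x ∈ S → (x ∈ 𝔐.tL X ↔ x ∈ 𝔐.tL X')) ∧
    ∀ D, D ∈ S → D ∈ 𝔐.tL X → ∀ c w, 𝔐.pr c w ∈ 𝔐.tY X D ↔ 𝔐.pr c w ∈ 𝔐.tY X' D

theorem Agree.symm {S X X' : Set 𝔐.carrier} (h : 𝔐.Agree S X X') : 𝔐.Agree S X' X :=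
  ⟨fun x hx z => (h.1 x hx z).symm, fun x hx => (h.2.1 x hx).symm,
    fun D hD hL c w => (h.2.2 D hD ((h.2.1 D hD).2 hL) c w).symm⟩

theorem Agree.mono {S S' X X' : Set 𝔐.carrier} (h : 𝔐.Agree S X X') (hS : S' ⊆ S) :
    𝔐.Agree S' X X' :=
  ⟨fun x hx => h.1 x (hS hx), fun x hx => h.2.1 x (hS hx), fun D hD => h.2.2 D (hS hD)⟩

theorem Agree.hit_iff {S X X' : Set 𝔐.carrier} (h : 𝔐.Agree S X X') {c p b x D : 𝔐.carrier}
    (hD : D ∈ S) : 𝔐.Hit X c p b x D ↔ 𝔐.Hit X' c p b x D := by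
  constructor
  · rintro ⟨h1, h2, h3⟩
    exact ⟨(h.2.1 D hD).1 h1, (h.1 D hD b).1 h2, (h.2.2 D hD h1 _ _).1 h3⟩
  · rintro ⟨h1, h2, h3⟩
    have h1' := (h.2.1 D hD).2 h1
    exact ⟨h1', (h.1 D hD b).2 h2, (h.2.2 D hD h1' _ _).2 h3⟩

theorem Agree.tagAt_imp {S X X' : Set 𝔐.carrier} (h : 𝔐.Agree S X X')
    (htr : ∀ x, x ∈ S → ∀ z, 𝔐.In X z x → z ∈ S) {t : 𝔐.carrier} (ht : 𝔐.TagAt S X t) :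
    𝔐.TagAt S X' t := by
  obtain ⟨c, p, a, b, rfl, ha, hb, h1, h2⟩ := ht
  refine ⟨c, p, a, b, rfl, ha, hb, fun x hx => ?_, fun ⟨B, hB, hBL, h3⟩ => h2 ⟨B, hB, ?_, fun x hx => ?_⟩⟩
  · obtain ⟨D, hD, hit⟩ := h1 x ((h.1 a ha x).2 hx)
    exact ⟨D, hD, (h.hit_iff hD).1 hit⟩
  · exact (h.2.1 B hB).2 hBL
  · obtain ⟨D, hD, hit⟩ := h3 x ((h.1 a ha x).1 hx)
    have hD' := (h.1 B hB D).2 hD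
    exact ⟨D, hD', (h.hit_iff (htr B hB D hD')).2 hit⟩

theorem Agree.tagAt_iff {S X X' : Set 𝔐.carrier} (h : 𝔐.Agree S X X')
    (htr : ∀ x, x ∈ S → ∀ z, 𝔐.In X z x → z ∈ S) {t : 𝔐.carrier} :
    𝔐.TagAt S X t ↔ 𝔐.TagAt S X' t :=
  ⟨h.tagAt_imp htr, h.symm.tagAt_imp fun x hx z hz => htr x hx z ((h.1 x hx z).2 hz)⟩

theorem Agree.rawFor_eq {S X X' Z Z' : Set 𝔐.carrier} (h : 𝔐.Agree S X X')
    (htr : ∀ x, x ∈ S → ∀ z, 𝔐.In X z x → z ∈ S) (hZ : ∀ c v, 𝔐.pr c v ∈ Z ↔ 𝔐.pr c v ∈ Z')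
    {x x' : 𝔐.carrier} (hx : ∀ z, 𝔐.In X z x ↔ 𝔐.In X' z x') :
    𝔐.RawFor S X Z x = 𝔐.RawFor S X' Z' x' := by
  ext r
  refine exists_congr fun t => exists_congr fun c => exists_congr fun p => and_congr_right fun _ =>
    and_congr (h.tagAt_iff htr) (forall_congr' fun z => ?_)
  rw [hx, hZ]

theorem Agree.newAt_iff {S X X' Z Z' : Set 𝔐.carrier} (h : 𝔐.Agree S X X')
    (htr : ∀ x, x ∈ S → ∀ z, 𝔐.In X z x → z ∈ S) (hZ : ∀ c v, 𝔐.pr c v ∈ Z ↔ 𝔐.pr c v ∈ Z')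
    {x : 𝔐.carrier} (hx : ∀ z, 𝔐.In X z x ↔ 𝔐.In X' z x) :
    𝔐.NewAt S X Z x ↔ 𝔐.NewAt S X' Z' x := by
  refine and_congr ?_ (not_congr (exists_congr fun y => and_congr_right fun hy =>
    forall_congr' fun z => ?_))
  · rw [h.rawFor_eq htr hZ hx]
  · rw [h.1 y hy, hx]

/-- New names with the same extension are equal. -/
theorem NewAt.eq {S X X' Z Z' : Set 𝔐.carrier} (h : 𝔐.Agree S X X')
    (htr : ∀ x, x ∈ S → ∀ z, 𝔐.In X z x → z ∈ S) (hZ : ∀ c v, 𝔐.pr c v ∈ Z ↔ 𝔐.pr c v ∈ Z')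
    {x x' : 𝔐.carrier} (hxx : ∀ z, 𝔐.In X z x ↔ 𝔐.In X' z x') (hx : 𝔐.NewAt S X Z x)
    (hx' : 𝔐.NewAt S X' Z' x') : x = x' := by
  obtain ⟨⟨s, rfl, hs⟩, -⟩ := hx
  obtain ⟨⟨s', rfl, hs'⟩, -⟩ := hx'
  rw [h.rawFor_eq htr hZ hxx] at hs
  rw [hs.unique hs']

theorem sec_mem {X : Set 𝔐.carrier} (hX : X ∈ 𝔐.classes) (i : 𝔐.carrier) :
    𝔐.sec X i ∈ 𝔐.classes := by
  have : Fact (X ∈ 𝔐.classes) := ⟨hX⟩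
  exact setOf_mem' fun x => x ∈ 𝔐.sec X i

namespace IsTower

variable {X X' : Set 𝔐.carrier} (h : 𝔐.IsTower X) (h' : 𝔐.IsTower X') (hX : X ∈ 𝔐.classes)
  (hX' : X' ∈ 𝔐.classes)

include h

include hX in
theorem classWF : 𝔐.ClassWF (𝔐.tN X) (𝔐.sec X (𝔐.num 1)) := h.wf.classWF (sec_mem hX _)

include hX in
theorem irrefl (x : 𝔐.carrier) : ¬ 𝔐.In X x x := fun hx =>
  (h.classWF hX).irrefl (h.in_left _ _ hx) hx

theorem extn_trans {B : 𝔐.carrier} (hB : B ∈ 𝔐.tL X) :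
    ∀ x, x ∈ 𝔐.extn X B → ∀ z, 𝔐.In X z x → z ∈ 𝔐.extn X B := fun x hx z => h.level_trans B hB x z hx

/-- An element of the level `B` which is new at the level `C` is new below `B`. -/
theorem in_of_new {B C x : 𝔐.carrier} (hB : B ∈ 𝔐.tL X) (hC : C ∈ 𝔐.tL X) (hx : 𝔐.In X x B)
    (hnew : 𝔐.NewAtLevel X C x) : 𝔐.In X C B := by
  rcases h.linear C hC B hB with h1 | rfl | h1
  · exact h1
  · exact absurd hx hnew.not_mem
  · exact absurd (h.level_trans C hC _ _ h1 hx) hnew.not_mem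

theorem level_not_base {x : 𝔐.carrier} (hx : 𝔐.iota x ∈ 𝔐.tL X) : False :=
  (h.level_new _ hx).ne_iota rfl

end IsTower

/-- The towers coded by `X` and `X'` have the same level `B`, up to which they agree. -/
def Good (𝔐 : ClassModel.{u}) [hM : Nbg 𝔐] (X X' : Set 𝔐.carrier) (B : 𝔐.carrier) : Prop :=
  B ∈ 𝔐.tL X ∧ B ∈ 𝔐.tL X' ∧ (∀ z, 𝔐.In X z B ↔ 𝔐.In X' z B) ∧ 𝔐.Agree (𝔐.extn X B) X X' ∧
    ∀ c w, 𝔐.pr c w ∈ 𝔐.tY X B ↔ 𝔐.pr c w ∈ 𝔐.tY X' B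

instance {n m : ℕ} {𝒞 : Set (Set 𝔐.carrier)} (s : (Fin n → 𝔐.carrier) → 𝔐.carrier)
    (F G : (Fin n → 𝔐.carrier) → (Fin m → Set 𝔐.carrier) → Set 𝔐.carrier)
    [Tm False 𝔐.mem 𝒞 s] [CT False 𝔐.mem 𝒞 F] [CT False 𝔐.mem 𝒞 G] :
    Dfn False 𝔐.mem 𝒞 fun v W => 𝔐.Good (F v W) (G v W) (s v) := by
  have : Dfn False 𝔐.mem 𝒞 fun (v : Fin 1 → 𝔐.carrier) (W : Fin 2 → Set 𝔐.carrier) =>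
      𝔐.Good (W 0) (W 1) (v 0) := by unfold Good Agree; infer_instance
  exact this.app ![s] ![F, G]

namespace Good

variable {X X' : Set 𝔐.carrier} {B : 𝔐.carrier} (hg : 𝔐.Good X X' B)

include hg

theorem extn_eq : 𝔐.extn X B = 𝔐.extn X' B := Set.ext hg.2.2.1

theorem symm : 𝔐.Good X' X B := by
  have e := hg.extn_eq
  obtain ⟨h1, h2, h3, h4, h5⟩ := hg
  exact ⟨h2, h1, fun z => (h3 z).symm, e ▸ h4.symm, fun c w => (h5 c w).symm⟩

theorem mono (h : 𝔐.IsTower X) {D : 𝔐.carrier} (hD : 𝔐.In X D B) (hDL : D ∈ 𝔐.tL X) :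
    𝔐.Good X X' D := by
  obtain ⟨h1, h2, h3, h4, h5⟩ := hg
  exact ⟨hDL, (h4.2.1 D hD).1 hDL, h4.1 D hD, h4.mono fun z hz => h.level_trans B h1 D z hD hz,
    h4.2.2 D hD hDL⟩

/-- If the towers agree up to `B`, then the names which are new at `B` are the same. -/
theorem of_new (h : 𝔐.IsTower X) (h' : 𝔐.IsTower X') {x : 𝔐.carrier} (hx : 𝔐.NewAtLevel X B x) :
    x ∈ 𝔐.tN X' ∧ (∀ z, 𝔐.In X z x ↔ 𝔐.In X' z x) ∧ 𝔐.NewAtLevel X' B x := by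
  have e := hg.extn_eq
  obtain ⟨h1, h2, h3, h4, h5⟩ := hg
  obtain ⟨t, c, p, -, hext⟩ := hx.exists_tag
  obtain ⟨x', hx'N, hx', hext'⟩ := h'.closed B h2 c p
  have hxx : ∀ z, 𝔐.In X z x ↔ 𝔐.In X' z x' := fun z => by
    rw [hext, hext', ← h3, h5]; rfl
  have hnew : 𝔐.NewAtLevel X' B x' := by
    refine hx'.resolve_left fun hin => hx.2 ⟨x', (h3 x').2 hin, fun z => ?_⟩
    rw [hxx, h4.1 x' ((h3 x').2 hin)]
  have hx2 := hnew
  unfold NewAtLevel at hnew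
  rw [← e] at hnew
  obtain rfl := NewAt.eq h4 (h.extn_trans h1) h5 hxx hx hnew
  exact ⟨hx'N, hxx, hx2⟩

end Good

/-- The tower coded by `X` is an initial segment of the tower coded by `X'`. -/
structure TowerLe (𝔐 : ClassModel.{u}) [hM : Nbg 𝔐] (X X' : Set 𝔐.carrier) : Prop where
  name : ∀ x ∈ 𝔐.tN X, x ∈ 𝔐.tN X'
  level : ∀ x ∈ 𝔐.tN X, (x ∈ 𝔐.tL X ↔ x ∈ 𝔐.tL X')
  in_iff : ∀ x ∈ 𝔐.tN X, ∀ z, 𝔐.In X z x ↔ 𝔐.In X' z x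
  sat : ∀ B ∈ 𝔐.tL X, ∀ c w, 𝔐.pr c w ∈ 𝔐.tY X B ↔ 𝔐.pr c w ∈ 𝔐.tY X' B

section Compare

variable {X X' : Set 𝔐.carrier} (h : 𝔐.IsTower X) (h' : 𝔐.IsTower X') (hX : X ∈ 𝔐.classes)
  (hX' : X' ∈ 𝔐.classes)

include h h' hX hX'

theorem towerLe_of_good (hg : ∀ B ∈ 𝔐.tL X, 𝔐.Good X X' B) : 𝔐.TowerLe X X' := by
  have key : ∀ x ∈ 𝔐.tN X, x ∈ 𝔐.tN X' ∧ (∀ z, 𝔐.In X z x ↔ 𝔐.In X' z x) ∧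
      (x ∈ 𝔐.tL X' → x ∈ 𝔐.tL X) := fun x hx => by
    rcases h.source x hx with ⟨y, rfl⟩ | ⟨C, hC, hnew⟩
    · exact ⟨h'.base y, fun z => by rw [h.base_in, h'.base_in], fun hL => (h'.level_not_base hL).elim⟩
    · obtain ⟨h1, h2, h3⟩ := (hg C hC).of_new h h' hnew
      refine ⟨h1, h2, fun hL => ?_⟩
      have hC' := (hg C hC).2.1
      rcases h'.linear C hC' x hL with h4 | rfl | h4
      · exact absurd (h'.up C hC' x hL h4 x h1 h3) (h'.irrefl hX' x)
      · exact hC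
      · exact absurd h4 h3.not_mem
  exact ⟨fun x hx => (key x hx).1, fun x hx => ⟨fun hL => (hg x hL).2.1, (key x hx).2.2⟩,
    fun x hx => (key x hx).2.1, fun B hB => (hg B hB).2.2.2.2⟩

/-- If all levels in `B` and in `B'` are good, then the elements of `B` belong to `B'`. -/
theorem in_of_good {B B' : 𝔐.carrier} (hB : B ∈ 𝔐.tL X) (hB' : B' ∈ 𝔐.tL X')
    (hg : ∀ D ∈ 𝔐.tL X, 𝔐.In X D B → 𝔐.Good X X' D)
    (hBg : ∀ D ∈ 𝔐.tL X, 𝔐.In X D B → D ≠ B' ∧ ¬ 𝔐.In X' B' D) {x : 𝔐.carrier}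
    (hx : 𝔐.In X x B) : 𝔐.In X' x B' ∧ ∀ z, 𝔐.In X z x ↔ 𝔐.In X' z x := by
  rcases h.source x (h.in_left _ _ hx) with ⟨y, rfl⟩ | ⟨C, hC, hnew⟩
  · exact ⟨h'.level_base B' hB' y, fun z => by rw [h.base_in, h'.base_in]⟩
  · have hCB := h.in_of_new hB hC hx hnew
    have hCg := hg C hC hCB
    obtain ⟨h1, h2, h3⟩ := hCg.of_new h h' hnew
    refine ⟨h'.up C hCg.2.1 B' hB' ?_ x h1 h3, h2⟩
    rcases h'.linear C hCg.2.1 B' hB' with h4 | h4 | h4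
    · exact h4
    · exact absurd h4 (hBg C hC hCB).1
    · exact absurd h4 (hBg C hC hCB).2

/-- Two towers agree as long as both last: otherwise compare the first levels where they differ. -/
theorem tower_comparable : 𝔐.TowerLe X X' ∨ 𝔐.TowerLe X' X := by
  have : Fact (X ∈ 𝔐.classes) := ⟨hX⟩
  have : Fact (X' ∈ 𝔐.classes) := ⟨hX'⟩
  by_cases hall : ∀ B ∈ 𝔐.tL X, 𝔐.Good X X' B
  · exact Or.inl (towerLe_of_good h h' hX hX' hall)
  by_cases hall' : ∀ B ∈ 𝔐.tL X', 𝔐.Good X' X B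
  · exact Or.inr (towerLe_of_good h' h hX' hX hall')
  exfalso
  push Not at hall hall'
  obtain ⟨B, ⟨hB, hBg⟩, hmin⟩ := h.classWF hX {B | B ∈ 𝔐.tL X ∧ ¬ 𝔐.Good X X' B} (setOf_mem' _)
    (fun B hB => h.level_name B hB.1) hall
  obtain ⟨B', ⟨hB', hBg'⟩, hmin'⟩ := h'.classWF hX' {B | B ∈ 𝔐.tL X' ∧ ¬ 𝔐.Good X' X B}
    (setOf_mem' _) (fun B hB => h'.level_name B hB.1) hall'
  have hg : ∀ D ∈ 𝔐.tL X, 𝔐.In X D B → 𝔐.Good X X' D := fun D hD hDB =>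
    by_contra fun hDg => hmin D ⟨hD, hDg⟩ hDB
  have hg' : ∀ D ∈ 𝔐.tL X', 𝔐.In X' D B' → 𝔐.Good X' X D := fun D hD hDB =>
    by_contra fun hDg => hmin' D ⟨hD, hDg⟩ hDB
  have h1 : ∀ D ∈ 𝔐.tL X, 𝔐.In X D B → D ≠ B' ∧ ¬ 𝔐.In X' B' D := fun D hD hDB =>
    ⟨fun e => hBg' (e ▸ (hg D hD hDB).symm), fun hin =>
      hBg' ((hg D hD hDB).symm.mono h' hin hB')⟩
  have h1' : ∀ D ∈ 𝔐.tL X', 𝔐.In X' D B' → D ≠ B ∧ ¬ 𝔐.In X B D := fun D hD hDB =>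
    ⟨fun e => hBg (e ▸ (hg' D hD hDB).symm), fun hin =>
      hBg ((hg' D hD hDB).symm.mono h hin hB)⟩
  -- the first levels `B` and `B'` where the towers differ have the same elements and the same
  -- satisfaction class, hence the same name
  have h2 := fun x => in_of_good h h' hX hX' hB hB' hg h1 (x := x)
  have h2' := fun x => in_of_good h' h hX' hX hB' hB hg' h1' (x := x)
  have hext : ∀ x, 𝔐.In X x B ↔ 𝔐.In X' x B' := fun x => ⟨fun hx => (h2 x hx).1, fun hx => (h2' x hx).1⟩
  have hS : 𝔐.extn X B = 𝔐.extn X' B' := Set.ext hext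
  have hagree : 𝔐.Agree (𝔐.extn X B) X X' :=
    ⟨fun x hx => (h2 x hx).2, fun x hx => ⟨fun hL => (hg x hL hx).2.1,
      fun hL => (hg' x hL ((hext x).1 hx)).2.1⟩, fun D hD hL => (hg D hL hD).2.2.2.2⟩
  have hZ : ∀ c v, 𝔐.pr c v ∈ 𝔐.tY X B ↔ 𝔐.pr c v ∈ 𝔐.tY X' B' := by
    have hs := h'.level_sat B' hB'
    rw [← hS] at hs
    exact IsSat.unique (fun x hx y => hagree.1 x hx y) (sec_mem (sec_mem hX _) _)
      (sec_mem (sec_mem hX' _) _) (h.level_sat B hB) hs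
  have hn' : 𝔐.NewAt (𝔐.extn X B) X' (𝔐.tY X' B') B' := by
    rw [hS]; exact h'.level_new B' hB'
  obtain rfl := NewAt.eq hagree (h.extn_trans hB) hZ hext (h.level_new B hB) hn'
  refine hBg ⟨hB, hB', hext, hagree, hZ⟩

end Compare

end ClassModel

end ClassTheory

namespace ClassTheory
open SetFormula
namespace ClassModel

variable {𝔐 : ClassModel.{u}} [hM : Nbg 𝔐]

theorem IsSat.congr {S E E' Z Z' : Set 𝔐.carrier} (hE : ∀ x ∈ S, ∀ y, 𝔐.Rel E y x ↔ 𝔐.Rel E' y x)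
    (hZ : ∀ c v, 𝔐.pr c v ∈ Z ↔ 𝔐.pr c v ∈ Z') (h : 𝔐.IsSat S E Z) : 𝔐.IsSat S E' Z' :=
  fun c v => by
    rw [← hZ, h]
    exact SatStep.congr hE fun c' _ => hZ c'

namespace TowerLe

variable {X U : Set 𝔐.carrier} (hle : 𝔐.TowerLe X U) (h : 𝔐.IsTower X)

include hle h

theorem in_of_in {x z : 𝔐.carrier} (hxz : 𝔐.In X z x) : 𝔐.In U z x :=
  (hle.in_iff x (h.in_right _ _ hxz) z).1 hxz

theorem extn_eq {B : 𝔐.carrier} (hB : B ∈ 𝔐.tL X) : 𝔐.extn X B = 𝔐.extn U B :=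
  Set.ext (hle.in_iff B (h.level_name B hB))

theorem agree : 𝔐.Agree (𝔐.tN X) X U :=
  ⟨hle.in_iff, hle.level, fun D _ => hle.sat D⟩

theorem newAtLevel_iff {B x : 𝔐.carrier} (hB : B ∈ 𝔐.tL X) (hx : x ∈ 𝔐.tN X) :
    𝔐.NewAtLevel X B x ↔ 𝔐.NewAtLevel U B x := by
  unfold NewAtLevel
  rw [← hle.extn_eq h hB]
  exact ((hle.agree h).mono fun z hz => h.in_left _ _ hz).newAt_iff (h.extn_trans hB) (hle.sat B hB)
    (hle.in_iff x hx)

end TowerLe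

/-! ### Unions of chains of towers -/

section Union

variable {𝒳 : Set (Set 𝔐.carrier)} (h𝒳 : ∀ X ∈ 𝒳, 𝔐.IsTower X) (h𝒳c : ∀ X ∈ 𝒳, X ∈ 𝔐.classes)

theorem in_sUnion {x y : 𝔐.carrier} : 𝔐.In (⋃₀ 𝒳) x y ↔ ∃ X ∈ 𝒳, 𝔐.In X x y := by
  simp only [In, rel_iff, sec, Set.mem_sUnion, Set.mem_ofPred_eq]

include h𝒳 h𝒳c

theorem towerLe_sUnion {X : Set 𝔐.carrier} (hX : X ∈ 𝒳) : 𝔐.TowerLe X (⋃₀ 𝒳) := by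
  have comp := fun {X'} (hX' : X' ∈ 𝒳) =>
    tower_comparable (h𝒳 X hX) (h𝒳 X' hX') (h𝒳c X hX) (h𝒳c X' hX')
  refine ⟨fun x hx => ⟨X, hX, hx⟩, fun x hx => ⟨fun hL => ⟨X, hX, hL⟩, ?_⟩, fun x hx z =>
    ⟨fun hz => in_sUnion.2 ⟨X, hX, hz⟩, fun hz => ?_⟩, fun B hB c w => ⟨fun hw => ⟨X, hX, hw⟩, ?_⟩⟩
  · rintro ⟨X', hX', hL⟩
    rcases comp hX' with hle | hle
    · exact (hle.level x hx).2 hL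
    · exact (hle.level x ((h𝒳 X' hX').level_name x hL)).1 hL
  · obtain ⟨X', hX', hz⟩ := in_sUnion.1 hz
    rcases comp hX' with hle | hle
    · exact (hle.in_iff x hx z).2 hz
    · exact hle.in_of_in (h𝒳 X' hX') hz
  · rintro ⟨X', hX', hw⟩
    have hB' := (h𝒳 X' hX').sat_level B c w hw
    rcases comp hX' with hle | hle
    · exact (hle.sat B hB c w).2 hw
    · exact (hle.sat B hB' c w).1 hw

theorem exists_common {x y : 𝔐.carrier} (hx : x ∈ 𝔐.tN (⋃₀ 𝒳)) (hy : y ∈ 𝔐.tN (⋃₀ 𝒳)) :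
    ∃ X ∈ 𝒳, x ∈ 𝔐.tN X ∧ y ∈ 𝔐.tN X := by
  obtain ⟨X, hX, hx⟩ := hx
  obtain ⟨X', hX', hy⟩ := hy
  rcases tower_comparable (h𝒳 X hX) (h𝒳 X' hX') (h𝒳c X hX) (h𝒳c X' hX') with hle | hle
  · exact ⟨X', hX', hle.name x hx, hy⟩
  · exact ⟨X, hX, hx, hle.name y hy⟩

theorem exists_common₃ {x y z : 𝔐.carrier} (hx : x ∈ 𝔐.tN (⋃₀ 𝒳)) (hy : y ∈ 𝔐.tN (⋃₀ 𝒳))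
    (hz : z ∈ 𝔐.tN (⋃₀ 𝒳)) : ∃ X ∈ 𝒳, x ∈ 𝔐.tN X ∧ y ∈ 𝔐.tN X ∧ z ∈ 𝔐.tN X := by
  obtain ⟨X, hX, hx, hy⟩ := exists_common h𝒳 h𝒳c hx hy
  obtain ⟨X', hX', hz⟩ := hz
  rcases tower_comparable (h𝒳 X hX) (h𝒳 X' hX') (h𝒳c X hX) (h𝒳c X' hX') with hle | hle
  · exact ⟨X', hX', hle.name x hx, hle.name y hy, hz⟩
  · exact ⟨X, hX, hx, hy, hle.name z hz⟩

/-- Towers are comparable, so that any collection of towers is a chain. -/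
theorem isTower_sUnion (hne : 𝒳.Nonempty) : 𝔐.IsTower (⋃₀ 𝒳) := by
  have le := fun {X} (hX : X ∈ 𝒳) => towerLe_sUnion h𝒳 h𝒳c hX
  have lev : ∀ {X}, X ∈ 𝒳 → ∀ {B}, B ∈ 𝔐.tL (⋃₀ 𝒳) → B ∈ 𝔐.tN X → B ∈ 𝔐.tL X :=
    fun hX B hB hBN => ((le hX).level _ hBN).2 hB
  have hLN : ∀ B, B ∈ 𝔐.tL (⋃₀ 𝒳) → B ∈ 𝔐.tN (⋃₀ 𝒳) := by
    rintro B ⟨X, hX, hB⟩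
    exact ⟨X, hX, (h𝒳 X hX).level_name B hB⟩
  obtain ⟨X₀, hX₀⟩ := hne
  constructor
  · intro x y hxy
    obtain ⟨X, hX, hxy⟩ := in_sUnion.1 hxy
    exact ⟨X, hX, (h𝒳 X hX).in_left _ _ hxy⟩
  · intro x y hxy
    obtain ⟨X, hX, hxy⟩ := in_sUnion.1 hxy
    exact ⟨X, hX, (h𝒳 X hX).in_right _ _ hxy⟩
  · exact hLN
  · exact fun x => ⟨X₀, hX₀, (h𝒳 X₀ hX₀).base x⟩
  · intro x z
    rw [← (le hX₀).in_iff _ ((h𝒳 X₀ hX₀).base x), (h𝒳 X₀ hX₀).base_in]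
  · rintro s ⟨x, hx⟩ hs
    obtain ⟨X, hX, hxX⟩ := hs x hx
    have : Fact (X ∈ 𝔐.classes) := ⟨h𝒳c X hX⟩
    obtain ⟨s', hs'⟩ := sep s fun y => y ∈ 𝔐.tN X
    obtain ⟨y, hy, hmin⟩ := (h𝒳 X hX).wf s' ⟨x, (hs' x).2 ⟨hx, hxX⟩⟩ fun y hy => ((hs' y).1 hy).2
    obtain ⟨hys, hyX⟩ := (hs' y).1 hy
    refine ⟨y, hys, fun z hz hzy => ?_⟩
    have hzy' := ((le hX).in_iff y hyX z).2 hzy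
    exact hmin z ((hs' z).2 ⟨hz, (h𝒳 X hX).in_left _ _ hzy'⟩) hzy'
  · intro x hx y hy hxy
    obtain ⟨X, hX, hx, hy⟩ := exists_common h𝒳 h𝒳c hx hy
    refine (h𝒳 X hX).ext x hx y hy fun z => ?_
    rw [(le hX).in_iff x hx, (le hX).in_iff y hy, hxy]
  · rintro B ⟨X, hX, hB⟩ x
    exact (le hX).in_of_in (h𝒳 X hX) ((h𝒳 X hX).level_base B hB x)
  · rintro B ⟨X, hX, hB⟩ z w hz hw
    have hz' := ((le hX).in_iff B ((h𝒳 X hX).level_name B hB) z).2 hz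
    have hw' := ((le hX).in_iff z ((h𝒳 X hX).in_left _ _ hz') w).2 hw
    exact (le hX).in_of_in (h𝒳 X hX) ((h𝒳 X hX).level_trans B hB z w hz' hw')
  · rintro B ⟨X, hX, hB⟩
    have h := h𝒳 X hX
    rw [← (le hX).extn_eq h hB]
    exact (h.level_sat B hB).congr (fun x hx => (le hX).in_iff x (h.in_left _ _ hx)) ((le hX).sat B hB)
  · rintro B ⟨X, hX, hB⟩
    have h := h𝒳 X hX
    exact ((le hX).newAtLevel_iff h hB (h.level_name B hB)).1 (h.level_new B hB)
  · rintro B ⟨X, hX, hB⟩ c p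
    have h := h𝒳 X hX
    obtain ⟨x, hx, hx', hext⟩ := h.closed B hB c p
    refine ⟨x, ⟨X, hX, hx⟩, hx'.imp ((le hX).in_of_in h) ((le hX).newAtLevel_iff h hB hx).1,
      fun z => ?_⟩
    rw [← (le hX).in_iff x hx, hext, (le hX).in_iff B (h.level_name B hB), (le hX).sat B hB]
  · rintro x ⟨X, hX, hx⟩
    refine ((h𝒳 X hX).source x hx).imp_right fun ⟨B, hB, hnew⟩ => ⟨B, ⟨X, hX, hB⟩, ?_⟩
    exact ((le hX).newAtLevel_iff (h𝒳 X hX) hB hx).1 hnew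
  · intro B hB C hC
    obtain ⟨X, hX, hBX, hCX⟩ := exists_common h𝒳 h𝒳c (hLN B hB) (hLN C hC)
    have h := h𝒳 X hX
    exact (h.linear B (lev hX hB hBX) C (lev hX hC hCX)).imp ((le hX).in_of_in h)
      (Or.imp_right ((le hX).in_of_in h))
  · intro B hB C hC hBC x hx hnew
    obtain ⟨X, hX, hBX, hCX, hxX⟩ := exists_common₃ h𝒳 h𝒳c (hLN B hB) (hLN C hC) hx
    have h := h𝒳 X hX
    exact (le hX).in_of_in h (h.up B (lev hX hB hBX) C (lev hX hC hCX)
      (((le hX).in_iff C hCX B).2 hBC) x hxX (((le hX).newAtLevel_iff h (lev hX hB hBX) hxX).2 hnew))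
  · rintro B c w ⟨X, hX, hw⟩
    exact ⟨X, hX, (h𝒳 X hX).sat_level B c w hw⟩

end Union

/-! ### The successor of a tower -/

/-- `r` is a raw name at the last stage of the tower `X`. -/
def Cand (𝔐 : ClassModel.{u}) [hM : Nbg 𝔐] (X : Set 𝔐.carrier) (r : 𝔐.carrier) : Prop :=
  ∃ t c p, r = 𝔐.pr t (𝔐.pr c p) ∧ 𝔐.TagAt (𝔐.tN X) X t

/-- `z` belongs to the class named by `r` at the last stage of the tower `X`. -/
def Den (𝔐 : ClassModel.{u}) [hM : Nbg 𝔐] (X Z : Set 𝔐.carrier) (r z : 𝔐.carrier) : Prop :=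
  ∃ t c p, r = 𝔐.pr t (𝔐.pr c p) ∧ z ∈ 𝔐.tN X ∧ 𝔐.pr c (𝔐.pr z p) ∈ Z

/-- `s` is the set of raw names of least rank of a definable class which is not in the tower. -/
def Fresh (𝔐 : ClassModel.{u}) [hM : Nbg 𝔐] (X Z : Set 𝔐.carrier) (s : 𝔐.carrier) : Prop :=
  ∃ r, 𝔐.Cand X r ∧ (¬ ∃ y, y ∈ 𝔐.tN X ∧ ∀ z, 𝔐.In X z y ↔ 𝔐.Den X Z r z) ∧
    𝔐.IsScott {r' | 𝔐.Cand X r' ∧ ∀ z, 𝔐.Den X Z r' z ↔ 𝔐.Den X Z r z} s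

/-- `z` is an element of the new name `x`. -/
def FreshIn (𝔐 : ClassModel.{u}) [hM : Nbg 𝔐] (X Z : Set 𝔐.carrier) (z x : 𝔐.carrier) : Prop :=
  ∃ s, x = 𝔐.pr s s ∧ 𝔐.Fresh X Z s ∧ ∃ r, 𝔐.mem r s ∧ 𝔐.Den X Z r z

/-- `x` is a new name for the class of all names of the tower. -/
def FreshTop (𝔐 : ClassModel.{u}) [hM : Nbg 𝔐] (X Z : Set 𝔐.carrier) (x : 𝔐.carrier) : Prop :=
  (∃ s, x = 𝔐.pr s s ∧ 𝔐.Fresh X Z s) ∧ ∀ z, z ∈ 𝔐.tN X → 𝔐.FreshIn X Z z x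

section Definability

variable {n m : ℕ} {𝒞 : Set (Set 𝔐.carrier)}
  (s t : (Fin n → 𝔐.carrier) → 𝔐.carrier)
  (F G : (Fin n → 𝔐.carrier) → (Fin m → Set 𝔐.carrier) → Set 𝔐.carrier)
  [Tm False 𝔐.mem 𝒞 s] [Tm False 𝔐.mem 𝒞 t] [CT False 𝔐.mem 𝒞 F] [CT False 𝔐.mem 𝒞 G]

instance : Dfn False 𝔐.mem 𝒞 fun v W => 𝔐.Cand (F v W) (s v) := by
  have : Dfn False 𝔐.mem 𝒞 fun (v : Fin 1 → 𝔐.carrier) (W : Fin 1 → Set 𝔐.carrier) =>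
      𝔐.Cand (W 0) (v 0) := by unfold Cand; infer_instance
  exact this.app ![s] ![F]

instance : Dfn False 𝔐.mem 𝒞 fun v W => 𝔐.Den (F v W) (G v W) (s v) (t v) := by
  have : Dfn False 𝔐.mem 𝒞 fun (v : Fin 2 → 𝔐.carrier) (W : Fin 2 → Set 𝔐.carrier) =>
      𝔐.Den (W 0) (W 1) (v 0) (v 1) := by unfold Den; infer_instance
  exact this.app ![s, t] ![F, G]

instance : Dfn False 𝔐.mem 𝒞 fun v W => 𝔐.Fresh (F v W) (G v W) (s v) := by
  have : Dfn False 𝔐.mem 𝒞 fun (v : Fin 1 → 𝔐.carrier) (W : Fin 2 → Set 𝔐.carrier) =>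
      𝔐.Fresh (W 0) (W 1) (v 0) := by unfold Fresh; infer_instance
  exact this.app ![s] ![F, G]

instance : Dfn False 𝔐.mem 𝒞 fun v W => 𝔐.FreshIn (F v W) (G v W) (s v) (t v) := by
  have : Dfn False 𝔐.mem 𝒞 fun (v : Fin 2 → 𝔐.carrier) (W : Fin 2 → Set 𝔐.carrier) =>
      𝔐.FreshIn (W 0) (W 1) (v 0) (v 1) := by unfold FreshIn; infer_instance
  exact this.app ![s, t] ![F, G]

instance : Dfn False 𝔐.mem 𝒞 fun v W => 𝔐.FreshTop (F v W) (G v W) (s v) := by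
  have : Dfn False 𝔐.mem 𝒞 fun (v : Fin 1 → 𝔐.carrier) (W : Fin 2 → Set 𝔐.carrier) =>
      𝔐.FreshTop (W 0) (W 1) (v 0) := by unfold FreshTop; infer_instance
  exact this.app ![s] ![F, G]

end Definability

/-- The tower `X` prolonged by the definable subclasses of its last stage, given by the satisfaction
class `Z`. -/
def nextTower (𝔐 : ClassModel.{u}) [hM : Nbg 𝔐] (X Z : Set 𝔐.carrier) : Set 𝔐.carrier :=
  {w | w ∈ X ∨ (∃ s, w = 𝔐.pr (𝔐.num 0) (𝔐.pr s s) ∧ 𝔐.Fresh X Z s) ∨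
    (∃ z x, w = 𝔐.pr (𝔐.num 1) (𝔐.pr z x) ∧ 𝔐.FreshIn X Z z x) ∨
    (∃ x, w = 𝔐.pr (𝔐.num 2) x ∧ 𝔐.FreshTop X Z x) ∨
    ∃ x v, w = 𝔐.pr (𝔐.num 3) (𝔐.pr x v) ∧ 𝔐.FreshTop X Z x ∧ v ∈ Z}

theorem nextTower_mem {𝒞 : Set (Set 𝔐.carrier)} (h𝒞 : 𝔐.IsDeltaClosed 𝒞) {X Z : Set 𝔐.carrier}
    (hX : X ∈ 𝒞) (hZ : Z ∈ 𝒞) : 𝔐.nextTower X Z ∈ 𝒞 := by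
  have : Fact (X ∈ 𝒞) := ⟨hX⟩
  have : Fact (Z ∈ 𝒞) := ⟨hZ⟩
  exact h𝒞.elem _ inferInstance

/-- The tags of the stage given by a level are not tags of later stages, as this level is a bound. -/
theorem TagAt.not_tagAt {X S : Set 𝔐.carrier} {C t : 𝔐.carrier} (hC : C ∈ 𝔐.tL X) (hCS : C ∈ S)
    (h : 𝔐.TagAt (𝔐.extn X C) X t) : ¬ 𝔐.TagAt S X t := by
  rintro ⟨c, p, a, b, rfl, ha, hb, h1, h2⟩
  obtain ⟨c', p', a', b', e, ha', hb', h1', h2'⟩ := h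
  simp only [pr_inj] at e
  obtain ⟨rfl, rfl, rfl, rfl⟩ := e
  exact h2 ⟨C, hCS, hC, h1'⟩

section Next

variable {X Z : Set 𝔐.carrier}

theorem mem_tN_nextTower {x : 𝔐.carrier} :
    x ∈ 𝔐.tN (𝔐.nextTower X Z) ↔ x ∈ 𝔐.tN X ∨ ∃ s, x = 𝔐.pr s s ∧ 𝔐.Fresh X Z s := by
  simp [tN, sec, nextTower, pr_inj, num_inj]

theorem in_nextTower {z x : 𝔐.carrier} :
    𝔐.In (𝔐.nextTower X Z) z x ↔ 𝔐.In X z x ∨ 𝔐.FreshIn X Z z x := by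
  simp [In, rel_iff, sec, nextTower, pr_inj, num_inj]

theorem mem_tL_nextTower {x : 𝔐.carrier} :
    x ∈ 𝔐.tL (𝔐.nextTower X Z) ↔ x ∈ 𝔐.tL X ∨ 𝔐.FreshTop X Z x := by
  simp [tL, sec, nextTower, pr_inj, num_inj]

theorem mem_tY_nextTower {x v : 𝔐.carrier} :
    v ∈ 𝔐.tY (𝔐.nextTower X Z) x ↔ v ∈ 𝔐.tY X x ∨ (𝔐.FreshTop X Z x ∧ v ∈ Z) := by
  simp [tY, sec, nextTower, pr_inj, num_inj]

theorem Fresh.exists_raw {s : 𝔐.carrier} (hs : 𝔐.Fresh X Z s) : ∃ t c p, 𝔐.TagAt (𝔐.tN X) X t ∧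
    (¬ ∃ y, y ∈ 𝔐.tN X ∧ ∀ z, 𝔐.In X z y ↔ z ∈ 𝔐.tN X ∧ 𝔐.pr c (𝔐.pr z p) ∈ Z) ∧
    𝔐.IsScott {r | ∃ t c' p', r = 𝔐.pr t (𝔐.pr c' p') ∧ 𝔐.TagAt (𝔐.tN X) X t ∧
      ∀ z, (z ∈ 𝔐.tN X ∧ 𝔐.pr c (𝔐.pr z p) ∈ Z) ↔ z ∈ 𝔐.tN X ∧ 𝔐.pr c' (𝔐.pr z p') ∈ Z} s ∧
    ∀ z, 𝔐.FreshIn X Z z (𝔐.pr s s) ↔ z ∈ 𝔐.tN X ∧ 𝔐.pr c (𝔐.pr z p) ∈ Z := by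
  have hs0 := hs
  obtain ⟨r, ⟨t, c, p, rfl, ht⟩, hr, hsc⟩ := hs
  have hden : ∀ t c p z, 𝔐.Den X Z (𝔐.pr t (𝔐.pr c p)) z ↔ z ∈ 𝔐.tN X ∧ 𝔐.pr c (𝔐.pr z p) ∈ Z := by
    intro t c p z
    constructor
    · rintro ⟨t', c', p', e, h⟩
      simp only [pr_inj] at e
      obtain ⟨rfl, rfl, rfl⟩ := e
      exact h
    · intro h; exact ⟨t, c, p, rfl, h⟩
  simp only [hden] at hr hsc
  refine ⟨t, c, p, ht, hr, ?_, fun z => ⟨?_, fun hz => ?_⟩⟩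
  · convert hsc using 2
    ext r
    constructor
    · rintro ⟨t', c', p', rfl, ht', h⟩
      exact ⟨⟨t', c', p', rfl, ht'⟩, fun z => by rw [hden, h]⟩
    · rintro ⟨⟨t', c', p', rfl, ht'⟩, h⟩
      exact ⟨t', c', p', rfl, ht', fun z => by rw [← h, hden]⟩
  · rintro ⟨s', e, -, r, hrs, hd⟩
    obtain ⟨rfl, -⟩ := pr_inj.1 e
    exact ((hsc.mem_of_mem hrs).2 z).1 hd
  · obtain ⟨r, hrs⟩ := hsc.nonempty
    exact ⟨s, rfl, hs0, r, hrs, ((hsc.mem_of_mem hrs).2 z).2 hz⟩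

variable (h : 𝔐.IsTower X) (hX : X ∈ 𝔐.classes) (hZc : Z ∈ 𝔐.classes)
  (hZ : 𝔐.IsSat (𝔐.tN X) (𝔐.sec X (𝔐.num 1)) Z)

include h

/-- A name carries a tag of the stage at which it is new, and no tag belongs to two stages. -/
theorem Fresh.not_mem {s : 𝔐.carrier} (hs : 𝔐.Fresh X Z s) : ¬ 𝔐.pr s s ∈ 𝔐.tN X := by
  intro hN
  obtain ⟨_, _, _, -, -, hsc, -⟩ := hs.exists_raw
  obtain ⟨r, hr⟩ := hsc.nonempty
  obtain ⟨t, c, p, rfl, ht, -⟩ := hsc.mem_of_mem hr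
  rcases h.source _ hN with ⟨y, e⟩ | ⟨C, hC, hnew⟩
  · exact not_mem_o _ ((pr_inj.1 e).1 ▸ hr)
  · obtain ⟨⟨s', e, hs'⟩, -⟩ := hnew
    obtain ⟨rfl, -⟩ := pr_inj.1 e
    obtain ⟨t', c', p', e, ht', -⟩ := hs'.mem_of_mem hr
    obtain ⟨rfl, -⟩ := pr_inj.1 e
    exact ht'.not_tagAt hC (h.level_name C hC) ht

theorem FreshIn.not_mem {z x : 𝔐.carrier} (hx : 𝔐.FreshIn X Z z x) : ¬ x ∈ 𝔐.tN X := by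
  obtain ⟨s, rfl, hs, -⟩ := hx
  exact hs.not_mem h

theorem FreshTop.not_mem {x : 𝔐.carrier} (hx : 𝔐.FreshTop X Z x) : ¬ x ∈ 𝔐.tN X := by
  obtain ⟨⟨s, rfl, hs⟩, -⟩ := hx
  exact hs.not_mem h

theorem towerLe_nextTower : 𝔐.TowerLe X (𝔐.nextTower X Z) := by
  refine ⟨fun x hx => mem_tN_nextTower.2 (Or.inl hx), fun x hx => ?_, fun x hx z => ?_,
    fun B hB c w => ?_⟩
  · rw [mem_tL_nextTower]
    exact ⟨Or.inl, fun hL => hL.resolve_right fun ht => ht.not_mem h hx⟩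
  · rw [in_nextTower]
    exact ⟨Or.inl, fun hL => hL.resolve_right fun ht => ht.not_mem h hx⟩
  · rw [mem_tY_nextTower]
    exact ⟨Or.inl, fun hL => hL.resolve_right fun ht => ht.1.not_mem h (h.level_name B hB)⟩

theorem in_fresh {s : 𝔐.carrier} (hs : 𝔐.Fresh X Z s) (z : 𝔐.carrier) :
    𝔐.In (𝔐.nextTower X Z) z (𝔐.pr s s) ↔ 𝔐.FreshIn X Z z (𝔐.pr s s) := by
  rw [in_nextTower]
  exact or_iff_right fun hin => hs.not_mem h (h.in_right _ _ hin)

theorem FreshTop.in_iff {B : 𝔐.carrier} (hB : 𝔐.FreshTop X Z B) (z : 𝔐.carrier) :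
    𝔐.In (𝔐.nextTower X Z) z B ↔ z ∈ 𝔐.tN X := by
  obtain ⟨⟨s, rfl, hs⟩, hall⟩ := hB
  rw [in_fresh h hs]
  refine ⟨?_, hall z⟩
  rintro ⟨-, -, -, r, -, t, c, p, -, hz, -⟩
  exact hz

theorem FreshTop.sat_iff {B : 𝔐.carrier} (hB : 𝔐.FreshTop X Z B) (c w : 𝔐.carrier) :
    𝔐.pr c w ∈ 𝔐.tY (𝔐.nextTower X Z) B ↔ 𝔐.pr c w ∈ Z := by
  rw [mem_tY_nextTower]
  exact ⟨fun hw => hw.elim (fun hw => absurd (h.level_name B (h.sat_level B c w hw)) (hB.not_mem h))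
    And.right, fun hw => Or.inr ⟨hB, hw⟩⟩

theorem tN_trans : ∀ x, x ∈ 𝔐.tN X → ∀ z, 𝔐.In X z x → z ∈ 𝔐.tN X := fun _ _ z hz =>
  h.in_left z _ hz

/-- Fresh names are new at the last stage of the old tower. -/
theorem newAt_fresh {s : 𝔐.carrier} (hs : 𝔐.Fresh X Z s) :
    𝔐.NewAt (𝔐.tN X) (𝔐.nextTower X Z) Z (𝔐.pr s s) := by
  have hle := towerLe_nextTower (Z := Z) h
  obtain ⟨t, c, p, ht, hne, hsc, hin⟩ := hs.exists_raw
  refine ⟨⟨s, rfl, ?_⟩, ?_⟩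
  · convert hsc using 2
    ext r
    refine exists_congr fun t' => exists_congr fun c' => exists_congr fun p' =>
      and_congr_right fun _ => and_congr ?_ (forall_congr' fun z => ?_)
    · exact ((hle.agree h).tagAt_iff (tN_trans h)).symm
    · rw [in_fresh h hs, hin]
  · rintro ⟨y, hy, hext⟩
    refine hne ⟨y, hy, fun z => ?_⟩
    rw [hle.in_iff y hy, hext, in_fresh h hs, hin]

theorem newAtLevel_fresh {s B : 𝔐.carrier} (hs : 𝔐.Fresh X Z s) (hB : 𝔐.FreshTop X Z B) :
    𝔐.NewAtLevel (𝔐.nextTower X Z) B (𝔐.pr s s) := by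
  unfold NewAtLevel
  have e : 𝔐.extn (𝔐.nextTower X Z) B = 𝔐.tN X := Set.ext (hB.in_iff h)
  have hle := towerLe_nextTower (Z := Z) h
  rw [e]
  refine (Agree.newAt_iff (X := 𝔐.nextTower X Z) (X' := 𝔐.nextTower X Z) ⟨fun _ _ _ => Iff.rfl,
    fun _ _ => Iff.rfl, fun _ _ _ _ _ => Iff.rfl⟩ (fun x hx z hz => ?_) (hB.sat_iff h)
    (fun _ => Iff.rfl)).2 (newAt_fresh h hs)
  exact h.in_left z x ((hle.in_iff x hx z).2 hz)

theorem fresh_not_newAtLevel {s B : 𝔐.carrier} (hs : 𝔐.Fresh X Z s) (hB : B ∈ 𝔐.tL X) :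
    ¬ 𝔐.NewAtLevel (𝔐.nextTower X Z) B (𝔐.pr s s) := by
  have hle := towerLe_nextTower (Z := Z) h
  rintro ⟨⟨s', e, hs'⟩, -⟩
  obtain ⟨rfl, -⟩ := pr_inj.1 e
  obtain ⟨_, _, _, -, -, hsc, -⟩ := hs.exists_raw
  obtain ⟨r, hr⟩ := hsc.nonempty
  obtain ⟨t, c, p, rfl, ht, -⟩ := hsc.mem_of_mem hr
  obtain ⟨t', c', p', e, ht', -⟩ := hs'.mem_of_mem hr
  obtain ⟨rfl, -⟩ := pr_inj.1 e
  rw [← hle.extn_eq h hB] at ht'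
  have ht'' := (((hle.agree h).mono fun z hz => h.in_left _ _ hz).tagAt_iff (h.extn_trans hB)).2 ht'
  exact ht''.not_tagAt hB (h.level_name B hB) ht

include hX hZc in
/-- A definable class which is not in the tower gets a fresh name if there is a tag. -/
theorem exists_fresh {t c p : 𝔐.carrier} (ht : 𝔐.TagAt (𝔐.tN X) X t)
    (hne : ¬ ∃ y, y ∈ 𝔐.tN X ∧ ∀ z, 𝔐.In X z y ↔ z ∈ 𝔐.tN X ∧ 𝔐.pr c (𝔐.pr z p) ∈ Z) :
    ∃ s, 𝔐.Fresh X Z s ∧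
      ∀ z, 𝔐.FreshIn X Z z (𝔐.pr s s) ↔ z ∈ 𝔐.tN X ∧ 𝔐.pr c (𝔐.pr z p) ∈ Z := by
  have : Fact (X ∈ 𝔐.classes) := ⟨hX⟩
  have : Fact (Z ∈ 𝔐.classes) := ⟨hZc⟩
  have hden : ∀ z, 𝔐.Den X Z (𝔐.pr t (𝔐.pr c p)) z ↔ z ∈ 𝔐.tN X ∧ 𝔐.pr c (𝔐.pr z p) ∈ Z := by
    intro z
    constructor
    · rintro ⟨t', c', p', e, h⟩
      simp only [pr_inj] at e
      obtain ⟨rfl, rfl, rfl⟩ := e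
      exact h
    · intro h; exact ⟨t, c, p, rfl, h⟩
  obtain ⟨s, hs⟩ := exists_isScott (X := {r' | 𝔐.Cand X r' ∧
    ∀ z, 𝔐.Den X Z r' z ↔ 𝔐.Den X Z (𝔐.pr t (𝔐.pr c p)) z}) (setOf_mem' _)
    ⟨_, ⟨t, c, p, rfl, ht⟩, fun _ => Iff.rfl⟩
  have hf : 𝔐.Fresh X Z s := ⟨_, ⟨t, c, p, rfl, ht⟩, by simpa only [hden] using hne, hs⟩
  refine ⟨s, hf, fun z => ?_⟩
  rw [← hden]
  constructor
  · rintro ⟨s', e, -, r, hrs, hd⟩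
    obtain ⟨rfl, -⟩ := pr_inj.1 e
    exact ((hs.mem_of_mem hrs).2 z).1 hd
  · intro hz
    obtain ⟨r, hrs⟩ := hs.nonempty
    exact ⟨s, rfl, hf, r, hrs, ((hs.mem_of_mem hrs).2 z).2 hz⟩

include hX hZc hZ in
/-- The class of all names is definable and not in the tower. -/
theorem exists_freshTop {t : 𝔐.carrier} (ht : 𝔐.TagAt (𝔐.tN X) X t) : ∃ B, 𝔐.FreshTop X Z B := by
  -- a code of the form `¬ (φ ∧ ¬ φ)`
  have htrue : ∀ v, 𝔐.pr (𝔐.nandC 𝔐.o (𝔐.negC 𝔐.o)) v ∈ Z := fun v => by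
    rw [hZ.nandC_iff, hZ.negC_iff]; tauto
  obtain ⟨s, hs, hin⟩ := exists_fresh h hX hZc (c := 𝔐.nandC 𝔐.o (𝔐.negC 𝔐.o)) (p := 𝔐.o) ht (by
    rintro ⟨y, hy, hext⟩
    exact h.irrefl hX y ((hext y).2 ⟨hy, htrue _⟩))
  exact ⟨_, ⟨s, rfl, hs⟩, fun z hz => (hin z).2 ⟨hz, htrue _⟩⟩

include hX hZc hZ in
/-- A tower with a tag can be prolonged by one stage. -/
theorem isTower_nextTower {t : 𝔐.carrier} (ht : 𝔐.TagAt (𝔐.tN X) X t) :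
    𝔐.IsTower (𝔐.nextTower X Z) := by
  have hle := towerLe_nextTower (Z := Z) h
  obtain ⟨T, hT⟩ := exists_freshTop h hX hZc hZ ht
  have hold : ∀ {x z}, x ∈ 𝔐.tN X → (𝔐.In (𝔐.nextTower X Z) z x ↔ 𝔐.In X z x) := fun hx =>
    (hle.in_iff _ hx _).symm
  have hleft : ∀ x y, 𝔐.In (𝔐.nextTower X Z) x y → x ∈ 𝔐.tN X := fun x y hxy => by
    rcases in_nextTower.1 hxy with hxy | ⟨-, -, -, r, -, t, c, p, -, hz, -⟩
    · exact h.in_left _ _ hxy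
    · exact hz
  constructor
  · exact fun x y hxy => hle.name x (hleft x y hxy)
  · intro x y hxy
    rw [mem_tN_nextTower]
    rcases in_nextTower.1 hxy with hxy | ⟨s, rfl, hs, -⟩
    · exact Or.inl (h.in_right _ _ hxy)
    · exact Or.inr ⟨s, rfl, hs⟩
  · intro B hB
    rw [mem_tN_nextTower]
    exact (mem_tL_nextTower.1 hB).imp (h.level_name B) And.left
  · exact fun x => hle.name _ (h.base x)
  · intro x z
    rw [hold (h.base x), h.base_in]
  · rintro s ⟨x, hx⟩ hs
    have : Fact (X ∈ 𝔐.classes) := ⟨hX⟩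
    by_cases hsX : ∃ y, 𝔐.mem y s ∧ y ∈ 𝔐.tN X
    · obtain ⟨s', hs'⟩ := sep s fun y => y ∈ 𝔐.tN X
      obtain ⟨y, hy⟩ := hsX
      obtain ⟨y, hy, hmin⟩ := h.wf s' ⟨y, (hs' y).2 hy⟩ fun y hy => ((hs' y).1 hy).2
      obtain ⟨hys, hyX⟩ := (hs' y).1 hy
      refine ⟨y, hys, fun z hz hzy => ?_⟩
      have hzy' := (hold hyX).1 hzy
      exact hmin z ((hs' z).2 ⟨hz, h.in_left _ _ hzy'⟩) hzy'
    · exact ⟨x, hx, fun y hy hyx => hsX ⟨y, hy, hleft y x hyx⟩⟩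
  · have key : ∀ x ∈ 𝔐.tN X, ∀ s, 𝔐.Fresh X Z s →
        ¬ ∀ z, 𝔐.In (𝔐.nextTower X Z) z x ↔ 𝔐.In (𝔐.nextTower X Z) z (𝔐.pr s s) := by
      intro x hx s hs hext
      obtain ⟨t, c, p, ht, hne, hsc, hin⟩ := hs.exists_raw
      exact hne ⟨x, hx, fun z => by rw [← hold hx, hext, in_fresh h hs, hin]⟩
    intro x hx y hy hext
    rcases mem_tN_nextTower.1 hx with hx | ⟨s, rfl, hs⟩ <;>
      rcases mem_tN_nextTower.1 hy with hy | ⟨s', rfl, hs'⟩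
    · exact h.ext x hx y hy fun z => by rw [← hold hx, hext, hold hy]
    · exact absurd hext (key x hx s' hs')
    · exact absurd (fun z => (hext z).symm) (key y hy s hs)
    · refine NewAt.eq (S := 𝔐.tN X) (X := 𝔐.nextTower X Z) (X' := 𝔐.nextTower X Z)
        ⟨fun _ _ _ => Iff.rfl, fun _ _ => Iff.rfl, fun _ _ _ _ _ => Iff.rfl⟩ (fun x hx z hz => ?_)
        (fun _ _ => Iff.rfl) hext (newAt_fresh h hs) (newAt_fresh h hs')
      exact hleft z x hz
  · intro B hB x
    rcases mem_tL_nextTower.1 hB with hB | hB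
    · exact (hold (h.level_name B hB)).2 (h.level_base B hB x)
    · exact (hB.in_iff h _).2 (h.base x)
  · intro B hB z w hz hw
    have hz' := hleft _ _ hz
    have hw' := (hold hz').1 hw
    rcases mem_tL_nextTower.1 hB with hB | hB
    · rw [hold (h.level_name B hB)] at hz ⊢
      exact h.level_trans B hB z w hz hw'
    · exact (hB.in_iff h _).2 (h.in_left _ _ hw')
  · intro B hB
    rcases mem_tL_nextTower.1 hB with hB | hB
    · rw [← hle.extn_eq h hB]
      exact (h.level_sat B hB).congr (fun x hx => hle.in_iff x (h.in_left _ _ hx)) (hle.sat B hB)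
    · have e : 𝔐.extn (𝔐.nextTower X Z) B = 𝔐.tN X := Set.ext (hB.in_iff h)
      rw [e]
      exact hZ.congr hle.in_iff fun c v => (hB.sat_iff h c v).symm
  · intro B hB
    rcases mem_tL_nextTower.1 hB with hB | hB
    · exact (hle.newAtLevel_iff h hB (h.level_name B hB)).1 (h.level_new B hB)
    · obtain ⟨s, rfl, hs⟩ := hB.1
      exact newAtLevel_fresh h hs hB
  · intro B hB c p
    rcases mem_tL_nextTower.1 hB with hB | hB
    · obtain ⟨x, hx, hx', hext⟩ := h.closed B hB c p
      refine ⟨x, hle.name x hx, hx'.imp (hle.in_of_in h) (hle.newAtLevel_iff h hB hx).1, fun z => ?_⟩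
      rw [hold hx, hext, hold (h.level_name B hB), hle.sat B hB]
    · simp only [hB.in_iff h, hB.sat_iff h]
      by_cases hex : ∃ y, y ∈ 𝔐.tN X ∧ ∀ z, 𝔐.In X z y ↔ z ∈ 𝔐.tN X ∧ 𝔐.pr c (𝔐.pr z p) ∈ Z
      · obtain ⟨y, hy, hext⟩ := hex
        exact ⟨y, hle.name y hy, Or.inl hy, fun z => by rw [hold hy, hext]⟩
      · obtain ⟨s, hs, hin⟩ := exists_fresh h hX hZc ht hex
        exact ⟨_, mem_tN_nextTower.2 (Or.inr ⟨s, rfl, hs⟩), Or.inr (newAtLevel_fresh h hs hB),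
          fun z => by rw [in_fresh h hs, hin]⟩
  · intro x hx
    rcases mem_tN_nextTower.1 hx with hx | ⟨s, rfl, hs⟩
    · exact (h.source x hx).imp_right fun ⟨B, hB, hnew⟩ =>
        ⟨B, mem_tL_nextTower.2 (Or.inl hB), (hle.newAtLevel_iff h hB hx).1 hnew⟩
    · exact Or.inr ⟨T, mem_tL_nextTower.2 (Or.inr hT), newAtLevel_fresh h hs hT⟩
  · have hext : ∀ {B C}, 𝔐.FreshTop X Z B → 𝔐.FreshTop X Z C → B = C := by
      intro B C hB hC
      have key := fun z => (hB.in_iff h z).trans (hC.in_iff h z).symm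
      obtain ⟨s, rfl, hs⟩ := hB.1
      obtain ⟨s', rfl, hs'⟩ := hC.1
      exact NewAt.eq (S := 𝔐.tN X) (X := 𝔐.nextTower X Z) (X' := 𝔐.nextTower X Z)
        ⟨fun _ _ _ => Iff.rfl, fun _ _ => Iff.rfl, fun _ _ _ _ _ => Iff.rfl⟩
        (fun x hx z hz => hleft z x hz)
        (fun _ _ => Iff.rfl) key (newAt_fresh h hs) (newAt_fresh h hs')
    intro B hB C hC
    rcases mem_tL_nextTower.1 hB with hB | hB <;> rcases mem_tL_nextTower.1 hC with hC | hC
    · exact (h.linear B hB C hC).imp (hle.in_of_in h) (Or.imp_right (hle.in_of_in h))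
    · exact Or.inl ((hC.in_iff h B).2 (h.level_name B hB))
    · exact Or.inr (Or.inr ((hB.in_iff h C).2 (h.level_name C hC)))
    · exact Or.inr (Or.inl (hext hB hC))
  · intro B hB C hC hBC x hx hnew
    have hBN := hleft _ _ hBC
    have hB : B ∈ 𝔐.tL X := (hle.level B hBN).2 hB
    rcases mem_tN_nextTower.1 hx with hx | ⟨s, rfl, hs⟩
    · rcases mem_tL_nextTower.1 hC with hC | hC
      · rw [hold (h.level_name C hC)] at hBC ⊢
        exact h.up B hB C hC hBC x hx ((hle.newAtLevel_iff h hB hx).2 hnew)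
      · exact (hC.in_iff h x).2 hx
    · exact absurd hnew (fresh_not_newAtLevel h hs hB)
  · intro B c w hw
    rw [mem_tL_nextTower]
    exact (mem_tY_nextTower.1 hw).imp (h.sat_level B c w) And.left

end Next

end ClassModel

end ClassTheory

namespace ClassTheory
open SetFormula

/-! ### Admissible graphs -/

theorem realize_equiv {A B : Type u} {e : A → A → Prop} {e' : B → B → Prop} (f : A ≃ B)
    (hf : ∀ a b, e' (f a) (f b) ↔ e a b) {n m : ℕ} (φ : SetFormula n m) :
    ∀ (v : Fin n → A) (W : Fin m → Set A), φ.Realize e' (fun i => f (v i)) (fun j => f '' W j) ↔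
      φ.Realize e v W := by
  induction φ with
  | eq i j => intro v W; exact f.injective.eq_iff
  | mem i j => intro v W; exact hf _ _
  | memClass i J => intro v W; exact f.injective.mem_set_image
  | neg φ ih => intro v W; exact not_congr (ih v W)
  | and φ ψ ih ih' => intro v W; exact and_congr (ih v W) (ih' v W)
  | all φ ih =>
    intro v W
    refine f.symm.forall_congr fun {b} => ?_
    rw [← ih]
    apply iff_of_eq; congr 1
    funext i
    refine Fin.cases ?_ (fun i => ?_) i <;> simp

theorem ModelsKP.of_equiv {A B : Type u} {e : A → A → Prop} {e' : B → B → Prop} (f : A ≃ B)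
    (hf : ∀ a b, e' (f a) (f b) ↔ e a b) (h : ModelsKP A e) : ModelsKP B e' := by
  have hr : ∀ {n : ℕ} (φ : SetFormula n 0) (v : Fin n → B),
      φ.Realize e' v Fin.elim0 ↔ φ.Realize e (fun i => f.symm (v i)) Fin.elim0 := fun φ v => by
    rw [← realize_equiv f hf]
    apply iff_of_eq; congr 1
    · funext i; simp
    · funext j; exact j.elim0
  have hf' : ∀ a b, e' a b ↔ e (f.symm a) (f.symm b) := fun a b => by rw [← hf]; simp
  have hcons : ∀ {n : ℕ} (x : B) (p : Fin n → B), (fun i => f.symm ((Fin.cons x p :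
      Fin (n + 1) → B) i)) = Fin.cons (f.symm x) fun i => f.symm (p i) := fun x p => by
    funext i
    refine Fin.cases ?_ (fun i => ?_) i <;> simp
  constructor
  · intro x y hxy
    refine f.symm.injective (h.extensionality _ _ fun z => ?_)
    have := hxy (f z)
    simpa [hf'] using this
  · intro x
    obtain ⟨y, hy⟩ := h.union (f.symm x)
    refine ⟨f y, fun z => ?_⟩
    rw [hf', f.symm_apply_apply, hy]
    refine f.exists_congr fun w => ?_
    simp [hf']
  · intro x y
    obtain ⟨z, hz⟩ := h.pairing (f.symm x) (f.symm y)
    refine ⟨f z, fun w => ?_⟩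
    rw [hf', f.symm_apply_apply, hz]
    simp
  · intro n φ p hx
    simp only [hr, hcons] at hx ⊢
    obtain ⟨x, hx⟩ := hx
    obtain ⟨x, hx, hmin⟩ := h.foundation φ _ ⟨_, hx⟩
    refine ⟨f x, by simpa using hx, fun y hy => hmin _ ?_⟩
    rw [hf'] at hy
    simpa using hy
  · intro n φ hφ p a
    obtain ⟨b, hb⟩ := h.separation φ hφ (fun i => f.symm (p i)) (f.symm a)
    refine ⟨f b, fun x => ?_⟩
    rw [hf', f.symm_apply_apply, hb, hf', hr, hcons]
  · intro n φ hφ p a ha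
    simp only [hr, hcons] at ha ⊢
    obtain ⟨b, hb⟩ := h.collection φ hφ (fun i => f.symm (p i)) (f.symm a) fun x hx => by
      obtain ⟨y, hy⟩ := ha (f x) (by rw [hf']; simpa using hx)
      exact ⟨_, by simpa using hy⟩
    refine ⟨f b, fun x hx => ?_⟩
    obtain ⟨y, hy, hxy⟩ := hb (f.symm x) ((hf' _ _).1 hx)
    exact ⟨f y, by rw [hf']; simpa using hy, by simpa using hxy⟩

theorem realizeIn_rename {A : Type u} {S : Set A} {e : A → A → Prop} {n m : ℕ} (φ : SetFormula n m) :
    ∀ {n' m' : ℕ} (σ : Fin n → Fin n') (τ : Fin m → Fin m') (v : Fin n' → A),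
      ClassModel.RealizeIn S e (φ.rename σ τ) v ↔ ClassModel.RealizeIn S e φ fun i => v (σ i) := by
  induction φ with
  | eq i j => intros; rfl
  | mem i j => intros; rfl
  | memClass i J => intros; rfl
  | neg φ ih => intros; exact not_congr (ih _ _ _)
  | and φ ψ ih ih' => intros; exact and_congr (ih _ _ _) (ih' _ _ _)
  | all φ ih =>
    intro n' m' σ τ v
    refine forall_congr' fun a => forall_congr' fun _ => ?_
    rw [ih]
    apply iff_of_eq; congr 1
    funext i
    refine Fin.cases ?_ (fun i => ?_) i <;> simp

namespace ClassModel

variable {𝔐 : ClassModel.{u}} [hM : Nbg 𝔐]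

/-- `(N, R)` is an admissible set over `V`, presented by a well-founded graph whose nodes stand for
its elements. -/
structure IsAdm (𝔐 : ClassModel.{u}) [hM : Nbg 𝔐] (N R : Set 𝔐.carrier) : Prop where
  graph : 𝔐.IsGraph N R
  kp : ModelsKP {a // a ∈ N} fun a b => 𝔐.Rel R a.1 b.1
  copy : ∃ v ∈ N, ∃ F, 𝔐.IsCopyOfV ⟨N, R, v⟩ v F

theorem rel_quot_o {N R : Set 𝔐.carrier} {b : 𝔐.carrier} :
    𝔐.Rel (𝔐.quot N R).rel b 𝔐.o ↔ ∃ x, x ∈ N ∧ b = 𝔐.pr x 𝔐.o := by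
  rw [rel_quot]
  constructor
  · rintro ⟨-, x, rfl, hx⟩
    exact ⟨x, lab_o.1 hx, rfl⟩
  · rintro ⟨x, hx, rfl⟩
    exact ⟨Or.inl rfl, x, rfl, lab_o.2 hx⟩

theorem rel_quot_pr {N R : Set 𝔐.carrier} (hR : ∀ x y, 𝔐.Rel R x y → y ∈ N) {b y : 𝔐.carrier} :
    𝔐.Rel (𝔐.quot N R).rel b (𝔐.pr y 𝔐.o) ↔ ∃ x, b = 𝔐.pr x 𝔐.o ∧ 𝔐.Rel R x y := by
  rw [rel_quot]
  constructor
  · rintro ⟨-, x, rfl, hx⟩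
    exact ⟨x, rfl, lab_pr.1 hx⟩
  · rintro ⟨x, rfl, hx⟩
    exact ⟨Or.inr ⟨y, hR x y hx, rfl⟩, x, rfl, lab_pr.2 hx⟩

theorem rel_quot_pr_pr {N R : Set 𝔐.carrier} (hR : ∀ x y, 𝔐.Rel R x y → y ∈ N) {x y : 𝔐.carrier} :
    𝔐.Rel (𝔐.quot N R).rel (𝔐.pr x 𝔐.o) (𝔐.pr y 𝔐.o) ↔ 𝔐.Rel R x y := by
  rw [rel_quot_pr hR]
  constructor
  · rintro ⟨x', e, h⟩
    rwa [(pr_inj.1 e).1]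
  · intro h; exact ⟨x, rfl, h⟩

theorem IsAdm.isAdmissibleOverV {N R : Set 𝔐.carrier} (h : 𝔐.IsAdm N R) :
    𝔐.IsAdmissibleOverV (𝔐.quot N R) := by
  have hR := h.graph.right
  refine ⟨h.graph.isQuotientPair_quot, ?_, ?_, ?_⟩
  · intro b c hb hc
    obtain ⟨y, -, rfl⟩ := rel_quot_o.1 hb
    obtain ⟨x, rfl, hx⟩ := (rel_quot_pr hR).1 hc
    exact rel_quot_o.2 ⟨x, h.graph.left _ _ hx, rfl⟩
  · let f : {a // a ∈ N} → {b // 𝔐.Rel (𝔐.quot N R).rel b (𝔐.quot N R).top} := fun a =>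
      ⟨𝔐.pr a.1 𝔐.o, rel_quot_o.2 ⟨a.1, a.2, rfl⟩⟩
    have hf : Function.Bijective f := by
      constructor
      · intro a b hab
        have e : 𝔐.pr a.1 𝔐.o = 𝔐.pr b.1 𝔐.o := congrArg Subtype.val hab
        exact Subtype.ext (pr_inj.1 e).1
      · rintro ⟨b, hb⟩
        obtain ⟨x, hx, rfl⟩ := rel_quot_o.1 hb
        exact ⟨⟨x, hx⟩, rfl⟩
    exact h.kp.of_equiv (Equiv.ofBijective f hf) fun a b => rel_quot_pr_pr hR
  · obtain ⟨v, hv, F, hF⟩ := h.copy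
    have : Fact (F ∈ 𝔐.classes) := ⟨hF.class_mem⟩
    have hG : ∀ x c, 𝔐.Rel {w | ∃ x c, w = 𝔐.pr x c ∧ ∃ c', c = 𝔐.pr c' 𝔐.o ∧ 𝔐.Rel F x c'} x c ↔
        ∃ c', c = 𝔐.pr c' 𝔐.o ∧ 𝔐.Rel F x c' := fun x c =>
      rel_setOf_pr (P := fun x c => ∃ c', c = 𝔐.pr c' 𝔐.o ∧ 𝔐.Rel F x c')
    refine ⟨𝔐.pr v 𝔐.o, {w | ∃ x c, w = 𝔐.pr x c ∧ ∃ c', c = 𝔐.pr c' 𝔐.o ∧ 𝔐.Rel F x c'},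
      rel_quot_o.2 ⟨v, hv, rfl⟩, setOf_mem' _, ?_, ?_, ?_, ?_, ?_⟩
    · intro x
      obtain ⟨c, hc, huniq⟩ := hF.total x
      refine ⟨_, (hG _ _).2 ⟨c, rfl, hc⟩, fun c' hc' => ?_⟩
      obtain ⟨d, rfl, hd⟩ := (hG _ _).1 hc'
      rw [huniq d hd]
    · intro x c hc
      obtain ⟨c₁, rfl, hc₁⟩ := (hG _ _).1 hc
      exact (rel_quot_pr_pr hR).2 (hF.range x c₁ hc₁)
    · intro c hc
      obtain ⟨c₁, rfl, hc₁⟩ := (rel_quot_pr hR).1 hc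
      obtain ⟨x, hx, huniq⟩ := hF.bijective c₁ hc₁
      refine ⟨x, (hG _ _).2 ⟨c₁, rfl, hx⟩, fun y hy => ?_⟩
      obtain ⟨c', e, hy⟩ := (hG _ _).1 hy
      obtain ⟨rfl, -⟩ := pr_inj.1 e
      exact huniq y hy
    · intro x y c d hc hd
      obtain ⟨c₁, rfl, hc₁⟩ := (hG _ _).1 hc
      obtain ⟨d₁, rfl, hd₁⟩ := (hG _ _).1 hd
      rw [rel_quot_pr_pr hR]
      exact hF.mem_iff x y c₁ d₁ hc₁ hd₁
    · intro c d hc hd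
      obtain ⟨c₁, rfl, hc₁⟩ := (rel_quot_pr hR).1 hc
      obtain ⟨d₁, rfl, hd₁⟩ := (rel_quot_pr hR).1 hd
      exact (rel_quot_pr_pr hR).2 (hF.transitive c₁ d₁ hc₁ hd₁)

/-! ### A tower without a tag is admissible -/

section NoTag

variable {X : Set 𝔐.carrier} (h : 𝔐.IsTower X) (hX : X ∈ 𝔐.classes)
  (hno : ∀ t, ¬ 𝔐.TagAt (𝔐.tN X) X t)

include h

theorem level_in_trans {x B C : 𝔐.carrier} (hC : C ∈ 𝔐.tL X) (hx : 𝔐.In X x B) (hB : 𝔐.In X B C) :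
    𝔐.In X x C := h.level_trans C hC B x hB hx

include hno

/-- There is a level: without levels, even the empty set gives rise to a tag. -/
theorem exists_level : ∃ B, B ∈ 𝔐.tL X := by
  by_contra hc
  push Not at hc
  have hz : ∀ x, ¬ 𝔐.In X x (𝔐.iota 𝔐.o) := fun x hx => by
    obtain ⟨y, hy, -⟩ := (h.base_in _ _).1 hx
    exact not_mem_o y hy
  exact hno _ ⟨𝔐.o, 𝔐.o, 𝔐.iota 𝔐.o, 𝔐.iota 𝔐.o, rfl, h.base _, h.base _,
    fun x hx => absurd hx (hz x), fun ⟨B, _, hB, _⟩ => hc B hB⟩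

/-- There is no last level: it would be singled out by the condition of being equal to it. -/
theorem exists_next_level {B : 𝔐.carrier} (hB : B ∈ 𝔐.tL X) : ∃ C, C ∈ 𝔐.tL X ∧ 𝔐.In X B C := by
  by_contra hc
  have hhit : ∀ x D, 𝔐.Hit X (𝔐.eqC 1) (𝔐.pr B 𝔐.o) (𝔐.iota 𝔐.o) x D ↔ D = B := by
    intro x D
    constructor
    · rintro ⟨hD, -, hs⟩
      rw [eqC, (h.level_sat D hD).skipC_iff, (h.level_sat D hD).eqC_zero_iff] at hs
      exact hs
    · rintro rfl
      refine ⟨hB, h.level_base D hB _, ?_⟩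
      rw [eqC, (h.level_sat D hB).skipC_iff, (h.level_sat D hB).eqC_zero_iff]
  refine hno _ ⟨𝔐.eqC 1, 𝔐.pr B 𝔐.o, 𝔐.iota (𝔐.sc 𝔐.o), 𝔐.iota 𝔐.o, rfl, h.base _, h.base _,
    fun x hx => ⟨B, h.level_name B hB, (hhit x B).2 rfl⟩, ?_⟩
  rintro ⟨C, -, hC, hall⟩
  obtain ⟨D, hD, hD'⟩ := hall (𝔐.iota 𝔐.o) ((h.base_in _ _).2 ⟨𝔐.o, mem_sc.2 (Or.inr rfl), rfl⟩)
  rw [(hhit _ D).1 hD'] at hD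
  exact hc ⟨C, hC, hD⟩

theorem exists_level_of_mem {x : 𝔐.carrier} (hx : x ∈ 𝔐.tN X) : ∃ B, B ∈ 𝔐.tL X ∧ 𝔐.In X x B := by
  rcases h.source x hx with ⟨y, rfl⟩ | ⟨B, hB, hnew⟩
  · obtain ⟨B, hB⟩ := exists_level h hno
    exact ⟨B, hB, h.level_base B hB y⟩
  · obtain ⟨C, hC, hBC⟩ := exists_next_level h hno hB
    exact ⟨C, hC, h.up B hB C hC hBC x hx hnew⟩

theorem exists_level_pair {x y : 𝔐.carrier} (hx : x ∈ 𝔐.tN X) (hy : y ∈ 𝔐.tN X) :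
    ∃ B, B ∈ 𝔐.tL X ∧ 𝔐.In X x B ∧ 𝔐.In X y B := by
  obtain ⟨B, hB, hx⟩ := exists_level_of_mem h hno hx
  obtain ⟨C, hC, hy⟩ := exists_level_of_mem h hno hy
  rcases h.linear B hB C hC with h1 | rfl | h1
  · exact ⟨C, hC, level_in_trans h hC hx h1, hy⟩
  · exact ⟨B, hB, hx, hy⟩
  · exact ⟨B, hB, hx, level_in_trans h hB hy h1⟩

theorem exists_level_all {n : ℕ} (p : Fin n → 𝔐.carrier) (hp : ∀ i, p i ∈ 𝔐.tN X) :
    ∃ B, B ∈ 𝔐.tL X ∧ ∀ i, 𝔐.In X (p i) B := by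
  induction n with
  | zero =>
    obtain ⟨B, hB⟩ := exists_level h hno
    exact ⟨B, hB, fun i => i.elim0⟩
  | succ n ih =>
    obtain ⟨B, hB, hall⟩ := ih (fun i => p i.succ) fun i => hp _
    obtain ⟨C, hC, h0, hBC⟩ := exists_level_pair h hno (hp 0) (h.level_name B hB)
    refine ⟨C, hC, fun i => ?_⟩
    refine Fin.cases h0 (fun i => ?_) i
    exact level_in_trans h hC (hall i) hBC

omit hno in
theorem exists_definable {B : 𝔐.carrier} (hB : B ∈ 𝔐.tL X) {n : ℕ} (φ : SetFormula (n + 1) 0)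
    (p : Fin n → 𝔐.carrier) (hp : ∀ i, 𝔐.In X (p i) B) : ∃ y, y ∈ 𝔐.tN X ∧ ∀ z, 𝔐.In X z y ↔
      𝔐.In X z B ∧ RealizeIn (𝔐.extn X B) (𝔐.In X) φ (Fin.cons z p) := by
  obtain ⟨y, hy, -, hext⟩ := h.closed B hB (𝔐.code φ) (𝔐.list p)
  refine ⟨y, hy, fun z => ?_⟩
  rw [hext]
  refine and_congr_right fun hz => ?_
  rw [← list_cons]
  refine (h.level_sat B hB).code_iff φ _ fun i => ?_
  refine Fin.cases hz (fun i => ?_) i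
  exact hp i

theorem exists_inter {a b : 𝔐.carrier} (ha : a ∈ 𝔐.tN X) (hb : b ∈ 𝔐.tN X) :
    ∃ y, y ∈ 𝔐.tN X ∧ ∀ z, 𝔐.In X z y ↔ 𝔐.In X z a ∧ 𝔐.In X z b := by
  obtain ⟨B, hB, haB, hbB⟩ := exists_level_pair h hno ha hb
  obtain ⟨y, hy, hext⟩ := exists_definable h hB (n := 2) (.and (.mem 0 1) (.mem 0 2)) ![a, b]
    (fun i => by fin_cases i <;> assumption)
  refine ⟨y, hy, fun z => ?_⟩
  rw [hext]
  simp only [RealizeIn]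
  exact and_iff_right_of_imp fun hz => h.level_trans B hB a z haB hz.1

omit hno in
theorem realizeIn_level {B : 𝔐.carrier} (hB : B ∈ 𝔐.tL X) {n m : ℕ} {φ : SetFormula n m}
    (hφ : φ.IsDelta0) (v : Fin n → 𝔐.carrier) (hv : ∀ i, 𝔐.In X (v i) B) :
    RealizeIn (𝔐.extn X B) (𝔐.In X) φ v ↔ RealizeIn (𝔐.tN X) (𝔐.In X) φ v :=
  realizeIn_delta0 (fun _ hz => h.in_left _ _ hz) (h.extn_trans hB) hφ v hv

theorem tower_separation {n : ℕ} {φ : SetFormula (n + 1) 0} (hφ : φ.IsDelta0)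
    (p : Fin n → 𝔐.carrier) (hp : ∀ i, p i ∈ 𝔐.tN X) {a : 𝔐.carrier} (ha : a ∈ 𝔐.tN X) :
    ∃ y, y ∈ 𝔐.tN X ∧ ∀ z, 𝔐.In X z y ↔
      𝔐.In X z a ∧ RealizeIn (𝔐.tN X) (𝔐.In X) φ (Fin.cons z p) := by
  obtain ⟨B, hB, hall⟩ := exists_level_all h hno (Fin.cons a p : Fin (n + 1) → _)
    (fun i => Fin.cases ha (fun i => hp i) i)
  obtain ⟨w, hw, hwext⟩ := exists_definable h hB φ p fun i => hall i.succ
  obtain ⟨y, hy, hext⟩ := exists_inter h hno ha hw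
  refine ⟨y, hy, fun z => ?_⟩
  rw [hext]
  refine and_congr_right fun hz => ?_
  have hzB : 𝔐.In X z B := h.level_trans B hB a z (hall 0) hz
  rw [hwext, realizeIn_level h hB hφ, and_iff_right hzB]
  intro i
  exact Fin.cases hzB (fun i => hall i.succ) i

/-- A failure of `Δ₀`-Collection yields a tag: the levels that contain a witness are not bounded. -/
theorem tower_collection {n : ℕ} {φ : SetFormula (n + 2) 0} (hφ : φ.IsDelta0)
    (p : Fin n → 𝔐.carrier) (hp : ∀ i, p i ∈ 𝔐.tN X) {a : 𝔐.carrier} (ha : a ∈ 𝔐.tN X)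
    (hall : ∀ x, 𝔐.In X x a → ∃ y, y ∈ 𝔐.tN X ∧
      RealizeIn (𝔐.tN X) (𝔐.In X) φ (Fin.cons x (Fin.cons y p))) :
    ∃ b, b ∈ 𝔐.tN X ∧ ∀ x, 𝔐.In X x a → ∃ y, 𝔐.In X y b ∧
      RealizeIn (𝔐.tN X) (𝔐.In X) φ (Fin.cons x (Fin.cons y p)) := by
  obtain ⟨b, hb, hbp⟩ := exists_level_all h hno (Fin.cons a p : Fin (n + 1) → _)
    (fun i => Fin.cases ha (fun i => hp i) i)
  -- the universal quantifier only serves to get rid of the first entry of the list, a level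
  have hhit : ∀ x D, 𝔐.In X x a → (𝔐.Hit X (𝔐.allC (𝔐.skipC (𝔐.exC (𝔐.code (φ.rename
      (Fin.cons 2 (Fin.cons 0 fun i => i.succ.succ.succ) : Fin (n + 2) → Fin (n + 3)) id)))))
      (𝔐.list p) b x D ↔ D ∈ 𝔐.tL X ∧ 𝔐.In X b D ∧ ∃ y, 𝔐.In X y D ∧
        RealizeIn (𝔐.tN X) (𝔐.In X) φ (Fin.cons x (Fin.cons y p))) := by
    intro x D hx
    refine and_congr_right fun hD => and_congr_right fun hbD => ?_
    have hs := h.level_sat D hD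
    have hpD : ∀ i, 𝔐.In X ((Fin.cons x p : Fin (n + 1) → _) i) D := fun i => by
      refine Fin.cases ?_ (fun i => ?_) i
      · exact h.level_trans D hD b x hbD (h.level_trans b hb a x (hbp 0) hx)
      · exact h.level_trans D hD b _ hbD (hbp i.succ)
    have key : ∀ x', 𝔐.In X x' D → (𝔐.pr (𝔐.exC (𝔐.code (φ.rename
        (Fin.cons 2 (Fin.cons 0 fun i => i.succ.succ.succ) : Fin (n + 2) → Fin (n + 3)) id)))
        (𝔐.pr x' (𝔐.pr x (𝔐.list p))) ∈ 𝔐.tY X D ↔ ∃ y, 𝔐.In X y D ∧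
          RealizeIn (𝔐.tN X) (𝔐.In X) φ (Fin.cons x (Fin.cons y p))) := fun x' hx' => by
      rw [hs.exC_iff]
      refine exists_congr fun y => and_congr_right fun hy => ?_
      have hv : ∀ i, 𝔐.In X ((Fin.cons y (Fin.cons x' (Fin.cons x p)) : Fin (n + 3) → _) i) D :=
        fun i => Fin.cases hy (fun i => Fin.cases hx' (fun i => hpD i) i) i
      rw [← list_cons, ← list_cons, ← list_cons, hs.code_iff _ _ hv, realizeIn_rename]
      have e : (fun i => (Fin.cons y (Fin.cons x' (Fin.cons x p)) : Fin (n + 3) → 𝔐.carrier)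
          ((Fin.cons 2 (Fin.cons 0 fun i => i.succ.succ.succ) : Fin (n + 2) → Fin (n + 3)) i)) =
          Fin.cons x (Fin.cons y p) := by
        funext i
        refine Fin.cases rfl (fun i => Fin.cases rfl (fun i => ?_) i) i
        simp
      rw [← realizeIn_level h hD hφ, ← e]
      · rfl
      · intro i
        exact Fin.cases (hpD 0) (fun i => Fin.cases hy (fun i => hpD i.succ) i) i
    rw [hs.allC_iff]
    constructor
    · intro hx'
      have h0 := h.level_base D hD 𝔐.o
      have := hx' _ h0
      rw [hs.skipC_iff] at this
      exact (key _ h0).1 this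
    · intro hy x' hx'
      rw [hs.skipC_iff]
      exact (key x' hx').2 hy
  by_contra hc
  refine hno _ ⟨𝔐.allC (𝔐.skipC (𝔐.exC (𝔐.code (φ.rename
      (Fin.cons 2 (Fin.cons 0 fun i => i.succ.succ.succ) : Fin (n + 2) → Fin (n + 3)) id)))),
    𝔐.list p, a, b, rfl, ha, h.level_name b hb, fun x hx => ?_, ?_⟩
  · obtain ⟨y, hy, hφ⟩ := hall x hx
    obtain ⟨D, hD, hyD, hbD⟩ := exists_level_pair h hno hy (h.level_name b hb)
    exact ⟨D, h.level_name D hD, (hhit x D hx).2 ⟨hD, hbD, y, hyD, hφ⟩⟩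
  · rintro ⟨B, hBN, hB, hbound⟩
    refine hc ⟨B, hBN, fun x hx => ?_⟩
    obtain ⟨D, hDB, hit⟩ := hbound x hx
    obtain ⟨-, -, y, hy, hφ⟩ := (hhit x D hx).1 hit
    exact ⟨y, level_in_trans h hB hy hDB, hφ⟩

include hX in
/-- Foundation for all formulas holds because definable parts of the tower are classes. -/
theorem tower_modelsKP : ModelsKP {a // a ∈ 𝔐.tN X} fun a b => 𝔐.In X a.1 b.1 := by
  have hr : ∀ {n : ℕ} (φ : SetFormula n 0) (v : Fin n → {a // a ∈ 𝔐.tN X}),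
      φ.Realize (fun a b => 𝔐.In X a.1 b.1) v Fin.elim0 ↔
        RealizeIn (𝔐.tN X) (𝔐.In X) φ fun i => (v i).1 := fun φ v =>
    realize_subtype φ v _ fun j => j.elim0
  have hcons : ∀ {n : ℕ} (x : {a // a ∈ 𝔐.tN X}) (p : Fin n → {a // a ∈ 𝔐.tN X}),
      (fun i => ((Fin.cons x p : Fin (n + 1) → {a // a ∈ 𝔐.tN X}) i).1) =
        Fin.cons x.1 fun i => (p i).1 := fun x p => by
    funext i
    refine Fin.cases ?_ (fun i => ?_) i <;> simp
  constructor
  · intro x y hxy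
    exact Subtype.ext (h.ext x x.2 y y.2 fun z =>
      ⟨fun hz => (hxy ⟨z, h.in_left _ _ hz⟩).1 hz, fun hz => (hxy ⟨z, h.in_left _ _ hz⟩).2 hz⟩)
  · rintro ⟨x, hx⟩
    obtain ⟨B, hB, hxB⟩ := exists_level_of_mem h hno hx
    obtain ⟨y, hy, hext⟩ := exists_definable h hB (n := 1)
      (.neg (.all (.neg (.and (.mem 0 2) (.mem 1 0))))) ![x] (fun i => by fin_cases i; exact hxB)
    refine ⟨⟨y, hy⟩, fun z => ?_⟩
    change 𝔐.In X z y ↔ _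
    rw [hext]
    simp only [RealizeIn, not_forall, not_not]
    constructor
    · rintro ⟨-, w, hw, h1, h2⟩
      exact ⟨⟨w, h.in_left _ _ hw⟩, h1, h2⟩
    · rintro ⟨w, h1, h2⟩
      have hwB := h.level_trans B hB _ _ hxB h1
      exact ⟨h.level_trans B hB _ _ hwB h2, w, hwB, h1, h2⟩
  · rintro ⟨x, hx⟩ ⟨y, hy⟩
    obtain ⟨B, hB, hxB, hyB⟩ := exists_level_pair h hno hx hy
    obtain ⟨w, hw, hext⟩ := exists_definable h hB (n := 2)
      (.neg (.and (.neg (.eq 0 1)) (.neg (.eq 0 2)))) ![x, y] (fun i => by fin_cases i <;> assumption)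
    refine ⟨⟨w, hw⟩, fun z => ?_⟩
    change 𝔐.In X z w ↔ _
    rw [hext, Subtype.ext_iff, Subtype.ext_iff]
    have e : RealizeIn (𝔐.extn X B) (𝔐.In X) (.neg (.and (.neg (.eq 0 1)) (.neg (.eq 0 2))) :
        SetFormula 3 0) (Fin.cons z.1 ![x, y]) ↔ z.1 = x ∨ z.1 = y := by
      change ¬ (¬ z.1 = x ∧ ¬ z.1 = y) ↔ _
      tauto
    rw [e]
    refine and_iff_right_of_imp ?_
    rintro (hz | hz) <;> rw [hz] <;> assumption
  · intro n φ p hx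
    simp only [hr, hcons] at hx ⊢
    obtain ⟨x, hx⟩ := hx
    have : Fact (X ∈ 𝔐.classes) := ⟨hX⟩
    have hcl : {x | x ∈ 𝔐.tN X ∧ RealizeIn (𝔐.tN X) (𝔐.In X) φ (Fin.cons x fun i => (p i).1)} ∈
        𝔐.classes := by
      have hd := El.realizeIn (𝔐 := 𝔐) (𝒞 := 𝔐.classes) (S := 𝔐.tN X) (E := 𝔐.sec X (𝔐.num 1))
        (setOf_mem' fun x => x ∈ 𝔐.tN X) (sec_mem hX _) φ (n' := 1) (m' := 0)
        (Fin.cons (fun v => v 0) fun i _ => (p i).1) (fun i => by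
          refine Fin.cases ?_ (fun i => ?_) i
          · exact Tm.var 0
          · exact Tm.const _)
      have hd' : 𝔐.El fun (v : Fin 1 → 𝔐.carrier) (_ : Fin 0 → Set 𝔐.carrier) =>
          RealizeIn (𝔐.tN X) (𝔐.In X) φ (Fin.cons (v 0) fun i => (p i).1) := by
        refine hd.congr fun v W => ?_
        apply iff_of_eq; congr 1
        funext i
        refine Fin.cases ?_ (fun i => ?_) i <;> simp
      exact setOf_mem' _ (hP := @Dfn.and _ _ _ _ _ _ _ _ inferInstance hd')
    obtain ⟨y, ⟨hyN, hy⟩, hmin⟩ := h.classWF hX _ hcl (fun x hx => hx.1) ⟨x, x.2, hx⟩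
    exact ⟨⟨y, hyN⟩, hy, fun z hz hz' => hmin z ⟨z.2, hz'⟩ hz⟩
  · intro n φ hφ p a
    obtain ⟨y, hy, hext⟩ := tower_separation h hno hφ (fun i => (p i).1) (fun i => (p i).2) a.2
    refine ⟨⟨y, hy⟩, fun z => ?_⟩
    rw [hr, hcons]
    exact hext z
  · intro n φ hφ p a hall
    simp only [hr, hcons] at hall ⊢
    obtain ⟨b, hb, hb'⟩ := tower_collection h hno hφ (fun i => (p i).1) (fun i => (p i).2) a.2
      (fun x hx => by
        obtain ⟨y, hy⟩ := hall ⟨x, h.in_left _ _ hx⟩ hx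
        exact ⟨y, y.2, hy⟩)
    refine ⟨⟨b, hb⟩, fun x hx => ?_⟩
    obtain ⟨y, hy, hxy⟩ := hb' x hx
    exact ⟨⟨y, h.in_left _ _ hy⟩, hy, hxy⟩

include hX in
theorem isAdm_of_noTag : 𝔐.IsAdm (𝔐.tN X) (𝔐.sec X (𝔐.num 1)) := by
  have : Fact (X ∈ 𝔐.classes) := ⟨hX⟩
  refine ⟨⟨setOf_mem' fun x => x ∈ 𝔐.tN X, sec_mem hX _, h.in_left, h.in_right, h.classWF hX, h.ext⟩,
    tower_modelsKP h hX hno, ?_⟩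
  obtain ⟨B, hB, hmin⟩ := h.classWF hX (𝔐.tL X) (setOf_mem' fun x => x ∈ 𝔐.tL X) h.level_name
    (exists_level h hno)
  have hB' : ∀ z, 𝔐.In X z B ↔ ∃ x, z = 𝔐.iota x := fun z => by
    constructor
    · intro hz
      rcases h.source z (h.in_left _ _ hz) with hz' | ⟨C, hC, hnew⟩
      · exact hz'
      · exact absurd (h.in_of_new hB hC hz hnew) (hmin C hC)
    · rintro ⟨x, rfl⟩; exact h.level_base B hB x
  have hF : ∀ x c, 𝔐.Rel {w | ∃ x c, w = 𝔐.pr x c ∧ c = 𝔐.iota x} x c ↔ c = 𝔐.iota x := fun x c =>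
    rel_setOf_pr (P := fun x c => c = 𝔐.iota x)
  refine ⟨B, h.level_name B hB, {w | ∃ x c, w = 𝔐.pr x c ∧ c = 𝔐.iota x}, setOf_mem' _, ?_, ?_, ?_, ?_, ?_⟩
  · intro x
    exact ⟨𝔐.iota x, (hF _ _).2 rfl, fun c hc => (hF _ _).1 hc⟩
  · intro x c hc
    exact (hB' c).2 ⟨x, (hF _ _).1 hc⟩
  · intro c hc
    obtain ⟨x, rfl⟩ := (hB' c).1 hc
    exact ⟨x, (hF _ _).2 rfl, fun y hy => (iota_inj ((hF _ _).1 hy)).symm⟩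
  · intro x y c d hc hd
    rw [(hF _ _).1 hc, (hF _ _).1 hd]
    change _ ↔ 𝔐.In X _ _
    rw [h.base_in]
    constructor
    · intro hxy; exact ⟨x, hxy, rfl⟩
    · rintro ⟨x', hx', e⟩
      rwa [iota_inj e]
  · intro c d hc hd
    exact h.level_trans B hB c d hc hd

end NoTag

/-! ### The tower of all towers -/

/-- The tower without levels. -/
def baseTower (𝔐 : ClassModel.{u}) [hM : Nbg 𝔐] : Set 𝔐.carrier :=
  {w | (∃ x, w = 𝔐.pr (𝔐.num 0) (𝔐.iota x)) ∨
    ∃ x y, w = 𝔐.pr (𝔐.num 1) (𝔐.pr (𝔐.iota x) (𝔐.iota y)) ∧ 𝔐.mem x y}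

theorem baseTower_mem {𝒞 : Set (Set 𝔐.carrier)} (h𝒞 : 𝔐.IsDeltaClosed 𝒞) : 𝔐.baseTower ∈ 𝒞 :=
  h𝒞.elem _ inferInstance

theorem isTower_baseTower : 𝔐.IsTower 𝔐.baseTower := by
  have hN : ∀ x, x ∈ 𝔐.tN 𝔐.baseTower ↔ ∃ y, x = 𝔐.iota y := fun x => by
    simp [tN, sec, baseTower, pr_inj, num_inj]
  have hin : ∀ z x, 𝔐.In 𝔐.baseTower z x ↔ ∃ z' x', z = 𝔐.iota z' ∧ x = 𝔐.iota x' ∧ 𝔐.mem z' x' :=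
    fun z x => by simp [In, rel_iff, sec, baseTower, pr_inj, num_inj, and_assoc]
  have hL : ∀ x, ¬ x ∈ 𝔐.tL 𝔐.baseTower := fun x => by
    simp [tL, sec, baseTower, pr_inj, num_inj]
  have hb : ∀ x z, 𝔐.In 𝔐.baseTower z (𝔐.iota x) ↔ ∃ y, 𝔐.mem y x ∧ z = 𝔐.iota y := fun x z => by
    rw [hin]
    constructor
    · rintro ⟨z', x', rfl, e, hz⟩
      obtain rfl := iota_inj e
      exact ⟨z', hz, rfl⟩
    · rintro ⟨y, hy, rfl⟩
      exact ⟨y, x, rfl, rfl, hy⟩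
  constructor
  · intro x y hxy
    obtain ⟨z, -, rfl, -, -⟩ := (hin _ _).1 hxy
    exact (hN _).2 ⟨z, rfl⟩
  · intro x y hxy
    obtain ⟨-, z, -, rfl, -⟩ := (hin _ _).1 hxy
    exact (hN _).2 ⟨z, rfl⟩
  · exact fun B hB => absurd hB (hL B)
  · exact fun x => (hN _).2 ⟨x, rfl⟩
  · exact hb
  · rintro s ⟨x, hx⟩ hs
    obtain ⟨x, rfl⟩ := (hN x).1 (hs x hx)
    obtain ⟨y, hy, hmin⟩ := hM.out.foundation {y | 𝔐.mem (𝔐.iota y) s} (setOf_mem' _) ⟨x, hx⟩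
    refine ⟨_, hy, fun z hz hzy => ?_⟩
    obtain ⟨w, hw, rfl⟩ := (hb _ _).1 hzy
    exact hmin w hz hw
  · intro x hx y hy hxy
    obtain ⟨x, rfl⟩ := (hN x).1 hx
    obtain ⟨y, rfl⟩ := (hN y).1 hy
    rw [ClassModel.ext (x := x) (y := y) fun z => ?_]
    have := hxy (𝔐.iota z)
    rw [hb, hb] at this
    constructor
    · intro hz
      obtain ⟨w, hw, e⟩ := this.1 ⟨z, hz, rfl⟩
      rwa [iota_inj e]
    · intro hz
      obtain ⟨w, hw, e⟩ := this.2 ⟨z, hz, rfl⟩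
      rwa [iota_inj e]
  · exact fun B hB => absurd hB (hL B)
  · exact fun B hB => absurd hB (hL B)
  · exact fun B hB => absurd hB (hL B)
  · exact fun B hB => absurd hB (hL B)
  · exact fun B hB => absurd hB (hL B)
  · exact fun x hx => Or.inl ((hN x).1 hx)
  · exact fun B hB => absurd hB (hL B)
  · exact fun B hB => absurd hB (hL B)
  · intro B c w hw
    simp [tY, sec, baseTower, pr_inj, num_inj] at hw

/-- The union of all towers. -/
def allTower (𝔐 : ClassModel.{u}) [hM : Nbg 𝔐] : Set 𝔐.carrier :=
  ⋃₀ {X | X ∈ 𝔐.classes ∧ 𝔐.IsTower X}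

section AllTower

variable (hS : 𝔐.Sigma11Comprehension)

include hS

theorem allTower_mem : 𝔐.allTower ∈ 𝔐.classes := by
  have := (IsDeltaClosed.of_sigma11 hS).sigma (fun x X => 𝔐.IsTower X ∧ x ∈ X) inferInstance
  convert this using 1
  ext x
  simp [allTower, and_assoc]

theorem isTower_allTower : 𝔐.IsTower 𝔐.allTower := by
  have hb := baseTower_mem (IsDeltaClosed.of_sigma11 hS)
  exact isTower_sUnion (fun _ hX => hX.2) (fun _ hX => hX.1) ⟨_, hb, isTower_baseTower⟩

theorem towerLe_allTower {X : Set 𝔐.carrier} (hX : X ∈ 𝔐.classes) (h : 𝔐.IsTower X) :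
    𝔐.TowerLe X 𝔐.allTower :=
  towerLe_sUnion (𝒳 := {X | X ∈ 𝔐.classes ∧ 𝔐.IsTower X}) (fun _ hX => hX.2) (fun _ hX => hX.1)
    ⟨hX, h⟩

/-- The union of all towers has no tag: otherwise it could be prolonged. -/
theorem allTower_noTag (t : 𝔐.carrier) : ¬ 𝔐.TagAt (𝔐.tN 𝔐.allTower) 𝔐.allTower t := by
  intro ht
  have hU := allTower_mem hS
  have h := isTower_allTower hS
  have hc := IsDeltaClosed.of_sigma11 hS
  have : Fact (𝔐.allTower ∈ 𝔐.classes) := ⟨hU⟩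
  obtain ⟨Z, hZ, hsat⟩ := exists_isSat hc (S := 𝔐.tN 𝔐.allTower) (E := 𝔐.sec 𝔐.allTower (𝔐.num 1))
    (setOf_mem' fun x => x ∈ 𝔐.tN 𝔐.allTower) (sec_mem hU _)
  obtain ⟨B, hB⟩ := exists_freshTop h hU hZ hsat ht
  have hle := towerLe_allTower hS (nextTower_mem hc hU hZ) (isTower_nextTower h hU hZ hsat ht)
  exact hB.not_mem h (hle.name B (mem_tN_nextTower.2 (Or.inr hB.1)))

theorem isAdm_allTower : 𝔐.IsAdm (𝔐.tN 𝔐.allTower) (𝔐.sec 𝔐.allTower (𝔐.num 1)) :=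
  isAdm_of_noTag (isTower_allTower hS) (allTower_mem hS) (allTower_noTag hS)

end AllTower

end ClassModel

end ClassTheory

namespace ClassTheory
open SetFormula

namespace ClassModel

/-! ### Classes that are elements of a model of KP -/

/-- The sets of `𝔎` form a model of KP. The classes of `𝔎` play no role. -/
class KP (𝔎 : ClassModel.{u}) : Prop where
  out : ModelsKP 𝔎.carrier 𝔎.mem

instance (𝔎 : ClassModel.{u}) [h : KP 𝔎] : Pairs 𝔎 := ⟨h.out.extensionality, h.out.pairing⟩

/-- An isomorphism of the sets of `𝔐` with a transitive element `v` of `𝔎`. -/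
structure Emb (𝔐 𝔎 : ClassModel.{u}) : Type u where
  v : 𝔎.carrier
  ι : 𝔐.carrier → 𝔎.carrier
  mem_v : ∀ b, 𝔎.mem b v ↔ ∃ x, b = ι x
  inj : Function.Injective ι
  mem_iff : ∀ x y, 𝔎.mem (ι x) (ι y) ↔ 𝔐.mem x y
  trans : ∀ x b, 𝔎.mem b (ι x) → 𝔎.mem b v

namespace Emb

variable {𝔐 𝔎 : ClassModel.{u}} (j : Emb 𝔐 𝔎)

/-- The intersection of `b` with `v`, regarded as a collection of sets of `𝔐`. -/
def trace (b : 𝔎.carrier) : Set 𝔐.carrier := {x | 𝔎.mem (j.ι x) b}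

/-- The collections of sets of `𝔐` that are elements of `𝔎`. -/
def coded : Set (Set 𝔐.carrier) := Set.range j.trace

theorem mem_trace {b : 𝔎.carrier} {x : 𝔐.carrier} : x ∈ j.trace b ↔ 𝔎.mem (j.ι x) b := Iff.rfl

/-- The `Δ₀` translation of an elementary formula: set quantifiers are bounded by `v`, and class
variables are replaced by variables for elements of `𝔎`. -/
def tr : {n m : ℕ} → SetFormula n m → (Fin n → 𝔎.carrier) → (Fin m → 𝔎.carrier) → Prop
  | _, _, .eq i k, w, _ => w i = w k
  | _, _, .mem i k, w, _ => 𝔎.mem (w i) (w k)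
  | _, _, .memClass i k, w, c => 𝔎.mem (w i) (c k)
  | _, _, .neg φ, w, c => ¬ tr φ w c
  | _, _, .and φ ψ, w, c => tr φ w c ∧ tr ψ w c
  | _, _, .all φ, w, c => ∀ a, 𝔎.mem a j.v → tr φ (Fin.cons a w) c

theorem d0_tr {n m : ℕ} (φ : SetFormula n m) : ∀ {k : ℕ}
    (s : Fin n → (Fin k → 𝔎.carrier) → 𝔎.carrier) (t : Fin m → (Fin k → 𝔎.carrier) → 𝔎.carrier)
    (_ : ∀ i, Tm True 𝔎.mem ∅ (s i)) (_ : ∀ i, Tm True 𝔎.mem ∅ (t i)),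
    ModelsKP.D0 𝔎.mem fun w _ => j.tr φ (fun i => s i w) fun i => t i w := by
  induction φ with
  | eq i k => intro _ s t hs ht; exact Dfn.eq (s i) (s k)
  | mem i k => intro _ s t hs ht; exact Dfn.mem (s i) (s k)
  | memClass i k => intro _ s t hs ht; exact Dfn.mem (s i) (t k)
  | neg φ ih => intro _ s t hs ht; exact @Dfn.not _ _ _ _ _ _ _ (ih s t hs ht)
  | and φ ψ ih ih' =>
    intro _ s t hs ht; exact @Dfn.and _ _ _ _ _ _ _ _ (ih s t hs ht) (ih' s t hs ht)
  | all φ ih =>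
    intro k s t hs ht
    refine @Dfn.ball _ _ _ _ _ _ (fun _ => j.v)
      (fun x w _ => j.tr φ (Fin.cons x fun i => s i w) fun i => t i w) (Tm.const _) ?_
    refine (ih (Fin.cons (fun w => w 0) fun i w => s i fun i => w i.succ)
      (fun i w => t i fun i => w i.succ) (fun i => ?_) fun i => (ht i).rename _).congr fun w W => ?_
    · refine Fin.cases ?_ (fun i => ?_) i
      · exact Tm.var 0
      · exact (hs i).rename _
    · apply iff_of_eq; congr 1
      funext i
      refine Fin.cases ?_ (fun i => ?_) i <;> simp

theorem tr_iff {n m : ℕ} (φ : SetFormula n m) : ∀ (w : Fin n → 𝔐.carrier) (c : Fin m → 𝔎.carrier),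
    j.tr φ (fun i => j.ι (w i)) c ↔ φ.Realize 𝔐.mem w fun i => j.trace (c i) := by
  induction φ with
  | eq i k => intro w c; exact j.inj.eq_iff
  | mem i k => intro w c; exact j.mem_iff _ _
  | memClass i k => intro w c; rfl
  | neg φ ih => intro w c; exact not_congr (ih w c)
  | and φ ψ ih ih' => intro w c; exact and_congr (ih w c) (ih' w c)
  | all φ ih =>
    intro w c
    have e : ∀ x, (Fin.cons (j.ι x) fun i => j.ι (w i)) =
        fun i => j.ι ((Fin.cons x w : Fin (_ + 1) → 𝔐.carrier) i) := fun x => by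
      funext i
      refine Fin.cases ?_ (fun i => ?_) i <;> simp
    constructor
    · intro h x
      rw [← ih, ← e]
      exact h _ ((j.mem_v _).2 ⟨x, rfl⟩)
    · intro h a ha
      obtain ⟨x, rfl⟩ := (j.mem_v a).1 ha
      rw [e, ih]
      exact h x

/-- A predicate that is elementary over the coded classes is `Δ₀` in `𝔎`. -/
theorem exists_d0 {n m : ℕ} {P : (Fin n → 𝔐.carrier) → (Fin m → Set 𝔐.carrier) → Prop}
    (hP : Dfn False 𝔐.mem j.coded P) :
    ∃ Q : (Fin n → 𝔎.carrier) → (Fin m → 𝔎.carrier) → Prop,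
      (∀ (k : ℕ) (s : Fin n → (Fin k → 𝔎.carrier) → 𝔎.carrier)
        (t : Fin m → (Fin k → 𝔎.carrier) → 𝔎.carrier), (∀ i, Tm True 𝔎.mem ∅ (s i)) →
          (∀ i, Tm True 𝔎.mem ∅ (t i)) →
            ModelsKP.D0 𝔎.mem fun w _ => Q (fun i => s i w) fun i => t i w) ∧
      ∀ w c, Q (fun i => j.ι (w i)) c ↔ P w fun i => j.trace (c i) := by
  obtain ⟨a, b, φ, p, C, -, hC, hφ⟩ := hP.out
  choose d hd using hC
  refine ⟨fun w c => j.tr φ (Fin.append w fun i => j.ι (p i)) (Fin.append c d), ?_, ?_⟩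
  · intro k s t hs ht
    refine (j.d0_tr φ (Fin.append s fun i _ => j.ι (p i)) (Fin.append t fun i _ => d i)
      (fun i => ?_) fun i => ?_).congr fun w W => ?_
    · refine Fin.addCases (fun i => ?_) (fun i => ?_) i
      · simpa using hs i
      · simpa using Tm.const _
    · refine Fin.addCases (fun i => ?_) (fun i => ?_) i
      · simpa using ht i
      · simpa using Tm.const _
    · apply iff_of_eq; dsimp only; congr 1 <;>
      · funext i
        refine Fin.addCases (fun i => ?_) (fun i => ?_) i <;> simp
  · intro w c
    rw [hφ]
    have e : (Fin.append (fun i => j.ι (w i)) fun i => j.ι (p i)) =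
        fun i => j.ι (Fin.append w p i) := by
      funext i
      refine Fin.addCases (fun i => ?_) (fun i => ?_) i <;> simp
    change j.tr φ _ _ ↔ _
    rw [e, tr_iff]
    apply iff_of_eq; congr 1
    funext i
    refine Fin.addCases (fun i => ?_) (fun i => ?_) i <;> simp [hd]

variable [hK : KP 𝔎]

theorem elem_mem (P : 𝔐.carrier → Prop)
    (hP : Dfn False 𝔐.mem j.coded fun (v : Fin 1 → 𝔐.carrier) (_ : Fin 0 → Set 𝔐.carrier) =>
      P (v 0)) : {x | P x} ∈ j.coded := by
  obtain ⟨Q, hQ, hQP⟩ := j.exists_d0 hP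
  have h0 := hQ 1 (fun _ w => w 0) (fun i _ => i.elim0) (fun _ => inferInstance) fun i => i.elim0
  obtain ⟨b, hb⟩ := hK.out.sep (fun x => Q (fun _ => x) fun i => Fin.elim0 i) (hP := h0) j.v
  refine ⟨b, Set.ext fun x => ?_⟩
  rw [mem_trace, hb]
  have h1 := hQP (fun _ => x) fun i => Fin.elim0 i
  refine (and_iff_right ((j.mem_v _).2 ⟨x, rfl⟩)).trans (Iff.trans ?_ h1)
  rfl

/-- `Δ₀`-Collection, for classes coded in `𝔎`. -/
theorem exists_bound (P : 𝔐.carrier → Set 𝔐.carrier → Prop)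
    (hP : Dfn False 𝔐.mem j.coded fun (v : Fin 1 → 𝔐.carrier) (W : Fin 1 → Set 𝔐.carrier) =>
      P (v 0) (W 0)) (h : ∀ x, ∃ X ∈ j.coded, P x X) :
    ∃ b, ∀ x, ∃ y, 𝔎.mem y b ∧ P x (j.trace y) := by
  obtain ⟨Q, hQ, hQP⟩ := j.exists_d0 hP
  have := hQ 2 (fun _ w => w 0) (fun _ w => w 1) (fun _ => inferInstance) fun _ => inferInstance
  obtain ⟨b, hb⟩ := hK.out.coll (fun x y => Q (fun _ => x) fun _ => y) j.v (fun x hx => by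
    obtain ⟨x, rfl⟩ := (j.mem_v x).1 hx
    obtain ⟨X, ⟨y, rfl⟩, hy⟩ := h x
    exact ⟨y, (hQP (fun _ => x) fun _ => y).2 hy⟩)
  refine ⟨b, fun x => ?_⟩
  obtain ⟨y, hy, hxy⟩ := hb (j.ι x) ((j.mem_v _).2 ⟨x, rfl⟩)
  exact ⟨y, hy, (hQP (fun _ => x) fun _ => y).1 hxy⟩

/-- `Δ₀`-Separation, for quantification over the classes coded by the elements of a set. -/
theorem bex_mem (P : 𝔐.carrier → Set 𝔐.carrier → Prop)
    (hP : Dfn False 𝔐.mem j.coded fun (v : Fin 1 → 𝔐.carrier) (W : Fin 1 → Set 𝔐.carrier) =>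
      P (v 0) (W 0)) (b : 𝔎.carrier) : {x | ∃ y, 𝔎.mem y b ∧ P x (j.trace y)} ∈ j.coded := by
  obtain ⟨Q, hQ, hQP⟩ := j.exists_d0 hP
  have h2 := hQ 2 (fun _ w => w 1) (fun _ w => w 0) (fun _ => inferInstance) fun _ => inferInstance
  have : ModelsKP.D0 𝔎.mem fun (w : Fin 1 → 𝔎.carrier) _ =>
      ∃ y, 𝔎.mem y b ∧ Q (fun _ => w 0) fun _ => y :=
    @Dfn.bex _ _ _ _ _ _ (fun _ => b) (fun y w _ => Q (fun _ => w 0) fun _ => y) _ h2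
  obtain ⟨d, hd⟩ := hK.out.sep (fun x => ∃ y, 𝔎.mem y b ∧ Q (fun _ => x) fun _ => y) j.v
  refine ⟨d, Set.ext fun x => ?_⟩
  rw [mem_trace, hd]
  refine (and_iff_right ((j.mem_v _).2 ⟨x, rfl⟩)).trans (exists_congr fun y => and_congr_right
    fun _ => hQP (fun _ => x) fun _ => y)

/-- `Δ¹₁`-Comprehension for coded classes: by `Δ₀`-Collection, witnesses of `P x` or of `¬ P' x` can be
found in a fixed element of `𝔎`, which makes the class `Δ₀`. -/
theorem delta_mem (P P' : 𝔐.carrier → Set 𝔐.carrier → Prop)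
    (hP : Dfn False 𝔐.mem j.coded fun (v : Fin 1 → 𝔐.carrier) (W : Fin 1 → Set 𝔐.carrier) =>
      P (v 0) (W 0))
    (hP' : Dfn False 𝔐.mem j.coded fun (v : Fin 1 → 𝔐.carrier) (W : Fin 1 → Set 𝔐.carrier) =>
      P' (v 0) (W 0))
    (h : ∀ x, (∃ X ∈ j.coded, P x X) ↔ ∀ X ∈ j.coded, P' x X) :
    {x | ∃ X ∈ j.coded, P x X} ∈ j.coded := by
  obtain ⟨b, hb⟩ := j.exists_bound (fun x X => P x X ∨ ¬ P' x X) inferInstance fun x => by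
    by_cases hx : ∃ X ∈ j.coded, P x X
    · obtain ⟨X, hX, hx⟩ := hx
      exact ⟨X, hX, Or.inl hx⟩
    · rw [h] at hx
      push Not at hx
      obtain ⟨X, hX, hx⟩ := hx
      exact ⟨X, hX, Or.inr hx⟩
  convert j.bex_mem P hP b using 1
  ext x
  constructor
  · intro hx
    obtain ⟨y, hy, hxy | hxy⟩ := hb x
    · exact ⟨y, hy, hxy⟩
    · exact absurd ((h x).1 hx _ ⟨y, rfl⟩) hxy
  · rintro ⟨y, -, hxy⟩
    exact ⟨_, ⟨y, rfl⟩, hxy⟩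

end Emb

section Tuples

variable {𝔐 : ClassModel.{u}} [hM : Nbg 𝔐]

/-- A tuple of classes is coded by a single class. -/
theorem exists_join {k : ℕ} (X : Fin k → Set 𝔐.carrier) (hX : ∀ i, X i ∈ 𝔐.classes) :
    ∃ Y ∈ 𝔐.classes, ∀ i : Fin k, 𝔐.sec Y (𝔐.num i) = X i := by
  have : ∀ i, Fact (X i ∈ 𝔐.classes) := fun i => ⟨hX i⟩
  refine ⟨{w | ∃ i : Fin k, ∃ x, w = 𝔐.pr (𝔐.num i) x ∧ x ∈ X i}, setOf_mem' _, fun i => ?_⟩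
  ext x
  simp only [sec, Set.mem_ofPred_eq, pr_inj, num_inj]
  constructor
  · rintro ⟨i', x', ⟨e, rfl⟩, hx⟩
    rwa [Fin.ext e]
  · intro hx; exact ⟨i, x, ⟨rfl, rfl⟩, hx⟩

/-- In `Δ¹₁`-Comprehension, one class quantifier is enough. -/
theorem delta11_of_single
    (h : ∀ P P' : 𝔐.carrier → Set 𝔐.carrier → Prop,
      (𝔐.El fun (v : Fin 1 → 𝔐.carrier) (W : Fin 1 → Set 𝔐.carrier) => P (v 0) (W 0)) →
      (𝔐.El fun (v : Fin 1 → 𝔐.carrier) (W : Fin 1 → Set 𝔐.carrier) => P' (v 0) (W 0)) →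
      (∀ x, (∃ X ∈ 𝔐.classes, P x X) ↔ ∀ X ∈ 𝔐.classes, P' x X) →
        {x | ∃ X ∈ 𝔐.classes, P x X} ∈ 𝔐.classes) : 𝔐.Delta11Comprehension := by
  intro n m k l φ ψ p P hP e
  have hel : ∀ {k : ℕ} (φ : SetFormula (n + 1) (m + k)), 𝔐.El fun (v : Fin 1 → 𝔐.carrier)
      (W : Fin 1 → Set 𝔐.carrier) => φ.Realize 𝔐.mem (Fin.cons (v 0) p)
        (Fin.append P fun i : Fin k => 𝔐.sec (W 0) (𝔐.num i)) := fun {k} φ => by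
    refine (Dfn.realize φ (n' := 1) (m' := 1) (Fin.cons (fun v => v 0) fun i _ => p i)
      (Fin.append (fun i _ _ => P i) fun (i : Fin k) _ W => 𝔐.sec (W 0) (𝔐.num i))
      (fun i => ?_) fun i => ?_).congr fun v W => ?_
    · refine Fin.cases ?_ (fun i => ?_) i
      · exact Tm.var 0
      · exact Tm.const _
    · refine Fin.addCases (fun i => ?_) (fun i => ?_) i
      · have : Fact (P i ∈ 𝔐.classes) := ⟨hP i⟩
        rw [Fin.append_left]
        exact CT.const _
      · rw [Fin.append_right]
        infer_instance
    · apply iff_of_eq; congr 1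
      · funext i
        refine Fin.cases ?_ (fun i => ?_) i <;> simp
      · funext i
        refine Fin.addCases (fun i => ?_) (fun i => ?_) i <;> simp
  have hsec : ∀ {k : ℕ} {Y : Set 𝔐.carrier}, Y ∈ 𝔐.classes →
      ∀ i : Fin k, 𝔐.sec Y (𝔐.num i) ∈ 𝔐.classes := fun hY i => sec_mem hY _
  have hφ : 𝔐.sigmaExt φ p P = {x | ∃ X ∈ 𝔐.classes, φ.Realize 𝔐.mem (Fin.cons x p)
      (Fin.append P fun i : Fin k => 𝔐.sec X (𝔐.num i))} := by
    ext x
    constructor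
    · rintro ⟨X, hX, hx⟩
      obtain ⟨Y, hY, e⟩ := exists_join X hX
      refine ⟨Y, hY, ?_⟩
      simp only [e]
      exact hx
    · rintro ⟨Y, hY, hx⟩
      exact ⟨_, hsec hY, hx⟩
  have hψ : 𝔐.piExt ψ p P = {x | ∀ X ∈ 𝔐.classes, ψ.Realize 𝔐.mem (Fin.cons x p)
      (Fin.append P fun i : Fin l => 𝔐.sec X (𝔐.num i))} := by
    ext x
    constructor
    · intro hx Y hY
      exact hx _ (hsec hY)
    · intro hx X hX
      obtain ⟨Y, hY, e⟩ := exists_join X hX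
      have := hx Y hY
      simp only [e] at this
      exact this
  rw [hφ]
  refine h _ (fun x X => ψ.Realize 𝔐.mem (Fin.cons x p)
    (Fin.append P fun i : Fin l => 𝔐.sec X (𝔐.num i))) (hel φ) (hel ψ) fun x => ?_
  rw [hφ, hψ] at e
  exact Set.ext_iff.1 e x

end Tuples

end ClassModel

end ClassTheory

namespace ClassTheory
open SetFormula
namespace ClassModel

/-! ### Collapsing well-founded relations in models of KP -/

/-- `f` is an attempt at the collapse of the relation `r` on `n`: a function on a part of `n` closed
under `r`-predecessors, with `f x = {f x' | x' r x}`. -/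
def Att (𝔎 : ClassModel.{u}) (n r f : 𝔎.carrier) : Prop :=
  ∀ x, 𝔎.mem x n → ∀ y, 𝔎.App f x y → (∀ y', 𝔎.App f x y' → y' = y) ∧
    (∀ x', 𝔎.mem x' n → 𝔎.App r x' x → ∃ y', 𝔎.App f x' y' ∧ 𝔎.mem y' y) ∧
    ∀ z, 𝔎.mem z y → ∃ x', 𝔎.mem x' n ∧ 𝔎.App r x' x ∧ 𝔎.App f x' z

/-- `y` is the value of the collapse of the relation `r` on `n` at `x`. -/
def Collapse (𝔎 : ClassModel.{u}) (n r x y : 𝔎.carrier) : Prop :=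
  𝔎.mem x n ∧ ∃ f, 𝔎.Att n r f ∧ 𝔎.App f x y

variable {𝔎 : ClassModel.{u}}

instance {d : Prop} {k m : ℕ} {𝒞 : Set (Set 𝔎.carrier)} (s t r : (Fin k → 𝔎.carrier) → 𝔎.carrier)
    [Tm d 𝔎.mem 𝒞 s] [Tm d 𝔎.mem 𝒞 t] [Tm d 𝔎.mem 𝒞 r] :
    Dfn d 𝔎.mem 𝒞 fun v (_ : Fin m → Set 𝔎.carrier) => 𝔎.Att (s v) (t v) (r v) := by
  have : Dfn d 𝔎.mem 𝒞 fun (v : Fin 3 → 𝔎.carrier) (_ : Fin 0 → Set 𝔎.carrier) =>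
      𝔎.Att (v 0) (v 1) (v 2) := by unfold Att; infer_instance
  exact this.app ![s, t, r] ![]

variable [hK : KP 𝔎]

theorem KP.exists_range_bound (g : 𝔎.carrier) : ∃ u, ∀ x y, 𝔎.App g x y → 𝔎.mem y u := by
  obtain ⟨u, hu⟩ := hK.out.union g
  obtain ⟨w, hw⟩ := hK.out.union u
  refine ⟨w, fun x y ⟨p, hp, hxy⟩ => ?_⟩
  obtain ⟨e, he, -, hy⟩ := hxy.exists_mem
  exact (hw y).2 ⟨e, (hu e).2 ⟨p, hp, he⟩, hy⟩

theorem KP.exists_insert (x y : 𝔎.carrier) : ∃ u, ∀ z, 𝔎.mem z u ↔ 𝔎.mem z x ∨ z = y := by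
  obtain ⟨p, hp⟩ := hK.out.pairing y y
  obtain ⟨q, hq⟩ := hK.out.pairing x p
  obtain ⟨u, hu⟩ := hK.out.union q
  refine ⟨u, fun z => (hu z).trans ?_⟩
  constructor
  · rintro ⟨w, hw, hz⟩
    rcases (hq w).1 hw with rfl | rfl
    · exact Or.inl hz
    · exact Or.inr (by simpa using (hp z).1 hz)
  · rintro (h | h)
    · exact ⟨x, (hq x).2 (Or.inl rfl), h⟩
    · exact ⟨p, (hq p).2 (Or.inr rfl), (hp z).2 (Or.inl h)⟩

section Collapse

variable {n r : 𝔎.carrier} (hwf : ∀ P : 𝔎.carrier → Prop,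
  (Dfn False 𝔎.mem ∅ fun (v : Fin 1 → 𝔎.carrier) (_ : Fin 0 → Set 𝔎.carrier) => P (v 0)) →
    (∃ x, 𝔎.mem x n ∧ P x) → ∃ x, 𝔎.mem x n ∧ P x ∧ ∀ y, 𝔎.mem y n → P y → ¬ 𝔎.App r y x)

include hwf

theorem Att.unique {f f' x y y' : 𝔎.carrier} (h : 𝔎.Att n r f) (h' : 𝔎.Att n r f')
    (hx : 𝔎.mem x n) (hy : 𝔎.App f x y) (hy' : 𝔎.App f' x y') : y = y' := by
  by_contra hne
  obtain ⟨x, hx, ⟨f, f', h, h', y, y', hy, hy', hne⟩, hmin⟩ := hwf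
    (fun x => ∃ f f', 𝔎.Att n r f ∧ 𝔎.Att n r f' ∧ ∃ y y', 𝔎.App f x y ∧ 𝔎.App f' x y' ∧ y ≠ y')
    inferInstance ⟨x, hx, f, f', h, h', y, y', hy, hy', hne⟩
  have key : ∀ f f', 𝔎.Att n r f → 𝔎.Att n r f' → ∀ y y', 𝔎.App f x y → 𝔎.App f' x y' →
      ∀ z, 𝔎.mem z y → 𝔎.mem z y' := fun f f' h h' y y' hy hy' z hz => by
    obtain ⟨x', hx', hr, hz⟩ := (h x hx y hy).2.2 z hz
    obtain ⟨z', hz', hzy⟩ := (h' x hx y' hy').2.1 x' hx' hr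
    have : z = z' := by
      by_contra hne
      exact hmin x' hx' ⟨f, f', h, h', z, z', hz, hz', hne⟩ hr
    rwa [this]
  exact hne (Pairs.ext _ _ fun z => ⟨key f f' h h' y y' hy hy' z, key f' f h' h y' y hy' hy z⟩)

/-- Attempts defined at all elements of a subset of `n` can be glued. -/
theorem exists_att_glue {s : 𝔎.carrier}
    (h : ∀ x, 𝔎.mem x s → ∃ f, 𝔎.Att n r f ∧ ∃ y, 𝔎.App f x y) :
    ∃ g, 𝔎.Att n r g ∧ ∀ x, 𝔎.mem x s → ∃ y, 𝔎.App g x y := by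
  obtain ⟨b, hb⟩ := hK.out.coll (fun x f => 𝔎.Att n r f ∧ ∃ y, 𝔎.App f x y ∧ y = y) s
    (fun x hx => by simpa using h x hx)
  obtain ⟨u, hu⟩ := hK.out.union b
  obtain ⟨g, hg⟩ := hK.out.sep (fun p => ∃ f, 𝔎.mem f b ∧ 𝔎.Att n r f ∧ 𝔎.mem p f) u
  have happ : ∀ x y, 𝔎.App g x y ↔ ∃ f, 𝔎.mem f b ∧ 𝔎.Att n r f ∧ 𝔎.App f x y := fun x y => by
    simp only [app_iff, hg, hu]
    constructor
    · rintro ⟨-, h⟩; exact h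
    · rintro ⟨f, hf, ha, hp⟩
      exact ⟨⟨f, hf, hp⟩, f, hf, ha, hp⟩
  refine ⟨g, fun x hx y hy => ?_, fun x hx => ?_⟩
  · obtain ⟨f, hf, ha, hy⟩ := (happ x y).1 hy
    refine ⟨fun y' hy' => ?_, fun x' hx' hr => ?_, fun z hz => ?_⟩
    · obtain ⟨f', hf', ha', hy'⟩ := (happ x y').1 hy'
      exact ha'.unique hwf ha hx hy' hy
    · obtain ⟨y', hy', hm⟩ := (ha x hx y hy).2.1 x' hx' hr
      exact ⟨y', (happ _ _).2 ⟨f, hf, ha, hy'⟩, hm⟩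
    · obtain ⟨x', hx', hr, hz⟩ := (ha x hx y hy).2.2 z hz
      exact ⟨x', hx', hr, (happ _ _).2 ⟨f, hf, ha, hz⟩⟩
  · obtain ⟨f, hf, ha, y, hy, -⟩ := hb x hx
    exact ⟨y, (happ _ _).2 ⟨f, hf, ha, hy⟩⟩

/-- By induction: the attempts at the predecessors of `x` are glued and prolonged by the value at `x`. -/
theorem exists_att {x : 𝔎.carrier} (hx : 𝔎.mem x n) : ∃ f, 𝔎.Att n r f ∧ ∃ y, 𝔎.App f x y := by
  by_contra hc
  obtain ⟨x, hx, hc, hmin⟩ := hwf (fun x => ¬ ∃ f, 𝔎.Att n r f ∧ ∃ y, 𝔎.App f x y) inferInstance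
    ⟨x, hx, hc⟩
  obtain ⟨s, hs⟩ := hK.out.sep (fun x' => 𝔎.App r x' x) n
  obtain ⟨g, hg, hgs⟩ := exists_att_glue hwf (s := s) fun x' hx' => by
      by_contra hc'
      exact hmin x' ((hs x').1 hx').1 hc' ((hs x').1 hx').2
  obtain ⟨u, hu⟩ := KP.exists_range_bound g
  obtain ⟨y, hy⟩ := hK.out.sep (fun z => ∃ x', 𝔎.mem x' n ∧ 𝔎.App r x' x ∧ 𝔎.App g x' z) u
  have hxg : ∀ z, ¬ 𝔎.App g x z := fun z hz => hc ⟨g, hg, z, hz⟩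
  obtain ⟨f, hf⟩ := KP.exists_insert g (𝔎.pr x y)
  have happ : ∀ x' y', 𝔎.App f x' y' ↔ 𝔎.App g x' y' ∨ x' = x ∧ y' = y := fun x' y' => by
    rw [app_iff, app_iff, hf, pr_inj]
  refine hc ⟨f, fun x₁ hx₁ y₁ hy₁ => ?_, y, (happ _ _).2 (Or.inr ⟨rfl, rfl⟩)⟩
  rcases (happ _ _).1 hy₁ with hy₁ | ⟨rfl, rfl⟩
  · refine ⟨fun y' hy' => ?_, fun x' hx' hr => ?_, fun z hz => ?_⟩
    · rcases (happ _ _).1 hy' with hy' | ⟨rfl, rfl⟩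
      · exact (hg _ hx₁ _ hy₁).1 y' hy'
      · exact absurd hy₁ (hxg _)
    · obtain ⟨y', hy', hm⟩ := (hg _ hx₁ _ hy₁).2.1 x' hx' hr
      exact ⟨y', (happ _ _).2 (Or.inl hy'), hm⟩
    · obtain ⟨x', hx', hr, hz⟩ := (hg _ hx₁ _ hy₁).2.2 z hz
      exact ⟨x', hx', hr, (happ _ _).2 (Or.inl hz)⟩
  · refine ⟨fun y' hy' => ?_, fun x' hx' hr => ?_, fun z hz => ?_⟩
    · rcases (happ _ _).1 hy' with hy' | ⟨-, rfl⟩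
      · exact absurd hy' (hxg _)
      · rfl
    · obtain ⟨y', hy'⟩ := hgs x' ((hs x').2 ⟨hx', hr⟩)
      exact ⟨y', (happ _ _).2 (Or.inl hy'), (hy y').2 ⟨hu _ _ hy', x', hx', hr, hy'⟩⟩
    · obtain ⟨-, x', hx', hr, hz⟩ := (hy z).1 hz
      exact ⟨x', hx', hr, (happ _ _).2 (Or.inl hz)⟩

omit hwf in
theorem Collapse.dfn (n r : 𝔎.carrier) : Dfn False 𝔎.mem ∅ fun (v : Fin 2 → 𝔎.carrier)
    (_ : Fin 0 → Set 𝔎.carrier) => 𝔎.Collapse n r (v 0) (v 1) := by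
  unfold Collapse; infer_instance

theorem exists_collapse {x : 𝔎.carrier} (hx : 𝔎.mem x n) : ∃ y, 𝔎.Collapse n r x y := by
  obtain ⟨f, hf, y, hy⟩ := exists_att hwf hx
  exact ⟨y, hx, f, hf, hy⟩

theorem Collapse.unique {x y y' : 𝔎.carrier} (h : 𝔎.Collapse n r x y) (h' : 𝔎.Collapse n r x y') :
    y = y' := by
  obtain ⟨hx, f, hf, hy⟩ := h
  obtain ⟨-, f', hf', hy'⟩ := h'
  exact hf.unique hwf hf' hx hy hy'

omit hwf in
theorem Collapse.exists_of_mem {x y z : 𝔎.carrier} (h : 𝔎.Collapse n r x y) (hz : 𝔎.mem z y) :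
    ∃ x', 𝔎.App r x' x ∧ 𝔎.Collapse n r x' z := by
  obtain ⟨hx, f, hf, hy⟩ := h
  obtain ⟨x', hx', hr, hz⟩ := (hf x hx y hy).2.2 z hz
  exact ⟨x', hr, hx', f, hf, hz⟩

omit hwf in
theorem Collapse.exists_of_app {x x' y : 𝔎.carrier} (h : 𝔎.Collapse n r x y) (hx' : 𝔎.mem x' n)
    (hr : 𝔎.App r x' x) : ∃ y', 𝔎.Collapse n r x' y' ∧ 𝔎.mem y' y := by
  obtain ⟨hx, f, hf, hy⟩ := h
  obtain ⟨y', hy', hm⟩ := (hf x hx y hy).2.1 x' hx' hr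
  exact ⟨y', ⟨hx', f, hf, hy'⟩, hm⟩

/-- The range of the collapse is a set. -/
theorem exists_collapse_range : ∃ s, ∀ z, 𝔎.mem z s ↔ ∃ x, 𝔎.Collapse n r x z := by
  obtain ⟨g, hg, hgn⟩ := exists_att_glue hwf (s := n) fun x hx => exists_att hwf hx
  obtain ⟨u, hu⟩ := KP.exists_range_bound g
  obtain ⟨s, hs⟩ := hK.out.sep (fun z => ∃ x, 𝔎.mem x n ∧ 𝔎.App g x z) u
  refine ⟨s, fun z => (hs z).trans ⟨?_, ?_⟩⟩
  · rintro ⟨-, x, hx, hz⟩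
    exact ⟨x, hx, g, hg, hz⟩
  · rintro ⟨x, hxz⟩
    obtain ⟨y, hy⟩ := hgn x hxz.1
    obtain rfl := hxz.unique hwf ⟨hxz.1, g, hg, hy⟩
    exact ⟨hu _ _ hy, x, hxz.1, hy⟩

end Collapse

end ClassModel

end ClassTheory

namespace ClassTheory
open SetFormula

namespace ClassModel

variable {𝔐 : ClassModel.{u}} [hM : Nbg 𝔐]

/-! ### Bisimulations of extensional well-founded graphs -/

/-- A bisimulation of an extensional well-founded graph with itself relates only equal nodes. -/
theorem IsGraph.eq_of_bisim {N R F : Set 𝔐.carrier} (h : 𝔐.IsGraph N R) (hF : F ∈ 𝔐.classes)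
    (hFN : ∀ x y, 𝔐.Rel F x y → x ∈ N ∧ y ∈ N)
    (hforth : ∀ x y x', 𝔐.Rel F x y → 𝔐.Rel R x' x → ∃ y', 𝔐.Rel F x' y' ∧ 𝔐.Rel R y' y)
    (hback : ∀ x y y', 𝔐.Rel F x y → 𝔐.Rel R y' y → ∃ x', 𝔐.Rel F x' y' ∧ 𝔐.Rel R x' x)
    {x y : 𝔐.carrier} (hxy : 𝔐.Rel F x y) : x = y := by
  by_contra hne
  have : Fact (F ∈ 𝔐.classes) := ⟨hF⟩
  obtain ⟨x, ⟨y, hxy, hne⟩, hmin⟩ := h.wf {x | ∃ y, 𝔐.Rel F x y ∧ x ≠ y} (setOf_mem' _)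
    (fun x ⟨y, hxy, _⟩ => (hFN x y hxy).1) ⟨x, y, hxy, hne⟩
  refine hne (h.ext x (hFN x y hxy).1 y (hFN x y hxy).2 fun z => ⟨fun hz => ?_, fun hz => ?_⟩)
  · obtain ⟨w, hzw, hw⟩ := hforth x y z hxy hz
    have : z = w := by
      by_contra hne'
      exact hmin z ⟨w, hzw, hne'⟩ hz
    rwa [this]
  · obtain ⟨w, hwz, hw⟩ := hback x y z hxy hz
    have : w = z := by
      by_contra hne'
      exact hmin w ⟨z, hwz, hne'⟩ hw
    rwa [← this]

theorem IsGraph.bisim_right_unique {N R F S : Set 𝔐.carrier} (h : 𝔐.IsGraph N R) (hF : F ∈ 𝔐.classes)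
    (hFN : ∀ x y, 𝔐.Rel F x y → y ∈ N)
    (hforth : ∀ x y x', 𝔐.Rel F x y → 𝔐.Rel S x' x → ∃ y', 𝔐.Rel F x' y' ∧ 𝔐.Rel R y' y)
    (hback : ∀ x y y', 𝔐.Rel F x y → 𝔐.Rel R y' y → ∃ x', 𝔐.Rel F x' y' ∧ 𝔐.Rel S x' x)
    {x y y' : 𝔐.carrier} (hxy : 𝔐.Rel F x y) (hxy' : 𝔐.Rel F x y') : y = y' := by
  have : Fact (F ∈ 𝔐.classes) := ⟨hF⟩
  have hG : ∀ y y', 𝔐.Rel {w | ∃ y y', w = 𝔐.pr y y' ∧ ∃ x, 𝔐.Rel F x y ∧ 𝔐.Rel F x y'} y y' ↔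
      ∃ x, 𝔐.Rel F x y ∧ 𝔐.Rel F x y' := fun y y' =>
    rel_setOf_pr (P := fun y y' => ∃ x, 𝔐.Rel F x y ∧ 𝔐.Rel F x y')
  refine h.eq_of_bisim (F := {w | ∃ y y', w = 𝔐.pr y y' ∧ ∃ x, 𝔐.Rel F x y ∧ 𝔐.Rel F x y'})
    (setOf_mem' _) (fun y y' hy => ?_) (fun y y' z hy hz => ?_) (fun y y' z hy hz => ?_)
    ((hG _ _).2 ⟨x, hxy, hxy'⟩)
  · obtain ⟨x, h1, h2⟩ := (hG _ _).1 hy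
    exact ⟨hFN _ _ h1, hFN _ _ h2⟩
  · obtain ⟨x, h1, h2⟩ := (hG _ _).1 hy
    obtain ⟨x', h3, h4⟩ := hback _ _ _ h1 hz
    obtain ⟨z', h5, h6⟩ := hforth _ _ _ h2 h4
    exact ⟨z', (hG _ _).2 ⟨x', h3, h5⟩, h6⟩
  · obtain ⟨x, h1, h2⟩ := (hG _ _).1 hy
    obtain ⟨x', h3, h4⟩ := hback _ _ _ h2 hz
    obtain ⟨z', h5, h6⟩ := hforth _ _ _ h1 h4
    exact ⟨z', (hG _ _).2 ⟨x', h5, h3⟩, h6⟩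

theorem IsGraph.bisim_left_unique {N R F S : Set 𝔐.carrier} (h : 𝔐.IsGraph N R) (hF : F ∈ 𝔐.classes)
    (hFN : ∀ x y, 𝔐.Rel F x y → x ∈ N)
    (hforth : ∀ x y x', 𝔐.Rel F x y → 𝔐.Rel R x' x → ∃ y', 𝔐.Rel F x' y' ∧ 𝔐.Rel S y' y)
    (hback : ∀ x y y', 𝔐.Rel F x y → 𝔐.Rel S y' y → ∃ x', 𝔐.Rel F x' y' ∧ 𝔐.Rel R x' x)
    {x x' y : 𝔐.carrier} (hxy : 𝔐.Rel F x y) (hxy' : 𝔐.Rel F x' y) : x = x' := by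
  have : Fact (F ∈ 𝔐.classes) := ⟨hF⟩
  have hG : ∀ y x, 𝔐.Rel {w | ∃ y x, w = 𝔐.pr y x ∧ 𝔐.Rel F x y} y x ↔ 𝔐.Rel F x y := fun y x =>
    rel_setOf_pr (P := fun y x => 𝔐.Rel F x y)
  refine h.bisim_right_unique (F := {w | ∃ y x, w = 𝔐.pr y x ∧ 𝔐.Rel F x y}) (S := S)
    (setOf_mem' _) (fun y x hy => hFN _ _ ((hG _ _).1 hy)) (fun y x y' h1 h2 => ?_)
    (fun y x x' h1 h2 => ?_) ((hG _ _).2 hxy) ((hG _ _).2 hxy')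
  · obtain ⟨z, h3, h4⟩ := hback _ _ _ ((hG _ _).1 h1) h2
    exact ⟨z, (hG _ _).2 h3, h4⟩
  · obtain ⟨z, h3, h4⟩ := hforth _ _ _ ((hG _ _).1 h1) h2
    exact ⟨z, (hG _ _).2 h3, h4⟩

/-! ### The model of KP given by an admissible graph -/

/-- The nodes of a graph, regarded as sets. -/
def adm (𝔐 : ClassModel.{u}) (N R : Set 𝔐.carrier) : ClassModel.{u} :=
  ⟨{a // a ∈ N}, fun a b => 𝔐.Rel R a.1 b.1, ∅⟩

theorem IsAdm.isKP {N R : Set 𝔐.carrier} (h : 𝔐.IsAdm N R) : KP (𝔐.adm N R) := ⟨h.kp⟩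

/-- What is definable over a graph is elementary in the ambient model. -/
theorem exists_el_adm {N R : Set 𝔐.carrier} (hN : N ∈ 𝔐.classes) (hR : R ∈ 𝔐.classes) {n : ℕ}
    {P : (Fin n → (𝔐.adm N R).carrier) → Prop} (hP : Dfn False (𝔐.adm N R).mem ∅
      fun v (_ : Fin 0 → Set (𝔐.adm N R).carrier) => P v) :
    ∃ Q : (Fin n → 𝔐.carrier) → Prop, (𝔐.El fun v (_ : Fin 0 → Set 𝔐.carrier) => Q v) ∧
      ∀ v : Fin n → (𝔐.adm N R).carrier, Q (fun i => (v i).1) ↔ P v := by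
  obtain ⟨a, φ, p, -, hφ⟩ := ModelsKP.exists_formula hP
  refine ⟨fun v => RealizeIn N (𝔐.Rel R) φ (Fin.append v fun i => (p i).1), ?_, fun v => ?_⟩
  · refine (El.realizeIn hN hR φ (Fin.append (fun i v => v i) fun i _ => (p i).1)
      fun i => ?_).congr fun v W => ?_
    · refine Fin.addCases (fun i => ?_) (fun i => ?_) i
      · simpa using Tm.var i
      · simpa using Tm.const _
    · apply iff_of_eq; dsimp only; congr 1
      funext i
      refine Fin.addCases (fun i => ?_) (fun i => ?_) i <;> simp
  · rw [hφ]
    refine Iff.trans ?_ (realize_subtype (e := 𝔐.Rel R) φ (Fin.append v p)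
      (Fin.elim0 : Fin 0 → Set {a // a ∈ N}) fun j => j.elim0).symm
    apply iff_of_eq; dsimp only; congr 1
    funext i
    refine Fin.addCases (fun i => ?_) (fun i => ?_) i
    · exact (Fin.append_left _ _ i).trans (congrArg Subtype.val (Fin.append_left v p i)).symm
    · exact (Fin.append_right _ _ i).trans (congrArg Subtype.val (Fin.append_right v p i)).symm

theorem adm_setOf_mem {N R : Set 𝔐.carrier} (hN : N ∈ 𝔐.classes) (hR : R ∈ 𝔐.classes)
    (P : (𝔐.adm N R).carrier → Prop) (hP : Dfn False (𝔐.adm N R).mem ∅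
      fun (v : Fin 1 → (𝔐.adm N R).carrier) (_ : Fin 0 → Set (𝔐.adm N R).carrier) => P (v 0)) :
    {x | ∃ h : x ∈ N, P ⟨x, h⟩} ∈ 𝔐.classes := by
  obtain ⟨Q, hQ, hQP⟩ := exists_el_adm hN hR hP
  have : Fact (N ∈ 𝔐.classes) := ⟨hN⟩
  have h1 : 𝔐.El fun (v : Fin 1 → 𝔐.carrier) (_ : Fin 0 → Set 𝔐.carrier) => Q fun _ => v 0 :=
    (hQ.comp (fun _ v => v 0) Fin.elim0 (fun _ => Tm.var 0) fun i => i.elim0).congr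
      fun _ _ => Iff.rfl
  convert setOf_mem' (fun x => x ∈ N ∧ Q fun _ => x) (hP := @Dfn.and _ _ _ _ _ _ _ _ inferInstance h1)
    using 1
  ext x
  constructor
  · rintro ⟨h, hx⟩
    exact ⟨h, (hQP fun _ => ⟨x, h⟩).2 hx⟩
  · rintro ⟨h, hx⟩
    exact ⟨h, (hQP fun _ => ⟨x, h⟩).1 hx⟩

theorem adm_setOf_pr_mem {N R : Set 𝔐.carrier} (hN : N ∈ 𝔐.classes) (hR : R ∈ 𝔐.classes)
    (P : (𝔐.adm N R).carrier → (𝔐.adm N R).carrier → Prop) (hP : Dfn False (𝔐.adm N R).mem ∅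
      fun (v : Fin 2 → (𝔐.adm N R).carrier) (_ : Fin 0 → Set (𝔐.adm N R).carrier) =>
        P (v 0) (v 1)) :
    {w | ∃ x y, w = 𝔐.pr x y ∧ ∃ (hx : x ∈ N) (hy : y ∈ N), P ⟨x, hx⟩ ⟨y, hy⟩} ∈ 𝔐.classes := by
  obtain ⟨Q, hQ, hQP⟩ := exists_el_adm hN hR hP
  have : Fact (N ∈ 𝔐.classes) := ⟨hN⟩
  have h1 : 𝔐.El fun (v : Fin 3 → 𝔐.carrier) (_ : Fin 0 → Set 𝔐.carrier) => Q ![v 1, v 0] :=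
    hQ.rename ![1, 0] Fin.elim0 |>.congr fun v W => by
      apply iff_of_eq; congr 1; funext i; fin_cases i <;> rfl
  have h2 : 𝔐.El fun (v : Fin 1 → 𝔐.carrier) (_ : Fin 0 → Set 𝔐.carrier) =>
      ∃ x y, v 0 = 𝔐.pr x y ∧ x ∈ N ∧ y ∈ N ∧ Q ![x, y] := by
    have h3 : 𝔐.El fun (v : Fin 3 → 𝔐.carrier) (_ : Fin 0 → Set 𝔐.carrier) =>
        v 1 ∈ N ∧ v 0 ∈ N ∧ Q ![v 1, v 0] :=
      @Dfn.and _ _ _ _ _ _ _ _ inferInstance (@Dfn.and _ _ _ _ _ _ _ _ inferInstance h1)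
    have h4 : 𝔐.El fun (v : Fin 3 → 𝔐.carrier) (_ : Fin 0 → Set 𝔐.carrier) =>
        v 2 = 𝔐.pr (v 1) (v 0) ∧ v 1 ∈ N ∧ v 0 ∈ N ∧ Q ![v 1, v 0] :=
      @Dfn.and _ _ _ _ _ _ _ _ inferInstance h3
    exact @Dfn.ex _ _ _ _ _ (fun x v _ => ∃ y, v 0 = 𝔐.pr x y ∧ x ∈ N ∧ y ∈ N ∧ Q ![x, y])
      (@Dfn.ex _ _ _ _ _ (fun y w _ => w 1 = 𝔐.pr (w 0) y ∧ w 0 ∈ N ∧ y ∈ N ∧ Q ![w 0, y]) h4)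
  convert setOf_mem' (fun w => ∃ x y, w = 𝔐.pr x y ∧ x ∈ N ∧ y ∈ N ∧ Q ![x, y]) (hP := h2) using 1
  ext w
  refine exists_congr fun x => exists_congr fun y => and_congr_right fun _ => ?_
  have e : ∀ hx hy, Q ![x, y] ↔ P ⟨x, hx⟩ ⟨y, hy⟩ := fun hx hy => by
    rw [show ![x, y] = fun i => ((![⟨x, hx⟩, ⟨y, hy⟩] : Fin 2 → {a // a ∈ N}) i).1 by
      funext i; fin_cases i <;> rfl]
    exact hQP ![⟨x, hx⟩, ⟨y, hy⟩]
  constructor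
  · rintro ⟨hx, hy, h⟩
    exact ⟨hx, hy, (e hx hy).2 h⟩
  · rintro ⟨hx, hy, h⟩
    exact ⟨hx, hy, (e hx hy).1 h⟩

/-- The embedding of `V` into an admissible graph is given by a class. -/
class DefEmb {N R : Set 𝔐.carrier} (j : Emb 𝔐 (𝔐.adm N R)) : Prop where
  out : {w | ∃ x c, w = 𝔐.pr x c ∧ c = (j.ι x).1} ∈ 𝔐.classes

theorem IsCopyOfV.exists_emb {N R F : Set 𝔐.carrier} {v : 𝔐.carrier} (hG : 𝔐.IsGraph N R)
    (hv : v ∈ N) (hF : 𝔐.IsCopyOfV ⟨N, R, v⟩ v F) : ∃ j : Emb 𝔐 (𝔐.adm N R), DefEmb j ∧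
      j.v.1 = v ∧ ∀ x c, 𝔐.Rel F x c ↔ c = (j.ι x).1 := by
  choose f hf hfu using hF.total
  have hfN : ∀ x, f x ∈ N := fun x => hG.left _ _ (hF.range x _ (hf x))
  have hrel : ∀ x c, 𝔐.Rel F x c ↔ c = f x := fun x c =>
    ⟨fun h => hfu x c h, by rintro rfl; exact hf x⟩
  refine ⟨⟨⟨v, hv⟩, fun x => ⟨f x, hfN x⟩, ?_, ?_, ?_, ?_⟩, ⟨?_⟩, rfl, hrel⟩
  · rintro ⟨b, hb⟩
    constructor
    · intro h
      obtain ⟨x, hx, -⟩ := hF.bijective b h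
      exact ⟨x, Subtype.ext ((hrel _ _).1 hx)⟩
    · rintro ⟨x, e⟩
      obtain rfl : b = f x := congrArg Subtype.val e
      exact hF.range x _ (hf x)
  · intro x y e
    have e' : f x = f y := congrArg Subtype.val e
    obtain ⟨z, -, hz⟩ := hF.bijective _ (hF.range x _ (hf x))
    rw [hz x (hf x), hz y (e' ▸ hf y)]
  · intro x y
    exact (hF.mem_iff x y _ _ (hf x) (hf y)).symm
  · intro x b hb
    exact hF.transitive _ _ (hF.range x _ (hf x)) hb
  · have : Fact (F ∈ 𝔐.classes) := ⟨hF.class_mem⟩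
    convert setOf_mem' fun w => ∃ x c, w = 𝔐.pr x c ∧ 𝔐.Rel F x c using 1
    ext w
    exact exists_congr fun x => exists_congr fun c => and_congr_right fun _ => (hrel x c).symm

section Emb

variable {N R : Set 𝔐.carrier} (j : Emb 𝔐 (𝔐.adm N R)) [hj : DefEmb j]

instance {n : ℕ} (s : (Fin n → 𝔐.carrier) → 𝔐.carrier) [Tm False 𝔐.mem 𝔐.classes s] :
    Tm False 𝔐.mem 𝔐.classes fun v => (j.ι (s v)).1 := by
  have : Fact ({w | ∃ x c, w = 𝔐.pr x c ∧ c = (j.ι x).1} ∈ 𝔐.classes) := ⟨hj.out⟩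
  have : Tm False 𝔐.mem 𝔐.classes fun v : Fin 1 → 𝔐.carrier => (j.ι (v 0)).1 := by
    refine Tm.of_graph _ ?_
    have : 𝔐.El fun (w : Fin 2 → 𝔐.carrier) (_ : Fin 0 → Set 𝔐.carrier) =>
      𝔐.Rel {w | ∃ x c, w = 𝔐.pr x c ∧ c = (j.ι x).1} (w 1) (w 0) := inferInstance
    exact this.congr fun v W => (rel_setOf_pr (P := fun x c => c = (j.ι x).1)).symm
  exact this.comp ![s] inferInstance

variable (h : 𝔐.IsAdm N R)

include h hj

theorem coded_subset : j.coded ⊆ 𝔐.classes := by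
  have : Fact (R ∈ 𝔐.classes) := ⟨h.graph.rel_mem⟩
  rintro _ ⟨b, rfl⟩
  exact setOf_mem' fun x => 𝔐.Rel R (j.ι x).1 b.1

/-- The classes that are elements of an admissible set over `V`. -/
theorem isDeltaClosed_coded : 𝔐.IsDeltaClosed j.coded := by
  have := h.isKP
  refine ⟨coded_subset j h, j.elem_mem, j.delta_mem, fun P hP => ?_⟩
  have : Fact (R ∈ 𝔐.classes) := ⟨h.graph.rel_mem⟩
  have : Fact (N ∈ 𝔐.classes) := ⟨h.graph.nodes_mem⟩
  have h1 : 𝔐.El fun (w : Fin 2 → 𝔐.carrier) (_ : Fin 0 → Set 𝔐.carrier) =>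
      P (w 1) {y | 𝔐.Rel R (j.ι y).1 (w 0)} :=
    (hP.mono (coded_subset j h)).app ![fun w => w 1] ![fun w _ => {y | 𝔐.Rel R (j.ι y).1 (w 0)}]
  convert setOf_mem' (fun x => ∃ b, b ∈ N ∧ P x {y | 𝔐.Rel R (j.ι y).1 b})
    (hP := @Dfn.ex _ _ _ _ _ _ (@Dfn.and _ _ _ _ _ _ _ _ inferInstance h1)) using 1
  ext x
  constructor
  · rintro ⟨_, ⟨b, rfl⟩, hx⟩
    exact ⟨b.1, b.2, hx⟩
  · rintro ⟨b, hb, hx⟩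
    exact ⟨_, ⟨⟨b, hb⟩, rfl⟩, hx⟩

omit hj in
theorem isUPair_ι {z x y : 𝔐.carrier} (hz : 𝔐.IsUPair z x y) :
    (𝔐.adm N R).IsUPair (j.ι z) (j.ι x) (j.ι y) := by
  intro w
  constructor
  · intro hw
    obtain ⟨w', rfl⟩ := (j.mem_v _).1 (j.trans _ _ hw)
    rcases (hz w').1 ((j.mem_iff _ _).1 hw) with rfl | rfl
    · exact Or.inl rfl
    · exact Or.inr rfl
  · rintro (rfl | rfl)
    · exact (j.mem_iff _ _).2 ((hz x).2 (Or.inl rfl))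
    · exact (j.mem_iff _ _).2 ((hz y).2 (Or.inr rfl))

omit hj in
theorem isPair_ι (x y : 𝔐.carrier) : (𝔐.adm N R).IsPair (j.ι (𝔐.pr x y)) (j.ι x) (j.ι y) := by
  obtain ⟨s, d, hs, hd, hp⟩ := isPair_pr x y
  exact ⟨_, _, isUPair_ι j h hs, isUPair_ι j h hd, isUPair_ι j h hp⟩

/-- A well-founded relation which is an element of an admissible set over `V` is isomorphic, modulo
extensionality, to a set of that admissible set. -/
theorem exists_collapse_class {N' R' : Set 𝔐.carrier} (hN' : N' ∈ j.coded) (hR' : R' ∈ j.coded)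
    (hl : ∀ x y, 𝔐.Rel R' x y → x ∈ N') (hwf : 𝔐.ClassWF N' R') :
    ∃ G ∈ 𝔐.classes, (∀ x ∈ N', ∃ y, 𝔐.Rel G x y) ∧ (∀ x y, 𝔐.Rel G x y → x ∈ N' ∧ y ∈ N) ∧
      (∀ x y x', 𝔐.Rel G x y → 𝔐.Rel R' x' x → ∃ y', 𝔐.Rel G x' y' ∧ 𝔐.Rel R y' y) ∧
      (∀ x y y', 𝔐.Rel G x y → 𝔐.Rel R y' y → ∃ x', 𝔐.Rel G x' y' ∧ 𝔐.Rel R' x' x) ∧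
      ∃ s ∈ N, ∀ z, 𝔐.Rel R z s ↔ ∃ x, 𝔐.Rel G x z := by
  have hK := h.isKP
  have hgr := h.graph
  obtain ⟨n₀, hn₀⟩ := hN'
  obtain ⟨r, hr⟩ := hR'
  obtain ⟨n, hn⟩ := hK.out.sep (fun b => (𝔐.adm N R).mem b n₀) j.v
  have hnι : ∀ x, (𝔐.adm N R).mem (j.ι x) n ↔ x ∈ N' := fun x => by
    rw [hn, ← hn₀]
    exact and_iff_right ((j.mem_v _).2 ⟨x, rfl⟩)
  have hnι' : ∀ b, (𝔐.adm N R).mem b n → ∃ x ∈ N', b = j.ι x := fun b hb => by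
    obtain ⟨x, rfl⟩ := (j.mem_v b).1 ((hn b).1 hb).1
    exact ⟨x, (hnι x).1 hb, rfl⟩
  have hrι : ∀ x y, (𝔐.adm N R).App r (j.ι x) (j.ι y) ↔ 𝔐.Rel R' x y := fun x y => by
    rw [app_iff, ← isPair_iff.1 (isPair_ι j h x y), rel_iff, ← hr]
    rfl
  -- predicates definable over the graph are classes, so that `R'` remains well-founded for them
  have hwf' : ∀ P : (𝔐.adm N R).carrier → Prop, (Dfn False (𝔐.adm N R).mem ∅
      fun (v : Fin 1 → (𝔐.adm N R).carrier) (_ : Fin 0 → Set (𝔐.adm N R).carrier) => P (v 0)) →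
      (∃ x, (𝔐.adm N R).mem x n ∧ P x) → ∃ x, (𝔐.adm N R).mem x n ∧ P x ∧
        ∀ y, (𝔐.adm N R).mem y n → P y → ¬ (𝔐.adm N R).App r y x := by
    intro P hP ⟨x, hx, hPx⟩
    have hQ : Fact ({x | ∃ h : x ∈ N, P ⟨x, h⟩} ∈ 𝔐.classes) :=
      ⟨adm_setOf_mem hgr.nodes_mem hgr.rel_mem P hP⟩
    have hN'' : Fact (N' ∈ 𝔐.classes) := ⟨coded_subset j h ⟨n₀, hn₀⟩⟩
    obtain ⟨x, hx', rfl⟩ := hnι' x hx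
    obtain ⟨y, ⟨hy, hPy⟩, hmin⟩ := hwf {y | y ∈ N' ∧ (j.ι y).1 ∈ {x | ∃ h : x ∈ N, P ⟨x, h⟩}}
      (setOf_mem' _) (fun y hy => hy.1) ⟨x, hx', (j.ι x).2, hPx⟩
    refine ⟨j.ι y, (hnι y).2 hy, hPy.2, fun z hz hPz hzy => ?_⟩
    obtain ⟨z, hz', rfl⟩ := hnι' z hz
    exact hmin z ⟨hz', (j.ι z).2, hPz⟩ ((hrι z y).1 hzy)
  have hC := adm_setOf_pr_mem hgr.nodes_mem hgr.rel_mem _ (Collapse.dfn n r)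
  set C := {w | ∃ x y, w = 𝔐.pr x y ∧ ∃ (hx : x ∈ N) (hy : y ∈ N),
    (𝔐.adm N R).Collapse n r ⟨x, hx⟩ ⟨y, hy⟩} with hCdef
  have hCrel : ∀ x y, 𝔐.Rel C x y ↔ ∃ (hx : x ∈ N) (hy : y ∈ N),
      (𝔐.adm N R).Collapse n r ⟨x, hx⟩ ⟨y, hy⟩ := fun x y =>
    rel_setOf_pr (P := fun x y => ∃ (hx : x ∈ N) (hy : y ∈ N),
      (𝔐.adm N R).Collapse n r ⟨x, hx⟩ ⟨y, hy⟩)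
  have : Fact (C ∈ 𝔐.classes) := ⟨hC⟩
  have hG : ∀ x y, 𝔐.Rel {w | ∃ x y, w = 𝔐.pr x y ∧ 𝔐.Rel C (j.ι x).1 y} x y ↔
      ∃ hy : y ∈ N, (𝔐.adm N R).Collapse n r (j.ι x) ⟨y, hy⟩ := fun x y => by
    rw [rel_setOf_pr (P := fun x y => 𝔐.Rel C (j.ι x).1 y), hCrel]
    exact ⟨fun ⟨_, hy, h⟩ => ⟨hy, h⟩, fun ⟨hy, h⟩ => ⟨(j.ι x).2, hy, h⟩⟩
  refine ⟨{w | ∃ x y, w = 𝔐.pr x y ∧ 𝔐.Rel C (j.ι x).1 y}, setOf_mem' _, fun x hx => ?_,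
    fun x y hxy => ?_, fun x y x' hxy hx' => ?_, fun x y z hxy hz => ?_, ?_⟩
  · obtain ⟨y, hy⟩ := exists_collapse hwf' ((hnι x).2 hx)
    exact ⟨y.1, (hG _ _).2 ⟨y.2, hy⟩⟩
  · obtain ⟨hy, hxy⟩ := (hG _ _).1 hxy
    exact ⟨(hnι x).1 hxy.1, hy⟩
  · obtain ⟨hy, hxy⟩ := (hG _ _).1 hxy
    obtain ⟨y', h1, h2⟩ := hxy.exists_of_app ((hnι x').2 (hl _ _ hx')) ((hrι _ _).2 hx')
    exact ⟨y'.1, (hG _ _).2 ⟨y'.2, h1⟩, h2⟩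
  · obtain ⟨hy, hxy⟩ := (hG _ _).1 hxy
    have hzN : z ∈ N := hgr.left _ _ hz
    obtain ⟨x', h1, h2⟩ := hxy.exists_of_mem
      (show (𝔐.adm N R).mem ⟨z, hzN⟩ ⟨y, hy⟩ from hz)
    obtain ⟨x', hx', rfl⟩ := hnι' _ h2.1
    exact ⟨x', (hG _ _).2 ⟨_, h2⟩, (hrι _ _).1 h1⟩
  · obtain ⟨s, hs⟩ := exists_collapse_range hwf'
    refine ⟨s.1, s.2, fun z => ⟨fun hz => ?_, fun hx => ?_⟩⟩
    · have hzN : z ∈ N := hgr.left _ _ hz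
      obtain ⟨x, hx⟩ := (hs (⟨z, hzN⟩ : {a // a ∈ N})).1 hz
      obtain ⟨x', hx', rfl⟩ := hnι' _ hx.1
      exact ⟨x', (hG _ _).2 ⟨_, hx⟩⟩
    · obtain ⟨x, hx⟩ := hx
      obtain ⟨hz, hx⟩ := (hG _ _).1 hx
      exact (hs ⟨z, hz⟩).2 ⟨_, hx⟩

end Emb

/-! ### Admissible sets presented by quotient pairs -/

/-- The elements of the ideal set coded by `K`, if it is transitive. -/
def elems (𝔐 : ClassModel.{u}) (K : PointedGraph 𝔐.carrier) : Set 𝔐.carrier :=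
  {b | 𝔐.Rel K.rel b K.top}

/-- The membership relation between the elements of the ideal set coded by `K`. -/
def elemRel (𝔐 : ClassModel.{u}) (K : PointedGraph 𝔐.carrier) : Set 𝔐.carrier :=
  {w | ∃ x y, w = 𝔐.pr x y ∧ 𝔐.Rel K.rel x y ∧ 𝔐.Rel K.rel y K.top}

theorem rel_elemRel {K : PointedGraph 𝔐.carrier} {x y : 𝔐.carrier} :
    𝔐.Rel (𝔐.elemRel K) x y ↔ 𝔐.Rel K.rel x y ∧ 𝔐.Rel K.rel y K.top :=
  rel_setOf_pr (P := fun x y => 𝔐.Rel K.rel x y ∧ 𝔐.Rel K.rel y K.top)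

theorem IsCopyOfV.of_elems {K : PointedGraph 𝔐.carrier} {v : 𝔐.carrier} {F : Set 𝔐.carrier}
    (htr : ∀ b c, 𝔐.Rel K.rel b K.top → 𝔐.Rel K.rel c b → 𝔐.Rel K.rel c K.top)
    (hv : 𝔐.Rel K.rel v K.top) (hF : 𝔐.IsCopyOfV K v F) :
    𝔐.IsCopyOfV ⟨𝔐.elems K, 𝔐.elemRel K, v⟩ v F := by
  refine ⟨hF.class_mem, hF.total, ?_, ?_, ?_, ?_⟩
  · intro x c h
    exact rel_elemRel.2 ⟨hF.range x c h, hv⟩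
  · intro c h
    exact hF.bijective c (rel_elemRel.1 h).1
  · intro x y c d hc hd
    rw [hF.mem_iff x y c d hc hd]
    exact ⟨fun h => rel_elemRel.2 ⟨h, htr _ _ hv (hF.range y d hd)⟩, fun h => (rel_elemRel.1 h).1⟩
  · intro c d hc hd
    exact rel_elemRel.2 ⟨hF.transitive c d (rel_elemRel.1 hc).1 (rel_elemRel.1 hd).1, hv⟩

theorem IsAdmissibleOverV.isAdm {K : PointedGraph 𝔐.carrier} (hD : 𝔐.Delta11Comprehension)
    (h : 𝔐.IsAdmissibleOverV K) : 𝔐.IsAdm (𝔐.elems K) (𝔐.elemRel K) := by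
  obtain ⟨G, hG, hQ⟩ := h.quotientPair
  have : Fact (K.rel ∈ 𝔐.classes) := ⟨hQ.rel_mem⟩
  have hwf := hQ.classWF hD hG
  have hkp : (fun a b : {b // b ∈ 𝔐.elems K} => 𝔐.Rel (𝔐.elemRel K) a.1 b.1) =
      fun a b => 𝔐.Rel K.rel a.1 b.1 := by
    funext a b
    exact propext (rel_elemRel.trans (and_iff_left b.2))
  refine ⟨⟨setOf_mem' fun b => 𝔐.Rel K.rel b K.top,
    setOf_mem' fun w => ∃ x y, w = 𝔐.pr x y ∧ 𝔐.Rel K.rel x y ∧ 𝔐.Rel K.rel y K.top, ?_, ?_, ?_, ?_⟩,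
    ?_, ?_⟩
  · intro x y hxy
    exact h.transitive y x (rel_elemRel.1 hxy).2 (rel_elemRel.1 hxy).1
  · intro x y hxy
    exact (rel_elemRel.1 hxy).2
  · intro X hX hXN hne
    obtain ⟨x, hx, hmin⟩ := hwf X hX (fun x hx => hQ.rel_on.left _ _ (hXN hx)) hne
    exact ⟨x, hx, fun y hy hyx => hmin y hy (rel_elemRel.1 hyx).1⟩
  · intro x hx y hy hxy
    have := h.modelsKP.extensionality ⟨x, hx⟩ ⟨y, hy⟩ fun z => by
      have := hxy z.1
      rw [rel_elemRel, rel_elemRel] at this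
      exact (and_iff_left hx).symm.trans (this.trans (and_iff_left hy))
    exact congrArg Subtype.val this
  · rw [hkp]
    exact h.modelsKP
  · obtain ⟨v, F, hv, hF⟩ := h.contains_V
    exact ⟨v, hv, F, hF.of_elems h.transitive hv⟩

end ClassModel

end ClassTheory

namespace ClassTheory
open SetFormula
namespace ClassModel

variable {𝔐 : ClassModel.{u}} [hM : Nbg 𝔐]

/-! ### Minimality of the union of all towers -/

/-- A tower contains all names that are new at one of its levels. -/
theorem TowerLe.mem_of_newAtLevel {T U : Set 𝔐.carrier} (hle : 𝔐.TowerLe T U) (hT : 𝔐.IsTower T)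
    (hU : 𝔐.IsTower U) {B x : 𝔐.carrier} (hB : B ∈ 𝔐.tL T) (hx : x ∈ 𝔐.tN U)
    (hnew : 𝔐.NewAtLevel U B x) : x ∈ 𝔐.tN T := by
  obtain ⟨-, c, p, -, hxe⟩ := NewAt.exists_tag hnew
  obtain ⟨y, hy, -, hye⟩ := hT.closed B hB c p
  rw [hU.ext x hx y (hle.name y hy) fun z => ?_]
  · exact hy
  · rw [hxe, ← hle.in_iff y hy, hye, hle.sat B hB, ← hle.extn_eq hT hB]
    rfl

section Coded

variable {N R U : Set 𝔐.carrier} (h : 𝔐.IsAdm N R) (j : Emb 𝔐 (𝔐.adm N R)) [hj : DefEmb j]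
  (hU : 𝔐.IsTower U) (hUc : U ∈ 𝔐.classes)
  (hle : ∀ T ∈ 𝔐.classes, 𝔐.IsTower T → 𝔐.TowerLe T U)

include h hU hle

/-- If all levels below a stage occur in towers coded in an admissible set, then all names of that
stage do. -/
theorem exists_coded_tower_of_name {x : 𝔐.carrier} (hx : x ∈ 𝔐.tN U)
    (hlev : ∀ D ∈ 𝔐.tL U, 𝔐.NewAtLevel U D x → ∃ T ∈ j.coded, 𝔐.IsTower T ∧ D ∈ 𝔐.tL T) :
    ∃ T ∈ j.coded, 𝔐.IsTower T ∧ x ∈ 𝔐.tN T := by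
  have hc := isDeltaClosed_coded j h
  rcases hU.source x hx with ⟨y, rfl⟩ | ⟨D, hD, hnew⟩
  · have hb := baseTower_mem hc
    have hbt := isTower_baseTower (𝔐 := 𝔐)
    exact ⟨_, hb, hbt, hbt.base y⟩
  · obtain ⟨T, hT, hTt, hDT⟩ := hlev D hD hnew
    exact ⟨T, hT, hTt, (hle T (hc.subset hT) hTt).mem_of_newAtLevel hTt hU hDT hx hnew⟩

/-- If all levels before the level `B` occur in coded towers, then `Δ₀`-Collection, applied to a tag
of the stage `B`, yields a coded tower that contains all of them. -/
theorem exists_coded_tower_below {B : 𝔐.carrier} (hB : B ∈ 𝔐.tL U)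
    (hlev : ∀ D ∈ 𝔐.tL U, 𝔐.In U D B → ∃ T ∈ j.coded, 𝔐.IsTower T ∧ D ∈ 𝔐.tL T)
    (hBn : ¬ ∃ T ∈ j.coded, 𝔐.IsTower T ∧ B ∈ 𝔐.tL T) :
    ∃ Z ∈ j.coded, 𝔐.IsTower Z ∧ ∀ x, x ∈ 𝔐.tN Z ↔ 𝔐.In U x B := by
  have hK := h.isKP
  have hc := isDeltaClosed_coded j h
  obtain ⟨t, -, -, ⟨c, p, a, b, -, ha, hb, hall, hnb⟩, -⟩ := NewAt.exists_tag (hU.level_new B hB)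
  have hname : ∀ x, 𝔐.In U x B → ∃ T ∈ j.coded, 𝔐.IsTower T ∧ x ∈ 𝔐.tN T := fun x hx =>
    exists_coded_tower_of_name h j hU hle (hU.in_left _ _ hx) fun D hD hnew =>
      hlev D hD (hU.in_of_new hB hD hx hnew)
  obtain ⟨Ta, hTa, hTat, haT⟩ := hname a ha
  obtain ⟨Tb, hTb, hTbt, hbT⟩ := hname b hb
  have hina : ∀ x, 𝔐.In Ta x a ↔ 𝔐.In U x a := (hle Ta (hc.subset hTa) hTat).in_iff a haT
  have : Fact (Ta ∈ j.coded) := ⟨hTa⟩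
  -- for each element `x` of `a`, some coded tower contains a level satisfying the condition of the tag;
  -- `d` bounds the codes of such towers
  obtain ⟨d, hd⟩ := j.exists_bound (fun x T => 𝔐.IsTower T ∧ a ∈ 𝔐.tN T ∧ b ∈ 𝔐.tN T ∧
    (𝔐.In Ta x a → ∃ D, D ∈ 𝔐.tL T ∧ 𝔐.In T b D ∧ 𝔐.pr c (𝔐.pr D (𝔐.pr x p)) ∈ 𝔐.tY T D))
    inferInstance fun x => by
      have hcom : ∀ T ∈ j.coded, 𝔐.IsTower T → ∀ D ∈ 𝔐.tN T, ∃ T ∈ j.coded, 𝔐.IsTower T ∧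
          a ∈ 𝔐.tN T ∧ b ∈ 𝔐.tN T ∧ D ∈ 𝔐.tN T := fun T hT hTt D hD => by
        obtain ⟨T', ⟨hT', hTt'⟩, h1, h2, h3⟩ := exists_common₃
          (𝒳 := {T | T ∈ j.coded ∧ 𝔐.IsTower T}) (fun T hT => hT.2) (fun T hT => hc.subset hT.1)
          ⟨Ta, ⟨hTa, hTat⟩, haT⟩ ⟨Tb, ⟨hTb, hTbt⟩, hbT⟩ ⟨T, ⟨hT, hTt⟩, hD⟩
        exact ⟨T', hT', hTt', h1, h2, h3⟩
      by_cases hx : 𝔐.In Ta x a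
      · obtain ⟨D, hDB, hit⟩ := hall x ((hina x).1 hx)
        obtain ⟨T, hT, hTt, hDT⟩ := hlev D hit.1 hDB
        obtain ⟨T', hT', hTt', h1, h2, h3⟩ := hcom T hT hTt D (hTt.level_name D hDT)
        have hle' := hle T' (hc.subset hT') hTt'
        exact ⟨T', hT', hTt', h1, h2, fun _ => ⟨D, ((hle'.agree hTt').hit_iff h3).2 hit⟩⟩
      · obtain ⟨T', hT', hTt', h1, h2, -⟩ := hcom Ta hTa hTat a haT
        exact ⟨T', hT', hTt', h1, h2, fun hx' => absurd hx' hx⟩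
  have hZ := j.bex_mem (fun w T => 𝔐.IsTower T ∧ w ∈ T) inferInstance d
  have hZe : {w | ∃ y, (𝔐.adm N R).mem y d ∧ 𝔐.IsTower (j.trace y) ∧ w ∈ j.trace y} =
      ⋃₀ {T | ∃ y, (𝔐.adm N R).mem y d ∧ 𝔐.IsTower (j.trace y) ∧ T = j.trace y} := by
    ext w
    constructor
    · rintro ⟨y, h1, h2, h3⟩
      exact ⟨_, ⟨y, h1, h2, rfl⟩, h3⟩
    · rintro ⟨_, ⟨y, h1, h2, rfl⟩, h3⟩
      exact ⟨y, h1, h2, h3⟩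
  rw [hZe] at hZ
  set 𝒳 := {T | ∃ y, (𝔐.adm N R).mem y d ∧ 𝔐.IsTower (j.trace y) ∧ T = j.trace y} with h𝒳
  have h𝒳t : ∀ T ∈ 𝒳, 𝔐.IsTower T := by
    rintro _ ⟨y, -, hy, rfl⟩
    exact hy
  have h𝒳c : ∀ T ∈ 𝒳, T ∈ 𝔐.classes := by
    rintro _ ⟨y, -, -, rfl⟩
    exact hc.subset ⟨y, rfl⟩
  have hcol : ∀ x, ∃ T ∈ 𝒳, 𝔐.IsTower T ∧ a ∈ 𝔐.tN T ∧ b ∈ 𝔐.tN T ∧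
      (𝔐.In Ta x a → ∃ D, 𝔐.Hit T c p b x D) := fun x => by
    obtain ⟨y, hy, hT, h1, h2, h3⟩ := hd x
    exact ⟨_, ⟨y, hy, hT, rfl⟩, hT, h1, h2, h3⟩
  have hZt : 𝔐.IsTower (⋃₀ 𝒳) := isTower_sUnion h𝒳t h𝒳c (by
    obtain ⟨T, hT, -⟩ := hcol a
    exact ⟨T, hT⟩)
  have hleZ := hle _ (hc.subset hZ) hZt
  have hBZ : ¬ B ∈ 𝔐.tL (⋃₀ 𝒳) := fun hBL => hBn ⟨_, hZ, hZt, hBL⟩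
  -- every level below `B` is in the union, for otherwise it would bound the levels required by the tag
  have hlevZ : ∀ C ∈ 𝔐.tL U, 𝔐.In U C B → C ∈ 𝔐.tL (⋃₀ 𝒳) := fun C hC hCB => by
    by_contra hCZ
    refine hnb ⟨C, hCB, hC, fun x hx => ?_⟩
    obtain ⟨T, hT, hTt, -, -, hit⟩ := hcol x
    obtain ⟨D, hit⟩ := hit ((hina x).2 hx)
    have hTZ := towerLe_sUnion h𝒳t h𝒳c hT
    have hDT := hTt.level_name D hit.1
    have hitU := ((hle T (h𝒳c T hT) hTt).agree hTt).hit_iff hDT |>.1 hit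
    refine ⟨D, ?_, hitU⟩
    have hDZ : D ∈ 𝔐.tL (⋃₀ 𝒳) := (hTZ.level D hDT).1 hit.1
    rcases hU.linear D hitU.1 C hC with h1 | rfl | h1
    · exact h1
    · exact absurd hDZ hCZ
    · have hCN := hZt.in_left _ _ ((hleZ.in_iff D (hZt.level_name D hDZ) C).2 h1)
      exact absurd ((hleZ.level C hCN).2 hC) hCZ
  have hZlev : ∀ D ∈ 𝔐.tL (⋃₀ 𝒳), 𝔐.In U D B := fun D hD => by
    have hDN := hZt.level_name D hD
    rcases hU.linear D ((hleZ.level D hDN).1 hD) B hB with h1 | rfl | h1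
    · exact h1
    · exact absurd hD hBZ
    · have hBN := hZt.in_left _ _ ((hleZ.in_iff D hDN B).2 h1)
      exact absurd ((hleZ.level B hBN).2 hB) hBZ
  refine ⟨_, hZ, hZt, fun x => ⟨fun hx => ?_, fun hx => ?_⟩⟩
  · rcases hZt.source x hx with ⟨y, rfl⟩ | ⟨D, hD, hnew⟩
    · exact hU.level_base B hB y
    · exact hU.up D ((hleZ.level D (hZt.level_name D hD)).1 hD) B hB (hZlev D hD) x (hleZ.name x hx)
        ((hleZ.newAtLevel_iff hZt hD hx).1 hnew)
  · rcases hU.source x (hU.in_left _ _ hx) with ⟨y, rfl⟩ | ⟨C, hC, hnew⟩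
    · exact hZt.base y
    · exact hleZ.mem_of_newAtLevel hZt hU (hlevZ C hC (hU.in_of_new hB hC hx hnew))
        (hU.in_left _ _ hx) hnew

include hUc

/-- Every level of the union of all towers occurs in a tower which is an element of the given
admissible set. -/
theorem exists_coded_tower {B : 𝔐.carrier} (hB : B ∈ 𝔐.tL U) :
    ∃ T ∈ j.coded, 𝔐.IsTower T ∧ B ∈ 𝔐.tL T := by
  have hc := isDeltaClosed_coded j h
  by_contra hBn
  have hY : Fact ({x | ∃ T ∈ j.coded, 𝔐.IsTower T ∧ x ∈ 𝔐.tL T} ∈ 𝔐.classes) :=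
    ⟨hc.sigma (fun x T => 𝔐.IsTower T ∧ x ∈ 𝔐.tL T) inferInstance⟩
  have : Fact (U ∈ 𝔐.classes) := ⟨hUc⟩
  obtain ⟨B, ⟨hB, hBn⟩, hmin⟩ := hU.classWF hUc
    {B | B ∈ 𝔐.tL U ∧ ¬ B ∈ {x | ∃ T ∈ j.coded, 𝔐.IsTower T ∧ x ∈ 𝔐.tL T}} (setOf_mem' _)
    (fun B hB => hU.level_name B hB.1) ⟨B, hB, hBn⟩
  obtain ⟨Z, hZ, hZt, hZN⟩ := exists_coded_tower_below h j hU hle hB (fun D hD hDB => by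
    by_contra hDn
    exact hmin D ⟨hD, hDn⟩ hDB) hBn
  have hZc := hc.subset hZ
  have hleZ := hle Z hZc hZt
  obtain ⟨t, -, -, ht, -⟩ := NewAt.exists_tag (hU.level_new B hB)
  have e : 𝔐.extn U B = 𝔐.tN Z := Set.ext fun x => (hZN x).symm
  rw [e] at ht
  -- the tag of the stage `B` is a tag of the last stage of `Z`, so that `Z` can be prolonged, and the
  -- new level is `B`
  replace ht := ((hleZ.agree hZt).tagAt_iff fun x _ z hz => hZt.in_left z x hz).2 ht
  have : Fact (Z ∈ j.coded) := ⟨hZ⟩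
  obtain ⟨W, hW, hsat⟩ := exists_isSat hc (S := 𝔐.tN Z) (E := 𝔐.sec Z (𝔐.num 1))
    (hc.elem (fun x => x ∈ 𝔐.tN Z) inferInstance) (hc.elem (fun x => x ∈ 𝔐.sec Z (𝔐.num 1))
      inferInstance)
  obtain ⟨C, hC⟩ := exists_freshTop hZt hZc (hc.subset hW) hsat ht
  have hn := isTower_nextTower hZt hZc (hc.subset hW) hsat ht
  have hnc := nextTower_mem hc hZ hW
  have hlen := hle _ (hc.subset hnc) hn
  have hCL : C ∈ 𝔐.tL (𝔐.nextTower Z W) := mem_tL_nextTower.2 (Or.inr hC)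
  have hCN := hn.level_name C hCL
  refine hBn ⟨_, hnc, hn, ?_⟩
  rw [hU.ext B (hU.level_name B hB) C (hlen.name C hCN) fun z => ?_]
  · exact hCL
  · rw [← hlen.in_iff C hCN, hC.in_iff hZt, hZN]

theorem exists_coded_tower_name {x : 𝔐.carrier} (hx : x ∈ 𝔐.tN U) :
    ∃ T ∈ j.coded, 𝔐.IsTower T ∧ x ∈ 𝔐.tN T :=
  exists_coded_tower_of_name h j hU hle hx fun _ hD _ => exists_coded_tower h j hU hUc hle hD

end Coded

theorem IsTower.isGraph {T : Set 𝔐.carrier} (hT : 𝔐.IsTower T) (hTc : T ∈ 𝔐.classes) :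
    𝔐.IsGraph (𝔐.tN T) (𝔐.sec T (𝔐.num 1)) :=
  ⟨sec_mem hTc _, sec_mem hTc _, hT.in_left, hT.in_right, hT.classWF hTc, hT.ext⟩

theorem IsAdmissibleOverV.exists_emb {K : PointedGraph 𝔐.carrier} (hD : 𝔐.Delta11Comprehension)
    (h : 𝔐.IsAdmissibleOverV K) : ∃ j : Emb 𝔐 (𝔐.adm (𝔐.elems K) (𝔐.elemRel K)), DefEmb j := by
  have ha := h.isAdm hD
  obtain ⟨v, hv, F, hF⟩ := ha.copy
  obtain ⟨j, hj, -⟩ := hF.exists_emb ha.graph hv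
  exact ⟨j, hj⟩

/-- A bisimulation between the graph `(N, R)` and the elements of an ideal set `K` yields
isomorphisms between the parts of the quotient pair of `(N, R)` and of `K`. -/
theorem iso_below_quot {N R N' R' G : Set 𝔐.carrier} {K : PointedGraph 𝔐.carrier}
    (hD : 𝔐.Delta11Comprehension) (hK : 𝔐.IsAdmissibleOverV K) (hg : 𝔐.IsGraph N R)
    (hg' : 𝔐.IsGraph N' R') (hNN : N' ⊆ N)
    (hRR : ∀ x ∈ N', ∀ z, 𝔐.Rel R' z x ↔ 𝔐.Rel R z x) (hG : G ∈ 𝔐.classes)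
    (hGN : ∀ x y, 𝔐.Rel G x y → x ∈ N' ∧ y ∈ 𝔐.elems K)
    (hforth : ∀ x y x', 𝔐.Rel G x y → 𝔐.Rel R' x' x →
      ∃ y', 𝔐.Rel G x' y' ∧ 𝔐.Rel (𝔐.elemRel K) y' y)
    (hback : ∀ x y y', 𝔐.Rel G x y → 𝔐.Rel (𝔐.elemRel K) y' y →
      ∃ x', 𝔐.Rel G x' y' ∧ 𝔐.Rel R' x' x) {x y : 𝔐.carrier} (hxy : 𝔐.Rel G x y) :
    𝔐.Iso (𝔐.below (𝔐.quot N R) (𝔐.pr x 𝔐.o)) (𝔐.below K y) := by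
  obtain ⟨C, hC, hQ⟩ := hK.quotientPair
  obtain ⟨C', hC', hQ'⟩ := hg.isQuotientPair_quot
  have : Fact (G ∈ 𝔐.classes) := ⟨hG⟩
  have hF : ∀ u y, 𝔐.Rel {w | ∃ u y, w = 𝔐.pr u y ∧ ∃ x, u = 𝔐.pr x 𝔐.o ∧ 𝔐.Rel G x y} u y ↔
      ∃ x, u = 𝔐.pr x 𝔐.o ∧ 𝔐.Rel G x y := fun u y =>
    rel_setOf_pr (P := fun u y => ∃ x, u = 𝔐.pr x 𝔐.o ∧ 𝔐.Rel G x y)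
  have hin : 𝔐.Rel (𝔐.quot N R).rel (𝔐.pr x 𝔐.o) 𝔐.o :=
    rel_quot_o.2 ⟨x, hNN (hGN _ _ hxy).1, rfl⟩
  refine iso_below_of_bisim hQ'.nodes_mem hQ'.rel_mem hQ'.rel_on.left hQ.nodes_mem hQ.rel_mem
    hQ.rel_on.left (hQ'.rel_on.left _ _ hin) (hQ.rel_on.left _ _ (hGN _ _ hxy).2)
    (F := {w | ∃ u y, w = 𝔐.pr u y ∧ ∃ x, u = 𝔐.pr x 𝔐.o ∧ 𝔐.Rel G x y}) (setOf_mem' _)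
    ((hF _ _).2 ⟨x, rfl, hxy⟩) ?_ ?_ ?_ ?_
  · intro u y y' h1 h2
    obtain ⟨x, rfl, h3⟩ := (hF _ _).1 h1
    obtain ⟨x', e, h4⟩ := (hF _ _).1 h2
    obtain ⟨rfl, -⟩ := pr_inj.1 e
    exact (hK.isAdm hD).graph.bisim_right_unique hG (fun x y h => (hGN x y h).2) hforth hback h3 h4
  · intro u u' y h1 h2
    obtain ⟨x, rfl, h3⟩ := (hF _ _).1 h1
    obtain ⟨x', rfl, h4⟩ := (hF _ _).1 h2
    rw [hg'.bisim_left_unique hG (fun x y h => (hGN x y h).1) hforth hback h3 h4]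
  · intro u y u' h1 h2
    obtain ⟨x, rfl, h5⟩ := (hF _ _).1 h1
    obtain ⟨x', rfl, h6⟩ := (rel_quot_pr hg.right).1 h2
    obtain ⟨y', h3, h4⟩ := hforth x y x' h5 ((hRR x (hGN _ _ h5).1 x').2 h6)
    exact ⟨y', (hF _ _).2 ⟨x', rfl, h3⟩, (rel_elemRel.1 h4).1⟩
  · intro u y y' h1 h2
    obtain ⟨x, rfl, h5⟩ := (hF _ _).1 h1
    obtain ⟨x', h3, h4⟩ := hback x y y' h5 (rel_elemRel.2 ⟨h2, (hGN _ _ h5).2⟩)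
    exact ⟨_, (hF _ _).2 ⟨x', rfl, h3⟩, (rel_quot_pr_pr hg.right).2 ((hRR x (hGN _ _ h5).1 x').1 h4)⟩

theorem Sigma11Comprehension.delta11 (hS : 𝔐.Sigma11Comprehension) : 𝔐.Delta11Comprehension :=
  fun φ _ p P hP _ => hS φ p P hP

/-- The union of all towers presents `Hyp(V)`. -/
theorem codesHyp_allTower (hS : 𝔐.Sigma11Comprehension) :
    𝔐.CodesHyp (𝔐.quot (𝔐.tN 𝔐.allTower) (𝔐.sec 𝔐.allTower (𝔐.num 1))) := by
  have hU := isTower_allTower hS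
  have hUc := allTower_mem hS
  have hD : 𝔐.Delta11Comprehension := hS.delta11
  have hle : ∀ T ∈ 𝔐.classes, 𝔐.IsTower T → 𝔐.TowerLe T 𝔐.allTower := fun T hT hTt =>
    towerLe_allTower hS hT hTt
  refine ⟨(isAdm_allTower hS).isAdmissibleOverV, fun K hK b hb => ?_⟩
  obtain ⟨x, hx, rfl⟩ := rel_quot_o.1 hb
  have ha := hK.isAdm hD
  obtain ⟨j, hj⟩ := hK.exists_emb hD
  obtain ⟨T, hT, hTt, hxT⟩ := exists_coded_tower_name ha j hU hUc hle hx
  have hc := isDeltaClosed_coded j ha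
  have : Fact (T ∈ j.coded) := ⟨hT⟩
  have hTc := hc.subset hT
  -- the collapse of the coded tower `T` inside `K` takes `x` to the required element of `K`
  obtain ⟨G, hG, htot, hGN, hforth, hback, -⟩ := exists_collapse_class j ha
    (hc.elem (fun x => x ∈ 𝔐.tN T) inferInstance)
    (hc.elem (fun x => x ∈ 𝔐.sec T (𝔐.num 1)) inferInstance) hTt.in_left (hTt.classWF hTc)
  obtain ⟨y, hxy⟩ := htot x hxT
  exact ⟨y, (hGN x y hxy).2, iso_below_quot hD hK (hU.isGraph hUc) (hTt.isGraph hTc)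
    (hle T hTc hTt).name (hle T hTc hTt).in_iff hG hGN hforth hback hxy⟩

/-! ### Codes of pairs -/

theorem isRep_iff {X A B : Set 𝔐.carrier} : 𝔐.IsRep X A B ↔ ∀ w, w ∈ X ↔
    ∃ z, (z ∈ A ∧ w = 𝔐.pr z (𝔐.sc 𝔐.o)) ∨ (z ∈ B ∧ w = 𝔐.pr z (𝔐.sc (𝔐.sc 𝔐.o))) := by
  unfold IsRep
  simp only [isZero_iff, isSucc_iff, isPair_iff]
  refine forall_congr' fun w => iff_congr Iff.rfl (exists_congr fun z => ?_)
  simp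

theorem IsRep.mem_right {X A B : Set 𝔐.carrier} (h : 𝔐.IsRep X A B) {z : 𝔐.carrier} :
    𝔐.pr z (𝔐.sc (𝔐.sc 𝔐.o)) ∈ X ↔ z ∈ B := by
  rw [isRep_iff.1 h]
  constructor
  · rintro ⟨z', ⟨hz, e⟩ | ⟨hz, e⟩⟩
    · exact absurd (sc_inj (pr_inj.1 e).2) (sc_ne_o _)
    · rwa [(pr_inj.1 e).1]
  · intro hz; exact ⟨z, Or.inr ⟨hz, rfl⟩⟩

theorem exists_isHypCode (hS : 𝔐.Sigma11Comprehension) : ∃ X, 𝔐.IsHypCode X := by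
  have hQ := codesHyp_allTower hS
  obtain ⟨C, hC, hq⟩ := hQ.1.quotientPair
  set Q := 𝔐.quot (𝔐.tN 𝔐.allTower) (𝔐.sec 𝔐.allTower (𝔐.num 1)) with hQd
  have : Fact (Q.nodes ∈ 𝔐.classes) := ⟨hq.nodes_mem⟩
  have : Fact (Q.rel ∈ 𝔐.classes) := ⟨hq.rel_mem⟩
  exact ⟨{w | ∃ z, (z ∈ Q.nodes ∧ w = 𝔐.pr z (𝔐.sc 𝔐.o)) ∨
    (z ∈ Q.rel ∧ w = 𝔐.pr z (𝔐.sc (𝔐.sc 𝔐.o)))}, setOf_mem' _, Q, isRep_iff.2 fun _ => Iff.rfl, hQ⟩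

end ClassModel

end ClassTheory

namespace ClassTheory
open SetFormula
namespace ClassModel

variable {𝔐 : ClassModel.{u}} [hM : Nbg 𝔐]

/-! ### The classes that are elements of `Hyp(V)` -/

/-- Two isomorphisms of the sets of `𝔐` with transitive elements of an extensional graph agree. -/
theorem Emb.unique {N R : Set 𝔐.carrier} (hg : 𝔐.IsGraph N R) (j j' : Emb 𝔐 (𝔐.adm N R)) [DefEmb j]
    [DefEmb j'] (x : 𝔐.carrier) : j.ι x = j'.ι x := by
  have key : ∀ (j : Emb 𝔐 (𝔐.adm N R)) x z, 𝔐.Rel R z (j.ι x).1 ↔ ∃ y, 𝔐.mem y x ∧ z = (j.ι y).1 :=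
    fun j x z => by
      constructor
      · intro hz
        have hz' : (𝔐.adm N R).mem ⟨z, hg.left _ _ hz⟩ (j.ι x) := hz
        obtain ⟨y, hy⟩ := (j.mem_v _).1 (j.trans _ _ hz')
        exact ⟨y, (j.mem_iff _ _).1 (hy ▸ hz'), congrArg Subtype.val hy⟩
      · rintro ⟨y, hy, rfl⟩
        exact (j.mem_iff _ _).2 hy
  refine Subtype.ext (mem_induction (fun x => (j.ι x).1 = (j'.ι x).1) (fun x ih => ?_) x)
  refine hg.ext _ (j.ι x).2 _ (j'.ι x).2 fun z => ?_
  rw [key, key]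
  exact exists_congr fun y => and_congr_right fun hy => by rw [ih y hy]

/-- The classes that are elements of the ideal set `Q` are the classes coded in its elements. -/
theorem exists_restrict_classes {Q : PointedGraph 𝔐.carrier} (hD : 𝔐.Delta11Comprehension)
    (hQ : 𝔐.IsAdmissibleOverV Q) :
    ∃ j : Emb 𝔐 (𝔐.adm (𝔐.elems Q) (𝔐.elemRel Q)), DefEmb j ∧ (𝔐.restrict Q).classes = j.coded := by
  have ha := hQ.isAdm hD
  have hK := ha.isKP
  obtain ⟨v, F, hv, hF⟩ := hQ.contains_V
  obtain ⟨j, hj, hjv, hjF⟩ := (hF.of_elems hQ.transitive hv).exists_emb ha.graph hv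
  refine ⟨j, hj, Set.ext fun X => ⟨?_, ?_⟩⟩
  · rintro ⟨-, v', F', b, hv', hF', hb, -, hX⟩
    obtain ⟨j', hj', -, hjF'⟩ := (hF'.of_elems hQ.transitive hv').exists_emb ha.graph hv'
    refine ⟨⟨b, hb⟩, Set.ext fun x => ?_⟩
    rw [hX x _ ((hjF' _ _).2 rfl), ← Emb.unique ha.graph j j' x]
    exact rel_elemRel.trans (and_iff_left hb)
  · rintro ⟨b, rfl⟩
    refine ⟨coded_subset j ha ⟨b, rfl⟩, ?_⟩
    obtain ⟨d, hd⟩ := hK.out.sep (fun c => (𝔐.adm (𝔐.elems Q) (𝔐.elemRel Q)).mem c b) j.v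
    have hd2 : 𝔐.Rel Q.rel d.1 Q.top := d.2
    refine ⟨v, F, d.1, hv, hF, hd2, fun c hc => ?_, fun x c hc => ?_⟩
    · have h1 := ((hd ⟨c, hQ.transitive _ _ hd2 hc⟩).1 (rel_elemRel.2 ⟨hc, hd2⟩)).1
      have h2 := (rel_elemRel.1 h1).1
      rwa [hjv] at h2
    · rw [(hjF x c).1 hc, j.mem_trace]
      refine Iff.trans (((hd (j.ι x)).trans (and_iff_right ((j.mem_v _).2 ⟨x, rfl⟩))).symm) ?_
      exact rel_elemRel.trans (and_iff_left hd2)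

theorem restrict_subset (Q : PointedGraph 𝔐.carrier) : (𝔐.restrict Q).classes ⊆ 𝔐.classes :=
  fun _ h => h.1

theorem Emb.realize_mem {N R : Set 𝔐.carrier} (j : Emb 𝔐 (𝔐.adm N R)) [DefEmb j] [(𝔐.adm N R).KP]
    {n m : ℕ} (φ : SetFormula (n + 1) m) (p : Fin n → 𝔐.carrier) (P : Fin m → Set 𝔐.carrier)
    (hP : ∀ i, P i ∈ j.coded) : {x | φ.Realize 𝔐.mem (Fin.cons x p) P} ∈ j.coded := by
  refine j.elem_mem (fun x => φ.Realize 𝔐.mem (Fin.cons x p) P) ?_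
  refine (Dfn.realize φ (n' := 1) (m' := 0) (Fin.cons (fun v => v 0) fun i _ => p i)
    (fun i _ _ => P i) (fun i => ?_) fun i => ?_).congr fun v W => ?_
  · refine Fin.cases ?_ (fun i => ?_) i
    · exact Tm.var 0
    · exact Tm.const _
  · have : Fact (P i ∈ j.coded) := ⟨hP i⟩
    exact CT.const _
  · apply iff_of_eq; congr 1
    funext i
    refine Fin.cases ?_ (fun i => ?_) i <;> simp

theorem nbgWithoutChoice_restrict {Q : PointedGraph 𝔐.carrier} (hD : 𝔐.Delta11Comprehension)
    (hQ : 𝔐.IsAdmissibleOverV Q) : (𝔐.restrict Q).NBGWithoutChoice := by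
  obtain ⟨j, hj, hcl⟩ := exists_restrict_classes hD hQ
  have := (hQ.isAdm hD).isKP
  have h := hM.out
  refine ⟨h.extensionality, h.pairing, h.infinity, h.union, h.powerSet,
    fun X hX => h.foundation X hX.1, ?_, fun F hF => h.replacement F hF.1⟩
  intro n m φ p P hP
  rw [hcl] at hP ⊢
  exact j.realize_mem φ p P hP

theorem delta11_restrict {Q : PointedGraph 𝔐.carrier} (hD : 𝔐.Delta11Comprehension)
    (hQ : 𝔐.IsAdmissibleOverV Q) : (𝔐.restrict Q).Delta11Comprehension := by
  have : Nbg (𝔐.restrict Q) := ⟨nbgWithoutChoice_restrict hD hQ⟩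
  obtain ⟨j, hj, hcl⟩ := exists_restrict_classes hD hQ
  have := (hQ.isAdm hD).isKP
  refine @delta11_of_single (𝔐.restrict Q) _ fun P P' hP hP' h => ?_
  unfold El at hP hP'
  rw [hcl] at hP hP' h ⊢
  exact j.delta_mem P P' hP hP' h

theorem GlobalChoice.setChoice (h : 𝔐.GlobalChoice) : 𝔐.SetChoice := by
  obtain ⟨F, hF, hfun, hch⟩ := h
  have : Fact (F ∈ 𝔐.classes) := ⟨hF⟩
  intro x hne hdis
  obtain ⟨c, hc⟩ := replace (fun y z => 𝔐.mem z y ∧ 𝔐.Rel F y z)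
    (fun y z z' h h' => hfun y z z' h.2 h'.2) x
  refine ⟨c, fun y hy => ?_⟩
  obtain ⟨z, hz, hyz⟩ := hch y (hne y hy)
  refine ⟨z, ⟨hz, (hc z).2 ⟨y, hy, hz, hyz⟩⟩, ?_⟩
  rintro z' ⟨hz', hzc⟩
  obtain ⟨y', hy', hzy', hF'⟩ := (hc z').1 hzc
  obtain rfl := hdis y y' z' hy hy' hz' hzy'
  exact hfun y z' z hF' hyz

/-! ### No element of `Hyp(V)` codes `Hyp(V)` -/

/-- Isomorphic parts of a transitive ideal set have the same top. -/
theorem IsAdmissibleOverV.eq_of_iso {Q : PointedGraph 𝔐.carrier} (hD : 𝔐.Delta11Comprehension)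
    (hQ : 𝔐.IsAdmissibleOverV Q) {x y : 𝔐.carrier} (hx : x ∈ 𝔐.elems Q) (hy : y ∈ 𝔐.elems Q)
    (h : 𝔐.Iso (𝔐.below Q x) (𝔐.below Q y)) : x = y := by
  obtain ⟨C, hC, hq⟩ := hQ.quotientPair
  have ha := hQ.isAdm hD
  obtain ⟨F, hF, h⟩ := iso_iff.1 h
  have hl := hq.rel_on.left
  have htop := h.top hq.nodes_mem hq.rel_mem hl hq.nodes_mem hq.rel_mem hl (hq.classWF hD hC)
    (hl _ _ hx) (hl _ _ hy)
  obtain ⟨h1, h2, h3⟩ := h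
  have hn : ∀ {x a}, x ∈ 𝔐.elems Q → a ∈ (𝔐.below Q x).nodes → a ∈ 𝔐.elems Q := fun hx ha => by
    have : Fact (Q.rel ∈ 𝔐.classes) := ⟨hq.rel_mem⟩
    exact reach_induction hq.rel_mem (fun a => 𝔐.Rel Q.rel a Q.top) hx
      (fun y z _ hy hz => hQ.transitive y z hy hz) ha.2
  have hpred : ∀ {x a b}, a ∈ (𝔐.below Q x).nodes → 𝔐.Rel Q.rel b a → b ∈ (𝔐.below Q x).nodes :=
    fun ha hb => ⟨hl _ _ hb, reach_step ha.2 hb⟩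
  have hb := below_nodes_mem hq.nodes_mem hq.rel_mem
  have : Fact (F ∈ 𝔐.classes) := ⟨hF⟩
  have : Fact ((𝔐.below Q x).nodes ∈ 𝔐.classes) := ⟨hb x⟩
  have : Fact ((𝔐.below Q y).nodes ∈ 𝔐.classes) := ⟨hb y⟩
  have hG : ∀ a b, 𝔐.Rel {w | ∃ a b, w = 𝔐.pr a b ∧ a ∈ (𝔐.below Q x).nodes ∧
      b ∈ (𝔐.below Q y).nodes ∧ 𝔐.Rel F a b} a b ↔ a ∈ (𝔐.below Q x).nodes ∧
      b ∈ (𝔐.below Q y).nodes ∧ 𝔐.Rel F a b := fun a b =>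
    rel_setOf_pr (P := fun a b => a ∈ (𝔐.below Q x).nodes ∧ b ∈ (𝔐.below Q y).nodes ∧ 𝔐.Rel F a b)
  refine ha.graph.eq_of_bisim (F := {w | ∃ a b, w = 𝔐.pr a b ∧ a ∈ (𝔐.below Q x).nodes ∧
    b ∈ (𝔐.below Q y).nodes ∧ 𝔐.Rel F a b}) (setOf_mem' _) (fun a b hab => ?_)
    (fun a b a' hab ha' => ?_) (fun a b b' hab hb' => ?_)
    ((hG _ _).2 ⟨⟨hl _ _ hx, reach_refl⟩, ⟨hl _ _ hy, reach_refl⟩, htop⟩)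
  · obtain ⟨ha, hb, -⟩ := (hG _ _).1 hab
    exact ⟨hn hx ha, hn hy hb⟩
  · obtain ⟨ha, hb, hab⟩ := (hG _ _).1 hab
    have ha'' := hpred ha (rel_elemRel.1 ha').1
    obtain ⟨b', ⟨hb', hab'⟩, -⟩ := h1 a' ha''
    exact ⟨b', (hG _ _).2 ⟨ha'', hb', hab'⟩, rel_elemRel.2
      ⟨(h3 a ha a' ha'' b hb b' hb' hab hab').1 (rel_elemRel.1 ha').1, hn hy hb⟩⟩
  · obtain ⟨ha, hb, hab⟩ := (hG _ _).1 hab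
    have hb'' := hpred hb (rel_elemRel.1 hb').1
    obtain ⟨a', ⟨ha', hab'⟩, -⟩ := h2 b' hb''
    exact ⟨a', (hG _ _).2 ⟨ha', hb'', hab'⟩, rel_elemRel.2
      ⟨(h3 a ha a' ha' b hb b' hb'' hab hab').2 (rel_elemRel.1 hb').1, hn hx ha⟩⟩

/-- No admissible set over `V` is presented by a graph which is an element of `Hyp(V)`: the collapse
of the graph would be a set of `Hyp(V)` that is an element of itself. -/
theorem CodesHyp.not_isAdm {Q : PointedGraph 𝔐.carrier} (hD : 𝔐.Delta11Comprehension)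
    (hQ : 𝔐.CodesHyp Q) {N R : Set 𝔐.carrier} (hN : N ∈ (𝔐.restrict Q).classes)
    (hR : R ∈ (𝔐.restrict Q).classes) : ¬ 𝔐.IsAdm N R := by
  intro h
  obtain ⟨j, hj, hcl⟩ := exists_restrict_classes hD hQ.1
  rw [hcl] at hN hR
  have hg := h.graph
  have ha := hQ.1.isAdm hD
  obtain ⟨G, hG, htot, hGN, hforth, hback, s, hs, hsG⟩ :=
    exists_collapse_class j ha hN hR hg.left hg.wf
  -- by minimality the range `s` of the collapse is an element of the given admissible set, hence a value
  -- of the collapse, that is, an element of itself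
  obtain ⟨u, hu, hiso⟩ := hQ.2 _ h.isAdmissibleOverV s hs
  obtain ⟨x, hx, rfl⟩ := rel_quot_o.1 hu
  obtain ⟨y, hxy⟩ := htot x hx
  have hiso' := iso_below_quot hD hQ.1 hg hg subset_rfl (fun _ _ _ => Iff.rfl) hG hGN hforth hback hxy
  obtain ⟨C, -, hq⟩ := h.isAdmissibleOverV.quotientPair
  have e := hQ.1.eq_of_iso hD hs (hGN x y hxy).2
    (hiso.trans (below_nodes_mem hq.nodes_mem hq.rel_mem _) hiso')
  have hys := (hsG y).2 ⟨x, hxy⟩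
  rw [← e] at hys
  exact ha.graph.wf.irrefl hs hys

/-- Well-foundedness passes from the restricted model to the ambient one, since it concerns only sets. -/
theorem IsAdm.of_restrict {Q : PointedGraph 𝔐.carrier} [Nbg (𝔐.restrict Q)] {N R : Set 𝔐.carrier}
    (h : (𝔐.restrict Q).IsAdm N R) : 𝔐.IsAdm N R := by
  have hg := h.graph
  have hR := restrict_subset Q hg.rel_mem
  have hwf : 𝔐.SetWF N R := hg.wf.setWF
  refine ⟨⟨restrict_subset Q hg.nodes_mem, hR, hg.left, hg.right, hwf.classWF hR, hg.ext⟩, h.kp, ?_⟩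
  obtain ⟨v, hv, F, hF⟩ := h.copy
  exact ⟨v, hv, F, restrict_subset Q hF.class_mem, hF.total, hF.range, hF.bijective, hF.mem_iff,
    hF.transitive⟩

theorem CodesHyp.not_isHypCode_restrict {Q : PointedGraph 𝔐.carrier} (hD : 𝔐.Delta11Comprehension)
    (hQ : 𝔐.CodesHyp Q) (X : Set 𝔐.carrier) : ¬ (𝔐.restrict Q).IsHypCode X := by
  rintro ⟨-, Q', -, hQ', -⟩
  have : Nbg (𝔐.restrict Q) := ⟨nbgWithoutChoice_restrict hD hQ.1⟩
  have ha := hQ'.isAdm (delta11_restrict hD hQ.1)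
  exact hQ.not_isAdm hD ha.graph.nodes_mem ha.graph.rel_mem ha.of_restrict

theorem CodesHyp.not_isHypCode {Q : PointedGraph 𝔐.carrier} (hD : 𝔐.Delta11Comprehension)
    (hQ : 𝔐.CodesHyp Q) {X : Set 𝔐.carrier} (hX : X ∈ (𝔐.restrict Q).classes) :
    ¬ 𝔐.IsHypCode X := by
  rintro ⟨-, Q', hrep, hQ', -⟩
  obtain ⟨j, hj, hcl⟩ := exists_restrict_classes hD hQ.1
  have hel := (isDeltaClosed_coded j (hQ.1.isAdm hD)).elem
  have hX' : Fact (X ∈ j.coded) := ⟨hcl ▸ hX⟩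
  -- a class representing a pair of classes yields both by elementary comprehension
  have hr : Q'.rel ∈ j.coded := by
    convert hel (fun z => 𝔐.pr z (𝔐.sc (𝔐.sc 𝔐.o)) ∈ X) inferInstance using 1
    exact Set.ext fun z => hrep.mem_right.symm
  have : Fact (Q'.rel ∈ j.coded) := ⟨hr⟩
  refine hQ.not_isAdm hD ?_ ?_ (hQ'.isAdm hD)
  · rw [hcl]
    exact hel (fun b => 𝔐.Rel Q'.rel b Q'.top) inferInstance
  · rw [hcl]
    exact hel (fun w => ∃ x y, w = 𝔐.pr x y ∧ 𝔐.Rel Q'.rel x y ∧ 𝔐.Rel Q'.rel y Q'.top) inferInstance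

theorem CodesHyp.restrict_spec {𝔐 : ClassModel.{u}} (hN : 𝔐.NBG) (hS : 𝔐.Sigma11Comprehension)
    {Q : PointedGraph 𝔐.carrier} (hQ : 𝔐.CodesHyp Q) :
    (𝔐.restrict Q).NBGWithoutChoice ∧ (𝔐.restrict Q).SetChoice ∧
      (𝔐.restrict Q).Delta11Comprehension ∧ (¬ ∃ X, (𝔐.restrict Q).IsHypCode X) ∧
      ¬ ∃ X ∈ (𝔐.restrict Q).classes, 𝔐.IsHypCode X := by
  have : Nbg 𝔐 := ⟨hN.toNBGWithoutChoice⟩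
  have hD : 𝔐.Delta11Comprehension := hS.delta11
  exact ⟨nbgWithoutChoice_restrict hD hQ.1, GlobalChoice.setChoice (𝔐 := 𝔐) hN.globalChoice,
    delta11_restrict hD hQ.1, fun ⟨X, hX⟩ => hQ.not_isHypCode_restrict hD X hX,
    fun ⟨_, hX, h⟩ => hQ.not_isHypCode hD hX h⟩

/-! ### The cumulative hierarchy with all its classes -/

/-- The sets of ZFC with all collections of sets as classes. -/
def full : ClassModel.{u + 1} := ⟨ZFSet.{u}, (· ∈ ·), Set.univ⟩

theorem full_isUPair (x y : ZFSet.{u}) : full.{u}.IsUPair ({x, y} : ZFSet.{u}) x y := fun _ =>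
  ZFSet.mem_pair

instance : Pairs full.{u} := ⟨fun _ _ h => ZFSet.ext h, fun x y => ⟨_, full_isUPair x y⟩⟩

theorem full_nbgWithoutChoice : full.{u}.NBGWithoutChoice where
  extensionality _ _ h := ZFSet.ext h
  pairing x y := ⟨_, full_isUPair x y⟩
  infinity := by
    refine ⟨ZFSet.omega, ⟨(∅ : ZFSet.{u}), ZFSet.omega_zero, fun z => ZFSet.notMem_empty z⟩,
      fun (x : ZFSet.{u}) hx => ⟨(insert x x : ZFSet.{u}), ZFSet.omega_succ hx, fun z => ?_⟩⟩
    exact ZFSet.mem_insert_iff.trans or_comm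
  union x := ⟨ZFSet.sUnion x, fun _ => ZFSet.mem_sUnion⟩
  powerSet x := ⟨ZFSet.powerset x, fun _ => ZFSet.mem_powerset⟩
  foundation X _ hX := by
    obtain ⟨x, hx, h⟩ := ZFSet.mem_wf.has_min X hX
    exact ⟨x, hx, h⟩
  comprehension _ _ _ _ := Set.mem_univ _
  replacement F _ hF (a : ZFSet.{u}) := by
    classical
    let I := {y : ZFSet.{u} // ∃ x : ZFSet.{u}, x ∈ a ∧ full.Rel F x y}
    have hI : Small.{u} I := by
      choose f hf using fun i : I => i.2
      refine small_of_injective (β := {x : ZFSet.{u} // x ∈ a})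
        (f := fun i => ⟨f i, (hf i).1⟩) fun i i' e => ?_
      have e' : f i = f i' := congrArg Subtype.val e
      exact Subtype.ext (hF _ _ _ (hf i).2 (e' ▸ (hf i').2))
    refine ⟨ZFSet.range fun i : I => i.1, fun y => ?_⟩
    refine ZFSet.mem_range.trans ⟨?_, fun h => ⟨⟨y, h⟩, rfl⟩⟩
    rintro ⟨i, rfl⟩
    exact i.2

instance : Nonempty full.{u}.carrier := ⟨(∅ : ZFSet.{u})⟩

theorem full_nbg : full.{u}.NBG where
  toNBGWithoutChoice := full_nbgWithoutChoice
  globalChoice := by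
    have hrel : ∀ x y, full.{u}.Rel {p | ∃ x, (∃ y, full.mem y x) ∧
        p = full.pr x (Classical.epsilon fun y => full.mem y x)} x y ↔
        (∃ y, full.mem y x) ∧ y = Classical.epsilon fun y => full.mem y x := fun x y => by
      rw [rel_iff]
      constructor
      · rintro ⟨x', hx, e⟩
        obtain ⟨rfl, rfl⟩ := pr_inj.1 e
        exact ⟨hx, rfl⟩
      · rintro ⟨hx, rfl⟩
        exact ⟨x, hx, rfl⟩
    refine ⟨_, Set.mem_univ {p | ∃ x, (∃ y, full.mem y x) ∧
        p = full.pr x (Classical.epsilon fun y => full.mem y x)}, fun x y y' h h' => ?_,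
        fun x hx => ⟨_, Classical.epsilon_spec hx, (hrel _ _).2 ⟨hx, rfl⟩⟩⟩
    rw [((hrel _ _).1 h).2, ((hrel _ _).1 h').2]

theorem full_sigma11 : full.{u}.Sigma11Comprehension := fun _ _ _ _ => Set.mem_univ _

end ClassModel

end ClassTheory

open ClassTheory in
theorem mainTheorem3 :
    (∀ 𝔐 : ClassModel.{u}, 𝔐.NBG → 𝔐.Sigma11Comprehension → ∃ X, 𝔐.IsHypCode X) ∧
    (∀ 𝔐 : ClassModel.{u}, 𝔐.NBG → 𝔐.Sigma11Comprehension → ∀ Q, 𝔐.CodesHyp Q →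
      (𝔐.restrict Q).NBGWithoutChoice ∧ (𝔐.restrict Q).SetChoice ∧
      (𝔐.restrict Q).Delta11Comprehension ∧
      (¬ ∃ X, (𝔐.restrict Q).IsHypCode X) ∧
      ¬ ∃ X ∈ (𝔐.restrict Q).classes, 𝔐.IsHypCode X) ∧
    ∃ 𝔑 : ClassModel.{u + 1}, 𝔑.NBGWithoutChoice ∧ 𝔑.SetChoice ∧ 𝔑.Delta11Comprehension ∧
      ¬ ∃ X, 𝔑.IsHypCode X := by
  refine ⟨fun 𝔐 hN hS => ?_, fun 𝔐 hN hS Q hQ => hQ.restrict_spec hN hS, ?_⟩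
  · have : 𝔐.Nbg := ⟨hN.toNBGWithoutChoice⟩
    exact ClassModel.exists_isHypCode hS
  · have : ClassModel.full.{u}.Nbg := ⟨ClassModel.full_nbgWithoutChoice⟩
    have hS : ClassModel.full.{u}.Sigma11Comprehension := ClassModel.full_sigma11
    obtain ⟨_, _, Q, _, hQ⟩ := ClassModel.exists_isHypCode hS
    obtain ⟨h1, h2, h3, h4, -⟩ := hQ.restrict_spec ClassModel.full_nbg hS
    exact ⟨_, h1, h2, h3, h4⟩
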